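/- **Setting.** Let $\mathcal R=(X,Y,R_0,R_0^\vee,F_0)$ be a reduced root datum with basis, $W_0$ its Weyl group, $Q=\mathbb ZR_0$, $W=W_0\ltimes X$ the (extended) affine Weyl group with its length function $l$, $q:W\to\mathbb R_{>0}$ a length multiplicative function with $q(\omega)=1$ if $l(\omega)=0$, and $\mathcal H=\mathcal H(\mathcal R,q)$ the affine Hecke algebra with basis $N_w$ ($w\in W$), $N_{ww'}=N_wN_{w'}$ if $l(ww')=l(w)+l(w')$ and $(N_s+q(s)^{-1/2})(N_s-q(s)^{1/2})=0$ for simple affine reflections $s$. Let $X^+$ be the dominant cone, $Z_X=X^+\cap(-X^+)$, fix a basis $(z_i)$ of $Z_X$ and put $\|\sum l_iz_i\|=\sum|l_i|$, $\mathcal N(w)=l(w)+\|w(0)^0\|$, where $x\mapsto x^0$ is the projection of $\mathbb Q\otimes X$ onto $\mathbb Q\otimes Z_X$ along $\mathbb Q\otimes Q$. The Schwartz completion $\mathcal S$ of $\mathcal H$ is the space of formal sums $x=\sum_w x_wN_w$ with $p_n(x)=\sup_w|x_w|(1+\mathcal N(w))^n<\infty$ for all $n\ge 0$, topologized by the norms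 $p_n$. For $P\subset F_0$ put $R_P=\mathbb ZP\cap R_0$, $W_P=W(R_P)$, and let $W^P\subset W_0$ be the set of shortest representatives of $W_0/W_P$. Let $\mathcal H^P\subset\mathcal H$ be the parabolic subalgebra spanned by the $\theta_xN_w$ ($x\in X$, $w\in W_P$, $\theta_x$ the Bernstein elements), and let $\mathcal H_P=\mathcal H(\mathcal R_P,q_P)$ be its semisimple quotient, with lattice $X_P=X/(X\cap(R_P^\vee)^\perp)$ and the restricted root labels. Let $\Delta_P$ be a complete set of representatives of the irreducible discrete series representations $(V_\delta,\delta)$ of $\mathcal H_P$ (irreducible $*$-representations, $N_w^*=N_{w^{-1}}$, that are equivalent to a subrepresentation of the left regular representation on $L_2(\mathcal H_P)$). Let $T^P$ be the complex torus of characters of $X/(X\cap\mathbb QR_P)$ and $T^P_u$ its compact form. For $\delta\in\Delta_P$ and $t\in T^P$ let $\pi(P,\delta,t)$ be the representation of $\mathcal H$ induced from $\delta\circ\phi_t$, where $\phi_t:\mathcal H^P\to\mathcal H_P$, $\phi_t(\theta_xN_w)=t(x)\theta_{\bar x}N_w$, realized on the fixed Hilbert space $i(V_\delta)=\bigoplus_{u\in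 W^P}N_u\otimes V_\delta$ (orthogonal sum of copies of $V_\delta$). Put $\Xi_{P,\delta}=\{(P,\delta,t):t\in T^P\}$, $\Xi_{P,\delta,u}=\{(P,\delta,t):t\in T^P_u\}$, $\Xi_u=\bigsqcup_{P,\delta}\Xi_{P,\delta,u}$, and $f_{a,b}(\xi,h)=\langle a,\pi(\xi)(h)b\rangle$ for $a,b\in i(V_\delta)$. Let $C^\infty(\Xi_u,\mathrm{End}(\mathcal V_\Xi))$ be the space of smooth sections $\sigma$, $\sigma(P,\delta,t)\in\mathrm{End}(i(V_\delta))$, with the seminorms $\sup_{t\in T^P_u}\|D\sigma(P,\delta,t)\|$, $D$ a constant coefficient differential operator on $T^P_u$. A section is $\mathcal W$-equivariant if $\sigma(g\xi)\,\pi(g,\xi)=\pi(g,\xi)\,\sigma(\xi)$ for all $\xi=(P,\delta,t)\in\Xi_u$ and all $g=k\times n$ with $n\in W_0$, $n(P)=Q\subset F_0$, $k\in T_Q\cap T^Q$ ($T_Q$ the torus of characters of $X_Q$). Here $g\xi=(Q,\Psi_g(\delta),k\,n(t))$, with $\Psi_g(\delta)\in\Delta_Q$ the representative of $\delta\circ\psi_g^{-1}$,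 $\psi_g(\theta_xN_w)=k(nx)\theta_{nx}N_{nwn^{-1}}$. Further $\pi(g,\xi)$ is the standard intertwining operator: with $\tilde\delta_g:V_\delta\to V_{\Psi_g(\delta)}$ a unitary isomorphism intertwining $\delta\circ\psi_g^{-1}$ and $\Psi_g(\delta)$, it is given for generic $\xi$ by $N_u\otimes v\mapsto N_u\,\iota^0_{n^{-1}}(1\otimes\tilde\delta_g v)$, $\iota^0$ the normalized intertwining elements, and for general $\xi\in\Xi_u$ by continuous extension. Let $\mathcal F_{\mathcal H}(h)(\xi)=\pi(\xi)(h)$ for $h\in\mathcal H$. **Theorem.** (1) Let $x_1,\dots,x_m$ generate the monoid $Q^+=Q\cap X^+$, let $x_{m+1},\dots,x_N$ be a $\mathbb Z$-basis of $Z_X$, and let $K>0$ be such that $\sum|l_i|\le K\mathcal N(x)$ whenever $x=\sum l_ix_i$ with $l_i\in\mathbb Z$ and $l_i\ge0$ for $i\le m$. For $t\in T$ put $\nu(|t|)=\max(\{1\}\cup\{|x_i(t)|^{\pm1}:i>m\}\cup\{|x_i(wt)|:i\le m,\ w\in W_0\})$. For all $R>1$, $P\subset F_0$ and $\delta\in\Delta_P$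 there exist $d\in\mathbb N$ and $c>0$ such that for all $w\in W$, $a,b\in i(V_\delta)$ and all $\xi=(P,\delta,t)\in\Xi_{P,\delta}$ with $\nu(|t|)\le R$, $$|f_{a,b}(\xi,N_w)|\le c\,\|a\|\,\|b\|\,(1+\mathcal N(w))^d\,\nu(|t|)^{K\mathcal N(w)}.$$ (2) For all $P\subset F_0$, $\delta\in\Delta_P$ and every constant coefficient differential operator $D$ there exist $d\in\mathbb N$ and $c>0$ such that for all $\xi\in\Xi_{P,\delta,u}$, $a,b\in i(V_\delta)$ and $w\in W$, $$|Df_{a,b}(\xi,N_w)|\le c\,\|a\|\,\|b\|\,(1+\mathcal N(w))^d.$$ (3) The Fourier transform maps $\mathcal S$ into $C^\infty(\Xi_u,\mathrm{End}(\mathcal V_\Xi))^{\mathcal W}$, and $\mathcal F_{\mathcal S}:\mathcal S\to C^\infty(\Xi_u,\mathrm{End}(\mathcal V_\Xi))^{\mathcal W}$ is continuous. That is, there is a continuous linear map $\mathcal F_{\mathcal S}$ between these spaces which extends $\mathcal F_{\mathcal H}$; it is given by $\mathcal F_{\mathcal S}(x)(\xi)=\sum_wx_w\pi(\xi)(N_w)$,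 with an unconditionally convergent sum; and it is the restriction to $\mathcal S$ of the $L_2$-extension of $\mathcal F_{\mathcal H}$: for every family $\mu$ of Borel measures on the components of $\Xi_u$ for which $\mathcal F_{\mathcal H}$ is isometric from $\mathcal H$ (with orthonormal basis $(N_w)$) to $L_2(\Xi_u,\mathrm{End}(\mathcal V_\Xi),\mu)$ (Hilbert–Schmidt norm in the fibres), such as the Plancherel measure, and every sequence $h_j\in\mathcal H$ converging to $x\in\mathcal S$ in $L_2(\mathcal H)$, one has $\mathcal F_{\mathcal H}(h_j)\to\mathcal F_{\mathcal S}(x)$ in $L_2(\mu)$. -/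

import Mathlib

open Filter Topology MeasureTheory
open scoped ENNReal ContDiff

namespace AffineHecke

noncomputable section

/-! ### Affine Weyl groups -/

/-- Roots, coroots (as functionals on the lattice `L`) and the positive roots among them. -/
structure Datum (J L : Type*) [AddCommGroup L] where
  root : J → L
  coroot : J → L →+ ℤ
  pos : J → Prop

/-- The action of `G` on the lattice `L`, written multiplicatively. -/
def latticeAut (G L : Type*) [Group G] [AddCommGroup L] [DistribMulAction G L] :
    G →* MulAut (Multiplicative L) where
  toFun g := AddEquiv.toMultiplicative (DistribMulAction.toAddEquiv L g)
  map_one' := by ext x; exact one_smul G x.toAdd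
  map_mul' g h := by ext x; exact mul_smul g h x.toAdd

/-- The semidirect product `G ⋉ L` of a lattice `L` and a group `G` acting on it. -/
abbrev AffW (G L : Type*) [Group G] [AddCommGroup L] [DistribMulAction G L] :=
  Multiplicative L ⋊[latticeAut G L] G

section Generic

variable {J L G : Type*} [AddCommGroup L] [Group G] [DistribMulAction G L]

/-- The translation by `x`. -/
def tr (G : Type*) [Group G] [DistribMulAction G L] (x : L) : AffW G L :=
  SemidirectProduct.inl (Multiplicative.ofAdd x)

/-- The element of `G` as an element of `G ⋉ L`. -/
def lin (L : Type*) [AddCommGroup L] [DistribMulAction G L] (g : G) : AffW G L :=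
  SemidirectProduct.inr g

/-- The action of `G ⋉ L` on `L` by affine transformations. -/
def act (w : AffW G L) (y : L) : L := w.left.toAdd + w.right • y

/-- The affine root `(α^∨, n)` as the affine function `y ↦ ⟨y, α^∨⟩ + n`. -/
def affEval (D : Datum J L) (a : J × ℤ) (y : L) : ℤ := D.coroot a.1 y + a.2

/-- Positive affine roots: `n > 0`, or `n = 0` and `α > 0`. -/
def AffPos (D : Datum J L) (a : J × ℤ) : Prop := 0 < a.2 ∨ (a.2 = 0 ∧ D.pos a.1)

/-- The positive affine roots `a` such that `w · a = a ∘ w⁻¹` is negative. -/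
def inversions (D : Datum J L) (w : AffW G L) : Set (J × ℤ) :=
  {a | AffPos D a ∧ ∃ a', ¬ AffPos D a' ∧ ∀ y, affEval D a' (act w y) = affEval D a y}

/-- The length function. -/
def len (D : Datum J L) (w : AffW G L) : ℕ := (inversions D w).ncard

/-- `r` is the affine reflection `s_a : y ↦ y - a(y) α`, where `a = (α^∨, n)`. -/
def IsRefl (D : Datum J L) (r : AffW G L) (a : J × ℤ) : Prop :=
  ∀ y, act r y = y - affEval D a y • D.root a.1

/-- The simple affine reflections: the affine reflections of length one. -/
def simpleRefl (G : Type*) [Group G] [DistribMulAction G L] (D : Datum J L) : Set (AffW G L) :=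
  {s | len D s = 1 ∧ ∃ a, IsRefl D s a}

/-- Positive, length multiplicative functions that are trivial on elements of length zero. -/
structure IsLabelFunction (D : Datum J L) (q : AffW G L → ℝ) : Prop where
  pos : ∀ w, 0 < q w
  mul : ∀ w w', len D (w * w') = len D w + len D w' → q (w * w') = q w * q w'
  one : ∀ w, len D w = 0 → q w = 1

open Classical in
/-- The label attached to the affine root `a`: the value of `q` at the simple affine reflections
that are conjugate to `s_a`. In the usual indexing of affine root labels this is `q_{a+1}`. -/
def affLabel (D : Datum J L) (q : AffW G L → ℝ) (a : J × ℤ) : ℝ :=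
  if h : ∃ s, s ∈ simpleRefl G D ∧ ∃ w, IsRefl D (w * s * w⁻¹) a then q h.choose else 1

/-! ### Hecke algebras -/

/-- The defining relations on generators `N_w`. -/
inductive HeckeRel (D : Datum J L) (q : AffW G L → ℝ) :
    FreeAlgebra ℂ (AffW G L) → FreeAlgebra ℂ (AffW G L) → Prop
  | one : HeckeRel D q (FreeAlgebra.ι ℂ 1) 1
  | mul (w w' : AffW G L) (h : len D (w * w') = len D w + len D w') :
      HeckeRel D q (FreeAlgebra.ι ℂ w * FreeAlgebra.ι ℂ w') (FreeAlgebra.ι ℂ (w * w'))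
  | quad (s : AffW G L) (hs : s ∈ simpleRefl G D) :
      HeckeRel D q
        ((FreeAlgebra.ι ℂ s + algebraMap ℂ _ (((√(q s))⁻¹ : ℝ) : ℂ)) *
          (FreeAlgebra.ι ℂ s - algebraMap ℂ _ ((√(q s) : ℝ) : ℂ))) 0

/-- The affine Hecke algebra. -/
abbrev HeckeAlg (D : Datum J L) (q : AffW G L → ℝ) := RingQuot (HeckeRel D q)

/-- The basis element `N_w`. -/
def basisN (D : Datum J L) (q : AffW G L → ℝ) (w : AffW G L) : HeckeAlg D q :=
  RingQuot.mkAlgHom ℂ (HeckeRel D q) (FreeAlgebra.ι ℂ w)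

/-- The sum of the positive roots. -/
def twoRho (D : Datum J L) : L := ∑ᶠ (j : J) (_ : D.pos j), D.root j

/-- The Bernstein element `θ_x = N_y N_z⁻¹`, where `x = y - z` with `y`, `z` dominant. Here `z` is
the multiple `(∑ |⟨x, α^∨⟩|) · 2ρ`, which makes both `z` and `x + z` dominant. -/
def theta (D : Datum J L) (q : AffW G L → ℝ) (x : L) : HeckeAlg D q :=
  basisN D q (tr G (x + (∑ᶠ j, |D.coroot j x|) • twoRho D)) *
    Ring.inverse (basisN D q (tr G ((∑ᶠ j, |D.coroot j x|) • twoRho D)))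

/-- Irreducible discrete series representations, realised on `ℂ^n` with its standard inner product:
irreducible `*`-representations (where `N_w^* = N_{w⁻¹}`) which are equivalent to a
subrepresentation of the left regular representation on `L₂(ℋ)`. The space `L₂(ℋ)` is the space of
square summable functions on the affine Weyl group, with the `N_w` as Hilbert basis; the left
regular representation is given by the left multiplication operators of the generators `N_s` (`s` a
simple affine reflection) and `N_u` (`u` of length zero). -/
structure DiscreteSeries (D : Datum J L) (q : AffW G L → ℝ) where
  dim : ℕ
  rep : HeckeAlg D q →ₐ[ℂ] Module.End ℂ (EuclideanSpace ℂ (Fin dim))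
  star_rep : ∀ w v v', inner ℂ (rep (basisN D q w) v) v' = inner ℂ v (rep (basisN D q w⁻¹) v')
  dim_pos : 0 < dim
  irreducible : ∀ p : Submodule ℂ (EuclideanSpace ℂ (Fin dim)),
    (∀ h, ∀ v ∈ p, rep h v ∈ p) → p = ⊥ ∨ p = ⊤
  regular : ∃ Φ : EuclideanSpace ℂ (Fin dim) →ₗ[ℂ] lp (fun _ : AffW G L => ℂ) 2,
    Function.Injective Φ ∧
    (∀ s ∈ simpleRefl G D, ∀ v w, Φ (rep (basisN D q s) v) w =
      Φ v (s⁻¹ * w) +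
        (if len D (s * w) < len D w then ((√(q s) - (√(q s))⁻¹ : ℝ) : ℂ) * Φ v w else 0)) ∧
    (∀ u, len D u = 0 → ∀ v w, Φ (rep (basisN D q u) v) w = Φ v (u⁻¹ * w))

/-- The representation space. -/
abbrev DiscreteSeries.V {D : Datum J L} {q : AffW G L → ℝ} (δ : DiscreteSeries D q) :=
  EuclideanSpace ℂ (Fin δ.dim)

/-- Unitary equivalence. -/
def DiscreteSeries.Equivalent {D : Datum J L} {q : AffW G L → ℝ} (δ δ' : DiscreteSeries D q) :
    Prop :=
  ∃ U : δ.V ≃ₗᵢ[ℂ] δ'.V, ∀ h v, U (δ.rep h v) = δ'.rep h (U v)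

end Generic

/-! ### Root data -/

section RootData

variable {ι X Y : Type*} [AddCommGroup X] [AddCommGroup Y]

theorem weylGroup_finite [Finite ι] (R : RootDatum ι X Y) : Finite R.weylGroup := by
  classical
  cases nonempty_fintype ι
  refine Finite.of_injective (fun g : R.weylGroup => R.weylGroupToPerm g) ?_
  change Function.Injective R.weylGroupToPerm
  rw [injective_iff_map_eq_one]
  intro g hg
  have hroot : ∀ x : X, g • x - x ∈ R.rootSpan ℤ := by
    obtain ⟨g, hgm⟩ := g
    clear hg
    induction hgm using RootPairing.weylGroup.induction with
    | mem i =>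
      intro x
      change RootPairing.Equiv.reflection R i • x - x ∈ _
      rw [RootPairing.Equiv.reflection_smul, RootPairing.reflection_apply]
      have : R.root i ∈ R.rootSpan ℤ := Submodule.subset_span (Set.mem_range_self i)
      simpa using (R.rootSpan ℤ).neg_mem ((R.rootSpan ℤ).smul_mem _ this)
    | one => intro x; change (1 : R.Aut) • x - x ∈ _; simp
    | mul g₁ g₂ h₁ h₂ ih₁ ih₂ =>
      intro x
      change (g₁ * g₂) • x - x ∈ _
      have := (R.rootSpan ℤ).add_mem (ih₁ (g₂ • x)) (ih₂ x)
      change (g₁ • (g₂ • x) - g₂ • x) + (g₂ • x - x) ∈ _ at this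
      rw [mul_smul]
      simpa using this
  have hco : ∀ (x : X) (i : ι), R.coroot' i (g • x) = R.coroot' i x := by
    intro x i
    have h1 := LinearMap.congr_fun
      (RootPairing.Hom.weight_coweight_transpose_apply R R (R.coroot i) g.1.toHom) x
    have h2 := RootPairing.Hom.coroot_coweightMap_apply R R i g.1.toHom
    have h3 : g.1.toHom.indexEquiv.symm i = i := by
      rw [Equiv.symm_apply_eq]
      exact (Equiv.congr_fun hg i).symm
    rw [h2, h3] at h1
    exact h1
  have hfix : ∀ x : X, g • x = x := by
    intro x
    have hker : g • x - x ∈ LinearMap.ker R.RootForm := by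
      rw [LinearMap.mem_ker]
      ext y
      rw [RootPairing.rootForm_apply_apply]
      simp [map_sub, hco]
    exact sub_eq_zero.mp
      ((Submodule.disjoint_def.mp R.disjoint_rootSpan_ker_rootForm) _ (hroot x) hker)
  refine Subtype.ext (RootPairing.Equiv.weightHom_injective R ?_)
  ext x
  exact hfix x

instance [Finite ι] (R : RootDatum ι X Y) : Finite R.weylGroup := weylGroup_finite R

variable (R : RootDatum ι X Y) (b : R.Base)

/-- The underlying datum of a based root datum. -/
def datum : Datum ι X where
  root := R.root
  coroot i := (R.coroot' i).toAddMonoidHom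
  pos i := R.root i ∈ AddSubmonoid.closure (R.root '' b.support)

/-- The (extended) affine Weyl group `W = W₀ ⋉ X`. -/
abbrev WX := AffW R.weylGroup X

/-- The affine Hecke algebra `ℋ = ℋ(ℛ, q)`. -/
abbrev Hk (q : WX R → ℝ) := HeckeAlg (datum R b) q

/-- The length zero translations `Z_X = X⁺ ∩ X⁻`. -/
def centralLattice : Submodule ℤ X where
  carrier := {x | ∀ i, R.coroot' i x = 0}
  add_mem' hx hy i := by rw [map_add, hx i, hy i, add_zero]
  zero_mem' i := map_zero _
  smul_mem' c x hx i := by rw [map_smul, hx i, smul_zero]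

open Classical in
/-- The norm of the projection of `x` onto `ℚ ⊗ Z_X` along `ℚ ⊗ Q`: if `m x = y + (element of Q)`
with `m > 0` and `y ∈ Z_X`, it is `m⁻¹` times the sum of the absolute values of the coordinates of
`y` with respect to the basis `z` of `Z_X`. -/
def centralNorm {κ : Type*} [Fintype κ] (z : Module.Basis κ ℤ (centralLattice R)) (x : X) : ℝ :=
  if h : ∃ p : ℕ × centralLattice R, 0 < p.1 ∧
      p.1 • x - (p.2 : X) ∈ Submodule.span ℤ (Set.range R.root) then
    (∑ k, |((z.repr h.choose.2 k : ℤ) : ℝ)|) / h.choose.1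
  else 0

/-- The norm `𝒩(w) = l(w) + ‖w(0)⁰‖` on the affine Weyl group. -/
def normW {κ : Type*} [Fintype κ] (z : Module.Basis κ ℤ (centralLattice R)) (w : WX R) : ℝ :=
  len (datum R b) w + centralNorm R z (act w 0)

/-! ### Parabolic subsystems -/

variable {R}

/-- The subsets of the set `F₀` of simple roots. -/
abbrev Par := {P : Finset ι // P ⊆ b.support}

variable {b} (P : Par b)

/-- The root lattice `ℤ P` of the standard parabolic subsystem `R_P = ℤ P ∩ R₀`. -/
def rootLat : Submodule ℤ X := Submodule.span ℤ (R.root '' P.1)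

/-- The parabolic subgroup `W_P` of `W₀`. -/
def parW : Subgroup R.weylGroup :=
  Subgroup.closure (RootPairing.weylGroup.ofIdx R '' P.1)

/-- The sublattice `X ∩ (R_P^∨)^⊥`. -/
def perpLat : Submodule ℤ X where
  carrier := {x | ∀ i, R.root i ∈ rootLat P → R.coroot' i x = 0}
  add_mem' hx hy i hi := by rw [map_add, hx i hi, hy i hi, add_zero]
  zero_mem' i _ := map_zero _
  smul_mem' c x hx i hi := by rw [map_smul, hx i hi, smul_zero]

theorem parW_smul_perpLat (w : parW P) : ∀ x ∈ perpLat P, w • x = x := by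
  obtain ⟨w, hw⟩ := w
  change ∀ x ∈ perpLat P, w • x = x
  induction hw using Subgroup.closure_induction with
  | mem w hw =>
    obtain ⟨i, hi, rfl⟩ := hw
    intro x hx
    have h0 : R.coroot' i x = 0 := hx i (Submodule.subset_span ⟨i, hi, rfl⟩)
    change RootPairing.Equiv.reflection R i • x = x
    rw [RootPairing.Equiv.reflection_smul, RootPairing.reflection_apply, h0, zero_smul, sub_zero]
  | one => intro x _; exact one_smul _ x
  | mul v w _ _ hv hw => intro x hx; rw [mul_smul, hw x hx, hv x hx]
  | inv w _ hw => intro x hx; rw [inv_smul_eq_iff, hw x hx]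

/-- The lattice `X_P = X / (X ∩ (R_P^∨)^⊥)`. -/
abbrev XP := X ⧸ perpLat P

/-- The action of `W_P` on `X_P`. -/
instance : DistribMulAction (parW P) (XP P) where
  smul w := (perpLat P).mapQ (perpLat P) (DistribSMul.toLinearMap ℤ X w)
    (fun x hx => by
      change w • x ∈ perpLat P
      rw [parW_smul_perpLat P w x hx]; exact hx)
  one_smul x := by
    obtain ⟨x, rfl⟩ := Submodule.Quotient.mk_surjective _ x
    exact congrArg (Submodule.Quotient.mk) (one_smul (parW P) x)
  mul_smul v w x := by
    obtain ⟨x, rfl⟩ := Submodule.Quotient.mk_surjective _ x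
    exact congrArg (Submodule.Quotient.mk) (mul_smul v w x)
  smul_zero w := map_zero _
  smul_add w x y := map_add _ x y

/-- The underlying datum of `ℛ_P`: the lattice `X_P`, the roots in `R_P` and their coroots. -/
def parDatum : Datum {i // R.root i ∈ rootLat P} (XP P) where
  root i := Submodule.Quotient.mk (R.root i)
  coroot i := ((perpLat P).liftQ (R.coroot' i) (fun _ hx => hx i i.2)).toAddMonoidHom
  pos i := (datum R b).pos i

variable (q : WX R → ℝ)

/-- The label function `q_P` on `W(ℛ_P)` determined by the restriction to `R_P` of the labels of
the affine roots. -/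
def parLabel (w : AffW (parW P) (XP P)) : ℝ :=
  ∏ᶠ (a) (_ : a ∈ inversions (parDatum P) w), affLabel (datum R b) q (a.1.1, a.2)

/-- Irreducible discrete series representations of `ℋ_P = ℋ(ℛ_P, q_P)`. -/
abbrev DS := DiscreteSeries (parDatum P) (parLabel P q)

/-! ### Tori -/

/-- The lattice `X ∩ ℚ R_P`. -/
def satLat : Set X := {x | ∃ m : ℤ, m ≠ 0 ∧ m • x ∈ rootLat P}

/-- The complex torus `T^P`, as a set of characters of `X`. -/
def torus : Set (AddChar X ℂ) := {t | ∀ x ∈ satLat P, t x = 1}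

/-- The compact torus `T^P_u`. -/
def UTorus := {t : AddChar X ℂ // t ∈ torus P ∧ ∀ x, ‖t x‖ = 1}

/-- The topology of pointwise convergence. -/
instance : TopologicalSpace (UTorus P) :=
  TopologicalSpace.induced (fun t (x : X) => t.1 x) inferInstance

instance : MeasurableSpace (UTorus P) := borel _

instance : BorelSpace (UTorus P) := ⟨rfl⟩

/-- The Lie algebra of `T^P_u`, divided by `i`. -/
def lieT : Submodule ℝ (X →ₗ[ℤ] ℝ) where
  carrier := {v | ∀ x ∈ satLat P, v x = 0}
  add_mem' hv hw x hx := by rw [LinearMap.add_apply, hv x hx, hw x hx, add_zero]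
  zero_mem' x _ := rfl
  smul_mem' c v hv x hx := by rw [LinearMap.smul_apply, hv x hx, smul_zero]

variable {P} in
/-- The translate `t · exp(i v)`. -/
def UTorus.shift (t : UTorus P) (v : lieT P) : UTorus P :=
  ⟨{ toFun := fun x => t.1 x * Complex.exp (v.1 x * Complex.I)
     map_zero_eq_one' := by simp
     map_add_eq_mul' := fun x y => by
      rw [AddChar.map_add_eq_mul, map_add, Complex.ofReal_add, add_mul, Complex.exp_add]; ring },
   fun x hx => by
    change t.1 x * Complex.exp (v.1 x * Complex.I) = 1
    rw [t.2.1 x hx, v.2 x hx]; simp,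
   fun x => by
    change ‖t.1 x * Complex.exp (v.1 x * Complex.I)‖ = 1
    rw [norm_mul, t.2.2 x, Complex.norm_exp_ofReal_mul_I, one_mul]⟩

section Calculus

variable {P} {E : Type*} [NormedAddCommGroup E] [NormedSpace ℂ E]

/-- Smooth functions on `T^P_u`, tested in the exponential coordinates. -/
def SmoothOnTorus (f : UTorus P → E) : Prop :=
  ∀ (k : ℕ) (v : Fin k → lieT P) (t : UTorus P),
    ContDiff ℝ ∞ (fun s : Fin k → ℝ => f (t.shift (∑ j, s j • v j)))

/-- The invariant vector field on `T^P_u` given by `v`. -/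
def vecField (v : lieT P) (f : UTorus P → E) : UTorus P → E :=
  fun t => deriv (fun s : ℝ => f (t.shift (s • v))) 0

/-- Constant coefficient differential operators: `D` is a finite linear combination of compositions
`v₁ ⋯ v_k` of invariant vector fields. -/
def diffOp (D : List (lieT P) →₀ ℂ) (f : UTorus P → E) (t : UTorus P) : E :=
  D.sum fun l c => c • l.foldr vecField f t

end Calculus

/-! ### Induced representations -/

/-- The shortest length representatives of the left cosets `W₀ / W_P`. -/
def minReps : Set R.weylGroup :=
  {u | ∀ w ∈ parW P, len (datum R b) (lin X u) ≤ len (datum R b) (lin X (u * w))}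

instance [Finite ι] : Fintype (minReps P) := Fintype.ofFinite _

variable (b) in
/-- The element `N_u θ_x N_w` of `ℋ`. -/
def bernsteinElt (u : R.weylGroup) (x : X) (w : R.weylGroup) : Hk R b q :=
  basisN (datum R b) q (lin X u) * theta (datum R b) q x * basisN (datum R b) q (lin X w)

/-- The coefficients of `h` in the basis `N_u θ_x N_w` (`u ∈ W^P`, `x ∈ X`, `w ∈ W_P`) of
`ℋ = ℋ(W^P) ⊗ ℋ^P`. -/
def bernsteinCoeff (h : Hk R b q) : (minReps P × X × parW P) →₀ ℂ :=
  Function.invFun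
    (Finsupp.linearCombination ℂ
      fun p : minReps P × X × parW P => bernsteinElt b q p.1 p.2.1 p.2.2.1) h

section Induced

variable {P q}

/-- The operator by which `θ_x N_w ∈ ℋ^P` acts in `δ_t = δ ∘ φ_t`, where
`φ_t(θ_x N_w) = t(x) θ_{x̄} N_w`. -/
def twisted (δ : DS P q) (t : AddChar X ℂ) (x : X) (w : parW P) : Module.End ℂ δ.V :=
  t x • δ.rep (theta (G := parW P) (parDatum P) (parLabel P q) (Submodule.Quotient.mk x) *
    basisN (parDatum P) (parLabel P q) (lin (XP P) w))

/-- The space `i(V_δ) = ℋ(W^P) ⊗ V_δ`, with the inner product for which the `N_u ⊗ e_j` (`u ∈ W^P`,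
`e_j` the standard basis of `V_δ = ℂ^n`) are orthonormal. -/
abbrev indSpace (δ : DS P q) := EuclideanSpace ℂ (minReps P × Fin δ.dim)

open Classical in
/-- The map `v ↦ N_u ⊗ v`, for `u ∈ W^P`. -/
def incl (δ : DS P q) (u : minReps P) : δ.V →ₗ[ℂ] indSpace δ where
  toFun v := WithLp.toLp 2 fun p => if p.1 = u then v p.2 else 0
  map_add' v w := by ext p; by_cases h : p.1 = u <;> simp [h]
  map_smul' c v := by ext p; by_cases h : p.1 = u <;> simp [h]

/-- The component in `N_u ⊗ V_δ` of a vector of `i(V_δ)`. -/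
def comp (δ : DS P q) (u : minReps P) : indSpace δ →ₗ[ℂ] δ.V where
  toFun f := WithLp.toLp 2 fun j => f (u, j)
  map_add' v w := by ext p; simp
  map_smul' c v := by ext p; simp

variable [Finite ι]

/-- The induced representation `π(P, δ, t)` in the compact realization: if
`h N_{u'} = ∑ c(u, x, w) N_u θ_x N_w`, then `h` sends `N_{u'} ⊗ v` to
`∑ c(u, x, w) N_u ⊗ δ_t(θ_x N_w) v`. -/
def indRep (δ : DS P q) (t : AddChar X ℂ) (h : Hk R b q) : indSpace δ →L[ℂ] indSpace δ :=
  LinearMap.toContinuousLinearMap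
    (∑ u' : minReps P, (bernsteinCoeff P q (h * basisN (datum R b) q (lin X u'.1))).sum
      fun p c => c • (incl δ p.1 ∘ₗ twisted δ t p.2.1 p.2.2 ∘ₗ comp δ u'))

end Induced

/-! ### Intertwining operators -/

/-- The product of simple reflections given by a word. -/
def wordElt (l : List b.support) : R.weylGroup :=
  (l.map fun i => RootPairing.weylGroup.ofIdx R i.1).prod

/-- `2α` belongs to the nonreduced root system `R_nr`, that is, `α^∨ ∈ 2Y`. -/
def IsDouble (i : ι) : Prop := ∃ y, R.coroot i = 2 • y

variable (b) in
open Classical in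
/-- The intertwining element `ι_s`, `s = s_α`. Here `q_{α^∨+1}` and `q_{α^∨}` are the labels of the
affine roots `(α^∨, 0)` and `(α^∨, -1)`. -/
def iotaElt (i : ι) : Hk R b q :=
  let q₁ : ℝ := affLabel (datum R b) q (i, 0)
  let q₂ : ℝ := affLabel (datum R b) q (i, -1)
  let N := basisN (datum R b) q (lin X (RootPairing.weylGroup.ofIdx R i))
  let θ : X → Hk R b q := theta (datum R b) q
  if IsDouble (R := R) i then
    ((√q₁ : ℝ) : ℂ) • ((1 - θ (-(2 • R.root i))) * N) + ((1 - q₁ : ℝ) : ℂ) • 1 +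
      ((√(q₁ / q₂) * (1 - q₂) : ℝ) : ℂ) • θ (-R.root i)
  else ((√q₁ : ℝ) : ℂ) • ((1 - θ (-R.root i)) * N) + ((1 - q₁ : ℝ) : ℂ) • 1

/-- The product of the `ι_s` along a word. -/
def iotaWord (l : List b.support) : Hk R b q := (l.map fun i => iotaElt b q i.1).prod

variable (b) in
open Classical in
/-- The normalizing element `n_α` of `ℂ[X]`, transformed by `g ∈ W₀`. -/
def normElt (i : ι) (g : R.weylGroup) : AddMonoidAlgebra ℂ X :=
  let q₁ : ℝ := affLabel (datum R b) q (i, 0)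
  let q₂ : ℝ := affLabel (datum R b) q (i, -1)
  let θ : AddMonoidAlgebra ℂ X := AddMonoidAlgebra.single (-(g • R.root i)) 1
  if IsDouble (R := R) i then
    (algebraMap ℂ _ ((√(q₁ / q₂) : ℝ) : ℂ) + θ) *
      (algebraMap ℂ _ ((√(q₁ / q₂) * q₂ : ℝ) : ℂ) - θ)
  else algebraMap ℂ _ (q₁ : ℂ) - θ

/-- The element `m` of `ℂ[X]` such that the product of the normalized intertwining elements
`n_α⁻¹ ι_s` along the word `l` is `ι_l m⁻¹`. -/
def normWord : List b.support → AddMonoidAlgebra ℂ X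
  | [] => 1
  | i :: l => normElt b q i.1 (wordElt (i :: l))⁻¹ * normWord l

section Intertwiners

variable {P Q : Par b} {q}

/-- The action of `ℂ[X] = 𝒜 ⊆ ℋ^P` in `δ_t`. -/
def twistedA (δ : DS P q) (t : AddChar X ℂ) (f : AddMonoidAlgebra ℂ X) : Module.End ℂ δ.V :=
  f.coeff.sum fun x c => c • twisted δ t x 1

/-- `n ∈ W(P, Q)`, that is, `n(P) = Q`. -/
def MapsPar (P Q : Par b) (n : R.weylGroup) : Prop :=
  (fun x => n • x) '' (R.root '' P.1) = R.root '' Q.1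

/-- `k ∈ K_Q = T_Q ∩ T^Q`. -/
def IsK (Q : Par b) (k : AddChar X ℂ) : Prop := k ∈ torus Q ∧ ∀ x ∈ perpLat Q, k x = 1

/-- The character `g(t) = k n(t)`, for `g = k × n`. -/
def moveChar (k : AddChar X ℂ) (n : R.weylGroup) (t : AddChar X ℂ) : AddChar X ℂ :=
  k * t.compAddMonoidHom (DistribSMul.toAddMonoidHom X n⁻¹)

/-- `U` is a unitary isomorphism intertwining `δ ∘ ψ_g⁻¹` and `δ'`, where `g = k × n` and
`ψ_g(θ_x N_w) = k(n x) θ_{n x} N_{n w n⁻¹}`. -/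
def IsTwistIso (n : R.weylGroup) (k : AddChar X ℂ) (δ : DS P q) (δ' : DS Q q)
    (U : δ.V ≃ₗᵢ[ℂ] δ'.V) : Prop :=
  ∀ (x : X) (w : parW P) (w' : parW Q), w'.1 = n * w.1 * n⁻¹ →
    ∀ v, U (twisted δ 1 x w v) = twisted δ' k (n • x) w' (U v)

variable [Finite ι]

open Classical in
/-- The map `v ↦ 1 ⊗ v`. -/
def inclOne (δ : DS P q) : δ.V →ₗ[ℂ] indSpace δ :=
  if h : (1 : R.weylGroup) ∈ minReps P then incl δ ⟨1, h⟩ else 0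

/-- The formula `N_u ⊗ v ↦ N_u ι⁰_{n⁻¹} (1 ⊗ U v)` for the intertwining operator `π(g, ξ)`, at the
points where the denominator of `ι⁰_{n⁻¹} = ι_l m⁻¹` is invertible. Here `l` is a reduced word of
`n⁻¹` and `t' = g(t)`. -/
def intertwinerFormula (l : List b.support) (δ : DS P q) (δ' : DS Q q) (U : δ.V ≃ₗᵢ[ℂ] δ'.V)
    (t' : AddChar X ℂ) : indSpace δ →L[ℂ] indSpace δ' :=
  LinearMap.toContinuousLinearMap
    (∑ u : minReps P,
      (indRep δ' t' (basisN (datum R b) q (lin X u.1) * iotaWord q l)).toLinearMap ∘ₗ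
        inclOne δ' ∘ₗ Ring.inverse (twistedA δ' t' (normWord q l)) ∘ₗ
          U.toLinearEquiv.toLinearMap ∘ₗ comp δ u)

/-- `A` is the value at `t ∈ T^P_u` of the continuous extension of the intertwining operator
`π(g, ξ)`, `ξ = (P, δ, t)`, `g = k × n`. -/
def IsIntertwiner (n : R.weylGroup) (k : AddChar X ℂ) (l : List b.support) (δ : DS P q)
    (δ' : DS Q q) (U : δ.V ≃ₗᵢ[ℂ] δ'.V) (t : UTorus P) (A : indSpace δ →L[ℂ] indSpace δ') : Prop :=
  Tendsto (fun s : UTorus P => intertwinerFormula l δ δ' U (moveChar k n s.1))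
    (𝓝[{s | IsUnit (twistedA δ' (moveChar k n s.1) (normWord q l))}] t) (𝓝 A)

end Intertwiners

/-! ### Sections, the Schwartz space -/

section Sections

variable {q} [Finite ι] (Δ : ∀ P : Par b, Set (DS P q))

/-- Sections of the endomorphism bundle over
`Ξ_u = {(P, δ, t) | P ⊆ F₀, δ ∈ Δ_P, t ∈ T^P_u}`. -/
abbrev Sec := ∀ (P : Par b) (δ : Δ P), UTorus P → (indSpace δ.1 →L[ℂ] indSpace δ.1)

/-- `𝒲`-equivariant sections: `f(g ξ) π(g, ξ) = π(g, ξ) f(ξ)`. -/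
def Equivariant (f : Sec Δ) : Prop :=
  ∀ (P Q : Par b) (n : R.weylGroup) (k : AddChar X ℂ), MapsPar P Q n → IsK Q k →
  ∀ (δ : Δ P) (δ' : Δ Q) (U : δ.1.V ≃ₗᵢ[ℂ] δ'.1.V), IsTwistIso n k δ.1 δ'.1 U →
  ∀ l : List b.support, wordElt l = n⁻¹ → l.length = len (datum R b) (lin X n⁻¹) →
  ∀ (t : UTorus P) (t' : UTorus Q), t'.1 = moveChar k n t.1 →
  ∀ A, IsIntertwiner n k l δ.1 δ'.1 U t A → f Q δ' t' ∘L A = A ∘L f P δ t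

/-- Smooth `𝒲`-equivariant sections, as a space of sections. -/
def smoothEquivariant : Submodule ℂ (Sec Δ) where
  carrier := {f | (∀ P δ, SmoothOnTorus (f P δ)) ∧ Equivariant Δ f}
  add_mem' := by
    rintro f g ⟨hf, hf'⟩ ⟨hg, hg'⟩
    refine ⟨fun P δ k v t => (hf P δ k v t).add (hg P δ k v t), ?_⟩
    intro P Q n k hn hk δ δ' U hU l hl hl' t t' ht A hA
    change (f Q δ' t' + g Q δ' t') ∘L A = A ∘L (f P δ t + g P δ t)
    rw [ContinuousLinearMap.add_comp, ContinuousLinearMap.comp_add,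
      hf' P Q n k hn hk δ δ' U hU l hl hl' t t' ht A hA,
      hg' P Q n k hn hk δ δ' U hU l hl hl' t t' ht A hA]
  zero_mem' := by
    refine ⟨fun P δ k v t => contDiff_const, ?_⟩
    intro P Q n k hn hk δ δ' U hU l hl hl' t t' ht A hA
    change (0 : indSpace δ'.1 →L[ℂ] indSpace δ'.1) ∘L A =
      A ∘L (0 : indSpace δ.1 →L[ℂ] indSpace δ.1)
    rw [ContinuousLinearMap.zero_comp, ContinuousLinearMap.comp_zero]
  smul_mem' := by
    rintro c f ⟨hf, hf'⟩
    refine ⟨fun P δ k v t => (contDiff_const (c := c)).smul (hf P δ k v t), ?_⟩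
    intro P Q n k hn hk δ δ' U hU l hl hl' t t' ht A hA
    change (c • f Q δ' t') ∘L A = A ∘L (c • f P δ t)
    rw [ContinuousLinearMap.smul_comp, ContinuousLinearMap.comp_smul,
      hf' P Q n k hn hk δ δ' U hU l hl hl' t t' ht A hA]

/-- The space `C^∞(Ξ_u, End(𝒱_Ξ))^𝒲`. -/
def CInfW : Type _ := ↥(smoothEquivariant Δ)

instance : AddCommGroup (CInfW Δ) := inferInstanceAs (AddCommGroup (smoothEquivariant Δ))

instance : Module ℂ (CInfW Δ) := inferInstanceAs (Module ℂ (smoothEquivariant Δ))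

/-- The topology of uniform convergence of all derivatives: it is defined by the seminorms
`sup_t ‖D f(P, δ, t)‖`. -/
instance : TopologicalSpace (CInfW Δ) :=
  ⨅ (P : Par b) (δ : Δ P) (D : List (lieT P) →₀ ℂ),
    TopologicalSpace.induced
      (fun f : CInfW Δ => UniformFun.ofFun (diffOp D (f.1 P δ))) inferInstance

end Sections

section Schwartz

variable (b) {κ : Type*} [Fintype κ] (z : Module.Basis κ ℤ (centralLattice R))

/-- The formal sums `x = ∑ x_w N_w` with `p_n(x) = sup_w |x_w| (1 + 𝒩(w))^n < ∞` for all `n`. -/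
def schwartzSums : Submodule ℂ (WX R → ℂ) where
  carrier := {x | ∀ n : ℕ, ∃ C : ℝ, ∀ w, ‖x w‖ * (1 + normW R b z w) ^ n ≤ C}
  add_mem' := by
    intro x y hx hy n
    obtain ⟨C, hC⟩ := hx n
    obtain ⟨C', hC'⟩ := hy n
    refine ⟨C + C', fun w => ?_⟩
    have h0 : 0 ≤ (1 + normW R b z w) ^ n := by
      refine pow_nonneg ?_ n
      unfold normW centralNorm
      split_ifs <;> positivity
    calc ‖x w + y w‖ * (1 + normW R b z w) ^ n
        ≤ (‖x w‖ + ‖y w‖) * (1 + normW R b z w) ^ n :=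
          mul_le_mul_of_nonneg_right (norm_add_le _ _) h0
      _ ≤ C + C' := by rw [add_mul]; exact add_le_add (hC w) (hC' w)
  zero_mem' n := ⟨0, fun w => by simp⟩
  smul_mem' := by
    intro c x hx n
    obtain ⟨C, hC⟩ := hx n
    refine ⟨‖c‖ * C, fun w => ?_⟩
    rw [Pi.smul_apply, norm_smul, mul_assoc]
    exact mul_le_mul_of_nonneg_left (hC w) (norm_nonneg c)

/-- The Schwartz completion `𝒮` of `ℋ`. -/
def Schwartz : Type _ := ↥(schwartzSums b z)

instance : AddCommGroup (Schwartz b z) := inferInstanceAs (AddCommGroup (schwartzSums b z))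

instance : Module ℂ (Schwartz b z) := inferInstanceAs (Module ℂ (schwartzSums b z))

/-- The topology defined by the norms `p_n`. -/
instance : TopologicalSpace (Schwartz b z) :=
  ⨅ n : ℕ, TopologicalSpace.induced
    (fun x : Schwartz b z =>
      UniformFun.ofFun (fun w => (((1 + normW R b z w) ^ n : ℝ) : ℂ) * x.1 w)) inferInstance

end Schwartz

section Fourier

variable {q} [Finite ι] (Δ : ∀ P : Par b, Set (DS P q))

/-- The element `∑ c_w N_w` of `ℋ`. -/
def elt (c : WX R →₀ ℂ) : Hk R b q := Finsupp.linearCombination ℂ (basisN (datum R b) q) c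

/-- The Fourier transform `ℱ_ℋ(h)(ξ) = π(ξ; h)`. -/
def fourierH (h : Hk R b q) : Sec Δ := fun _ δ t => indRep δ.1 t.1 h

/-- The square of the `L₂`-distance of two sections with respect to measures `μ` on the components
of `Ξ_u` and the Hilbert-Schmidt norm `tr(A^* A)`. -/
def distSq (μ : ∀ P : Par b, Δ P → Measure (UTorus P)) (f g : Sec Δ) : ℝ≥0∞ :=
  ∑' (P : Par b) (δ : Δ P), ∫⁻ t, ENNReal.ofReal (LinearMap.trace ℂ (indSpace δ.1)
    (ContinuousLinearMap.adjoint (f P δ t - g P δ t) ∘L (f P δ t - g P δ t)).toLinearMap).re ∂μ P δ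

/-- `ℱ_ℋ` is isometric for the inner product `(x, y) = τ(x^* y)` of `ℋ` and the `L₂`-inner product
with respect to `μ`; thus `ℱ_ℋ` extends to an isometric map on `L₂(ℋ)`. The Plancherel measure has
this property. -/
def FourierIsometric (μ : ∀ P : Par b, Δ P → Measure (UTorus P)) : Prop :=
  ∀ c : WX R →₀ ℂ, distSq Δ μ (fourierH Δ (elt c)) 0 = ∑' w, ENNReal.ofReal (‖c w‖ ^ 2)

/-- `Δ_P` is a complete set of representatives of the irreducible discrete series. -/
def IsComplete : Prop := ∀ (P : Par b) (δ : DS P q), ∃! δ' : Δ P, δ.Equivalent δ'.1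

end Fourier

/-- The multiplicative distance function `ν` attached to elements `x_i` of `X⁺` and a basis of
`Z_X`. -/
def nu {κ₁ κ₂ : Type*} (xQ : κ₁ → X) (xZ : κ₂ → X) (t : AddChar X ℂ) : ℝ :=
  sSup ({1} ∪ {r | ∃ j, r = ‖t (xZ j)‖ ∨ r = ‖t (-xZ j)‖} ∪
    {r | ∃ (i : κ₁) (w : R.weylGroup), r = ‖t (w • xQ i)‖})

end RootData

end

end AffineHecke

namespace AffineHecke

noncomputable section

/-! ### Reduced root data with an action of the Weyl group -/

/-- A datum `D` which consists of a reduced root system with Weyl group `G`. -/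
class RootedDatum {J L : Type*} [AddCommGroup L] (D : Datum J L) (G : Type*) [Group G]
    [DistribMulAction G L] where
  finite : Finite J
  perm : G →* Equiv.Perm J
  refl : J → G
  coroot_root : ∀ j, D.coroot j (D.root j) = 2
  refl_smul : ∀ j (y : L), refl j • y = y - D.coroot j y • D.root j
  root_perm : ∀ g j, D.root (perm g j) = g • D.root j
  coroot_perm : ∀ g j y, D.coroot (perm g j) (g • y) = D.coroot j y
  parallel : ∀ i j (m n : ℤ), 0 < m → 0 < n → (∀ y, m * D.coroot i y = n * D.coroot j y) → i = j
  pos_iff : ∀ j, D.pos j ↔ 0 < D.coroot j (twoRho D)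
  regular : ∀ j, D.coroot j (twoRho D) ≠ 0
  faithful : ∀ g : G, (∀ y : L, g • y = y) → g = 1
  gen : Subgroup.closure {g : G | ∃ j, g = refl j ∧ len D (lin L g) = 1} = ⊤
  torsionFree : ∀ (n : ℤ) (x : L), n ≠ 0 → n • x = 0 → x = 0

open RootedDatum

section Affine

variable {J L G : Type*} [AddCommGroup L] [Group G] [DistribMulAction G L]
variable (D : Datum J L) [RootedDatum D G]

theorem act_mul (w w' : AffW G L) (y : L) : act (w * w') y = act w (act w' y) := by
  unfold act
  rw [SemidirectProduct.mul_left, SemidirectProduct.mul_right, toAdd_mul, mul_smul, smul_add,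
    add_assoc]
  rfl

@[simp] theorem act_one (y : L) : act (1 : AffW G L) y = y := by
  simp [act]

@[simp] theorem act_tr (x y : L) : act (tr G x) y = x + y := by
  simp [act, tr]

@[simp] theorem act_lin (g : G) (y : L) : act (lin L g) y = g • y := by
  simp [act, lin]

theorem act_act_inv (w : AffW G L) (y : L) : act w (act w⁻¹ y) = y := by
  rw [← act_mul, mul_inv_cancel, act_one]

theorem tr_add (x y : L) : tr G (x + y) = tr G x * tr G y := by
  simp [tr, ofAdd_add]

theorem tr_zero : tr G (0 : L) = 1 := by simp [tr]

theorem lin_mul (g h : G) : lin L (g * h) = lin L g * lin L h := by simp [lin]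

theorem lin_one : lin L (1 : G) = 1 := by simp [lin]

theorem lin_inv (g : G) : lin L g⁻¹ = (lin L g)⁻¹ := by simp [lin]

theorem lin_injective : Function.Injective (lin L : G → AffW G L) :=
  SemidirectProduct.inr_injective

theorem lin_mul_tr (g : G) (x : L) : lin L g * tr G x = tr G (g • x) * lin L g := by
  have h := SemidirectProduct.inl_aut (φ := latticeAut G L) g (Multiplicative.ofAdd x)
  rw [map_inv, eq_mul_inv_iff_mul_eq] at h
  exact h.symm

theorem eq_tr_mul_lin (w : AffW G L) : w = tr G (act w 0) * lin L w.right := by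
  ext
  · simp [lin, tr, act]
  · simp [lin, tr]

include D in
theorem act_faithful {w w' : AffW G L} (h : ∀ y, act w y = act w' y) : w = w' := by
  have h0 : w.left.toAdd = w'.left.toAdd := by simpa [act] using h 0
  have h1 : w.right = w'.right := by
    have : w'.right⁻¹ * w.right = 1 := by
      refine faithful D _ fun y => ?_
      have := h y
      simp only [act, h0, add_right_inj] at this
      rw [mul_smul, this, inv_smul_smul]
    rw [inv_mul_eq_one] at this
    exact this.symm
  exact SemidirectProduct.ext h0 h1

/-- The action on affine roots. -/
def affAct (w : AffW G L) (a : J × ℤ) : J × ℤ :=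
  (perm D w.right a.1, a.2 - D.coroot (perm D w.right a.1) w.left.toAdd)

/-- The negative of an affine root. -/
def affNeg (G : Type*) [Group G] [DistribMulAction G L] [RootedDatum D G] (a : J × ℤ) : J × ℤ :=
  (perm D (refl D a.1 : G) a.1, -a.2)

/-- The reflection in an affine root. -/
def affRefl (G : Type*) [Group G] [DistribMulAction G L] [RootedDatum D G] (a : J × ℤ) :
    AffW G L :=
  tr G (-(a.2 • D.root a.1)) * lin L (refl D a.1)

/-- A positive functional on affine roots. -/
def affHt (a : J × ℤ) : ℤ :=
  affEval D a (twoRho D) + (∑ᶠ j, |D.coroot j (twoRho D)|) * affEval D a 0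

variable {D}

theorem affEval_affAct (w : AffW G L) (a : J × ℤ) (y : L) :
    affEval D (affAct D w a) (act w y) = affEval D a y := by
  simp only [affEval, affAct, act, map_add, coroot_perm]
  ring

theorem affEval_affAct' (w : AffW G L) (a : J × ℤ) (y : L) :
    affEval D (affAct D w a) y = affEval D a (act w⁻¹ y) := by
  conv_lhs => rw [← act_act_inv w y]
  rw [affEval_affAct]

variable (G) in
include G in
theorem affEval_ext {a b : J × ℤ} (h : ∀ y, affEval D a y = affEval D b y) : a = b := by
  have h2 : a.2 = b.2 := by simpa [affEval] using h 0
  refine Prod.ext ?_ h2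
  refine parallel (D := D) (G := G) a.1 b.1 1 1 one_pos one_pos fun y => ?_
  have := h y
  simp only [affEval, h2] at this
  linarith

theorem affAct_mul (w w' : AffW G L) (a : J × ℤ) :
    affAct D (w * w') a = affAct D w (affAct D w' a) := by
  refine affEval_ext (D := D) G fun y => ?_
  rw [affEval_affAct', affEval_affAct', affEval_affAct', mul_inv_rev, act_mul]

@[simp] theorem affAct_one (a : J × ℤ) : affAct D (1 : AffW G L) a = a := by
  refine affEval_ext (D := D) G fun y => ?_
  rw [affEval_affAct', inv_one, act_one]

theorem affAct_inv_affAct (w : AffW G L) (a : J × ℤ) : affAct D w⁻¹ (affAct D w a) = a := by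
  rw [← affAct_mul, inv_mul_cancel, affAct_one]

theorem affAct_affAct_inv (w : AffW G L) (a : J × ℤ) : affAct D w (affAct D w⁻¹ a) = a := by
  rw [← affAct_mul, mul_inv_cancel, affAct_one]

theorem affAct_injective (w : AffW G L) : Function.Injective (affAct D w) :=
  Function.LeftInverse.injective (affAct_inv_affAct w)

theorem refl_mul_self (j : J) : (refl D j : G) * refl D j = 1 := by
  refine faithful D _ fun y => ?_
  rw [mul_smul, refl_smul, refl_smul, map_sub, map_zsmul, coroot_root (G := G)]
  simp only [smul_eq_mul, sub_smul, mul_smul, two_smul, smul_add]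
  abel

theorem refl_inv (j : J) : (refl D j : G)⁻¹ = refl D j :=
  inv_eq_of_mul_eq_one_left (refl_mul_self j)

theorem root_neg (j : J) : D.root (perm D (refl D j : G) j) = -D.root j := by
  rw [root_perm, refl_smul, coroot_root (G := G), two_smul]
  abel

theorem coroot_refl_smul (j : J) (y : L) : D.coroot j ((refl D j : G) • y) = -D.coroot j y := by
  rw [refl_smul, map_sub, map_zsmul, coroot_root (G := G), smul_eq_mul]
  ring

theorem coroot_neg (j : J) (y : L) : D.coroot (perm D (refl D j : G) j) y = -D.coroot j y := by
  have : y = (refl D j : G) • (refl D j : G) • y := by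
    rw [← mul_smul, refl_mul_self, one_smul]
  rw [this, coroot_perm, coroot_refl_smul, ← mul_smul, refl_mul_self, one_smul]

theorem affEval_affNeg (a : J × ℤ) (y : L) : affEval D (affNeg D G a) y = -affEval D a y := by
  simp only [affEval, affNeg, coroot_neg]
  ring

@[simp] theorem affNeg_affNeg (a : J × ℤ) : affNeg D G (affNeg D G a) = a :=
  affEval_ext (D := D) G fun y => by rw [affEval_affNeg, affEval_affNeg, neg_neg]

theorem affAct_affNeg (w : AffW G L) (a : J × ℤ) :
    affAct D w (affNeg D G a) = affNeg D G (affAct D w a) :=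
  affEval_ext (D := D) G fun y => by
    rw [affEval_affAct', affEval_affNeg, affEval_affNeg, affEval_affAct']

theorem act_affRefl (a : J × ℤ) (y : L) :
    act (affRefl D G a) y = y - affEval D a y • D.root a.1 := by
  rw [affRefl, act_mul, act_lin, act_tr, refl_smul, affEval, add_smul]
  abel

theorem isRefl_affRefl (a : J × ℤ) : IsRefl D (affRefl D G a) a := act_affRefl a

theorem IsRefl.eq_affRefl {r : AffW G L} {a : J × ℤ} (h : IsRefl D r a) : r = affRefl D G a :=
  act_faithful D fun y => (h y).trans (act_affRefl a y).symm

theorem affRefl_mul_self (a : J × ℤ) : affRefl D G a * affRefl D G a = 1 := by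
  refine act_faithful D fun y => ?_
  rw [act_mul, act_one, act_affRefl, act_affRefl]
  simp only [affEval, map_sub, map_zsmul, coroot_root (G := G), smul_eq_mul]
  rw [sub_sub, ← add_smul, sub_eq_self]
  convert zero_smul ℤ (D.root a.1) using 2
  ring

theorem affRefl_inv (a : J × ℤ) : (affRefl D G a)⁻¹ = affRefl D G a :=
  inv_eq_of_mul_eq_one_left (affRefl_mul_self a)

theorem affEval_affRefl (a b : J × ℤ) (y : L) :
    affEval D (affAct D (affRefl D G a) b) y =
      affEval D b y - D.coroot b.1 (D.root a.1) * affEval D a y := by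
  rw [affEval_affAct', affRefl_inv, act_affRefl]
  simp only [affEval, map_sub, map_zsmul, smul_eq_mul]
  ring

theorem affAct_affRefl_self (a : J × ℤ) : affAct D (affRefl D G a) a = affNeg D G a :=
  affEval_ext (D := D) G fun y => by
    rw [affEval_affRefl, affEval_affNeg, coroot_root (G := G)]; ring

theorem affRefl_affNeg (a : J × ℤ) : affRefl D G (affNeg D G a) = affRefl D G a := by
  refine act_faithful D fun y => ?_
  rw [act_affRefl, act_affRefl, affEval_affNeg]
  simp [affNeg, root_neg]

theorem affRefl_affAct (w : AffW G L) (a : J × ℤ) :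
    affRefl D G (affAct D w a) = w * affRefl D G a * w⁻¹ := by
  refine act_faithful D fun y => ?_
  rw [act_mul, act_mul, act_affRefl, act_affRefl, affEval_affAct']
  have hsub : ∀ u v : L, act w (u - v) = act w u - w.right • v := by
    intro u v; simp only [act, smul_sub]; abel
  have hz : ∀ (n : ℤ) (v : L), w.right • (n • v) = n • w.right • v :=
    fun n v => map_zsmul (DistribSMul.toAddMonoidHom L w.right) n v
  rw [hsub, act_act_inv, hz]
  simp [affAct, root_perm]

theorem affRefl_finite (j : J) : affRefl D G (j, 0) = lin L (refl D j) := by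
  simp [affRefl, tr_zero]

theorem affAct_lin (g : G) (a : J × ℤ) : affAct D (lin L g) a = (perm D g a.1, a.2) := by
  simp [affAct, lin]

theorem affAct_tr (x : L) (a : J × ℤ) : affAct D (tr G x) a = (a.1, a.2 - D.coroot a.1 x) := by
  simp [affAct, tr]

/-! #### Positivity -/

variable (G) in
include G in
theorem affPos_iff (a : J × ℤ) :
    AffPos D a ↔ 0 < affHt D a := by
  have : Finite J := RootedDatum.finite D G
  cases nonempty_fintype J
  have hle : |D.coroot a.1 (twoRho D)| ≤ ∑ᶠ j, |D.coroot j (twoRho D)| := by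
    rw [finsum_eq_sum_of_fintype]
    exact Finset.single_le_sum (f := fun j => |D.coroot j (twoRho D)|)
      (fun j _ => abs_nonneg _) (Finset.mem_univ a.1)
  have hht : affHt D a = D.coroot a.1 (twoRho D) + a.2 +
      (∑ᶠ j, |D.coroot j (twoRho D)|) * a.2 := by simp [affHt, affEval]
  rw [hht, AffPos, pos_iff (D := D) (G := G)]
  have h1 := abs_le.mp hle
  generalize (∑ᶠ j, |D.coroot j (twoRho D)|) = S at *
  have hS : 0 ≤ S := (abs_nonneg _).trans hle
  rcases lt_trichotomy a.2 0 with h | h | h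
  · constructor
    · rintro (h' | h') <;> omega
    · intro h'; nlinarith
  · simp [h]
  · simp only [h, true_or, true_iff]
    nlinarith

variable (G) in
include G in
theorem affHt_ne_zero (a : J × ℤ) :
    affHt D a ≠ 0 := by
  intro h0
  have h1 : ¬ AffPos D a := by rw [affPos_iff G, h0]; simp
  have h2 : ¬ AffPos D (affNeg D G a) := by
    rw [affPos_iff G, affHt, affEval_affNeg, affEval_affNeg]
    rw [affHt] at h0; linarith
  have h3 := regular (D := D) (G := G) a.1
  simp only [AffPos, affNeg, pos_iff (D := D) (G := G), coroot_neg] at h1 h2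
  omega

theorem affHt_affNeg (a : J × ℤ) : affHt D (affNeg D G a) = -affHt D a := by
  simp only [affHt, affEval_affNeg]; ring

theorem affPos_affNeg (a : J × ℤ) : AffPos D (affNeg D G a) ↔ ¬ AffPos D a := by
  rw [affPos_iff G, affPos_iff G, affHt_affNeg]
  have := affHt_ne_zero G (D := D) a
  omega

theorem affHt_linear {k : ℤ} {a b c : J × ℤ}
    (h : ∀ y, k * affEval D a y = affEval D b y + affEval D c y) :
    k * affHt D a = affHt D b + affHt D c := by
  simp only [affHt]
  linear_combination h (twoRho D) + (∑ᶠ j, |D.coroot j (twoRho D)|) * h 0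

theorem affHt_affAct_linear (w : AffW G L) {k : ℤ} {a b c : J × ℤ}
    (h : ∀ y, k * affEval D a y = affEval D b y + affEval D c y) :
    k * affHt D (affAct D w a) = affHt D (affAct D w b) + affHt D (affAct D w c) := by
  refine affHt_linear fun y => ?_
  simp only [affEval_affAct', h]

/-- A positive affine root is simple if its reflection leaves all other positive affine roots
positive. -/
def IsSimpleAff (D : Datum J L) (G : Type*) [Group G] [DistribMulAction G L] [RootedDatum D G]
    (a : J × ℤ) : Prop :=
  AffPos D a ∧ ∀ b, AffPos D b → b ≠ a → AffPos D (affAct D (affRefl D G a) b)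

theorem exists_isSimpleAff {Φ : Set (J × ℤ)} (hΦ : ∀ a ∈ Φ, AffPos D a)
    (hcl : ∀ a ∈ Φ, ∀ b, AffPos D b → ¬ AffPos D (affAct D (affRefl D G a) b) →
      b ∈ Φ ∧ affNeg D G (affAct D (affRefl D G a) b) ∈ Φ)
    (F : J × ℤ → ℤ)
    (hF : ∀ (k : ℤ) (a b c : J × ℤ),
      (∀ y, k * affEval D a y = affEval D b y + affEval D c y) → k * F a = F b + F c)
    (hfin : {a ∈ Φ | F a < 0}.Finite) (hne : {a ∈ Φ | F a < 0}.Nonempty) :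
    ∃ a ∈ Φ, F a < 0 ∧ IsSimpleAff D G a := by
  have hpos : ∀ a ∈ Φ, (0 : ℤ) < affHt D a := fun a ha => (affPos_iff G a).1 (hΦ a ha)
  obtain ⟨a₀, ha₀, hmin⟩ := Set.exists_min_image _ (fun a => (F a : ℝ) / affHt D a) hfin hne
  set S : Set (J × ℤ) := {a | (a ∈ Φ ∧ F a < 0) ∧ (F a : ℝ) / affHt D a = F a₀ / affHt D a₀}
    with hS
  set v : J × ℤ → L → ℝ := fun a y => (affEval D a y : ℝ) / affHt D a with hv
  have hSfin : S.Finite := hfin.subset fun a ha => ha.1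
  have hcomp : IsCompact (convexHull ℝ (v '' S)) := Set.Finite.isCompact_convexHull ℝ (hSfin.image v)
  have hnonempty : (convexHull ℝ (v '' S)).Nonempty :=
    (convexHull_nonempty_iff).2 ⟨v a₀, a₀, ⟨ha₀, rfl⟩, rfl⟩
  obtain ⟨e, he⟩ := hcomp.extremePoints_nonempty hnonempty
  obtain ⟨a, ha, rfl⟩ := extremePoints_convexHull_subset he
  refine ⟨a, ha.1.1, ha.1.2, hΦ a ha.1.1, fun b hb hba => ?_⟩
  by_contra hneg
  obtain ⟨hbΦ, hcΦ⟩ := hcl a ha.1.1 b hb hneg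
  set c := affNeg D G (affAct D (affRefl D G a) b) with hc
  set k := D.coroot b.1 (D.root a.1) with hk
  have hlin : ∀ y, k * affEval D a y = affEval D b y + affEval D c y := by
    intro y; rw [hc, affEval_affNeg, affEval_affRefl]; ring
  have hH := affHt_linear hlin
  have hFk := hF k a b c hlin
  have pa := hpos a ha.1.1
  have pb := hpos b hbΦ
  have pc := hpos c hcΦ
  have hk0 : 0 < k := by
    by_contra hk0
    nlinarith
  have hFa := ha.1.2
  have hmin' : ∀ d ∈ Φ, F d < 0 → F a * affHt D d ≤ F d * affHt D a := by
    intro d hd hFd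
    have h1 := hmin d ⟨hd, hFd⟩
    rw [← ha.2, div_le_div_iff₀ (by exact_mod_cast pa) (by exact_mod_cast hpos d hd)] at h1
    exact_mod_cast h1
  have hFb : F b < 0 := by
    by_contra hFb
    have h1 := hmin' c hcΦ (by nlinarith)
    nlinarith
  have hFc : F c < 0 := by
    by_contra hFc
    have h1 := hmin' b hbΦ (by nlinarith)
    nlinarith
  have h1 := hmin' b hbΦ hFb
  have h2 := hmin' c hcΦ hFc
  have h3 : k * F a * affHt D a = F a * (k * affHt D a) := by ring
  rw [hFk, hH] at h3
  have e1 : F b * affHt D a = F a * affHt D b := by nlinarith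
  have e2 : F c * affHt D a = F a * affHt D c := by nlinarith
  have ra : (affHt D a : ℝ) ≠ 0 := by exact_mod_cast pa.ne'
  have rb : (affHt D b : ℝ) ≠ 0 := by exact_mod_cast pb.ne'
  have rc : (affHt D c : ℝ) ≠ 0 := by exact_mod_cast pc.ne'
  have hbS : b ∈ S := ⟨⟨hbΦ, hFb⟩, by
    rw [← ha.2, div_eq_div_iff rb ra]; exact_mod_cast e1⟩
  have hcS : c ∈ S := ⟨⟨hcΦ, hFc⟩, by
    rw [← ha.2, div_eq_div_iff rc ra]; exact_mod_cast e2⟩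
  have hseg : v a ∈ openSegment ℝ (v b) (v c) := by
    have rk : (0 : ℝ) < k := by exact_mod_cast hk0
    have rpa : (0 : ℝ) < affHt D a := by exact_mod_cast pa
    have rpb : (0 : ℝ) < affHt D b := by exact_mod_cast pb
    have rpc : (0 : ℝ) < affHt D c := by exact_mod_cast pc
    have hHr : (k : ℝ) * affHt D a = affHt D b + affHt D c := by exact_mod_cast hH
    refine ⟨affHt D b / (k * affHt D a), affHt D c / (k * affHt D a), by positivity,
      by positivity, ?_, ?_⟩
    · rw [← add_div, ← hHr, div_self (by positivity)]
    · funext y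
      have hy : (k : ℝ) * affEval D a y = affEval D b y + affEval D c y := by
        exact_mod_cast hlin y
      simp only [hv, Pi.add_apply, Pi.smul_apply, smul_eq_mul]
      field_simp
      linarith
  have hext := (mem_extremePoints.1 he).2 (v b) (subset_convexHull ℝ _ ⟨b, hbS, rfl⟩)
    (v c) (subset_convexHull ℝ _ ⟨c, hcS, rfl⟩) hseg
  have hvb : ∀ y, affHt D a * affEval D b y = affHt D b * affEval D a y := by
    intro y
    have h4 := congrFun hext.1 y
    simp only [hv] at h4
    rw [div_eq_div_iff rb ra] at h4
    have h5 : affEval D b y * affHt D a = affEval D a y * affHt D b := by exact_mod_cast h4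
    linarith
  have h20 : affHt D a * b.2 = affHt D b * a.2 := by simpa [affEval] using hvb 0
  have hpar : ∀ y, affHt D a * D.coroot b.1 y = affHt D b * D.coroot a.1 y := by
    intro y
    have := hvb y
    simp only [affEval] at this
    linarith
  have h11 : b.1 = a.1 := parallel (D := D) (G := G) _ _ _ _ pa pb hpar
  have h6 := hpar (D.root a.1)
  rw [h11, coroot_root (D := D) (G := G)] at h6
  have h7 : affHt D a = affHt D b := by linarith
  rw [h7] at h20
  exact hba (Prod.ext h11 (mul_left_cancel₀ pb.ne' h20))

end Affine


open RootedDatum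

section Length

variable {J L G : Type*} [AddCommGroup L] [Group G] [DistribMulAction G L]
variable {D : Datum J L} [RootedDatum D G]

theorem inversions_eq (w : AffW G L) :
    inversions D w = {a | AffPos D a ∧ ¬ AffPos D (affAct D w a)} := by
  ext a
  refine and_congr_right fun _ => ⟨?_, fun h => ⟨_, h, fun y => affEval_affAct w a y⟩⟩
  rintro ⟨a', ha', h⟩
  have : a' = affAct D w a := affEval_ext (D := D) G fun y => by
    rw [affEval_affAct', ← h, act_act_inv]
  rwa [← this]

theorem inversions_finite (w : AffW G L) : (inversions D w).Finite := by
  have : Finite J := RootedDatum.finite D G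
  refine (Set.finite_iUnion fun j : J =>
    (Set.finite_singleton j).prod
      (Set.finite_Icc 0 (D.coroot (perm D w.right j) w.left.toAdd))).subset ?_
  rintro ⟨j, n⟩ h
  rw [inversions_eq] at h
  simp only [AffPos, affAct, Set.mem_ofPred_eq, not_or] at h
  simp only [Set.mem_iUnion, Set.mem_prod, Set.mem_singleton_iff, Set.mem_Icc]
  refine ⟨j, rfl, ?_, ?_⟩ <;> omega

theorem affPos_or_affNeg (a : J × ℤ) : AffPos D a ∨ AffPos D (affNeg D G a) := by
  rw [affPos_affNeg]; exact em _

theorem len_mul_add (w w' : AffW G L) :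
    len D (w * w') +
      2 * {a | (AffPos D a ∧ ¬ AffPos D (affAct D w' a)) ∧
        AffPos D (affAct D (w * w') a)}.ncard = len D w + len D w' := by
  set A₁ : Set (J × ℤ) := {a | (AffPos D a ∧ ¬ AffPos D (affAct D w' a)) ∧
    ¬ AffPos D (affAct D (w * w') a)} with hA₁
  set A₂ : Set (J × ℤ) := {a | (AffPos D a ∧ ¬ AffPos D (affAct D w' a)) ∧
    AffPos D (affAct D (w * w') a)} with hA₂
  set B : Set (J × ℤ) := {a | (AffPos D a ∧ AffPos D (affAct D w' a)) ∧
    ¬ AffPos D (affAct D (w * w') a)} with hB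
  have h1 : inversions D w' = A₁ ∪ A₂ := by
    rw [inversions_eq]; ext a; simp only [hA₁, hA₂, Set.mem_union, Set.mem_ofPred_eq]; grind
  have h2 : inversions D (w * w') = A₁ ∪ B := by
    rw [inversions_eq]; ext a; simp only [hA₁, hB, Set.mem_union, Set.mem_ofPred_eq]; grind
  have h3 : inversions D w = affAct D w' '' B ∪ (affNeg D G ∘ affAct D w') '' A₂ := by
    rw [inversions_eq]
    ext b
    constructor
    · rintro ⟨hb, hwb⟩
      have hb' : affAct D w' (affAct D w'⁻¹ b) = b := affAct_affAct_inv w' b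
      by_cases ha : AffPos D (affAct D w'⁻¹ b)
      · refine Or.inl ⟨affAct D w'⁻¹ b, ⟨⟨ha, by rwa [hb']⟩, ?_⟩, hb'⟩
        rwa [affAct_mul, hb']
      · refine Or.inr ⟨affNeg D G (affAct D w'⁻¹ b), ⟨⟨?_, ?_⟩, ?_⟩, ?_⟩
        · rwa [affPos_affNeg]
        · rw [affAct_affNeg, affPos_affNeg, hb', not_not]; exact hb
        · rwa [affAct_affNeg, affPos_affNeg, affAct_mul, hb']
        · simp [affAct_affNeg, hb']
    · rintro (⟨a, ⟨⟨ha, ha'⟩, hwa⟩, rfl⟩ | ⟨a, ⟨⟨ha, ha'⟩, hwa⟩, rfl⟩)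
      · exact ⟨ha', by rwa [← affAct_mul]⟩
      · refine ⟨?_, ?_⟩
        · simpa [affPos_affNeg] using ha'
        · simpa [affAct_affNeg, affPos_affNeg, ← affAct_mul] using hwa
  have f1 := inversions_finite (D := D) w'
  have f2 := inversions_finite (D := D) (w * w')
  have f3 := inversions_finite (D := D) w
  have d1 : Disjoint A₁ A₂ := by
    rw [Set.disjoint_left]; rintro a h h'; exact h.2 h'.2
  have d2 : Disjoint A₁ B := by
    rw [Set.disjoint_left]; rintro a h h'; exact h.1.2 h'.1.2
  have d3 : Disjoint (affAct D w' '' B) ((affNeg D G ∘ affAct D w') '' A₂) := by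
    rw [Set.disjoint_left]
    rintro _ ⟨a, ha, rfl⟩ ⟨b, hb, hab⟩
    have : affNeg D G b = a := by
      apply affAct_injective (D := D) w'; rw [affAct_affNeg]; exact hab
    have h4 := ha.1.1
    rw [← this, affPos_affNeg] at h4
    exact h4 hb.1.1
  have hinj : Function.Injective (affNeg D G ∘ affAct D w') :=
    (Function.LeftInverse.injective (g := affNeg D G) (affNeg_affNeg (D := D))).comp (affAct_injective (D := D) w')
  have e1 : len D w' = A₁.ncard + A₂.ncard := by
    rw [len, h1]; rw [h1] at f1
    exact Set.ncard_union_eq d1 (f1.subset Set.subset_union_left) (f1.subset Set.subset_union_right)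
  have e2 : len D (w * w') = A₁.ncard + B.ncard := by
    rw [len, h2]; rw [h2] at f2
    exact Set.ncard_union_eq d2 (f2.subset Set.subset_union_left) (f2.subset Set.subset_union_right)
  have e3 : len D w = B.ncard + A₂.ncard := by
    rw [len, h3]; rw [h3] at f3
    rw [Set.ncard_union_eq d3 (f3.subset Set.subset_union_left)
      (f3.subset Set.subset_union_right), Set.ncard_image_of_injective _ (affAct_injective w'),
      Set.ncard_image_of_injective _ hinj]
  omega

theorem len_mul_le (w w' : AffW G L) : len D (w * w') ≤ len D w + len D w' := by
  have := len_mul_add (D := D) w w'; omega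

theorem len_mul_eq_iff (w w' : AffW G L) : len D (w * w') = len D w + len D w' ↔
    ∀ a, AffPos D a → ¬ AffPos D (affAct D w' a) → ¬ AffPos D (affAct D (w * w') a) := by
  have h := len_mul_add (D := D) w w'
  have hfin : {a | (AffPos D a ∧ ¬ AffPos D (affAct D w' a)) ∧
        AffPos D (affAct D (w * w') a)}.Finite := by
    refine (inversions_finite (D := D) w').subset fun a ha => ?_
    rw [inversions_eq]; exact ha.1
  constructor
  · intro he a ha ha' hwa
    have : {a | (AffPos D a ∧ ¬ AffPos D (affAct D w' a)) ∧
        AffPos D (affAct D (w * w') a)}.ncard = 0 := by omega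
    rw [Set.ncard_eq_zero hfin] at this
    exact this.subset ⟨⟨ha, ha'⟩, hwa⟩
  · intro hall
    have : {a | (AffPos D a ∧ ¬ AffPos D (affAct D w' a)) ∧
        AffPos D (affAct D (w * w') a)} = ∅ := by
      ext a; simp only [Set.mem_ofPred_eq, Set.mem_empty_iff_false, iff_false]
      rintro ⟨⟨h1, h2⟩, h3⟩; exact hall a h1 h2 h3
    rw [this, Set.ncard_empty] at h
    omega

variable (D) in
theorem len_one : len D (1 : AffW G L) = 0 := by
  have : inversions D (1 : AffW G L) = ∅ := by
    rw [inversions_eq]; ext a; simp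
  rw [len, this, Set.ncard_empty]

theorem len_inv (w : AffW G L) : len D w⁻¹ = len D w := by
  have h := len_mul_add (D := D) w w⁻¹
  rw [mul_inv_cancel, len_one] at h
  have : {a | (AffPos D a ∧ ¬ AffPos D (affAct D w⁻¹ a)) ∧
      AffPos D (affAct D (1 : AffW G L) a)} = inversions D w⁻¹ := by
    rw [inversions_eq]; ext a; simp; grind
  rw [this] at h
  change 0 + 2 * len D w⁻¹ = _ at h
  omega

theorem len_eq_zero_iff (w : AffW G L) :
    len D w = 0 ↔ ∀ a, AffPos D a → AffPos D (affAct D w a) := by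
  rw [len, Set.ncard_eq_zero (inversions_finite w), inversions_eq]
  simp only [Set.eq_empty_iff_forall_notMem, Set.mem_ofPred_eq, not_and, not_not]

theorem len_mul_of_len_zero {u : AffW G L} (hu : len D u = 0) (w : AffW G L) :
    len D (w * u) = len D w := by
  have h1 := len_mul_le (D := D) w u
  have h2 := len_mul_le (D := D) (w * u) u⁻¹
  rw [mul_inv_cancel_right, len_inv] at h2
  omega

theorem len_zero_mul {u : AffW G L} (hu : len D u = 0) (w : AffW G L) :
    len D (u * w) = len D w := by
  rw [← len_inv, mul_inv_rev, len_mul_of_len_zero (by rw [len_inv, hu]), len_inv]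

theorem len_affRefl_mul (a : J × ℤ) (w : AffW G L) :
    len D (affRefl D G a * w) = len D (w⁻¹ * affRefl D G a) := by
  rw [← len_inv, mul_inv_rev, affRefl_inv]

namespace IsSimpleAff

variable {a : J × ℤ}

theorem inversions (ha : IsSimpleAff D G a) :
    AffineHecke.inversions D (affRefl D G a) = {a} := by
  rw [inversions_eq]
  ext b
  simp only [Set.mem_ofPred_eq, Set.mem_singleton_iff]
  constructor
  · rintro ⟨hb, hb'⟩
    by_contra hne
    exact hb' (ha.2 b hb hne)
  · rintro rfl
    exact ⟨ha.1, by rw [affAct_affRefl_self, affPos_affNeg, not_not]; exact ha.1⟩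

theorem len (ha : IsSimpleAff D G a) : len D (affRefl D G a) = 1 := by
  rw [AffineHecke.len, ha.inversions, Set.ncard_singleton]

theorem len_mul_of_pos (ha : IsSimpleAff D G a) {w : AffW G L} (hw : AffPos D (affAct D w a)) :
    AffineHecke.len D (w * affRefl D G a) = AffineHecke.len D w + 1 := by
  rw [← ha.len, len_mul_eq_iff]
  intro b hb hb'
  have : b ∈ AffineHecke.inversions D (affRefl D G a) := by rw [inversions_eq]; exact ⟨hb, hb'⟩
  rw [ha.inversions, Set.mem_singleton_iff] at this
  subst this
  rw [affAct_mul, affAct_affRefl_self, affAct_affNeg, affPos_affNeg, not_not]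
  exact hw

theorem len_mul_of_neg (ha : IsSimpleAff D G a) {w : AffW G L} (hw : ¬ AffPos D (affAct D w a)) :
    AffineHecke.len D (w * affRefl D G a) + 1 = AffineHecke.len D w := by
  rw [← ha.len_mul_of_pos (w := w * affRefl D G a), mul_assoc, affRefl_mul_self, mul_one]
  rwa [affAct_mul, affAct_affRefl_self, affAct_affNeg, affPos_affNeg]

theorem lt_len_mul_iff (ha : IsSimpleAff D G a) {w : AffW G L} :
    AffineHecke.len D w < AffineHecke.len D (w * affRefl D G a) ↔ AffPos D (affAct D w a) := by
  by_cases h : AffPos D (affAct D w a)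
  · have := ha.len_mul_of_pos h; simp only [h, iff_true]; omega
  · have := ha.len_mul_of_neg h; simp only [h, iff_false]; omega

theorem refl_mul_len_of_pos (ha : IsSimpleAff D G a) {w : AffW G L}
    (hw : AffPos D (affAct D w⁻¹ a)) :
    AffineHecke.len D (affRefl D G a * w) = AffineHecke.len D w + 1 := by
  rw [len_affRefl_mul, ha.len_mul_of_pos hw, len_inv]

theorem refl_mul_len_of_neg (ha : IsSimpleAff D G a) {w : AffW G L}
    (hw : ¬ AffPos D (affAct D w⁻¹ a)) :
    AffineHecke.len D (affRefl D G a * w) + 1 = AffineHecke.len D w := by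
  rw [len_affRefl_mul, ha.len_mul_of_neg hw, len_inv]

theorem mem_simpleRefl (ha : IsSimpleAff D G a) : affRefl D G a ∈ simpleRefl G D :=
  ⟨ha.len, a, isRefl_affRefl a⟩

end IsSimpleAff

theorem isSimpleAff_of_len_eq_one {a : J × ℤ} (ha : AffPos D a)
    (h : len D (affRefl D G a) = 1) : IsSimpleAff D G a := by
  rw [len, Set.ncard_eq_one] at h
  obtain ⟨b, hb⟩ := h
  have hab : a ∈ inversions D (affRefl D G a) := by
    rw [inversions_eq]
    exact ⟨ha, by rw [affAct_affRefl_self, affPos_affNeg, not_not]; exact ha⟩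
  rw [hb, Set.mem_singleton_iff] at hab
  subst hab
  refine ⟨ha, fun c hc hca => ?_⟩
  by_contra hneg
  refine hca ?_
  rw [← Set.mem_singleton_iff, ← hb, inversions_eq]
  exact ⟨hc, hneg⟩

theorem mem_simpleRefl_iff (s : AffW G L) :
    s ∈ simpleRefl G D ↔ ∃ a, IsSimpleAff D G a ∧ s = affRefl D G a := by
  constructor
  · rintro ⟨h1, a, ha⟩
    have hs := ha.eq_affRefl
    rcases affPos_or_affNeg (D := D) (G := G) a with hp | hp
    · exact ⟨a, isSimpleAff_of_len_eq_one hp (hs ▸ h1), hs⟩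
    · refine ⟨_, isSimpleAff_of_len_eq_one hp ?_, ?_⟩ <;> rw [affRefl_affNeg]
      · exact hs ▸ h1
      · exact hs
  · rintro ⟨a, ha, rfl⟩; exact ha.mem_simpleRefl

theorem exists_simple_descent {w : AffW G L} (hw : len D w ≠ 0) :
    ∃ a, IsSimpleAff D G a ∧ ¬ AffPos D (affAct D w a) := by
  have key : ∀ a, affHt D (affAct D w a) < 0 ↔ ¬ AffPos D (affAct D w a) := by
    intro a
    have := affHt_ne_zero (D := D) G (affAct D w a)
    rw [affPos_iff G]; omega
  have hset : {a ∈ {a | AffPos D a} | affHt D (affAct D w a) < 0} = inversions D w := by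
    rw [inversions_eq]; ext a; simp [key]
  obtain ⟨a, -, ha, hs⟩ := exists_isSimpleAff (D := D) (G := G) (Φ := {a | AffPos D a})
    (fun a ha => ha) (fun a _ b hb hb' => ⟨hb, by
      change AffPos D _; rwa [affPos_affNeg]⟩)
    (fun a => affHt D (affAct D w a)) (fun k a b c h => affHt_affAct_linear w h)
    (by rw [hset]; exact inversions_finite w)
    (by rw [hset, ← Set.ncard_pos (inversions_finite w)]; exact Nat.pos_of_ne_zero hw)
  exact ⟨a, hs, (key a).1 ha⟩

variable (D) in
theorem len_induction_right {p : AffW G L → Prop}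
    (zero : ∀ u, len D u = 0 → p u)
    (step : ∀ w a, IsSimpleAff D G a → AffPos D (affAct D w a) → p w → p (w * affRefl D G a))
    (w : AffW G L) : p w := by
  induction hn : len D w generalizing w with
  | zero => exact zero w hn
  | succ n ih =>
    obtain ⟨a, ha, hwa⟩ := exists_simple_descent (D := D) (w := w) (by omega)
    have h := step (w * affRefl D G a) a ha
      (by rwa [affAct_mul, affAct_affRefl_self, affAct_affNeg, affPos_affNeg])
      (ih _ (by have := ha.len_mul_of_neg hwa; omega))
    rwa [mul_assoc, affRefl_mul_self, mul_one] at h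

variable (D) in
theorem len_induction_left {p : AffW G L → Prop}
    (zero : ∀ u, len D u = 0 → p u)
    (step : ∀ w a, IsSimpleAff D G a → AffPos D (affAct D w⁻¹ a) → p w → p (affRefl D G a * w))
    (w : AffW G L) : p w := by
  rw [← inv_inv w]
  refine len_induction_right D (p := fun w => p w⁻¹) (fun u hu => zero _ (by rwa [len_inv]))
    (fun w a ha hwa hp => ?_) w⁻¹
  rw [mul_inv_rev, affRefl_inv]
  exact step _ a ha (by rwa [inv_inv]) hp

/-- The strong exchange condition. -/
theorem strong_exchange (v : AffW G L) : ∀ c, AffPos D c → ¬ AffPos D (affAct D v c) →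
    ∃ A B : AffW G L, ∃ a, IsSimpleAff D G a ∧ v = A * affRefl D G a * B ∧
      v * affRefl D G c = A * B ∧ len D v = len D A + 1 + len D B ∧
      len D (affRefl D G a * B) = 1 + len D B ∧ affAct D B c = a := by
  refine len_induction_right D (p := fun v => ∀ c, AffPos D c → ¬ AffPos D (affAct D v c) →
    ∃ A B : AffW G L, ∃ a, IsSimpleAff D G a ∧ v = A * affRefl D G a * B ∧
      v * affRefl D G c = A * B ∧ len D v = len D A + 1 + len D B ∧
      len D (affRefl D G a * B) = 1 + len D B ∧ affAct D B c = a)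
    (fun u hu c hc hc' => ?_) (fun v a ha hva ih c hc hc' => ?_) v
  · exact absurd ((len_eq_zero_iff u).1 hu c hc) hc'
  · by_cases hca : c = a
    · subst hca
      refine ⟨v, 1, c, ha, by rw [mul_one], ?_, ?_, ?_, affAct_one c⟩
      · rw [mul_assoc, affRefl_mul_self]
      · rw [ha.len_mul_of_pos hva, len_one]
      · rw [mul_one, ha.len, len_one]
    · obtain ⟨A, B, b, hb, h1, h2, h3, h4, h5⟩ := ih (affAct D (affRefl D G a) c) (ha.2 c hc hca)
        (by rwa [← affAct_mul])
      have hl := ha.len_mul_of_pos hva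
      have l1 := len_mul_le (D := D) B (affRefl D G a)
      have l2 := len_mul_le (D := D) A (affRefl D G b * (B * affRefl D G a))
      have l3 := len_mul_le (D := D) (affRefl D G b) (B * affRefl D G a)
      have e1 : v * affRefl D G a = A * affRefl D G b * (B * affRefl D G a) := by
        rw [h1]; group
      rw [e1, mul_assoc A] at hl
      rw [hb.len] at l3
      rw [ha.len] at l1
      refine ⟨A, B * affRefl D G a, b, hb, e1, ?_, ?_, ?_, ?_⟩
      · rw [affRefl_affAct, affRefl_inv] at h2
        rw [← mul_assoc, ← h2]
        have := affRefl_mul_self (D := D) (G := G) a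
        simp only [mul_assoc, this, mul_one]
      · rw [e1, mul_assoc A]; omega
      · omega
      · rw [affAct_mul, h5]

end Length


open RootedDatum

theorem finsum_cond_eq_sum_filter {J M : Type*} [Fintype J] [AddCommMonoid M] (p : J → Prop)
    [DecidablePred p] (f : J → M) : ∑ᶠ (j) (_ : p j), f j = ∑ j with p j, f j := by
  rw [finsum_eq_sum_of_fintype, Finset.sum_filter]
  exact Finset.sum_congr rfl fun j _ => finsum_eq_if

section FinitePart

variable {J L G : Type*} [AddCommGroup L] [Group G] [DistribMulAction G L]
variable {D : Datum J L} [RootedDatum D G]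

theorem affPos_zero (j : J) : AffPos D (j, 0) ↔ D.pos j := by simp [AffPos]

variable (G) in
include G in
theorem pos_neg_iff (j : J) : D.pos (perm D (refl D j : G) j) ↔ ¬ D.pos j := by
  rw [← affPos_zero (D := D) j, ← affPos_affNeg (G := G), affNeg, neg_zero, affPos_zero]

theorem refl_perm (g : G) (j : J) : (refl D (perm D g j) : G) = g * refl D j * g⁻¹ := by
  apply lin_injective (L := L)
  rw [← affRefl_finite, lin_mul, lin_mul, lin_inv, ← affRefl_finite,
    show ((perm D g j, 0) : J × ℤ) = affAct D (lin L g) (j, 0) by rw [affAct_lin], affRefl_affAct]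

theorem IsSimpleAff.refl_eq {j k : J} (hj : IsSimpleAff D G (j, 0)) (hk : D.pos k)
    (h : (refl D j : G) = refl D k) : j = k := by
  by_contra hne
  have := hj.2 (k, 0) ((affPos_zero k).2 hk) (by simpa using fun h => hne h.symm)
  rw [affRefl_finite, h, affAct_lin, affPos_zero, pos_neg_iff G] at this
  exact this hk

theorem exists_isSimpleAff_of_refl_len_one {j : J} (h : len D (lin L (refl D j : G)) = 1) :
    ∃ k, IsSimpleAff D G (k, 0) ∧ (refl D k : G) = refl D j := by
  rw [← affRefl_finite] at h
  rcases affPos_or_affNeg (D := D) (G := G) (j, 0) with hp | hp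
  · exact ⟨j, isSimpleAff_of_len_eq_one hp h, rfl⟩
  · refine ⟨perm D (refl D j : G) j, ?_, by rw [refl_perm, refl_inv, refl_mul_self, one_mul]⟩
    have := isSimpleAff_of_len_eq_one (G := G) hp (by rwa [affRefl_affNeg])
    simpa [affNeg] using this

/-- The product of reflections along a list of roots. -/
def reflProd (D : Datum J L) (G : Type*) [Group G] [DistribMulAction G L] [RootedDatum D G]
    (l : List J) : G := (l.map (refl D)).prod

theorem list_exchange (l : List J) (hl : ∀ j ∈ l, IsSimpleAff D G (j, 0)) (c : J)
    (hc : D.pos c) (h : ¬ D.pos (perm D (reflProd D G l) c)) :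
    ∃ l' : List J, (∀ j ∈ l', IsSimpleAff D G (j, 0)) ∧ l'.length + 1 = l.length ∧
      reflProd D G l * refl D c = reflProd D G l' := by
  induction l with
  | nil => simp [reflProd, hc] at h
  | cons i l ih =>
    have hl' : ∀ j ∈ l, IsSimpleAff D G (j, 0) := fun j hj => hl j (List.mem_cons_of_mem _ hj)
    have hcons : reflProd D G (i :: l) = refl D i * reflProd D G l := by simp [reflProd]
    by_cases hp : D.pos (perm D (reflProd D G l) c)
    · refine ⟨l, hl', rfl, ?_⟩
      have hi := hl i List.mem_cons_self
      have heq : perm D (reflProd D G l) c = i := by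
        by_contra hne
        have := hi.2 (_, 0) ((affPos_zero _).2 hp) (by simpa using hne)
        rw [affRefl_finite, affAct_lin, affPos_zero] at this
        rw [hcons, map_mul] at h
        exact h this
      have := refl_perm (D := D) (reflProd D G l) c
      rw [heq] at this
      rw [hcons, this]
      simp only [mul_assoc, inv_mul_cancel_left, refl_mul_self, mul_one]
    · obtain ⟨l', h1, h2, h3⟩ := ih hl' hp
      refine ⟨i :: l', ?_, by simp [h2], ?_⟩
      · intro j hj
        rcases List.mem_cons.1 hj with rfl | hj
        · exact hl _ List.mem_cons_self
        · exact h1 j hj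
      · rw [hcons, mul_assoc, h3]; simp [reflProd]

variable (D) in
theorem exists_reduced_list (g : G) : ∃ l : List J, (∀ j ∈ l, IsSimpleAff D G (j, 0)) ∧
    g = reflProd D G l ∧ l.length = len D (lin L g) := by
  have hg : g ∈ Subgroup.closure {g : G | ∃ j, g = refl D j ∧ len D (lin L g) = 1} := by
    rw [gen]; trivial
  have key : ∀ (x : G) (j : J), len D (lin L (refl D j : G)) = 1 →
      (∃ l : List J, (∀ j ∈ l, IsSimpleAff D G (j, 0)) ∧
        x = reflProd D G l ∧ l.length = len D (lin L x)) →
      ∃ l : List J, (∀ j ∈ l, IsSimpleAff D G (j, 0)) ∧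
        x * refl D j = reflProd D G l ∧ l.length = len D (lin L (x * refl D j)) := by
    rintro x j hj ⟨l, hl, rfl, hlen⟩
    obtain ⟨k, hk, hkj⟩ := exists_isSimpleAff_of_refl_len_one hj
    rw [← hkj]
    by_cases hp : D.pos (perm D (reflProd D G l) k)
    · refine ⟨l ++ [k], ?_, by simp [reflProd], ?_⟩
      · intro i hi
        rcases List.mem_append.1 hi with hi | hi
        · exact hl i hi
        · rw [List.mem_singleton.1 hi]; exact hk
      · rw [lin_mul, ← affRefl_finite, hk.len_mul_of_pos]
        · simp [hlen]
        · rwa [affAct_lin, affPos_zero]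
    · obtain ⟨l', h1, h2, h3⟩ := list_exchange l hl k ((affPos_zero k).1 hk.1) hp
      refine ⟨l', h1, h3, ?_⟩
      have := hk.len_mul_of_neg (w := lin L (reflProd D G l))
        (by rwa [affAct_lin, affPos_zero])
      rw [lin_mul, ← affRefl_finite]
      omega
  induction hg using Subgroup.closure_induction_right with
  | one => exact ⟨[], by simp, rfl, by rw [lin_one, len_one]; rfl⟩
  | mul_right x y hx hy ih =>
    obtain ⟨j, rfl, hj⟩ := hy
    exact key x j hj ih
  | mul_inv_cancel x y hx hy ih =>
    obtain ⟨j, rfl, hj⟩ := hy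
    rw [refl_inv]
    exact key x j hj ih

theorem eq_one_of_len_eq_zero {g : G} (h : len D (lin L g) = 0) : g = 1 := by
  obtain ⟨l, -, h1, h2⟩ := exists_reduced_list D g
  rw [h, List.length_eq_zero_iff] at h2
  subst h2
  simpa [reflProd] using h1

theorem IsSimpleAff.finite_of_lin {a : J × ℤ} (ha : IsSimpleAff D G a) {g : G}
    (h : ¬ AffPos D (affAct D (lin L g) a)) : a.2 = 0 := by
  have h1 := ha.1
  rw [affAct_lin] at h
  simp only [AffPos, not_or] at h h1
  omega

theorem exists_finite_descent {g : G} (hg : len D (lin L g) ≠ 0) :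
    ∃ j, IsSimpleAff D G (j, 0) ∧ ¬ D.pos (perm D g j) := by
  obtain ⟨⟨j, n⟩, ha, hw⟩ := exists_simple_descent (D := D) hg
  obtain rfl : n = 0 := ha.finite_of_lin hw
  exact ⟨j, ha, by rwa [affAct_lin, affPos_zero] at hw⟩

variable (D) in
theorem fin_induction_right {p : G → Prop} (one : p 1)
    (step : ∀ g j, IsSimpleAff D G (j, 0) → D.pos (perm D g j) → p g → p (g * refl D j)) (g : G) :
    p g := by
  induction hn : len D (lin L g) generalizing g with
  | zero => rw [eq_one_of_len_eq_zero hn]; exact one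
  | succ n ih =>
    obtain ⟨j, hj, hg⟩ := exists_finite_descent (D := D) (g := g) (by omega)
    have hl := hj.len_mul_of_neg (w := lin L g) (by rwa [affAct_lin, affPos_zero])
    rw [affRefl_finite, ← lin_mul] at hl
    have h := step (g * refl D j) j hj
      (by
        rw [map_mul, Equiv.Perm.mul_apply]
        have h2 := (affPos_affNeg (D := D) (G := G) (perm D g j, 0)).2
          (by rwa [affPos_zero])
        have h3 := affAct_affNeg (D := D) (lin L g) (j, 0)
        rw [affAct_lin, affAct_lin] at h3
        rw [← h3] at h2
        simpa [affNeg, AffPos] using h2)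
      (ih _ (by omega))
    rwa [mul_assoc, refl_mul_self, mul_one] at h

theorem len_lin_le (g : G) : len D (lin L g) ≤ Nat.card J := by
  have : Finite J := RootedDatum.finite D G
  have h : inversions D (lin L g) ⊆ (fun j => (j, (0 : ℤ))) '' Set.univ := by
    rw [inversions_eq]
    rintro ⟨j, n⟩ ⟨h1, h2⟩
    rw [affAct_lin] at h2
    simp only [AffPos, not_or] at h1 h2
    exact ⟨j, trivial, by simp; omega⟩
  refine (Set.ncard_le_ncard h (Set.toFinite _)).trans ?_
  refine (Set.ncard_image_le Set.finite_univ).trans ?_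
  rw [Set.ncard_univ]

theorem exists_simple_pos {w : AffW G L} (h : ∃ j, D.pos j ∧ AffPos D (affAct D w (j, 0))) :
    ∃ j, IsSimpleAff D G (j, 0) ∧ AffPos D (affAct D w (j, 0)) := by
  have : Finite J := RootedDatum.finite D G
  obtain ⟨a, ha, ha', hs⟩ := exists_isSimpleAff (D := D) (G := G)
    (Φ := {a | a.2 = 0 ∧ D.pos a.1}) (fun a ha => Or.inr ha)
    (fun a ha b hb hb' => by
      have hb2 : b.2 = 0 := by
        have e : affRefl D G a = lin L (refl D a.1) := by
          rw [← affRefl_finite]; congr 1; exact Prod.ext rfl ha.1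
        rw [e, affAct_lin] at hb'
        simp only [AffPos, not_or] at hb hb'
        omega
      refine ⟨⟨hb2, by simpa [AffPos, hb2] using hb⟩, ?_⟩
      have hc : AffPos D (affNeg D G (affAct D (affRefl D G a) b)) := by rwa [affPos_affNeg]
      have e : affRefl D G a = lin L (refl D a.1) := by
        rw [← affRefl_finite]; congr 1; exact Prod.ext rfl ha.1
      have h2 : (affNeg D G (affAct D (affRefl D G a) b)).2 = 0 := by
        rw [e, affAct_lin]; simp [affNeg, hb2]
      exact ⟨h2, by simpa [AffPos, h2] using hc⟩)
    (fun a => -affHt D (affAct D w a))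
    (fun k a b c h => by have := affHt_affAct_linear (D := D) w h; linarith)
    ((Set.toFinite ((fun j => (j, (0 : ℤ))) '' Set.univ)).subset (by
      rintro ⟨j, n⟩ ⟨⟨rfl, -⟩, -⟩; exact ⟨j, trivial, rfl⟩))
    (by
      obtain ⟨j, hj, hw⟩ := h
      exact ⟨(j, 0), ⟨rfl, hj⟩, by rw [affPos_iff G] at hw; simpa using hw⟩)
  obtain ⟨j, n⟩ := a
  obtain rfl : n = 0 := ha.1
  exact ⟨j, hs, by rw [affPos_iff G]; simpa using ha'⟩

/-- Dominant elements of the lattice. -/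
def Dom (D : Datum J L) (x : L) : Prop := ∀ j, D.pos j → 0 ≤ D.coroot j x

theorem Dom.add {x y : L} (hx : Dom D x) (hy : Dom D y) : Dom D (x + y) := fun j hj => by
  rw [map_add]; exact add_nonneg (hx j hj) (hy j hj)

theorem Dom.zero : Dom D (0 : L) := fun j _ => by rw [map_zero]

variable (G) in
include G in
theorem Dom.nonpos {x : L} (hx : Dom D x) {j : J} (hj : ¬ D.pos j) : D.coroot j x ≤ 0 := by
  have := hx _ ((pos_neg_iff G j).2 hj)
  rw [coroot_neg] at this
  linarith

variable (G) in
include G in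
theorem dom_twoRho : Dom D (twoRho D) := fun j hj => ((pos_iff (G := G) j).1 hj).le

theorem Dom.tr_neg_iff (G : Type*) [Group G] [DistribMulAction G L] [RootedDatum D G]
    {x : L} (hx : Dom D x) {a : J × ℤ} (ha : AffPos D a) :
    ¬ AffPos D (affAct D (tr G x) a) ↔ D.pos a.1 ∧ a.2 < D.coroot a.1 x := by
  rw [affAct_tr]
  simp only [AffPos] at ha ⊢
  by_cases hp : D.pos a.1
  · have := hx _ hp
    simp only [hp, and_true, true_and] at ha ⊢
    omega
  · have := hx.nonpos G hp
    simp only [hp, and_false, or_false, false_and, iff_false, not_not] at ha ⊢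
    omega

theorem Dom.len_tr_add (G : Type*) [Group G] [DistribMulAction G L] [RootedDatum D G]
    {x y : L} (hx : Dom D x) (hy : Dom D y) :
    len D (tr G (x + y)) = len D (tr G x) + len D (tr G y) := by
  rw [tr_add, len_mul_eq_iff]
  intro a ha h
  rw [← tr_add, (hx.add hy).tr_neg_iff G ha]
  rw [hy.tr_neg_iff G ha] at h
  have := hx _ h.1
  rw [map_add]
  exact ⟨h.1, by omega⟩

theorem Dom.len_lin_mul_tr {x : L} (hx : Dom D x) (g : G) :
    len D (lin L g * tr G x) = len D (lin L g) + len D (tr G x) := by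
  rw [len_mul_eq_iff]
  intro a ha h
  rw [hx.tr_neg_iff G ha] at h
  rw [affAct_mul, affAct_tr, affAct_lin]
  simp only [AffPos]
  omega

theorem Dom.len_tr (G : Type*) [Group G] [DistribMulAction G L] [RootedDatum D G]
    {x : L} (hx : Dom D x) :
    (len D (tr G x) : ℤ) = ∑ᶠ (j : J) (_ : D.pos j), D.coroot j x := by
  classical
  have : Finite J := RootedDatum.finite D G
  cases nonempty_fintype J
  have h : inversions D (tr G x) = (((Finset.univ : Finset J).filter D.pos).sigma
      fun j => Finset.Ico 0 (D.coroot j x)).map (Equiv.sigmaEquivProd J ℤ).toEmbedding := by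
    rw [inversions_eq]
    ext ⟨j, n⟩
    simp only [Set.mem_ofPred_eq, Finset.coe_map, Set.mem_image, SetLike.mem_coe,
      Finset.mem_sigma, Finset.mem_filter, Finset.mem_univ, true_and, Finset.mem_Ico]
    constructor
    · rintro ⟨h1, h2⟩
      rw [hx.tr_neg_iff G h1] at h2
      refine ⟨⟨j, n⟩, ⟨h2.1, ?_, h2.2⟩, rfl⟩
      rcases h1 with h1 | h1
      · exact le_of_lt h1
      · exact h1.1.ge
    · rintro ⟨⟨i, m⟩, ⟨h1, h2, h3⟩, h4⟩
      simp only [Equiv.toEmbedding_apply, Equiv.sigmaEquivProd_apply, Prod.mk.injEq] at h4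
      obtain ⟨rfl, rfl⟩ := h4
      have hp : AffPos D (i, m) := by
        simp only [AffPos, h1, and_true]
        simp only at h2
        omega
      exact ⟨hp, (hx.tr_neg_iff G hp).2 ⟨h1, h3⟩⟩
  rw [len, h, Set.ncard_coe_finset, Finset.card_map, Finset.card_sigma,
    finsum_cond_eq_sum_filter]
  push_cast
  refine Finset.sum_congr rfl fun j hj => ?_
  rw [Int.card_Ico, sub_zero, Int.toNat_of_nonneg]
  exact hx j (by simpa using hj)

theorem IsSimpleAff.pos_perm {j : J} (hj : IsSimpleAff D G (j, 0)) {i : J} (hi : D.pos i)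
    (hij : i ≠ j) : D.pos (perm D (refl D j : G) i) := by
  have := hj.2 (i, 0) ((affPos_zero i).2 hi) (by simpa using hij)
  rwa [affRefl_finite, affAct_lin, affPos_zero] at this

theorem IsSimpleAff.pos {j : J} (hj : IsSimpleAff D G (j, 0)) : D.pos j := (affPos_zero j).1 hj.1

theorem perm_refl_refl (j i : J) :
    perm D (refl D j : G) (perm D (refl D j : G) i) = i := by
  rw [← Equiv.Perm.mul_apply, ← map_mul, refl_mul_self, map_one, Equiv.Perm.one_apply]

theorem IsSimpleAff.sum_coroot_root {j : J} (hj : IsSimpleAff D G (j, 0)) :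
    ∑ᶠ (i : J) (_ : D.pos i), D.coroot i (D.root j) = 2 := by
  classical
  have : Finite J := RootedDatum.finite D G
  cases nonempty_fintype J
  rw [finsum_cond_eq_sum_filter]
  have hjm : j ∈ (Finset.univ.filter D.pos) := by simpa using hj.pos
  rw [← Finset.add_sum_erase _ _ hjm, coroot_root (G := G)]
  have : ∑ i ∈ (Finset.univ.filter D.pos).erase j, D.coroot i (D.root j) = 0 := by
    have hneg : ∀ i, D.coroot (perm D (refl D j : G) i) (D.root j) = -D.coroot i (D.root j) := by
      intro i
      have := coroot_perm (D := D) (refl D j : G) i ((refl D j : G) • D.root j)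
      rw [← mul_smul, refl_mul_self, one_smul, refl_smul, coroot_root (G := G), two_smul] at this
      simpa using this
    have h2 : ∑ i ∈ (Finset.univ.filter D.pos).erase j, D.coroot i (D.root j) =
        ∑ i ∈ (Finset.univ.filter D.pos).erase j, -D.coroot i (D.root j) := by
      refine Finset.sum_nbij' (perm D (refl D j : G)) (perm D (refl D j : G)) ?_ ?_ ?_ ?_ ?_
      · intro i hi
        simp only [Finset.mem_erase, Finset.mem_filter, Finset.mem_univ, true_and] at hi ⊢
        refine ⟨fun h => ?_, hj.pos_perm hi.2 hi.1⟩
        have h3 := perm_refl_refl (D := D) (G := G) j i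
        rw [h] at h3
        exact (pos_neg_iff G j).1 (h3 ▸ hi.2) hj.pos
      · intro i hi
        simp only [Finset.mem_erase, Finset.mem_filter, Finset.mem_univ, true_and] at hi ⊢
        refine ⟨fun h => ?_, hj.pos_perm hi.2 hi.1⟩
        have h3 := perm_refl_refl (D := D) (G := G) j i
        rw [h] at h3
        exact (pos_neg_iff G j).1 (h3 ▸ hi.2) hj.pos
      · intro i _; exact perm_refl_refl j i
      · intro i _; exact perm_refl_refl j i
      · intro i _; rw [hneg, neg_neg]
    rw [Finset.sum_neg_distrib] at h2
    linarith
  rw [this, add_zero]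

/-- Every element of the affine Weyl group is of the form `u t_x v⁻¹` with `x` dominant, compatibly
with lengths. -/
theorem exists_dominant_decomposition (w : AffW G L) : ∃ (u v : G) (x : L), Dom D x ∧
    w * lin L v = lin L u * tr G x ∧ len D (w * lin L v) = len D w + len D (lin L v) := by
  obtain ⟨v, hv, hmax⟩ : ∃ v : G, len D (w * lin L v) = len D w + len D (lin L v) ∧
      ∀ v' : G, len D (w * lin L v') = len D w + len D (lin L v') →
        len D (lin L v') ≤ len D (lin L v) := by
    by_contra hcon
    push Not at hcon
    have : ∀ n : ℕ, ∃ v : G, len D (w * lin L v) = len D w + len D (lin L v) ∧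
        n ≤ len D (lin L v) := by
      intro n
      induction n with
      | zero => exact ⟨1, by rw [lin_one, mul_one, len_one, add_zero], Nat.zero_le _⟩
      | succ n ih =>
        obtain ⟨v, hv, hn⟩ := ih
        obtain ⟨v', hv', hlt⟩ := hcon v hv
        exact ⟨v', hv', by omega⟩
    obtain ⟨v, -, hv⟩ := this (Nat.card J + 1)
    have := len_lin_le (D := D) v
    omega
  have hneg : ∀ j, D.pos j → ¬ AffPos D (affAct D (w * lin L v) (j, 0)) := by
    by_contra hcon
    push Not at hcon
    obtain ⟨j, hj, hw⟩ := exists_simple_pos (D := D) hcon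
    have h1 := hj.len_mul_of_pos hw
    rw [affRefl_finite, mul_assoc, ← lin_mul] at h1
    have h2 := len_mul_le (D := D) w (lin L (v * refl D j))
    have h3 := len_mul_le (D := D) (lin L v) (lin L (refl D j : G))
    rw [← affRefl_finite, hj.len, affRefl_finite, ← lin_mul] at h3
    have := hmax (v * refl D j) (by omega)
    omega
  set w' := w * lin L v with hw'
  refine ⟨w'.right, v, w'.right⁻¹ • act w' 0, fun j hj => ?_, ?_, hv⟩
  · have h := hneg j hj
    simp only [affAct, AffPos, zero_sub, not_or] at h
    rw [← coroot_perm (D := D) w'.right, smul_inv_smul]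
    simp only [act, smul_zero, add_zero]
    omega
  · rw [lin_mul_tr, smul_inv_smul, ← eq_tr_mul_lin]

end FinitePart


open RootedDatum

section Hecke

variable {J L G : Type*} [AddCommGroup L] [Group G] [DistribMulAction G L]
variable {D : Datum J L} [RootedDatum D G]

/-- `qa` gives the labels of the affine roots that correspond to the label function `q`. -/
structure IsLabeling (D : Datum J L) [RootedDatum D G] (q : AffW G L → ℝ) (qa : J × ℤ → ℝ) :
    Prop where
  pos : ∀ a, 0 < qa a
  inv : ∀ (w : AffW G L) a, qa (affAct D w a) = qa a
  simple : ∀ a, IsSimpleAff D G a → q (affRefl D G a) = qa a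

/-- The difference `q^{1/2} - q^{-1/2}`. -/
def qdiff (qa : J × ℤ → ℝ) (a : J × ℤ) : ℂ := ((√(qa a) - (√(qa a))⁻¹ : ℝ) : ℂ)

theorem IsSimpleAff.affPos_affRefl {b c : J × ℤ} (hb : IsSimpleAff D G b) (h1 : c ≠ b)
    (h2 : c ≠ affNeg D G b) : AffPos D (affAct D (affRefl D G b) c) ↔ AffPos D c := by
  constructor
  · intro h
    by_contra hc
    have h3 := hb.2 (affNeg D G c) (by rwa [affPos_affNeg])
      (fun e => h2 (by rw [← e, affNeg_affNeg]))
    rw [affAct_affNeg, affPos_affNeg] at h3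
    exact h3 h
  · intro h; exact hb.2 c h h1

theorem affRefl_mul_eq {a b : J × ℤ} {w : AffW G L} (h : affAct D w b = a) :
    affRefl D G a * w = w * affRefl D G b := by
  rw [← h, affRefl_affAct, inv_mul_cancel_right]

section Regular

variable (D) (qa : J × ℤ → ℝ)

open Classical in
/-- Left multiplication by the generator attached to `a` in the regular representation. -/
def leftOp (a : J × ℤ) : Module.End ℂ (AffW G L →₀ ℂ) :=
  Finsupp.linearCombination ℂ fun w =>
    Finsupp.single (affRefl D G a * w) 1 +
      if AffPos D (affAct D w⁻¹ a) then 0 else qdiff qa a • Finsupp.single w 1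

open Classical in
/-- Right multiplication by the generator attached to `b` in the regular representation. -/
def rightOp (b : J × ℤ) : Module.End ℂ (AffW G L →₀ ℂ) :=
  Finsupp.linearCombination ℂ fun w =>
    Finsupp.single (w * affRefl D G b) 1 +
      if AffPos D (affAct D w b) then 0 else qdiff qa b • Finsupp.single w 1

/-- Left translation in the regular representation. -/
def leftTrans (u : AffW G L) : Module.End ℂ (AffW G L →₀ ℂ) :=
  Finsupp.linearCombination ℂ fun w => Finsupp.single (u * w) 1

/-- Right translation in the regular representation. -/
def rightTrans (u : AffW G L) : Module.End ℂ (AffW G L →₀ ℂ) :=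
  Finsupp.linearCombination ℂ fun w => Finsupp.single (w * u) 1

open Classical in
theorem leftOp_single (a : J × ℤ) (w : AffW G L) : leftOp D qa a (Finsupp.single w 1) =
    Finsupp.single (affRefl D G a * w) 1 +
      if AffPos D (affAct D w⁻¹ a) then 0 else qdiff qa a • Finsupp.single w 1 := by
  simp [leftOp]

open Classical in
theorem rightOp_single (b : J × ℤ) (w : AffW G L) : rightOp D qa b (Finsupp.single w 1) =
    Finsupp.single (w * affRefl D G b) 1 +
      if AffPos D (affAct D w b) then 0 else qdiff qa b • Finsupp.single w 1 := by
  simp [rightOp]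

theorem leftTrans_single (u w : AffW G L) :
    leftTrans u (Finsupp.single w 1) = Finsupp.single (u * w) 1 := by
  simp [leftTrans]

theorem rightTrans_single (u w : AffW G L) :
    rightTrans u (Finsupp.single w 1) = Finsupp.single (w * u) 1 := by
  simp [rightTrans]

variable {D qa}

theorem leftOp_rightOp {q : AffW G L → ℝ} (hqa : IsLabeling D q qa) {a b : J × ℤ}
    (ha : IsSimpleAff D G a) (hb : IsSimpleAff D G b) (w : AffW G L) :
    leftOp D qa a (rightOp D qa b (Finsupp.single w 1)) =
      rightOp D qa b (leftOp D qa a (Finsupp.single w 1)) := by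
  classical
  have e1 : affAct D (w * affRefl D G b)⁻¹ a = affAct D (affRefl D G b) (affAct D w⁻¹ a) := by
    rw [mul_inv_rev, affRefl_inv, affAct_mul]
  have e2 : affAct D (affRefl D G a * w) b = affAct D (affRefl D G a) (affAct D w b) :=
    affAct_mul _ _ _
  rw [rightOp_single, leftOp_single, map_add, map_add, leftOp_single, rightOp_single, e1, e2,
    ← mul_assoc]
  by_cases h1 : affAct D w b = a
  · have h1' : affAct D w⁻¹ a = b := by rw [← h1, affAct_inv_affAct]
    have hq : qdiff qa a = qdiff qa b := by rw [qdiff, qdiff, ← h1, hqa.inv]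
    have hs := affRefl_mul_eq h1
    rw [h1, h1', if_pos hb.1, if_pos ha.1, affAct_affRefl_self, affAct_affRefl_self,
      if_neg (by rw [affPos_affNeg, not_not]; exact hb.1),
      if_neg (by rw [affPos_affNeg, not_not]; exact ha.1), hs, hq]
    simp
  by_cases h2 : affAct D w b = affNeg D G a
  · have h2' : affAct D w⁻¹ a = affNeg D G b := by
      rw [← affNeg_affNeg (D := D) (G := G) a, ← h2, affAct_affNeg, affAct_inv_affAct]
    have hq : qdiff qa a = qdiff qa b := by
      rw [qdiff, qdiff, ← hqa.inv w b, h2, ← affAct_affRefl_self, hqa.inv]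
    have hs : affRefl D G a * w = w * affRefl D G b := by
      rw [← affRefl_affNeg, affRefl_mul_eq h2]
    have na : ¬ AffPos D (affNeg D G a) := by rw [affPos_affNeg, not_not]; exact ha.1
    have nb : ¬ AffPos D (affNeg D G b) := by rw [affPos_affNeg, not_not]; exact hb.1
    simp only [h2, h2', affAct_affNeg, affAct_affRefl_self, affNeg_affNeg, na, nb, ha.1, hb.1,
      if_true, if_false, map_smul, leftOp_single, rightOp_single, hs, hq]
  · have h1' : affAct D w⁻¹ a ≠ b := by
      rintro rfl; exact h1 (affAct_affAct_inv _ _)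
    have h2' : affAct D w⁻¹ a ≠ affNeg D G b := by
      intro h; apply h2
      rw [← affNeg_affNeg (D := D) (G := G) b, ← h, affAct_affNeg, affAct_affAct_inv]
    simp only [ha.affPos_affRefl h1 h2, hb.affPos_affRefl h1' h2']
    by_cases p : AffPos D (affAct D w⁻¹ a) <;> by_cases r : AffPos D (affAct D w b) <;>
      simp only [p, r, if_true, if_false, map_zero, map_smul, leftOp_single, rightOp_single,
        add_zero, smul_add]
    rw [smul_comm (qdiff qa a)]
    abel

variable (D qa) in
/-- The right multiplications. -/
def rightOps : Set (Module.End ℂ (AffW G L →₀ ℂ)) :=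
  {T | (∃ b, IsSimpleAff D G b ∧ T = rightOp D qa b) ∨ ∃ u, len D u = 0 ∧ T = rightTrans u}

theorem end_ext {S T : Module.End ℂ (AffW G L →₀ ℂ)}
    (h : ∀ w, S (Finsupp.single w 1) = T (Finsupp.single w 1)) : S = T :=
  Finsupp.lhom_ext' fun w => LinearMap.ext_ring (h w)

theorem leftOp_mem {q : AffW G L → ℝ} (hqa : IsLabeling D q qa) {a : J × ℤ}
    (ha : IsSimpleAff D G a) :
    leftOp D qa a ∈ Subalgebra.centralizer ℂ (rightOps D qa : Set (Module.End ℂ (AffW G L →₀ ℂ))) := by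
  classical
  rw [Subalgebra.mem_centralizer_iff]
  rintro _ (⟨b, hb, rfl⟩ | ⟨u, hu, rfl⟩)
  · exact end_ext fun w => (leftOp_rightOp hqa ha hb w).symm
  · refine end_ext fun w => ?_
    have hu' : ∀ c, AffPos D (affAct D u⁻¹ c) ↔ AffPos D c := by
      intro c
      have h1 := (len_eq_zero_iff (D := D) u).1 hu
      have h2 := (len_eq_zero_iff (D := D) u⁻¹).1 (by rw [len_inv, hu])
      refine ⟨fun h => ?_, h2 c⟩
      have := h1 _ h
      rwa [affAct_affAct_inv] at this
    simp only [Module.End.mul_apply, leftOp_single, rightTrans_single, map_add, mul_inv_rev,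
      affAct_mul, hu', mul_assoc]
    split_ifs <;> simp only [rightTrans_single, map_zero, map_smul]

theorem leftTrans_mem {u : AffW G L} (hu : len D u = 0) :
    leftTrans u ∈ Subalgebra.centralizer ℂ (rightOps D qa : Set (Module.End ℂ (AffW G L →₀ ℂ))) := by
  classical
  rw [Subalgebra.mem_centralizer_iff]
  have hu' : ∀ c, AffPos D (affAct D u c) ↔ AffPos D c := by
    intro c
    have h1 := (len_eq_zero_iff (D := D) u).1 hu
    have h2 := (len_eq_zero_iff (D := D) u⁻¹).1 (by rw [len_inv, hu])
    refine ⟨fun h => ?_, h1 c⟩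
    have := h2 _ h
    rwa [affAct_inv_affAct] at this
  rintro _ (⟨b, hb, rfl⟩ | ⟨u', hu', rfl⟩)
  · refine end_ext fun w => ?_
    simp only [Module.End.mul_apply, rightOp_single, leftTrans_single, map_add,
      affAct_mul, hu', mul_assoc]
    split_ifs <;> simp only [leftTrans_single, map_zero, map_smul]
  · refine end_ext fun w => ?_
    simp only [Module.End.mul_apply, rightTrans_single, leftTrans_single, mul_assoc]

theorem exists_left (hqa : ∃ q : AffW G L → ℝ, IsLabeling D q qa) (w : AffW G L) :
    ∃ T ∈ Subalgebra.centralizer ℂ (rightOps D qa : Set (Module.End ℂ (AffW G L →₀ ℂ))),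
      T (Finsupp.single 1 1) = Finsupp.single w 1 := by
  obtain ⟨q, hqa⟩ := hqa
  refine len_induction_left D (p := fun w =>
    ∃ T ∈ Subalgebra.centralizer ℂ (rightOps D qa : Set (Module.End ℂ (AffW G L →₀ ℂ))),
      T (Finsupp.single 1 1) = Finsupp.single w 1) (fun u hu => ?_) (fun w a ha hw ih => ?_) w
  · exact ⟨leftTrans u, leftTrans_mem hu, by rw [leftTrans_single, mul_one]⟩
  · obtain ⟨T, hT, h1⟩ := ih
    refine ⟨leftOp D qa a * T, mul_mem (leftOp_mem hqa ha) hT, ?_⟩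
    rw [Module.End.mul_apply, h1, leftOp_single, if_pos hw, add_zero]

theorem exists_right (w' : AffW G L) : ∃ R : Module.End ℂ (AffW G L →₀ ℂ),
    (∀ T ∈ Subalgebra.centralizer ℂ (rightOps D qa : Set (Module.End ℂ (AffW G L →₀ ℂ))),
      R * T = T * R) ∧
    ∀ w, len D (w * w') = len D w + len D w' →
      R (Finsupp.single w 1) = Finsupp.single (w * w') 1 := by
  refine len_induction_right D (p := fun w' => ∃ R : Module.End ℂ (AffW G L →₀ ℂ),
    (∀ T ∈ Subalgebra.centralizer ℂ (rightOps D qa : Set (Module.End ℂ (AffW G L →₀ ℂ))),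
      R * T = T * R) ∧
    ∀ w, len D (w * w') = len D w + len D w' →
      R (Finsupp.single w 1) = Finsupp.single (w * w') 1) (fun u hu => ?_)
    (fun w' b hb hw' ih => ?_) w'
  · refine ⟨rightTrans u, fun T hT => ?_, fun w _ => rightTrans_single u w⟩
    exact (Subalgebra.mem_centralizer_iff ℂ).1 hT _ (Or.inr ⟨u, hu, rfl⟩)
  · obtain ⟨R, hR, h1⟩ := ih
    refine ⟨rightOp D qa b * R, fun T hT => ?_, fun w hw => ?_⟩
    · rw [mul_assoc, hR T hT, ← mul_assoc, ← mul_assoc,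
        (Subalgebra.mem_centralizer_iff ℂ).1 hT _ (Or.inl ⟨b, hb, rfl⟩)]
    · have h2 := hb.len_mul_of_pos hw'
      have h3 := len_mul_le (D := D) w w'
      have h4 : AffPos D (affAct D (w * w') b) := by
        rw [← hb.lt_len_mul_iff, mul_assoc]; omega
      have h5 := hb.len_mul_of_pos h4
      rw [mul_assoc] at h5
      rw [Module.End.mul_apply, h1 w (by omega), rightOp_single, if_pos h4, add_zero, mul_assoc]

theorem eq_of_apply_one {S T : Module.End ℂ (AffW G L →₀ ℂ)}
    (hS : S ∈ Subalgebra.centralizer ℂ (rightOps D qa : Set (Module.End ℂ (AffW G L →₀ ℂ))))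
    (hT : T ∈ Subalgebra.centralizer ℂ (rightOps D qa : Set (Module.End ℂ (AffW G L →₀ ℂ))))
    (h : S (Finsupp.single 1 1) = T (Finsupp.single 1 1)) : S = T := by
  refine end_ext fun w => ?_
  obtain ⟨R, hR, h1⟩ := exists_right (D := D) (qa := qa) w
  have h2 := h1 1 (by rw [one_mul, len_one, zero_add])
  rw [one_mul] at h2
  rw [← h2, ← Module.End.mul_apply, ← Module.End.mul_apply, ← hR S hS, ← hR T hT,
    Module.End.mul_apply, Module.End.mul_apply, h]

end Regular

variable {q : AffW G L → ℝ} {qa : J × ℤ → ℝ}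

theorem IsLabeling.sqrt_pos (hqa : IsLabeling D q qa) (a : J × ℤ) : 0 < √(qa a) :=
  Real.sqrt_pos.2 (hqa.pos a)

theorem exists_regular_rep (hqa : IsLabeling D q qa) :
    ∃ ρ : HeckeAlg D q →ₐ[ℂ] Module.End ℂ (AffW G L →₀ ℂ),
      ∀ w, ρ (basisN D q w) (Finsupp.single 1 1) = Finsupp.single w 1 := by
  classical
  choose T hT h1 using exists_left (D := D) ⟨q, hqa⟩
  have hmul : ∀ w w', len D (w * w') = len D w + len D w' → T w * T w' = T (w * w') := by
    intro w w' h
    refine eq_of_apply_one (D := D) (mul_mem (hT w) (hT w')) (hT _) ?_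
    obtain ⟨R, hR, h2⟩ := exists_right (D := D) (qa := qa) w'
    have h3 := h2 1 (by rw [one_mul, len_one, zero_add])
    rw [one_mul] at h3
    rw [Module.End.mul_apply, h1, ← h3, ← Module.End.mul_apply, ← hR _ (hT w),
      Module.End.mul_apply, h1, h2 w h, h1]
  have hone : T 1 = 1 := eq_of_apply_one (hT 1) (one_mem _) (h1 1)
  have hrefl : ∀ a, IsSimpleAff D G a → T (affRefl D G a) = leftOp D qa a := by
    intro a ha
    refine eq_of_apply_one (hT _) (leftOp_mem hqa ha) ?_
    rw [h1, leftOp_single, inv_one, affAct_one, if_pos ha.1, add_zero, mul_one]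
  let ρ₀ : FreeAlgebra ℂ (AffW G L) →ₐ[ℂ] Module.End ℂ (AffW G L →₀ ℂ) := FreeAlgebra.lift ℂ T
  have hρ₀ : ∀ w, ρ₀ (FreeAlgebra.ι ℂ w) = T w := fun w => FreeAlgebra.lift_ι_apply _ _
  have hrel : ∀ ⦃x y⦄, HeckeRel D q x y → ρ₀ x = ρ₀ y := by
    intro x y h
    induction h with
    | one => rw [hρ₀, hone, map_one]
    | mul w w' h => rw [map_mul, hρ₀, hρ₀, hρ₀, hmul w w' h]
    | quad s hs =>
      obtain ⟨a, ha, rfl⟩ := (mem_simpleRefl_iff s).1 hs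
      rw [map_mul, map_add, map_sub, hρ₀, map_zero, AlgHom.commutes, AlgHom.commutes]
      have e : T (affRefl D G a) - algebraMap ℂ _ ((√(q (affRefl D G a)) : ℝ) : ℂ) =
          T (affRefl D G a) + algebraMap ℂ _ (-((√(q (affRefl D G a)) : ℝ) : ℂ)) := by
        rw [map_neg]
        exact LinearMap.ext fun x => by
          rw [LinearMap.sub_apply, LinearMap.add_apply, LinearMap.neg_apply, sub_eq_add_neg]
      refine eq_of_apply_one (D := D) (qa := qa) ?_ (Subalgebra.zero_mem _) ?_
      · rw [e]
        exact Subalgebra.mul_mem _ (Subalgebra.add_mem _ (hT _) (Subalgebra.algebraMap_mem _ _))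
          (Subalgebra.add_mem _ (hT _) (Subalgebra.algebraMap_mem _ _))
      · rw [hqa.simple a ha, hrefl a ha]
        have hc : ((√(qa a) : ℝ) : ℂ) ≠ 0 := by exact_mod_cast (hqa.sqrt_pos a).ne'
        have e1 : leftOp D qa a (Finsupp.single 1 1) =
            (Finsupp.single (affRefl D G a) 1 : AffW G L →₀ ℂ) := by
          rw [leftOp_single, inv_one, affAct_one, if_pos ha.1, add_zero, mul_one]
        have e2 : leftOp D qa a (Finsupp.single (affRefl D G a) 1) =
            (Finsupp.single 1 1 + qdiff qa a • Finsupp.single (affRefl D G a) 1 :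
              AffW G L →₀ ℂ) := by
          rw [leftOp_single, affRefl_inv, affAct_affRefl_self,
            if_neg (by rw [affPos_affNeg, not_not]; exact ha.1), affRefl_mul_self]
        simp only [Module.End.mul_apply, LinearMap.sub_apply, LinearMap.add_apply, map_sub, e1, e2,
          Module.algebraMap_end_apply, map_smul, LinearMap.zero_apply, qdiff]
        push_cast
        rw [sub_smul, smul_add, smul_smul, mul_inv_cancel₀ hc, one_smul]
        abel
  refine ⟨RingQuot.liftAlgHom ℂ ⟨ρ₀, hrel⟩, fun w => ?_⟩
  rw [basisN, RingQuot.liftAlgHom_mkAlgHom_apply, hρ₀, h1]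

theorem basisN_linearIndependent (hqa : IsLabeling D q qa) :
    LinearIndependent ℂ (basisN D q : AffW G L → HeckeAlg D q) := by
  obtain ⟨ρ, hρ⟩ := exists_regular_rep hqa
  let f : HeckeAlg D q →ₗ[ℂ] (AffW G L →₀ ℂ) :=
    (LinearMap.applyₗ (Finsupp.single 1 1)).comp ρ.toLinearMap
  refine LinearIndependent.of_comp f ?_
  have : (f ∘ basisN D q : AffW G L → AffW G L →₀ ℂ) = fun w => Finsupp.single w 1 :=
    funext fun w => hρ w
  rw [this]
  exact (Finsupp.basisSingleOne (R := ℂ) (ι := AffW G L)).linearIndependent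

omit [RootedDatum D G] in
variable (D q) in
theorem basisN_one : basisN D q (1 : AffW G L) = 1 := by
  rw [basisN, RingQuot.mkAlgHom_rel ℂ HeckeRel.one, map_one]

omit [RootedDatum D G] in
theorem basisN_mul {w w' : AffW G L} (h : len D (w * w') = len D w + len D w') :
    basisN D q w * basisN D q w' = basisN D q (w * w') := by
  rw [basisN, basisN, basisN, ← map_mul, RingQuot.mkAlgHom_rel ℂ (HeckeRel.mul w w' h)]

theorem basisN_sq (hqa : IsLabeling D q qa) {a : J × ℤ} (ha : IsSimpleAff D G a) :
    basisN D q (affRefl D G a) * basisN D q (affRefl D G a) =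
      1 + qdiff qa a • basisN D q (affRefl D G a) := by
  have h := RingQuot.mkAlgHom_rel ℂ (HeckeRel.quad (D := D) (q := q) _ ha.mem_simpleRefl)
  rw [map_mul, map_add, map_sub, map_zero, AlgHom.commutes, AlgHom.commutes] at h
  change (basisN D q (affRefl D G a) + _) * (basisN D q (affRefl D G a) - _) = 0 at h
  rw [hqa.simple a ha] at h
  have hc : ((√(qa a) : ℝ) : ℂ) ≠ 0 := by exact_mod_cast (hqa.sqrt_pos a).ne'
  rw [add_mul, mul_sub, mul_sub, ← map_mul, Complex.ofReal_inv, inv_mul_cancel₀ hc, map_one,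
    ← Algebra.commutes (((√(qa a) : ℝ) : ℂ)), ← Algebra.smul_def, ← Algebra.smul_def] at h
  rw [qdiff]
  push_cast
  rw [← sub_eq_zero, ← h]
  have := sub_smul (R := ℂ) (M := HeckeAlg D q) (√(qa a) : ℝ) (((√(qa a) : ℝ) : ℂ)⁻¹) (basisN D q (affRefl D G a))
  rw [this]
  abel

theorem IsSimpleAff.basisN_mul_of_pos {a : J × ℤ} (ha : IsSimpleAff D G a) {w : AffW G L}
    (hw : AffPos D (affAct D w a)) :
    basisN D q w * basisN D q (affRefl D G a) = basisN D q (w * affRefl D G a) :=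
  basisN_mul (by rw [ha.len_mul_of_pos hw, ha.len])

theorem IsSimpleAff.basisN_mul_of_neg (hqa : IsLabeling D q qa) {a : J × ℤ}
    (ha : IsSimpleAff D G a) {w : AffW G L} (hw : ¬ AffPos D (affAct D w a)) :
    basisN D q w * basisN D q (affRefl D G a) =
      basisN D q (w * affRefl D G a) + qdiff qa a • basisN D q w := by
  have h1 : basisN D q (w * affRefl D G a) * basisN D q (affRefl D G a) = basisN D q w := by
    rw [ha.basisN_mul_of_pos, mul_assoc, affRefl_mul_self, mul_one]
    rwa [affAct_mul, affAct_affRefl_self, affAct_affNeg, affPos_affNeg]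
  rw [← h1, mul_assoc, basisN_sq hqa ha, mul_add, mul_one, mul_smul_comm]

theorem IsSimpleAff.basisN_mul_left_of_pos {a : J × ℤ} (ha : IsSimpleAff D G a) {w : AffW G L}
    (hw : AffPos D (affAct D w⁻¹ a)) :
    basisN D q (affRefl D G a) * basisN D q w = basisN D q (affRefl D G a * w) :=
  basisN_mul (by rw [ha.refl_mul_len_of_pos hw, ha.len, add_comm])

theorem IsSimpleAff.basisN_mul_left_of_neg (hqa : IsLabeling D q qa) {a : J × ℤ}
    (ha : IsSimpleAff D G a) {w : AffW G L} (hw : ¬ AffPos D (affAct D w⁻¹ a)) :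
    basisN D q (affRefl D G a) * basisN D q w =
      basisN D q (affRefl D G a * w) + qdiff qa a • basisN D q w := by
  have h1 : basisN D q (affRefl D G a) * basisN D q (affRefl D G a * w) = basisN D q w := by
    rw [ha.basisN_mul_left_of_pos, ← mul_assoc, affRefl_mul_self, one_mul]
    rwa [mul_inv_rev, affRefl_inv, affAct_mul, affAct_affRefl_self, affAct_affNeg, affPos_affNeg]
  rw [← h1, ← mul_assoc, basisN_sq hqa ha, add_mul, one_mul, smul_mul_assoc]

theorem basisN_span (hqa : IsLabeling D q qa) :
    Submodule.span ℂ (Set.range (basisN D q : AffW G L → HeckeAlg D q)) = ⊤ := by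
  set S := Submodule.span ℂ (Set.range (basisN D q : AffW G L → HeckeAlg D q)) with hS
  have hN : ∀ w, basisN D q w ∈ S := fun w => Submodule.subset_span ⟨w, rfl⟩
  have hright : ∀ (w : AffW G L), ∀ h ∈ S, h * basisN D q w ∈ S := by
    refine len_induction_right D (fun u hu => ?_) (fun w a ha hw ih => ?_)
    · intro h hh
      induction hh using Submodule.span_induction with
      | mem x hx =>
        obtain ⟨v, rfl⟩ := hx
        rw [basisN_mul (by rw [len_mul_of_len_zero hu, hu, add_zero])]
        exact hN _
      | zero => rw [zero_mul]; exact zero_mem _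
      | add x y _ _ hx hy => rw [add_mul]; exact add_mem hx hy
      | smul c x _ hx => rw [smul_mul_assoc]; exact S.smul_mem c hx
    · intro h hh
      rw [← ha.basisN_mul_of_pos hw, ← mul_assoc]
      have h' := ih h hh
      generalize h * basisN D q w = y at h'
      induction h' using Submodule.span_induction with
      | mem x hx =>
        obtain ⟨v, rfl⟩ := hx
        by_cases hv : AffPos D (affAct D v a)
        · rw [ha.basisN_mul_of_pos hv]; exact hN _
        · rw [ha.basisN_mul_of_neg hqa hv]; exact add_mem (hN _) (S.smul_mem _ (hN _))
      | zero => rw [zero_mul]; exact zero_mem _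
      | add x y _ _ hx hy => rw [add_mul]; exact add_mem hx hy
      | smul c x _ hx => rw [smul_mul_assoc]; exact S.smul_mem c hx
  rw [eq_top_iff]
  rintro h -
  obtain ⟨f, rfl⟩ := RingQuot.mkAlgHom_surjective ℂ (HeckeRel D q) h
  have key : ∀ g ∈ S, g * RingQuot.mkAlgHom ℂ (HeckeRel D q) f ∈ S := by
    induction f using FreeAlgebra.induction with
    | grade0 r =>
      intro g hg
      rw [AlgHom.commutes, ← Algebra.commutes, ← Algebra.smul_def]; exact S.smul_mem _ hg
    | grade1 w => exact hright w
    | mul a b ha hb =>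
      intro g hg; rw [map_mul, ← mul_assoc]; exact hb _ (ha g hg)
    | add a b ha hb =>
      intro g hg; rw [map_add, mul_add]; exact add_mem (ha g hg) (hb g hg)
  have := key 1 (by rw [← basisN_one D q]; exact hN 1)
  rwa [one_mul] at this

end Hecke


open RootedDatum

section Bernstein

variable {J L G : Type*} [AddCommGroup L] [Group G] [DistribMulAction G L]
variable {D : Datum J L} [RootedDatum D G]
variable {q : AffW G L → ℝ} {qa : J × ℤ → ℝ}

theorem basisN_mul_basisN_sub (hqa : IsLabeling D q qa) {a : J × ℤ} (ha : IsSimpleAff D G a) :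
    basisN D q (affRefl D G a) * (basisN D q (affRefl D G a) - algebraMap ℂ _ (qdiff qa a)) = 1 := by
  rw [mul_sub, basisN_sq hqa ha, ← Algebra.commutes, ← Algebra.smul_def, add_sub_cancel_right]

theorem basisN_sub_mul_basisN (hqa : IsLabeling D q qa) {a : J × ℤ} (ha : IsSimpleAff D G a) :
    (basisN D q (affRefl D G a) - algebraMap ℂ _ (qdiff qa a)) * basisN D q (affRefl D G a) = 1 := by
  rw [sub_mul, basisN_sq hqa ha, ← Algebra.smul_def, add_sub_cancel_right]

theorem isUnit_basisN (hqa : IsLabeling D q qa) (w : AffW G L) : IsUnit (basisN D q w) := by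
  refine len_induction_right D (p := fun w => IsUnit (basisN D q w)) (fun u hu => ?_)
    (fun w a ha hw ih => ?_) w
  · have hu' : len D u⁻¹ = 0 := by rw [len_inv, hu]
    refine ⟨⟨basisN D q u, basisN D q u⁻¹, ?_, ?_⟩, rfl⟩
    · rw [basisN_mul, mul_inv_cancel, basisN_one]
      rw [mul_inv_cancel, len_one, hu, hu']
    · rw [basisN_mul, inv_mul_cancel, basisN_one]
      rw [inv_mul_cancel, len_one, hu, hu']
  · rw [← ha.basisN_mul_of_pos hw]
    exact ih.mul ⟨⟨_, _, basisN_mul_basisN_sub hqa ha, basisN_sub_mul_basisN hqa ha⟩, rfl⟩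

theorem Dom.basisN_mul (hx : Dom D x) (hy : Dom D y) :
    basisN D q (tr G x) * basisN D q (tr G y) = basisN D q (tr G (x + y)) := by
  rw [tr_add]
  exact AffineHecke.basisN_mul (by rw [← tr_add, hx.len_tr_add G hy])

variable (G) in
include G in
theorem dom_shift (x : L) : Dom D ((∑ᶠ j, |D.coroot j x|) • twoRho D) ∧
    Dom D (x + (∑ᶠ j, |D.coroot j x|) • twoRho D) := by
  have : Finite J := RootedDatum.finite D G
  cases nonempty_fintype J
  have h0 : ∀ j, |D.coroot j x| ≤ ∑ᶠ j, |D.coroot j x| := by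
    intro j
    rw [finsum_eq_sum_of_fintype]
    exact Finset.single_le_sum (f := fun j => |D.coroot j x|)
      (fun j _ => abs_nonneg _) (Finset.mem_univ j)
  refine ⟨fun j hj => ?_, fun j hj => ?_⟩
  · rw [map_zsmul, smul_eq_mul]
    exact mul_nonneg ((abs_nonneg _).trans (h0 j)) ((pos_iff (G := G) j).1 hj).le
  · rw [map_add, map_zsmul, smul_eq_mul]
    have h1 := (pos_iff (D := D) (G := G) j).1 hj
    have h2 := abs_le.1 (h0 j)
    have h3 := (abs_nonneg _).trans (h0 j)
    nlinarith

theorem theta_mul_basisN (hqa : IsLabeling D q qa) {x z : L} (hz : Dom D z) (hxz : Dom D (x + z)) :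
    theta D q x * basisN D q (tr G z) = basisN D q (tr G (x + z)) := by
  rw [theta]
  set z₀ := (∑ᶠ j, |D.coroot j x|) • twoRho D with hz₀
  have h1 : Dom D z₀ := (dom_shift G x).1
  have h2 : Dom D (x + z₀) := (dom_shift G x).2
  have hu := isUnit_basisN hqa (tr G z₀)
  have hcomm : Ring.inverse (basisN D q (tr G z₀)) * basisN D q (tr G z) =
      basisN D q (tr G z) * Ring.inverse (basisN D q (tr G z₀)) := by
    rw [← hu.mul_right_inj, ← mul_assoc, Ring.mul_inverse_cancel _ hu, one_mul, ← mul_assoc,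
      h1.basisN_mul hz, add_comm, ← hz.basisN_mul h1, mul_assoc, Ring.mul_inverse_cancel _ hu,
      mul_one]
  rw [mul_assoc, hcomm, ← mul_assoc, h2.basisN_mul hz, add_assoc, add_comm z₀, ← add_assoc,
    ← hxz.basisN_mul h1, mul_assoc, Ring.mul_inverse_cancel _ hu, mul_one]

theorem theta_dom (hqa : IsLabeling D q qa) {x : L} (hx : Dom D x) :
    theta D q x = basisN D q (tr G x) := by
  have := theta_mul_basisN hqa (x := x) Dom.zero (by rwa [add_zero])
  rwa [tr_zero, basisN_one, mul_one, add_zero] at this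

theorem theta_add (hqa : IsLabeling D q qa) (x y : L) :
    theta D q (x + y) = theta D q x * theta D q y := by
  obtain ⟨z, hz, hxz⟩ : ∃ z, Dom D z ∧ Dom D (x + z) := ⟨_, dom_shift G x⟩
  obtain ⟨z', hz', hyz⟩ : ∃ z, Dom D z ∧ Dom D (y + z) := ⟨_, dom_shift G y⟩
  have hu := isUnit_basisN hqa (tr G (z' + z))
  rw [← hu.mul_left_inj, ← hz'.basisN_mul hz, mul_assoc, ← mul_assoc (theta D q y),
    theta_mul_basisN hqa hz' hyz, hyz.basisN_mul hz, add_comm (y + z'), ← hz.basisN_mul hyz,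
    ← mul_assoc (theta D q x), theta_mul_basisN hqa hz hxz, hxz.basisN_mul hyz, hz'.basisN_mul hz,
    theta_mul_basisN hqa (hz'.add hz)]
  · congr 2; abel
  · have := hxz.add hyz
    rwa [show x + y + (z' + z) = x + z + (y + z') by abel]

theorem theta_zero (hqa : IsLabeling D q qa) : theta D q (0 : L) = 1 := by
  rw [theta_dom hqa Dom.zero, tr_zero, basisN_one]

/-- The embedding of the group algebra of the lattice given by the Bernstein elements. -/
def thetaHom (hqa : IsLabeling D q qa) : AddMonoidAlgebra ℂ L →ₐ[ℂ] HeckeAlg D q :=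
  AddMonoidAlgebra.lift ℂ (HeckeAlg D q) L
    { toFun := fun x => theta D q x.toAdd
      map_one' := theta_zero hqa
      map_mul' := fun x y => theta_add hqa x.toAdd y.toAdd }

theorem thetaHom_single (hqa : IsLabeling D q qa) (x : L) (c : ℂ) :
    thetaHom hqa (AddMonoidAlgebra.single x c) = c • theta D q x := by
  rw [thetaHom, AddMonoidAlgebra.lift_single]
  rfl

theorem isUnit_theta (hqa : IsLabeling D q qa) (x : L) : IsUnit (theta D q x) :=
  ⟨⟨theta D q x, theta D q (-x), by rw [← theta_add hqa, add_neg_cancel, theta_zero hqa],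
    by rw [← theta_add hqa, neg_add_cancel, theta_zero hqa]⟩, rfl⟩

variable {j : J}

theorem exists_regular_orthogonal (hj : IsSimpleAff D G (j, 0)) (x : L) (hx : D.coroot j x = 0 ∨
    D.coroot j x = 1 ∨ D.coroot j x = 2) :
    ∃ z, Dom D z ∧ D.coroot j z = 0 ∧ Dom D (x + z) := by
  have : Finite J := RootedDatum.finite D G
  cases nonempty_fintype J
  have h0 : ∀ j, |D.coroot j x| ≤ ∑ᶠ j, |D.coroot j x| := by
    intro j
    rw [finsum_eq_sum_of_fintype]
    exact Finset.single_le_sum (f := fun j => |D.coroot j x|)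
      (fun j _ => abs_nonneg _) (Finset.mem_univ j)
  set n := ∑ᶠ j, |D.coroot j x| with hn
  set z₀ := twoRho D + (refl D j : G) • twoRho D with hz₀
  have hzj : D.coroot j z₀ = 0 := by rw [hz₀, map_add, coroot_refl_smul, add_neg_cancel]
  have hsw : ∀ i, D.coroot i ((refl D j : G) • twoRho D) =
      D.coroot (perm D (refl D j : G) i) (twoRho D) := by
    intro i
    rw [← coroot_perm (D := D) (refl D j : G), ← mul_smul, refl_mul_self, one_smul]
  have hzi : ∀ i, D.pos i → i ≠ j → 1 ≤ D.coroot i z₀ := by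
    intro i hi hij
    have h1 := (pos_iff (D := D) (G := G) i).1 hi
    have h2 := (pos_iff (D := D) (G := G) _).1 (hj.pos_perm hi hij)
    rw [hz₀, map_add, hsw]
    omega
  refine ⟨n • z₀, fun i hi => ?_, by rw [map_zsmul, hzj, smul_zero], fun i hi => ?_⟩
  · rw [map_zsmul, smul_eq_mul]
    refine mul_nonneg ((abs_nonneg _).trans (h0 i)) ?_
    by_cases hij : i = j
    · rw [hij, hzj]
    · have := hzi i hi hij; omega
  · rw [map_add, map_zsmul, smul_eq_mul]
    by_cases hij : i = j
    · rw [hij, hzj]; omega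
    · have h1 := hzi i hi hij
      have h2 := abs_le.1 (h0 i)
      have h3 := (abs_nonneg _).trans (h0 i)
      nlinarith

theorem refl_smul_of_coroot_zero {x : L} (hx : D.coroot j x = 0) : (refl D j : G) • x = x := by
  rw [refl_smul, hx, zero_smul, sub_zero]

theorem basisN_comm_of_dom (hj : IsSimpleAff D G (j, 0)) {x : L} (hx : D.coroot j x = 0)
    (hd : Dom D x) : basisN D q (tr G x) * basisN D q (lin L (refl D j)) =
      basisN D q (lin L (refl D j)) * basisN D q (tr G x) := by
  rw [AffineHecke.basisN_mul (hd.len_lin_mul_tr _), ← affRefl_finite, hj.basisN_mul_of_pos,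
    affRefl_finite, lin_mul_tr, refl_smul_of_coroot_zero hx]
  rw [affAct_tr, hx]
  exact hj.1

theorem theta_comm_basisN (hqa : IsLabeling D q qa) (hj : IsSimpleAff D G (j, 0)) {x : L}
    (hx : D.coroot j x = 0) : theta D q x * basisN D q (lin L (refl D j)) =
      basisN D q (lin L (refl D j)) * theta D q x := by
  obtain ⟨z, hz, hzj, hxz⟩ := exists_regular_orthogonal hj x (Or.inl hx)
  have hu := isUnit_basisN hqa (tr G z)
  rw [← hu.mul_left_inj, mul_assoc, ← basisN_comm_of_dom hj hzj hz, ← mul_assoc,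
    theta_mul_basisN hqa hz hxz, mul_assoc, theta_mul_basisN hqa hz hxz,
    basisN_comm_of_dom hj (by rw [map_add, hx, hzj, add_zero]) hxz]

/-- For `x` dominant with `⟨x, α^∨⟩ > 0`, one has `N_{t_x s} = N_{t_x} N_s⁻¹`. -/
theorem basisN_tr_mul_sub (hqa : IsLabeling D q qa) (hj : IsSimpleAff D G (j, 0)) {x : L}
    (hx : 0 < D.coroot j x) : basisN D q (tr G x) *
      (basisN D q (lin L (refl D j)) - algebraMap ℂ _ (qdiff qa (j, 0))) =
        basisN D q (tr G x * lin L (refl D j)) := by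
  have h := hj.basisN_mul_of_pos (q := q) (w := tr G x * lin L (refl D j)) (by
    rw [affAct_mul, ← affRefl_finite, affAct_affRefl_self, affAct_affNeg, affPos_affNeg,
      affAct_tr]
    simp only [AffPos]; omega)
  rw [affRefl_finite, mul_assoc, ← lin_mul, refl_mul_self, lin_one, mul_one] at h
  rw [← h, mul_assoc, ← affRefl_finite, basisN_mul_basisN_sub hqa hj, mul_one]

theorem theta_mul_basisN_of_one (hqa : IsLabeling D q qa) (hj : IsSimpleAff D G (j, 0)) {x : L}
    (hx : D.coroot j x = 1) : theta D q x * basisN D q (lin L (refl D j)) =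
      basisN D q (lin L (refl D j)) * theta D q ((refl D j : G) • x) +
        qdiff qa (j, 0) • theta D q x := by
  obtain ⟨z, hz, hzj, hxz⟩ := exists_regular_orthogonal hj x (Or.inr (Or.inl hx))
  set s : G := refl D j with hs
  set n' := basisN D q (lin L s) - algebraMap ℂ _ (qdiff qa (j, 0)) with hn'
  have hsn : basisN D q (lin L s) * n' = 1 := by
    rw [hn', hs, ← affRefl_finite, basisN_mul_basisN_sub hqa hj]
  have hns : n' * basisN D q (lin L s) = 1 := by
    rw [hn', hs, ← affRefl_finite, basisN_sub_mul_basisN hqa hj]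
  set y := x + z with hy
  have hyj : D.coroot j y = 1 := by rw [hy, map_add, hx, hzj, add_zero]
  have hsd : Dom D (y + s • y) := by
    intro i hi
    rw [map_add]
    by_cases hij : i = j
    · rw [hij, hs, coroot_refl_smul, add_neg_cancel]
    · have h1 := hxz i hi
      have h2 := hxz _ (hj.pos_perm hi hij)
      have h3 := coroot_perm (D := D) s i (s • y)
      rw [← mul_smul, hs, refl_mul_self, one_smul] at h3
      rw [hs, ← h3]; omega
  have hsdj : D.coroot j (y + s • y) = 0 := by rw [map_add, hs, coroot_refl_smul, add_neg_cancel]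
  have hlen : len D (tr G y * lin L s * tr G y) = len D (tr G y * lin L s) + len D (tr G y) := by
    rw [len_mul_eq_iff]
    intro a ha h
    rw [hxz.tr_neg_iff G ha] at h
    rw [affAct_mul, affAct_mul, affAct_tr, affAct_lin, affAct_tr]
    have hsw := coroot_perm (D := D) s a.1 (s • y)
    rw [← mul_smul, hs, refl_mul_self, one_smul] at hsw
    by_cases hij : a.1 = j
    · rw [hij] at h hsw ⊢
      rw [coroot_refl_smul] at hsw
      have hneg : ¬ D.pos (perm D s j) := by rw [hs, pos_neg_iff G, not_not]; exact hj.pos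
      simp only [AffPos, hneg, and_false, or_false]
      have hc : D.coroot (perm D s j) y = -1 := by rw [hsw, hyj]
      omega
    · have h2 := hxz _ (hj.pos_perm h.1 hij)
      rw [← hs] at h2
      simp only [AffPos]
      omega
  have hprod : tr G y * lin L s * tr G y = tr G (y + s • y) * lin L s := by
    rw [mul_assoc, lin_mul_tr, ← mul_assoc, tr_add y]
  have key : basisN D q (tr G y) * n' * basisN D q (tr G y) =
      basisN D q (tr G (y + s • y)) * basisN D q (lin L s) := by
    rw [hn', hs, basisN_tr_mul_sub hqa hj (by omega), ← hs, AffineHecke.basisN_mul hlen, hprod,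
      hs, ← affRefl_finite, hj.basisN_mul_of_pos]
    rw [affAct_tr, hsdj]; exact hj.1
  have h1 : n' * theta D q y = theta D q (s • y) * basisN D q (lin L s) := by
    rw [← theta_dom hqa hsd, theta_add hqa, ← theta_dom hqa hxz, mul_assoc, mul_assoc,
      (isUnit_theta hqa y).mul_right_inj] at key
    exact key
  have h2 : theta D q y * n' = basisN D q (lin L s) * theta D q (s • y) := by
    have := congrArg (fun t => basisN D q (lin L s) * t * n') h1
    simp only [← mul_assoc, hsn, one_mul] at this
    rw [this]
    simp only [mul_assoc, hsn, mul_one]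
  have h3 : theta D q x * n' = basisN D q (lin L s) * theta D q (s • x) := by
    have hzn : theta D q z * n' = n' * theta D q z := by
      rw [hn', mul_sub, sub_mul, hs, theta_comm_basisN hqa hj hzj, Algebra.commutes]
    rw [hy, smul_add, hs, refl_smul_of_coroot_zero hzj, ← hs, theta_add hqa, theta_add hqa,
      mul_assoc, hzn, ← mul_assoc, ← mul_assoc, (isUnit_theta hqa z).mul_left_inj] at h2
    exact h2
  rw [← h3, hn', mul_sub, ← Algebra.commutes, ← Algebra.smul_def, sub_add_cancel]

theorem qdiff_affNeg (hqa : IsLabeling D q qa) (a : J × ℤ) :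
    qdiff qa (affNeg D G a) = qdiff qa a := by
  rw [qdiff, qdiff, ← affAct_affRefl_self, hqa.inv]

theorem theta_root_mul_basisN (hqa : IsLabeling D q qa) (hj : IsSimpleAff D G (j, 0)) :
    theta D q (D.root j) * basisN D q (lin L (refl D j)) =
      basisN D q (lin L (refl D j)) * theta D q (-D.root j) +
        qdiff qa (j, 0) • theta D q (D.root j) + algebraMap ℂ _ (qdiff qa (j, -1)) := by
  obtain ⟨m, hm, hmj, hd⟩ := exists_regular_orthogonal hj (D.root j)
    (Or.inr (Or.inr (coroot_root (G := G) j)))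
  set s : G := refl D j with hs
  set n' := basisN D q (lin L s) - algebraMap ℂ _ (qdiff qa (j, 0)) with hn'
  have hns : n' * basisN D q (lin L s) = 1 := by
    rw [hn', hs, ← affRefl_finite, basisN_sub_mul_basisN hqa hj]
  set x := D.root j + m with hx
  have hxj : D.coroot j x = 2 := by rw [hx, map_add, hmj, coroot_root (G := G), add_zero]
  set c : J × ℤ := affNeg D G (j, -1) with hc
  have hcpos : AffPos D c := by
    rw [hc, affPos_affNeg]; simp [AffPos]
  set v := tr G x * lin L s with hv
  have hvc : ¬ AffPos D (affAct D v c) := by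
    rw [hc, affAct_affNeg, affPos_affNeg, not_not, hv, affAct_mul, affAct_lin, affAct_tr,
      hs, coroot_neg, hxj]
    simp [AffPos]
  have hvm : v * affRefl D G c = tr G m := by
    rw [hc, affRefl_affNeg, affRefl, hv, ← mul_assoc, mul_assoc (tr G x), lin_mul_tr, ← hs,
      mul_assoc, mul_assoc, ← lin_mul, hs, refl_mul_self, lin_one, mul_one, ← tr_add, ← hs]
    congr 1
    have : s • (-((-1 : ℤ) • D.root j)) = -D.root j := by
      rw [neg_smul, one_smul, neg_neg, hs, refl_smul, coroot_root (G := G), two_smul]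
      abel
    rw [this, hx]
    abel
  obtain ⟨A, B, a, ha, h1, h2, h3, h4, h5⟩ := strong_exchange v c hcpos hvc
  rw [hvm] at h2
  have hlx : len D (tr G x) = len D (tr G m) + 2 := by
    have e1 := hd.len_tr G
    have e2 := hm.len_tr G
    have e3 := hj.sum_coroot_root
    have : Finite J := RootedDatum.finite D G
    cases nonempty_fintype J
    classical
    rw [finsum_cond_eq_sum_filter] at e1 e2 e3
    simp only [hx, map_add] at e1
    rw [Finset.sum_add_distrib] at e1
    rw [hx]
    omega
  have hlv : len D v + 1 = len D (tr G x) := by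
    rw [hv, hs, ← affRefl_finite]
    refine hj.len_mul_of_neg ?_
    rw [affAct_tr, hxj, AffPos]
    omega
  have hN₁ : basisN D q v = basisN D q A * basisN D q (affRefl D G a) * basisN D q B := by
    rw [mul_assoc, AffineHecke.basisN_mul (w := affRefl D G a) (by rw [h4, ha.len]),
      AffineHecke.basisN_mul, h1, mul_assoc]
    rw [← mul_assoc, ← h1, h4]; omega
  have hN₂ : basisN D q (tr G m) = basisN D q A * basisN D q B := by
    rw [AffineHecke.basisN_mul, h2]
    rw [← h2]; omega
  set T := theta D q (D.root j) * n' with hT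
  have hmT : basisN D q (tr G m) * T = basisN D q v := by
    rw [hT, ← mul_assoc, ← theta_dom hqa hm, ← theta_add hqa, add_comm, ← hx, theta_dom hqa hd,
      hn', hs, basisN_tr_mul_sub hqa hj (by omega)]
  have hBT : basisN D q B * T = basisN D q (affRefl D G a) * basisN D q B := by
    rw [hN₂, hN₁, mul_assoc, mul_assoc, (isUnit_basisN hqa A).mul_right_inj] at hmT
    exact hmT
  have hqa' : qdiff qa a = qdiff qa (j, -1) := by
    rw [← qdiff_affNeg hqa (j, -1), ← h5, qdiff, qdiff, hqa.inv]
  have hTT : T * T = 1 + qdiff qa (j, -1) • T := by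
    rw [← (isUnit_basisN hqa B).mul_right_inj, ← mul_assoc, hBT, mul_assoc, hBT, ← mul_assoc,
      basisN_sq hqa ha, add_mul, one_mul, smul_mul_assoc, mul_add, mul_one, mul_smul_comm, hBT,
      hqa']
  have hTinv : T * (basisN D q (lin L s) * theta D q (-D.root j)) = 1 := by
    rw [hT, mul_assoc, ← mul_assoc n', hns, one_mul, ← theta_add hqa, add_neg_cancel,
      theta_zero hqa]
  have hfin : T = basisN D q (lin L s) * theta D q (-D.root j) +
      algebraMap ℂ _ (qdiff qa (j, -1)) := by
    have := congrArg (fun t => t * (basisN D q (lin L s) * theta D q (-D.root j))) hTT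
    simp only [mul_assoc, hTinv, mul_one, add_mul, one_mul, smul_mul_assoc] at this
    rw [this, Algebra.smul_def, mul_one]
  rw [hT, hn', mul_sub, ← Algebra.commutes, ← Algebra.smul_def] at hfin
  rw [eq_add_of_sub_eq hfin]
  abel

theorem qdiff_add_even (hqa : IsLabeling D q qa) (j : J) (n m : ℤ) :
    qdiff qa (j, n + 2 * m) = qdiff qa (j, n) := by
  have := hqa.inv (tr G (-(m • D.root j))) (j, n)
  rw [affAct_tr] at this
  simp only [map_neg, map_zsmul, coroot_root (G := G)] at this
  rw [qdiff, qdiff, ← this, show n - -(m • 2) = n + 2 * m by rw [smul_eq_mul]; ring]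

theorem qdiff_of_odd (hqa : IsLabeling D q qa) (j : J) {x : L} (hx : Odd (D.coroot j x)) (n : ℤ) :
    qdiff qa (j, n) = qdiff qa (j, 0) := by
  have h1 : ∀ n, qdiff qa (j, n + 1) = qdiff qa (j, n) := by
    intro n
    obtain ⟨k, hk⟩ := hx
    have := hqa.inv (tr G (-x)) (j, n)
    rw [affAct_tr] at this
    simp only [map_neg, sub_neg_eq_add, hk] at this
    rw [← qdiff_add_even hqa j (n + 1) k, qdiff, qdiff, ← this,
      show n + 1 + 2 * k = n + (2 * k + 1) by ring]
  induction n using Int.induction_on with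
  | zero => rfl
  | succ n ih => rw [h1, ih]
  | pred n ih => rw [← ih, ← h1 (-n - 1)]; simp

/-- The correction term in the Bernstein relation. -/
def bernPoly (D : Datum J L) (qa : J × ℤ → ℝ) (j : J) (x : L) : AddMonoidAlgebra ℂ L :=
  ∑ k ∈ Finset.range (D.coroot j x).toNat,
      AddMonoidAlgebra.single (x - (k : ℤ) • D.root j) (qdiff qa (j, -k)) -
    ∑ k ∈ Finset.range (-D.coroot j x).toNat,
      AddMonoidAlgebra.single (x - D.coroot j x • D.root j - (k : ℤ) • D.root j)
        (qdiff qa (j, -k))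

/-- The Bernstein relation. -/
theorem bernstein_relation (hqa : IsLabeling D q qa) (hj : IsSimpleAff D G (j, 0)) (x : L) :
    theta D q x * basisN D q (lin L (refl D j)) =
      basisN D q (lin L (refl D j)) * theta D q ((refl D j : G) • x) +
        thetaHom hqa (bernPoly D qa j x) := by
  have hnonneg : ∀ (n : ℕ) (x : L), D.coroot j x = n →
      theta D q x * basisN D q (lin L (refl D j)) =
      basisN D q (lin L (refl D j)) * theta D q ((refl D j : G) • x) +
        ∑ k ∈ Finset.range n, qdiff qa (j, -k) • theta D q (x - (k : ℤ) • D.root j) := by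
    intro n
    induction n using Nat.strong_induction_on with
    | _ n ih =>
      intro x hx
      match n, ih, hx with
      | 0, ih, hx =>
        have hx0 : D.coroot j x = 0 := by simpa using hx
        rw [theta_comm_basisN hqa hj hx0, refl_smul_of_coroot_zero hx0]
        simp
      | 1, ih, hx =>
        rw [theta_mul_basisN_of_one hqa hj (by simpa using hx)]
        simp
      | n + 2, ih, hx =>
        have hy : D.coroot j (x - D.root j) = n := by
          rw [map_sub, hx, coroot_root (G := G)]; push_cast; ring
        have h1 := ih n (by omega) _ hy
        have hxy : theta D q x = theta D q (D.root j) * theta D q (x - D.root j) := by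
          rw [← theta_add hqa, add_sub_cancel]
        have e1 : -D.root j + (refl D j : G) • (x - D.root j) = (refl D j : G) • x := by
          rw [smul_sub, refl_smul j (D.root j), coroot_root (G := G), two_smul]; abel
        have e2 : D.root j + (refl D j : G) • (x - D.root j) = x - (n : ℤ) • D.root j := by
          rw [refl_smul, hy]; abel
        have e3 : (refl D j : G) • (x - D.root j) = x - ((n + 1 : ℕ) : ℤ) • D.root j := by
          rw [refl_smul, hy]; push_cast; rw [add_smul, one_smul]; abel
        have q1 : qdiff qa (j, -(n : ℤ)) = qdiff qa (j, 0) := by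
          rcases Nat.even_or_odd n with ⟨k, hk⟩ | hodd
          · rw [← qdiff_add_even hqa j (-(n : ℤ)) k]; congr 2; omega
          · refine qdiff_of_odd hqa j (x := x - D.root j) ?_ _
            rw [hy]; exact_mod_cast hodd
        have q2 : qdiff qa (j, -((n + 1 : ℕ) : ℤ)) = qdiff qa (j, -1) := by
          rcases Nat.even_or_odd n with ⟨k, hk⟩ | hodd
          · rw [← qdiff_add_even hqa j (-((n + 1 : ℕ) : ℤ)) k]; congr 2; omega
          · have ho : Odd (D.coroot j (x - D.root j)) := by rw [hy]; exact_mod_cast hodd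
            exact (qdiff_of_odd hqa j ho _).trans (qdiff_of_odd hqa j ho _).symm
        rw [hxy, mul_assoc, h1, mul_add, ← mul_assoc, theta_root_mul_basisN hqa hj, add_mul,
          add_mul, mul_assoc, ← theta_add hqa, e1, smul_mul_assoc, ← theta_add hqa, e2, e3,
          ← Algebra.smul_def, Finset.sum_range_succ, Finset.sum_range_succ, q1, q2, Finset.mul_sum]
        have e4 : ∀ k : ℕ, theta D q (D.root j) *
            (qdiff qa (j, -(k : ℤ)) • theta D q (x - D.root j - (k : ℤ) • D.root j)) =
              qdiff qa (j, -(k : ℤ)) • theta D q (x - (k : ℤ) • D.root j) := by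
          intro k
          rw [mul_smul_comm, ← theta_add hqa]
          congr 2; abel
        simp only [e4]
        abel
  rcases le_total 0 (D.coroot j x) with h | h
  · rw [hnonneg _ x (Int.toNat_of_nonneg h).symm, bernPoly,
      show (-D.coroot j x).toNat = 0 by omega]
    simp [map_sum, thetaHom_single]
  · have hneg : D.coroot j (-x) = ((-D.coroot j x).toNat : ℤ) := by
      rw [map_neg, Int.toNat_of_nonneg (by omega)]
    have h1 := hnonneg _ (-x) hneg
    have h2 := congrArg (fun t => theta D q x * t * theta D q ((refl D j : G) • x)) h1
    have e1 : theta D q x * theta D q (-x) = 1 := by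
      rw [← theta_add hqa, add_neg_cancel, theta_zero hqa]
    have e2 : theta D q ((refl D j : G) • (-x)) * theta D q ((refl D j : G) • x) = 1 := by
      rw [smul_neg, ← theta_add hqa, neg_add_cancel, theta_zero hqa]
    simp only [mul_add, add_mul, ← mul_assoc, e1, one_mul] at h2
    simp only [mul_assoc, e2, mul_one] at h2
    rw [h2, bernPoly, show (D.coroot j x).toNat = 0 by omega]
    simp only [Finset.range_zero, Finset.sum_empty, zero_sub, map_neg, map_sum, thetaHom_single,
      Finset.mul_sum, Finset.sum_mul]
    rw [add_assoc, left_eq_add, ← sub_eq_add_neg, sub_eq_zero]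
    refine Finset.sum_congr rfl fun k _ => ?_
    rw [smul_mul_assoc, mul_smul_comm, ← theta_add hqa, ← theta_add hqa]
    congr 2
    rw [refl_smul]; abel

end Bernstein


open RootedDatum

section Helper

variable {J L G : Type*} [AddCommGroup L] [Group G] [DistribMulAction G L]

theorem len_lin_eq_one (D : Datum J L) (g : G) (σ : Equiv.Perm J)
    (hσ : ∀ j y, D.coroot (σ j) (g • y) = D.coroot j y)
    (hinj : ∀ j k, (∀ y, D.coroot j y = D.coroot k y) → j = k) (i : J) (hi : D.pos i)
    (hneg : ¬ D.pos (σ i)) (h : ∀ j, D.pos j → j ≠ i → D.pos (σ j)) : len D (lin L g) = 1 := by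
  have : inversions D (lin L g) = {(i, 0)} := by
    ext ⟨j, n⟩
    simp only [inversions, Set.mem_ofPred_eq, Set.mem_singleton_iff, Prod.mk.injEq]
    constructor
    · rintro ⟨h1, ⟨k, m⟩, h2, h3⟩
      have h4 : m = n := by simpa [affEval, act, lin] using h3 0
      subst h4
      have h5 : k = σ j := by
        refine hinj _ _ fun y => ?_
        have := h3 (g⁻¹ • y)
        rw [act_lin, smul_inv_smul] at this
        simp only [affEval, add_left_inj] at this
        rw [this, ← hσ, smul_inv_smul]
      subst h5
      simp only [AffPos] at h1 h2
      push Not at h2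
      have h6 : m = 0 := by rcases h1 with h | h <;> omega
      refine ⟨?_, h6⟩
      by_contra hj
      have := h j (by rcases h1 with h | h; · omega
                      · exact h.2) hj
      exact h2.2 h6 this
    · rintro ⟨rfl, rfl⟩
      exact ⟨Or.inr ⟨rfl, hi⟩, (σ j, 0), by simp [AffPos, hneg],
        fun y => by simp [affEval, act_lin, hσ]⟩
  rw [len, this, Set.ncard_singleton]

end Helper

section RootData

variable {ι X Y : Type*} [AddCommGroup X] [AddCommGroup Y] {R : RootDatum ι X Y}

theorem weyl_ext {g h : R.weylGroup} (H : ∀ x : X, g • x = h • x) : g = h := by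
  refine Subtype.ext (RootPairing.Equiv.weightHom_injective R ?_)
  ext x
  exact H x

theorem ofIdx_smul (i : ι) (x : X) : RootPairing.weylGroup.ofIdx R i • x =
    x - R.coroot' i x • R.root i := by
  change RootPairing.Equiv.reflection R i • x = _
  rw [RootPairing.Equiv.reflection_smul, RootPairing.reflection_apply]

theorem coroot'_perm_smul (g : R.weylGroup) (i : ι) (x : X) :
    R.coroot' (R.weylGroupToPerm g i) (g • x) = R.coroot' i x := by
  have h1 := LinearMap.congr_fun (RootPairing.Hom.weight_coweight_transpose_apply R R
    (R.coroot (R.weylGroupToPerm g i)) g.1.toHom) x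
  have h2 := RootPairing.Hom.coroot_coweightMap_apply R R (R.weylGroupToPerm g i) g.1.toHom
  have h3 : g.1.toHom.indexEquiv.symm (R.weylGroupToPerm g i) = i := by
    rw [Equiv.symm_apply_eq]
    rfl
  rw [h2, h3] at h1
  exact h1

theorem weylGroupToPerm_ofIdx (i : ι) :
    R.weylGroupToPerm (RootPairing.weylGroup.ofIdx R i) = R.reflectionPerm i := by
  ext j
  apply R.root.injective
  rw [← RootPairing.weylGroup_apply_root, RootPairing.root_reflectionPerm]
  rfl

theorem ofIdx_reflectionPerm (i j : ι) : RootPairing.weylGroup.ofIdx R (R.reflectionPerm i j) =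
    RootPairing.weylGroup.ofIdx R i * RootPairing.weylGroup.ofIdx R j *
      RootPairing.weylGroup.ofIdx R i := by
  refine weyl_ext fun x => ?_
  have hinv : ∀ y : X, RootPairing.weylGroup.ofIdx R i • RootPairing.weylGroup.ofIdx R i • y = y :=
    fun y => by
      change R.reflection i (R.reflection i y) = y
      simp
  have hc : R.coroot' (R.reflectionPerm i j) x =
      R.coroot' j (RootPairing.weylGroup.ofIdx R i • x) := by
    rw [← coroot'_perm_smul (RootPairing.weylGroup.ofIdx R i), weylGroupToPerm_ofIdx, RootPairing.reflectionPerm_self]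
  rw [mul_smul, mul_smul, ofIdx_smul, ofIdx_smul j, smul_sub, hinv, hc,
    RootPairing.root_reflectionPerm, smul_comm]
  rfl

theorem ofIdx_reflectionPerm_self (i : ι) : RootPairing.weylGroup.ofIdx R (R.reflectionPerm i i) =
    RootPairing.weylGroup.ofIdx R i := by
  rw [ofIdx_reflectionPerm]
  have : RootPairing.weylGroup.ofIdx R i * RootPairing.weylGroup.ofIdx R i = 1 := by
    refine weyl_ext fun x => ?_
    rw [mul_smul, one_smul]
    change R.reflection i (R.reflection i x) = x
    simp
  rw [this, one_mul]

theorem coroot'_injective {i j : ι} (h : ∀ x, R.coroot' i x = R.coroot' j x) : i = j := by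
  apply R.coroot.injective
  apply R.flip.toPerfPair.injective
  ext x
  exact h x

theorem datum_torsionFree (R : RootDatum ι X Y) (n : ℤ) (x : X) (hn : n ≠ 0) (h : n • x = 0) : x = 0 := by
  refine R.toPerfPair.injective ?_
  rw [map_zero]
  ext y
  have := congrArg (fun x => R.toLinearMap x y) h
  simpa [hn] using this

section Form

variable [Finite ι]

/-- The canonical form pairs `x` with a root as a multiple of the coroot. -/
theorem exists_form (R : RootDatum ι X Y) : ∃ B : X →ₗ[ℤ] X →ₗ[ℤ] ℤ, (∀ x y, B x y = B y x) ∧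
    (∀ i, 0 < B (R.root i) (R.root i)) ∧
    (∀ i x, R.coroot' i x * B (R.root i) (R.root i) = 2 * B x (R.root i)) ∧
    ∀ x ∈ R.rootSpan ℤ, B x x = 0 → x = 0 := by
  cases nonempty_fintype ι
  have h1 : ∀ x y, R.RootForm x y = R.RootForm y x := fun x y => by
    simp [RootPairing.rootForm_apply_apply, mul_comm]
  refine ⟨R.RootForm, h1, fun i => ?_, fun i x => ?_, fun x hx h => ?_⟩
  · rw [RootPairing.rootForm_apply_apply]
    refine Finset.sum_pos' (fun j _ => mul_self_nonneg _) ⟨i, Finset.mem_univ i, ?_⟩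
    have : R.coroot' i (R.root i) = 2 := R.root_coroot_two i
    rw [this]; norm_num
  · have h2 := R.rootForm_reflection_reflection_apply i x (R.root i)
    rw [RootPairing.reflection_apply_self, RootPairing.reflection_apply, map_neg, map_sub,
      map_smul, LinearMap.sub_apply, LinearMap.smul_apply, smul_eq_mul] at h2
    linarith
  · rw [RootPairing.rootForm_apply_apply, Finset.sum_eq_zero_iff_of_nonneg
      (fun j _ => mul_self_nonneg _)] at h
    refine Submodule.disjoint_def.mp R.disjoint_rootSpan_ker_rootForm _ hx ?_
    rw [LinearMap.mem_ker]
    ext y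
    rw [RootPairing.rootForm_apply_apply, LinearMap.zero_apply]
    refine Finset.sum_eq_zero fun j hj => ?_
    rw [mul_self_eq_zero.1 (h j hj), zero_mul]

end Form

variable {b : R.Base}

theorem pos_iff_isPos (i : ι) : (datum R b).pos i ↔ b.IsPos i := by
  change R.root i ∈ AddSubmonoid.closure (R.root '' b.support) ↔ _
  have key : ∀ i, R.root i ∈ AddSubmonoid.closure (R.root '' b.support) → b.IsPos i := by
    intro i hi
    have : ∀ x ∈ AddSubmonoid.closure (R.root '' b.support), ∃ f : ι → ℤ, (∀ j, 0 ≤ f j) ∧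
        x = ∑ j ∈ b.support, f j • R.root j := by
      intro x hx
      classical
      induction hx using AddSubmonoid.closure_induction with
      | mem x hx =>
        obtain ⟨j, hj, rfl⟩ := hx
        refine ⟨Pi.single j 1, fun k => ?_, ?_⟩
        · rw [Pi.single_apply]; split_ifs <;> simp
        · rw [Finset.sum_eq_single_of_mem j hj]
          · simp
          · intro k _ hk; simp [hk]
      | zero => exact ⟨0, fun _ => le_rfl, by simp⟩
      | add x y _ _ hx hy =>
        obtain ⟨f, hf, rfl⟩ := hx
        obtain ⟨g, hg, rfl⟩ := hy
        exact ⟨f + g, fun j => add_nonneg (hf j) (hg j), by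
          simp [add_smul, Finset.sum_add_distrib]⟩
    obtain ⟨f, hf, h⟩ := this _ hi
    rw [RootPairing.Base.isPos_iff', RootPairing.Base.height_eq_sum h]
    exact Finset.sum_nonneg fun j _ => hf j
  refine ⟨key i, fun hi => ?_⟩
  rcases b.root_mem_or_neg_mem i with h | h
  · exact h
  · exfalso
    have h2 := key (R.reflectionPerm i i) (by
      rwa [RootPairing.root_reflectionPerm, RootPairing.reflection_apply_self])
    exact (RootPairing.Base.IsPos.neg_iff_not b i).1 h2 hi

theorem datum_pos_neg_iff (i : ι) :
    (datum R b).pos (R.reflectionPerm i i) ↔ ¬ (datum R b).pos i := by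
  rw [pos_iff_isPos, pos_iff_isPos]
  exact RootPairing.Base.IsPos.neg_iff_not b i

theorem datum_pos_of_mem {i : ι} (hi : i ∈ b.support) : (datum R b).pos i :=
  AddSubmonoid.subset_closure ⟨i, hi, rfl⟩

variable [Finite ι] [R.IsReduced]

theorem datum_pos_reflectionPerm {i j : ι} (hi : i ∈ b.support) (hj : (datum R b).pos j)
    (hij : j ≠ i) : (datum R b).pos (R.reflectionPerm i j) := by
  rw [pos_iff_isPos] at hj ⊢
  exact hj.reflectionPerm hi hij

variable (P : Par b)

omit [Finite ι] [R.IsReduced] in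
theorem root_reflectionPerm_mem {i j : ι} (hi : R.root i ∈ rootLat P) :
    R.root (R.reflectionPerm i j) ∈ rootLat P ↔ R.root j ∈ rootLat P := by
  rw [RootPairing.root_reflectionPerm, RootPairing.reflection_apply]
  exact (rootLat P).sub_mem_iff_left ((rootLat P).smul_mem _ hi)

omit [Finite ι] [R.IsReduced] in
theorem root_mem_rootLat {i : ι} (hi : i ∈ P.1) : R.root i ∈ rootLat P :=
  Submodule.subset_span ⟨i, hi, rfl⟩

omit [Finite ι] [R.IsReduced] in
theorem mem_closure_of_pos {j : ι} (hj : (datum R b).pos j) (hjP : R.root j ∈ rootLat P) :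
    R.root j ∈ AddSubmonoid.closure (R.root '' P.1) := by
  classical
  obtain ⟨f, hf⟩ : ∃ f : ι → ℕ, R.root j = ∑ i ∈ b.support, f i • R.root i := by
    have hj' : R.root j ∈ AddSubmonoid.closure (R.root '' b.support) := hj
    clear hj hjP
    generalize R.root j = x at hj'
    induction hj' using AddSubmonoid.closure_induction with
    | mem x hx =>
      obtain ⟨i, hi, rfl⟩ := hx
      refine ⟨Pi.single i 1, ?_⟩
      rw [Finset.sum_eq_single_of_mem i hi]
      · simp
      · intro k _ hk; simp [hk]
    | zero => exact ⟨0, by simp⟩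
    | add x y _ _ hx hy =>
      obtain ⟨f, rfl⟩ := hx
      obtain ⟨g, rfl⟩ := hy
      exact ⟨f + g, by simp [add_smul, Finset.sum_add_distrib]⟩
  rw [← Finset.sum_sdiff P.2] at hf
  set a := ∑ i ∈ P.1, f i • R.root i with ha
  set c := ∑ i ∈ b.support \ P.1, f i • R.root i with hc
  have ha' : a ∈ AddSubmonoid.closure (R.root '' P.1) :=
    sum_mem fun i hi => nsmul_mem (AddSubmonoid.subset_closure (Set.mem_image_of_mem _ hi)) _
  have ha'' : a ∈ rootLat P :=
    sum_mem fun i hi => (rootLat P).smul_of_tower_mem _ (root_mem_rootLat P hi)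
  have hcP : c ∈ rootLat P := by
    rw [hf] at hjP
    exact ((rootLat P).add_mem_iff_left ha'').1 hjP
  have hcQ : c ∈ Submodule.span ℤ (R.root '' (b.support \ P.1 : Finset ι)) :=
    sum_mem fun i hi => Submodule.smul_of_tower_mem _ _
      (Submodule.subset_span (Set.mem_image_of_mem _ hi))
  have hdis := b.linearIndepOn_root.disjoint_span_image (s := {i | i.1 ∈ P.1})
    (t := {i | i.1 ∉ P.1}) (by rw [Set.disjoint_left]; exact fun i h1 h2 => h2 h1)
  have hc0 : c = 0 := by
    refine Submodule.disjoint_def.1 hdis c ?_ ?_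
    · refine Submodule.span_mono ?_ hcP
      rintro _ ⟨i, hi, rfl⟩
      exact ⟨⟨i, P.2 hi⟩, hi, rfl⟩
    · refine Submodule.span_mono ?_ hcQ
      rintro _ ⟨i, hi, rfl⟩
      have hi := Finset.mem_sdiff.1 hi
      exact ⟨⟨i, hi.1⟩, hi.2, rfl⟩
  rw [hf, hc0, zero_add]
  exact ha'

/-- The sum of the positive roots in `R_P`. -/
def twoRhoPar : X := ∑ᶠ (j) (_ : (datum R b).pos j ∧ R.root j ∈ rootLat P), R.root j

theorem coroot'_twoRhoPar {i : ι} (hi : i ∈ P.1) : R.coroot' i (twoRhoPar P) = 2 := by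
  classical
  cases nonempty_fintype ι
  have hiP := root_mem_rootLat P hi
  have hib := P.2 hi
  rw [twoRhoPar, finsum_cond_eq_sum_filter]
  set T : Finset ι := {j | (datum R b).pos j ∧ R.root j ∈ rootLat P} with hT
  have hmem : ∀ j, j ∈ T ↔ (datum R b).pos j ∧ R.root j ∈ rootLat P := fun j => by simp [hT]
  have hiT : i ∈ T := (hmem i).2 ⟨datum_pos_of_mem hib, hiP⟩
  have h2 : R.coroot' i (R.root i) = 2 := R.root_coroot_two i
  rw [← Finset.add_sum_erase _ _ hiT, map_add, h2]
  have hfix : R.reflection i (∑ j ∈ T.erase i, R.root j) = ∑ j ∈ T.erase i, R.root j := by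
    rw [map_sum]
    have hmaps : ∀ j ∈ T.erase i, R.reflectionPerm i j ∈ T.erase i := by
      intro j hj
      rw [Finset.mem_erase, hmem] at hj ⊢
      refine ⟨fun h => ?_, datum_pos_reflectionPerm hib hj.2.1 hj.1,
        (root_reflectionPerm_mem P hiP).2 hj.2.2⟩
      have h3 : R.reflectionPerm i i = j := by
        conv_rhs => rw [← RootPairing.reflectionPerm_self R i j, h]
      have h4 := (datum_pos_neg_iff (b := b) i).1 (h3 ▸ hj.2.1)
      exact h4 (datum_pos_of_mem hib)
    refine Finset.sum_nbij' (R.reflectionPerm i) (R.reflectionPerm i) hmaps hmaps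
      (fun j _ => RootPairing.reflectionPerm_self R i j)
      (fun j _ => RootPairing.reflectionPerm_self R i j)
      (fun j _ => (RootPairing.root_reflectionPerm R i j).symm)
  rw [RootPairing.reflection_apply, sub_eq_self] at hfix
  have := congrArg (R.coroot' i) hfix
  rw [map_smul, h2, map_zero, smul_eq_mul] at this
  omega

theorem coroot'_twoRhoPar_pos {j : ι} (hj : (datum R b).pos j) (hjP : R.root j ∈ rootLat P) :
    0 < R.coroot' j (twoRhoPar P) := by
  obtain ⟨B, hsymm, hpos, hco, -⟩ := exists_form R
  have key : ∀ x ∈ AddSubmonoid.closure (R.root '' P.1), x = 0 ∨ 0 < B (twoRhoPar P) x := by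
    intro x hx
    induction hx using AddSubmonoid.closure_induction with
    | mem x hx =>
      obtain ⟨i, hi, rfl⟩ := hx
      right
      have h1 := hco i (twoRhoPar P)
      rw [coroot'_twoRhoPar P hi] at h1
      have := hpos i
      omega
    | zero => left; rfl
    | add x y _ _ hx hy =>
      rcases hx with rfl | hx
      · rwa [zero_add]
      rcases hy with rfl | hy
      · rw [add_zero]; right; exact hx
      right; rw [map_add]; omega
  have h1 := (key _ (mem_closure_of_pos P hj hjP)).resolve_left (R.ne_zero j)
  have h2 := hco j (twoRhoPar P)
  have h3 := hpos j
  by_contra h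
  nlinarith

theorem ofIdx_mem_parW {j : ι} (hj : R.root j ∈ rootLat P) :
    RootPairing.weylGroup.ofIdx R j ∈ parW P := by
  obtain ⟨B, hsymm, hpos, hco, -⟩ := exists_form R
  have key : ∀ n : ℕ, ∀ j, (datum R b).pos j → R.root j ∈ rootLat P → b.height j ≤ n →
      RootPairing.weylGroup.ofIdx R j ∈ parW P := by
    intro n
    induction n with
    | zero =>
      intro j h1 _ h2
      rw [pos_iff_isPos, RootPairing.Base.isPos_iff] at h1
      exact absurd h1 (by push_cast at h2; omega)
    | succ n ih =>
      intro j h1 h2 h3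
      by_cases hjP : j ∈ P.1
      · exact Subgroup.subset_closure ⟨j, hjP, rfl⟩
      obtain ⟨i, hi, hc⟩ : ∃ i ∈ P.1, 0 < R.coroot' i (R.root j) := by
        by_contra! hcon
        have : ∀ x ∈ AddSubmonoid.closure (R.root '' P.1), B (R.root j) x ≤ 0 := by
          intro x hx
          induction hx using AddSubmonoid.closure_induction with
          | mem x hx =>
            obtain ⟨i, hi, rfl⟩ := hx
            have e1 := hco i (R.root j)
            have e2 := hcon i hi
            have e3 := hpos i
            nlinarith
          | zero => simp
          | add x y _ _ hx hy => rw [map_add]; omega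
        have := this _ (mem_closure_of_pos P h1 h2)
        have := hpos j
        omega
      have hiP := root_mem_rootLat P hi
      have hji : j ≠ i := fun h => hjP (h ▸ hi)
      have hk := ih (R.reflectionPerm i j) (datum_pos_reflectionPerm (P.2 hi) h1 hji)
        ((root_reflectionPerm_mem P hiP).2 h2) (by
          have e : R.root (R.reflectionPerm i j) =
              R.root j + (-R.coroot' i (R.root j)) • R.root i := by
            rw [RootPairing.root_reflectionPerm, RootPairing.reflection_apply, neg_smul,
              sub_eq_add_neg]
          rw [b.height_add_zsmul e, RootPairing.Base.height_one_of_mem_support (P.2 hi)]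
          simp only [smul_eq_mul, mul_one]
          push_cast at h3
          omega)
      have hs : RootPairing.weylGroup.ofIdx R i ∈ parW P :=
        Subgroup.subset_closure ⟨i, hi, rfl⟩
      have := (parW P).mul_mem ((parW P).mul_mem hs hk) hs
      rwa [← ofIdx_reflectionPerm, RootPairing.reflectionPerm_self] at this
  by_cases hp : (datum R b).pos j
  · exact key (b.height j).toNat j hp hj (Int.self_le_toNat _)
  · rw [← ofIdx_reflectionPerm_self]
    exact key (b.height (R.reflectionPerm j j)).toNat _ ((datum_pos_neg_iff j).2 hp)
      ((root_reflectionPerm_mem P hj).2 hj) (Int.self_le_toNat _)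

end RootData


open RootedDatum

section RootData

variable {ι X Y : Type*} [AddCommGroup X] [AddCommGroup Y] {R : RootDatum ι X Y} {b : R.Base}
variable [Finite ι] [R.IsReduced]

omit [Finite ι] [R.IsReduced] in
theorem coroot'_reflectionPerm_self (j : ι) (x : X) :
    R.coroot' (R.reflectionPerm j j) x = -R.coroot' j x := by
  rw [← coroot'_perm_smul (RootPairing.weylGroup.ofIdx R j), weylGroupToPerm_ofIdx,
    RootPairing.reflectionPerm_self, ofIdx_smul, map_sub, map_smul]
  have : R.coroot' j (R.root j) = 2 := R.root_coroot_two j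
  rw [this, smul_eq_mul]; ring

theorem datum_pos_iff (j : ι) : (datum R b).pos j ↔ 0 < R.coroot' j (twoRho (datum R b)) := by
  have hall : ∀ i, R.root i ∈ rootLat (⟨b.support, Finset.Subset.refl _⟩ : Par b) := fun i => by
    rw [rootLat, RootPairing.Base.span_int_root_support]
    exact Submodule.subset_span ⟨i, rfl⟩
  have h0 : twoRho (datum R b) = twoRhoPar (⟨b.support, Finset.Subset.refl _⟩ : Par b) := by
    rw [twoRho, twoRhoPar]
    simp only [hall, and_true]
    rfl
  have h1 : ∀ j, (datum R b).pos j → 0 < R.coroot' j (twoRho (datum R b)) := fun j hj => by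
    rw [h0]; exact coroot'_twoRhoPar_pos _ hj (hall j)
  refine ⟨h1 j, fun h => ?_⟩
  by_contra hj
  have h2 := h1 _ ((datum_pos_neg_iff j).2 hj)
  rw [coroot'_reflectionPerm_self] at h2
  omega

theorem coroot'_parallel (i j : ι) (m n : ℤ) (hm : 0 < m) (hn : 0 < n)
    (h : ∀ x, m * R.coroot' i x = n * R.coroot' j x) : i = j := by
  have hX : Module.IsReflexive ℤ X := .of_isPerfPair R.toLinearMap
  have hY : Module.IsReflexive ℤ Y := .of_isPerfPair R.flip.toLinearMap
  have hX' : Module.IsTorsionFree ℤ X := Module.IsReflexive.to_isTorsionFree ℤ X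
  have hY' : Module.IsTorsionFree ℤ Y := Module.IsReflexive.to_isTorsionFree ℤ Y
  have hdep : ¬ LinearIndependent ℤ ![R.flip.root i, R.flip.root j] := by
    intro hli
    rw [LinearIndependent.pair_iff] at hli
    have := hli m (-n) (by
      apply R.flip.toPerfPair.injective
      rw [map_zero]
      ext x
      have h1 := h x
      rw [map_add, map_smul, map_smul]
      change m * R.coroot' i x + -n * R.coroot' j x = 0
      linarith)
    omega
  rcases RootPairing.IsReduced.eq_or_eq_neg (P := R.flip) i j hdep with h1 | h1
  · exact R.flip.root.injective h1
  · exfalso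
    have h2 : ∀ x, R.coroot' i x = -R.coroot' j x := fun x => by
      change R.toLinearMap x (R.coroot i) = -R.toLinearMap x (R.coroot j)
      have h1 : R.coroot i = -R.coroot j := h1
      rw [h1, map_neg]
    have h3 := h (R.root i)
    have h4 := h2 (R.root i)
    have h5 : R.coroot' i (R.root i) = 2 := R.root_coroot_two i
    rw [h5] at h3 h4
    nlinarith

/-- The roots other than `α_i` which are made negative by `s_i`. -/
theorem len_lin_ofIdx {i : ι} (hi : i ∈ b.support) :
    len (datum R b) (lin X (RootPairing.weylGroup.ofIdx R i)) = 1 := by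
  refine len_lin_eq_one _ _ (R.weylGroupToPerm (RootPairing.weylGroup.ofIdx R i))
    (fun j y => coroot'_perm_smul _ j y) (fun j k h => coroot'_injective h) i
    (datum_pos_of_mem hi) ?_ ?_
  · rw [weylGroupToPerm_ofIdx, datum_pos_neg_iff, not_not]
    exact datum_pos_of_mem hi
  · intro j hj hij
    rw [weylGroupToPerm_ofIdx]
    exact datum_pos_reflectionPerm hi hj hij

theorem mem_parW_support (g : R.weylGroup) :
    g ∈ parW (⟨b.support, Finset.Subset.refl _⟩ : Par b) := by
  obtain ⟨g, hg⟩ := g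
  induction hg using RootPairing.weylGroup.induction with
  | mem i =>
    refine ofIdx_mem_parW _ ?_
    rw [rootLat, RootPairing.Base.span_int_root_support]
    exact Submodule.subset_span ⟨i, rfl⟩
  | one => exact one_mem _
  | mul g h hg hh ihg ihh => exact mul_mem ihg ihh

instance : RootedDatum (datum R b) R.weylGroup where
  finite := inferInstance
  perm := R.weylGroupToPerm
  refl := RootPairing.weylGroup.ofIdx R
  coroot_root := R.root_coroot_two
  refl_smul := ofIdx_smul
  root_perm g j := (RootPairing.weylGroup_apply_root R g j).symm
  coroot_perm := coroot'_perm_smul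
  parallel := coroot'_parallel
  pos_iff := datum_pos_iff
  regular j h := by
    have h1 : ¬ (datum R b).pos j := by rw [datum_pos_iff]; exact fun h' => h'.ne' h
    have h2 := (datum_pos_iff (b := b) _).1 ((datum_pos_neg_iff j).2 h1)
    rw [coroot'_reflectionPerm_self] at h2
    have h3 : R.coroot' j (twoRho (datum R b)) = 0 := h
    rw [h3] at h2
    simp at h2
  faithful g h := weyl_ext fun x => by rw [h, one_smul]
  gen := by
    refine eq_top_iff.2 fun g _ => ?_
    refine Subgroup.closure_mono ?_ (mem_parW_support (b := b) g)
    rintro _ ⟨i, hi, rfl⟩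
    exact ⟨i, rfl, len_lin_ofIdx hi⟩
  torsionFree := datum_torsionFree R

theorem isSimpleAff_of_mem {i : ι} (hi : i ∈ b.support) :
    IsSimpleAff (datum R b) R.weylGroup (i, 0) := by
  obtain ⟨k, hk, h⟩ := exists_isSimpleAff_of_refl_len_one (D := datum R b) (G := R.weylGroup)
    (len_lin_ofIdx (b := b) hi)
  rwa [hk.refl_eq (datum_pos_of_mem hi) h] at hk

/-! #### Parabolic subsystems -/

variable (P : Par b)

omit [Finite ι] [R.IsReduced] in
theorem parW_smul_sub_mem {g : R.weylGroup} (hg : g ∈ parW P) (x : X) :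
    g • x - x ∈ rootLat P := by
  induction hg using Subgroup.closure_induction generalizing x with
  | mem g hg =>
    obtain ⟨i, hi, rfl⟩ := hg
    rw [ofIdx_smul, sub_sub_cancel_left]
    exact (rootLat P).neg_mem ((rootLat P).smul_mem _ (root_mem_rootLat P hi))
  | one => simp
  | mul g h _ _ hg hh =>
    have := (rootLat P).add_mem (hg (h • x)) (hh x)
    rwa [sub_add_sub_cancel, ← mul_smul] at this
  | inv g _ hg =>
    have := (rootLat P).neg_mem (hg (g⁻¹ • x))
    rwa [smul_inv_smul, neg_sub] at this

omit [Finite ι] [R.IsReduced] in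
theorem parW_smul_mem_iff {g : R.weylGroup} (hg : g ∈ parW P) {x : X} :
    g • x ∈ rootLat P ↔ x ∈ rootLat P := by
  rw [← (rootLat P).sub_mem_iff_left (x := g • x) (parW_smul_sub_mem P hg x)]
  simp

omit [Finite ι] [R.IsReduced] in
theorem parW_perm_mem_iff {g : R.weylGroup} (hg : g ∈ parW P) (j : ι) :
    R.root (R.weylGroupToPerm g j) ∈ rootLat P ↔ R.root j ∈ rootLat P := by
  rw [← RootPairing.weylGroup_apply_root, parW_smul_mem_iff P hg]

/-- `W_P` permutes the positive roots outside `R_P`. -/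
theorem parW_perm_pos {g : R.weylGroup} (hg : g ∈ parW P) {j : ι} (hj : R.root j ∉ rootLat P) :
    (datum R b).pos (R.weylGroupToPerm g j) ↔ (datum R b).pos j := by
  have key : ∀ g ∈ parW P, ∀ j, R.root j ∉ rootLat P → (datum R b).pos j →
      (datum R b).pos (R.weylGroupToPerm g j) := by
    intro g hg
    induction hg using Subgroup.closure_induction'' with
    | mem g hg =>
      obtain ⟨i, hi, rfl⟩ := hg
      intro j hj hp
      rw [weylGroupToPerm_ofIdx]
      exact datum_pos_reflectionPerm (P.2 hi) hp fun h => hj (h ▸ root_mem_rootLat P hi)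
    | inv_mem g hg =>
      obtain ⟨i, hi, rfl⟩ := hg
      intro j hj hp
      have : (RootPairing.weylGroup.ofIdx R i)⁻¹ = RootPairing.weylGroup.ofIdx R i :=
        refl_inv (D := datum R b) i
      rw [this, weylGroupToPerm_ofIdx]
      exact datum_pos_reflectionPerm (P.2 hi) hp fun h => hj (h ▸ root_mem_rootLat P hi)
    | one => intro j _ hp; simpa using hp
    | mul g h hg hh ihg ihh =>
      intro j hj hp
      rw [map_mul, Equiv.Perm.mul_apply]
      exact ihg _ (by rwa [parW_perm_mem_iff P hh]) (ihh j hj hp)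
  refine ⟨fun h => ?_, key g hg j hj⟩
  have := key g⁻¹ (inv_mem hg) _ (by rwa [parW_perm_mem_iff P hg]) h
  simpa using this

/-- The permutation action of `W_P` on `R_P`. -/
def parPerm : parW P →* Equiv.Perm {i // R.root i ∈ rootLat P} where
  toFun g := Equiv.Perm.subtypePerm (R.weylGroupToPerm g.1) fun j => (parW_perm_mem_iff P g.2 j)
  map_one' := rfl
  map_mul' _ _ := rfl

/-- The reflection in a root of `R_P`. -/
def parRefl (j : {i // R.root i ∈ rootLat P}) : parW P :=
  ⟨RootPairing.weylGroup.ofIdx R j.1, ofIdx_mem_parW P j.2⟩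

omit [Finite ι] [R.IsReduced] in
theorem parW_smul_mk (g : parW P) (x : X) : g • (Submodule.Quotient.mk x : XP P) =
    Submodule.Quotient.mk (g.1 • x) := rfl

omit [Finite ι] [R.IsReduced] in
theorem parDatum_coroot_mk (j : {i // R.root i ∈ rootLat P}) (x : X) :
    (parDatum P).coroot j (Submodule.Quotient.mk x) = R.coroot' j.1 x := rfl

omit [R.IsReduced] in
theorem twoRho_parDatum : twoRho (parDatum P) = Submodule.Quotient.mk (twoRhoPar P) := by
  classical
  cases nonempty_fintype ι
  rw [twoRho, twoRhoPar, finsum_cond_eq_sum_filter, finsum_cond_eq_sum_filter]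
  change _ = (perpLat P).mkQ _
  rw [map_sum, ← Finset.filter_filter, Finset.filter_comm, Finset.sum_filter (p := (datum R b).pos),
    Finset.sum_subtype (p := fun i => R.root i ∈ rootLat P) _ (by simp), Finset.sum_filter]
  rfl

theorem parDatum_pos_iff (j : {i // R.root i ∈ rootLat P}) :
    (parDatum P).pos j ↔ 0 < (parDatum P).coroot j (twoRho (parDatum P)) := by
  rw [twoRho_parDatum, parDatum_coroot_mk]
  refine ⟨fun h => coroot'_twoRhoPar_pos P h j.2, fun h => ?_⟩
  by_contra hj
  have h2 := coroot'_twoRhoPar_pos P ((datum_pos_neg_iff j.1).2 hj)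
    ((root_reflectionPerm_mem P j.2).2 j.2)
  rw [coroot'_reflectionPerm_self] at h2
  omega

omit [R.IsReduced] in
theorem parW_faithful (g : parW P) (h : ∀ x : XP P, g • x = x) : g = 1 := by
  refine Subtype.ext (weyl_ext fun x => ?_)
  change g.1 • x = (1 : R.weylGroup) • x
  rw [one_smul]
  obtain ⟨B, -, hpos, hco, hdef⟩ := exists_form R
  have h1 := parW_smul_sub_mem P g.2 x
  have h2 : g.1 • x - x ∈ perpLat P := (Submodule.Quotient.eq _).1 (h (Submodule.Quotient.mk x))
  rw [← sub_eq_zero]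
  have h3 : rootLat P ≤ R.rootSpan ℤ := Submodule.span_mono (Set.image_subset_range _ _)
  refine hdef _ (h3 h1) ?_
  have h4 : rootLat P ≤ LinearMap.ker (B (g.1 • x - x)) := by
    rw [rootLat, Submodule.span_le]
    rintro _ ⟨i, hi, rfl⟩
    have := hco i (g.1 • x - x)
    rw [h2 i (root_mem_rootLat P hi)] at this
    simp only [SetLike.mem_coe, LinearMap.mem_ker]
    omega
  exact h4 h1

theorem len_lin_parRefl {i : ι} (hi : i ∈ P.1) : len (parDatum P) (lin (XP P)
    (parRefl P ⟨i, root_mem_rootLat P hi⟩)) = 1 := by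
  refine len_lin_eq_one _ _ (parPerm P (parRefl P ⟨i, root_mem_rootLat P hi⟩))
    (fun j y => ?_) (fun j k h => Subtype.ext (coroot'_injective fun x => h
      (Submodule.Quotient.mk x))) ⟨i, root_mem_rootLat P hi⟩
    (datum_pos_of_mem (P.2 hi)) ?_ ?_
  · obtain ⟨x, rfl⟩ := Submodule.Quotient.mk_surjective _ y
    rw [parW_smul_mk]
    exact coroot'_perm_smul _ _ _
  · change ¬ (datum R b).pos (R.weylGroupToPerm (RootPairing.weylGroup.ofIdx R i) i)
    rw [weylGroupToPerm_ofIdx, datum_pos_neg_iff, not_not]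
    exact datum_pos_of_mem (P.2 hi)
  · intro j hj hij
    change (datum R b).pos (R.weylGroupToPerm (RootPairing.weylGroup.ofIdx R i) j.1)
    rw [weylGroupToPerm_ofIdx]
    exact datum_pos_reflectionPerm (P.2 hi) hj fun h => hij (Subtype.ext h)

instance : RootedDatum (parDatum P) (parW P) where
  finite := inferInstance
  perm := parPerm P
  refl := parRefl P
  coroot_root j := R.root_coroot_two j.1
  refl_smul j y := by
    obtain ⟨x, rfl⟩ := Submodule.Quotient.mk_surjective _ y
    rw [parW_smul_mk]
    exact congrArg _ (ofIdx_smul j.1 x)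
  root_perm g j := congrArg _ (RootPairing.weylGroup_apply_root R g.1 j.1).symm
  coroot_perm g j y := by
    obtain ⟨x, rfl⟩ := Submodule.Quotient.mk_surjective _ y
    exact coroot'_perm_smul g.1 j.1 x
  parallel i j m n hm hn h := Subtype.ext
    (coroot'_parallel i.1 j.1 m n hm hn fun x => h (Submodule.Quotient.mk x))
  pos_iff := parDatum_pos_iff P
  regular j h := by
    have h0 := parDatum_pos_iff P j
    have h1 := parDatum_pos_iff P ⟨_, (root_reflectionPerm_mem P j.2).2 j.2⟩
    rw [twoRho_parDatum, parDatum_coroot_mk] at h h0 h1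
    rw [coroot'_reflectionPerm_self, h] at h1
    rw [h] at h0
    have h5 := datum_pos_neg_iff (b := b) j.1
    change (datum R b).pos j.1 ↔ _ at h0
    change (datum R b).pos (R.reflectionPerm j.1 j.1) ↔ _ at h1
    simp only [lt_self_iff_false, neg_zero, iff_false] at h0 h1
    exact h1 (h5.2 h0)
  faithful := parW_faithful P
  gen := by
    have h := Subgroup.closure_closure_coe_preimage (k := RootPairing.weylGroup.ofIdx R '' P.1)
    refine eq_top_iff.2 (h.symm.trans_le (Subgroup.closure_mono ?_))
    rintro g ⟨i, hi, hg⟩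
    have : g = parRefl P ⟨i, root_mem_rootLat P hi⟩ := Subtype.ext hg.symm
    exact ⟨⟨i, root_mem_rootLat P hi⟩, this, this ▸ len_lin_parRefl P hi⟩
  torsionFree n y hn h := by
    obtain ⟨x, rfl⟩ := Submodule.Quotient.mk_surjective _ y
    rw [← Submodule.Quotient.mk_smul, Submodule.Quotient.mk_eq_zero] at h
    rw [Submodule.Quotient.mk_eq_zero]
    intro i hi
    have := h i hi
    rw [map_smul, smul_eq_mul] at this
    exact (mul_eq_zero.1 this).resolve_left hn

end RootData


open RootedDatum

section Labels

variable {J L G : Type*} [AddCommGroup L] [Group G] [DistribMulAction G L]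
variable {D : Datum J L} [RootedDatum D G] {q : AffW G L → ℝ}

theorem affLabel_affAct (w : AffW G L) (a : J × ℤ) :
    affLabel D q (affAct D w a) = affLabel D q a := by
  have h : (fun s => s ∈ simpleRefl G D ∧ ∃ v, IsRefl D (v * s * v⁻¹) (affAct D w a)) =
      fun s => s ∈ simpleRefl G D ∧ ∃ v, IsRefl D (v * s * v⁻¹) a := by
    funext s
    refine propext (and_congr_right fun _ => ⟨?_, ?_⟩)
    · rintro ⟨v, hv⟩
      refine ⟨w⁻¹ * v, ?_⟩
      have h1 := hv.eq_affRefl (G := G)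
      have h2 : w⁻¹ * v * s * (w⁻¹ * v)⁻¹ = affRefl D G a := by
        rw [affRefl_affAct] at h1
        rw [mul_inv_rev, inv_inv, mul_assoc w⁻¹, mul_assoc w⁻¹, ← mul_assoc _ v⁻¹, h1]
        group
      rw [h2]
      exact isRefl_affRefl a
    · rintro ⟨v, hv⟩
      refine ⟨w * v, ?_⟩
      have h1 := hv.eq_affRefl (G := G)
      have h2 : w * v * s * (w * v)⁻¹ = affRefl D G (affAct D w a) := by
        rw [affRefl_affAct, ← h1]
        group
      rw [h2]
      exact isRefl_affRefl _
  classical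
  have key : ∀ p p' : AffW G L → Prop, p = p' → (if h : ∃ s, p s then q h.choose else 1) =
      if h : ∃ s, p' s then q h.choose else 1 := by
    rintro p _ rfl; rfl
  unfold affLabel
  convert key _ _ h

theorem IsLabelFunction.isLabeling (hq : IsLabelFunction D q) :
    IsLabeling D q (affLabel D q) where
  pos a := by
    unfold affLabel
    split_ifs
    · exact hq.pos _
    · exact one_pos
  inv := affLabel_affAct
  simple a ha := by
    have hex : ∃ s, s ∈ simpleRefl G D ∧ ∃ v, IsRefl D (v * s * v⁻¹) a :=
      ⟨affRefl D G a, ha.mem_simpleRefl, 1, by simpa using isRefl_affRefl a⟩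
    unfold affLabel
    rw [dif_pos hex]
    obtain ⟨hs, v, hv⟩ := hex.choose_spec
    set s := hex.choose
    obtain ⟨c, hc, hsc⟩ := (mem_simpleRefl_iff (D := D) s).1 hs
    rw [hsc]
    have h1 := hv.eq_affRefl (G := G)
    rw [hsc] at h1
    have h2 : affRefl D G (affAct D v c) = affRefl D G a := by rw [affRefl_affAct, h1]
    obtain ⟨u, hu⟩ : ∃ u, affAct D u c = a := by
      by_cases h3 : affAct D v c = a
      · exact ⟨v, h3⟩
      refine ⟨v * affRefl D G c, ?_⟩
      rw [affAct_mul, affAct_affRefl_self, affAct_affNeg]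
      have h4 := ha.2
      rcases affPos_or_affNeg (D := D) (G := G) (affAct D v c) with h5 | h5
      · have h6 := ha.2 _ h5 h3
        rw [← h2, affAct_affRefl_self, affPos_affNeg] at h6
        exact absurd h5 h6
      · by_contra h7
        have h6 := ha.2 _ h5 h7
        rw [← h2, ← affRefl_affNeg, affAct_affRefl_self, affPos_affNeg] at h6
        exact h6 h5
    have hpos : AffPos D (affAct D u c) := hu ▸ ha.1
    have e1 : q (u * affRefl D G c) = q u * q (affRefl D G c) :=
      hq.mul _ _ (by rw [hc.len_mul_of_pos hpos, hc.len])
    have e2 : q (affRefl D G a * u) = q (affRefl D G a) * q u := by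
      refine hq.mul _ _ ?_
      rw [ha.len, ha.refl_mul_len_of_pos, add_comm]
      rw [← hu, affAct_inv_affAct]
      exact hc.1
    rw [affRefl_mul_eq hu, e1, mul_comm] at e2
    exact (mul_right_cancel₀ (hq.pos u).ne' e2).symm

end Labels

section RootData

variable {ι X Y : Type*} [AddCommGroup X] [AddCommGroup Y] {R : RootDatum ι X Y} {b : R.Base}
variable [Finite ι] [R.IsReduced] {q : WX R → ℝ} (P : Par b)

theorem parLabel_isLabeling (hq : IsLabelFunction (datum R b) q) :
    IsLabeling (parDatum P) (parLabel P q) (fun a => affLabel (datum R b) q (a.1.1, a.2)) where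
  pos a := hq.isLabeling.pos _
  inv w a := by
    obtain ⟨x, hx⟩ := Submodule.Quotient.mk_surjective _ (act w 0)
    rw [eq_tr_mul_lin w, affAct_mul, affAct_lin, affAct_tr, ← hx, parDatum_coroot_mk]
    have h := hq.isLabeling.inv (tr R.weylGroup x * lin X w.right.1) (a.1.1, a.2)
    rw [affAct_mul, affAct_lin, affAct_tr] at h
    exact h
  simple a ha := by
    rw [parLabel, ha.inversions]
    simp

theorem isSimpleAff_parDatum_iff (j : {i // R.root i ∈ rootLat P}) :
    IsSimpleAff (parDatum P) (parW P) (j, 0) ↔ IsSimpleAff (datum R b) R.weylGroup (j.1, 0) := by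
  constructor
  · intro h
    refine ⟨(affPos_zero _).2 h.pos, ?_⟩
    rintro ⟨k, n⟩ hk hne
    rw [affRefl_finite, affAct_lin]
    rcases hk with hk | hk
    · exact Or.inl hk
    · obtain rfl : n = 0 := hk.1
      rw [affPos_zero]
      by_cases hkP : R.root k ∈ rootLat P
      · exact h.pos_perm (i := ⟨k, hkP⟩) hk.2 fun h => hne (by rw [← h])
      · exact (parW_perm_pos P (ofIdx_mem_parW P j.2) hkP).2 hk.2
  · intro h
    refine ⟨(affPos_zero _).2 h.pos, ?_⟩
    rintro ⟨k, n⟩ hk hne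
    rw [affRefl_finite, affAct_lin]
    rcases hk with hk | hk
    · exact Or.inl hk
    · obtain rfl : n = 0 := hk.1
      rw [affPos_zero]
      exact h.pos_perm (i := k.1) hk.2 fun h => hne (by rw [Subtype.ext h])

/-- Inversions of elements of `W_P` lie in `R_P`. -/
theorem mem_rootLat_of_inversion {g : R.weylGroup} (hg : g ∈ parW P) {j : ι}
    (hj : (datum R b).pos j) (hgj : ¬ (datum R b).pos (perm (datum R b) g j)) :
    R.root j ∈ rootLat P := by
  by_contra h
  exact hgj ((parW_perm_pos P hg h).2 hj)

theorem exists_simple_descent_parW {g : R.weylGroup} (hg : g ∈ parW P)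
    (h : len (datum R b) (lin X g) ≠ 0) :
    ∃ j : {i // R.root i ∈ rootLat P}, IsSimpleAff (datum R b) R.weylGroup (j.1, 0) ∧
      ¬ (datum R b).pos (perm (datum R b) g j.1) := by
  obtain ⟨j, hj, hgj⟩ := exists_finite_descent h
  exact ⟨⟨j, mem_rootLat_of_inversion P hg hj.pos hgj⟩, hj, hgj⟩

theorem minReps_perm_pos {u : R.weylGroup} (hu : u ∈ minReps P) {j : ι}
    (hj : (datum R b).pos j) (hjP : R.root j ∈ rootLat P) :
    (datum R b).pos (perm (datum R b) u j) := by
  change R.root _ ∈ _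
  have hgen : ∀ i ∈ P.1, u • R.root i ∈ AddSubmonoid.closure (R.root '' b.support) := by
    intro i hi
    have h1 := hu _ (Subgroup.subset_closure ⟨i, hi, rfl⟩ : RootPairing.weylGroup.ofIdx R i ∈ parW P)
    have hs := isSimpleAff_of_mem (b := b) (P.2 hi)
    by_contra h2
    have h3 := hs.len_mul_of_neg (w := lin X u) (by
      rw [affAct_lin, affPos_zero]
      intro h
      refine h2 ?_
      rw [RootPairing.weylGroup_apply_root]
      exact h)
    rw [affRefl_finite, ← lin_mul] at h3
    change len (datum R b) (lin X (u * RootPairing.weylGroup.ofIdx R i)) + 1 = _ at h3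
    omega
  have h2 := mem_closure_of_pos P hj hjP
  have h3 : R.root (perm (datum R b) u j) = u • R.root j :=
    (RootPairing.weylGroup_apply_root R u j).symm
  rw [h3]
  generalize R.root j = x at h2
  induction h2 using AddSubmonoid.closure_induction with
  | mem x hx => obtain ⟨i, hi, rfl⟩ := hx; exact hgen i hi
  | zero => rw [smul_zero]; exact zero_mem _
  | add x y _ _ hx hy => rw [smul_add]; exact add_mem hx hy

theorem len_minReps_mul {u w : R.weylGroup} (hu : u ∈ minReps P) (hw : w ∈ parW P) :
    len (datum R b) (lin X (u * w)) = len (datum R b) (lin X u) + len (datum R b) (lin X w) := by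
  rw [lin_mul, len_mul_eq_iff]
  rintro ⟨j, n⟩ ha h
  rw [affAct_mul]
  rw [affAct_lin] at h ⊢
  rw [affAct_lin]
  simp only [AffPos] at ha h ⊢
  have hn : n = 0 := by rcases ha with h1 | h1 <;> omega
  subst hn
  simp only [lt_self_iff_false, true_and, false_or] at ha h ⊢
  have hjP := mem_rootLat_of_inversion P hw ha h
  intro h1
  have h2 := (pos_neg_iff (D := datum R b) R.weylGroup (perm (datum R b) w j)).2 h
  have h3 := minReps_perm_pos P hu h2 (by
    change R.root (R.weylGroupToPerm (RootPairing.weylGroup.ofIdx R (R.weylGroupToPerm w j))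
      (R.weylGroupToPerm w j)) ∈ _
    have h4 := (parW_perm_mem_iff P hw j).2 hjP
    rw [weylGroupToPerm_ofIdx]
    exact (root_reflectionPerm_mem P h4).2 h4)
  have h4 : ∀ k, perm (datum R b) u (perm (datum R b) (refl (datum R b) k : R.weylGroup) k) =
      perm (datum R b) (refl (datum R b) (perm (datum R b) u k) : R.weylGroup)
        (perm (datum R b) u k) := by
    intro k
    rw [refl_perm, ← Equiv.Perm.mul_apply, ← Equiv.Perm.mul_apply, ← map_mul, ← map_mul,
      inv_mul_cancel_right]
  rw [h4, pos_neg_iff] at h3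
  exact h3 h1

omit [R.IsReduced] in
theorem exists_minReps_mul (g : R.weylGroup) : ∃ u ∈ minReps P, ∃ w ∈ parW P, g = u * w := by
  obtain ⟨w, hw, hmin⟩ : ∃ w ∈ parW P, ∀ w' ∈ parW P,
      len (datum R b) (lin X (g * w)) ≤ len (datum R b) (lin X (g * w')) := by
    obtain ⟨w, hw, h⟩ := Set.exists_min_image (parW P : Set R.weylGroup)
      (fun w => len (datum R b) (lin X (g * w))) (Set.toFinite _) ⟨1, one_mem _⟩
    exact ⟨w, hw, h⟩
  refine ⟨g * w, fun w' hw' => ?_, w⁻¹, inv_mem hw, by rw [mul_inv_cancel_right]⟩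
  rw [mul_assoc]
  exact hmin _ (mul_mem hw hw')

theorem minReps_mul_injective {u u' w w' : R.weylGroup} (hu : u ∈ minReps P) (hu' : u' ∈ minReps P)
    (hw : w ∈ parW P) (hw' : w' ∈ parW P) (h : u * w = u' * w') : u = u' ∧ w = w' := by
  have hv : w * w'⁻¹ ∈ parW P := mul_mem hw (inv_mem hw')
  have h1 : u * (w * w'⁻¹) = u' := by rw [← mul_assoc, h, mul_inv_cancel_right]
  have h2 := len_minReps_mul P hu hv
  have h3 := hu' _ (inv_mem hv)
  rw [h1] at h2
  rw [← h1, mul_inv_cancel_right, h1] at h3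
  have h4 := eq_one_of_len_eq_zero (D := datum R b) (g := w * w'⁻¹) (by omega)
  rw [mul_inv_eq_one] at h4
  subst h4
  exact ⟨mul_right_cancel h, rfl⟩

theorem one_mem_minReps : (1 : R.weylGroup) ∈ minReps P := fun w _ => by
  rw [lin_one, len_one]; exact Nat.zero_le _

end RootData


open RootedDatum

section Bases

variable {J L G : Type*} [AddCommGroup L] [Group G] [DistribMulAction G L]
variable {D : Datum J L} [RootedDatum D G]
variable {q : AffW G L → ℝ} {qa : J × ℤ → ℝ}

omit [Group G] [DistribMulAction G L] in
theorem algebra_induction {p : AddMonoidAlgebra ℂ L → Prop} (a : AddMonoidAlgebra ℂ L)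
    (h0 : p 0) (hadd : ∀ a b, p a → p b → p (a + b)) (hsmul : ∀ (c : ℂ) a, p a → p (c • a))
    (hs : ∀ x, p (AddMonoidAlgebra.single x 1)) : p a := by
  induction a using AddMonoidAlgebra.induction_linear with
  | zero => exact h0
  | add a b ha hb => exact hadd a b ha hb
  | single x c =>
    have := hsmul c _ (hs x)
    rwa [AddMonoidAlgebra.smul_single', mul_one] at this

/-- The action of `g` on the group algebra of the lattice. -/
def actA (g : G) : AddMonoidAlgebra ℂ L →ₐ[ℂ] AddMonoidAlgebra ℂ L :=
  AddMonoidAlgebra.mapDomainAlgHom ℂ ℂ (DistribSMul.toAddMonoidHom L g)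

theorem actA_single (g : G) (x : L) (c : ℂ) :
    actA g (AddMonoidAlgebra.single x c) = AddMonoidAlgebra.single (g • x) c :=
  AddMonoidAlgebra.mapDomain_single

theorem actA_mul (g h : G) (a : AddMonoidAlgebra ℂ L) : actA (g * h) a = actA g (actA h a) := by
  induction a using algebra_induction with
  | h0 => simp only [map_zero]
  | hadd a b ha hb => simp only [map_add, ha, hb]
  | hsmul c a ha => simp only [map_smul, ha]
  | hs x => simp only [actA_single, mul_smul]

theorem actA_one (a : AddMonoidAlgebra ℂ L) : actA (1 : G) a = a := by
  induction a using algebra_induction with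
  | h0 => simp only [map_zero]
  | hadd a b ha hb => simp only [map_add, ha, hb]
  | hsmul c a ha => simp only [map_smul, ha]
  | hs x => simp only [actA_single, one_smul]

theorem basisN_mul_theta (hqa : IsLabeling D q qa) {j : J} (hj : IsSimpleAff D G (j, 0)) (x : L) :
    basisN D q (lin L (refl D j)) * theta D q x =
      theta D q ((refl D j : G) • x) * basisN D q (lin L (refl D j)) -
        thetaHom hqa (bernPoly D qa j ((refl D j : G) • x)) := by
  rw [bernstein_relation hqa hj, ← mul_smul, refl_mul_self, one_smul, add_sub_cancel_right]

variable (D q) in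
/-- The span of the `N_g θ_x` with `g` of length less than `n`. -/
def lowerSpan (n : ℕ) : Submodule ℂ (HeckeAlg D q) :=
  Submodule.span ℂ {h | ∃ (g : G) (x : L), len D (lin L g) < n ∧
    h = basisN D q (lin L g) * theta D q x}

omit [RootedDatum D G] in
theorem lowerSpan_mono {m n : ℕ} (h : m ≤ n) : lowerSpan D q m ≤ lowerSpan D q n :=
  Submodule.span_mono fun _ ⟨g, x, hg, hx⟩ => ⟨g, x, hg.trans_le h, hx⟩

omit [RootedDatum D G] in
theorem mem_lowerSpan {n : ℕ} {g : G} (hg : len D (lin L g) < n) (x : L) :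
    basisN D q (lin L g) * theta D q x ∈ lowerSpan D q n :=
  Submodule.subset_span ⟨g, x, hg, rfl⟩

theorem lowerSpan_mul_theta (hqa : IsLabeling D q qa) {n : ℕ} {h : HeckeAlg D q}
    (hh : h ∈ lowerSpan D q n) (x : L) : h * theta D q x ∈ lowerSpan D q n := by
  induction hh using Submodule.span_induction with
  | mem h hh =>
    obtain ⟨g, y, hg, rfl⟩ := hh
    rw [mul_assoc, ← theta_add hqa]
    exact mem_lowerSpan hg _
  | zero => rw [zero_mul]; exact zero_mem _
  | add a b _ _ ha hb => rw [add_mul]; exact add_mem ha hb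
  | smul c a _ ha => rw [smul_mul_assoc]; exact Submodule.smul_mem _ _ ha

theorem lowerSpan_mul_thetaHom (hqa : IsLabeling D q qa) {n : ℕ} {h : HeckeAlg D q}
    (hh : h ∈ lowerSpan D q n) (a : AddMonoidAlgebra ℂ L) :
    h * thetaHom hqa a ∈ lowerSpan D q n := by
  induction a using algebra_induction with
  | h0 => rw [map_zero, mul_zero]; exact zero_mem _
  | hadd a b ha hb => rw [map_add, mul_add]; exact add_mem ha hb
  | hsmul c a ha => rw [map_smul, mul_smul_comm]; exact Submodule.smul_mem _ _ ha
  | hs x => rw [thetaHom_single, one_smul]; exact lowerSpan_mul_theta hqa hh x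

theorem mem_lowerSpan' (hqa : IsLabeling D q qa) {n : ℕ} {g : G} (hg : len D (lin L g) < n)
    (a : AddMonoidAlgebra ℂ L) : basisN D q (lin L g) * thetaHom hqa a ∈ lowerSpan D q n := by
  refine lowerSpan_mul_thetaHom hqa ?_ a
  have := mem_lowerSpan (q := q) hg 0
  rwa [theta_zero hqa, mul_one] at this

theorem len_mul_refl_le (g : G) {j : J} (hj : IsSimpleAff D G (j, 0)) :
    len D (lin L (g * refl D j)) ≤ len D (lin L g) + 1 := by
  have := len_mul_le (D := D) (lin L g) (lin L (refl D j))
  rw [← affRefl_finite, hj.len, affRefl_finite, ← lin_mul] at this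
  exact this

theorem basisN_mul_refl_mem (hqa : IsLabeling D q qa) (g : G) {j : J}
    (hj : IsSimpleAff D G (j, 0)) (x : L) :
    basisN D q (lin L g) * basisN D q (lin L (refl D j)) * theta D q x ∈
      lowerSpan D q (len D (lin L g) + 2) := by
  have hlen := len_mul_refl_le g hj
  by_cases hpos : AffPos D (affAct D (lin L g) (j, 0))
  · rw [← affRefl_finite, hj.basisN_mul_of_pos hpos, affRefl_finite, ← lin_mul]
    exact mem_lowerSpan (by omega) _
  · rw [← affRefl_finite, hj.basisN_mul_of_neg hqa hpos, affRefl_finite, ← lin_mul, add_mul,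
      smul_mul_assoc]
    exact add_mem (mem_lowerSpan (by omega) _)
      (Submodule.smul_mem _ _ (mem_lowerSpan (by omega) _))

theorem lowerSpan_mul_refl (hqa : IsLabeling D q qa) {n : ℕ} {h : HeckeAlg D q}
    (hh : h ∈ lowerSpan D q n) {j : J} (hj : IsSimpleAff D G (j, 0)) :
    h * basisN D q (lin L (refl D j)) ∈ lowerSpan D q (n + 1) := by
  induction hh using Submodule.span_induction with
  | mem h hh =>
    obtain ⟨g, y, hg, rfl⟩ := hh
    rw [mul_assoc, bernstein_relation hqa hj, mul_add, ← mul_assoc]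
    exact add_mem (lowerSpan_mono (by omega) (basisN_mul_refl_mem hqa g hj _))
      (mem_lowerSpan' hqa (by omega) _)
  | zero => rw [zero_mul]; exact zero_mem _
  | add a b _ _ ha hb => rw [add_mul]; exact add_mem ha hb
  | smul c a _ ha => rw [smul_mul_assoc]; exact Submodule.smul_mem _ _ ha

theorem len_mul_refl_of_pos {g : G} {j : J} (hj : IsSimpleAff D G (j, 0))
    (h : D.pos (perm D g j)) : len D (lin L (g * refl D j)) = len D (lin L g) + 1 := by
  rw [lin_mul, ← affRefl_finite]
  exact hj.len_mul_of_pos (by rwa [affAct_lin, affPos_zero])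

theorem basisN_mul_refl_of_pos {g : G} {j : J} (hj : IsSimpleAff D G (j, 0))
    (h : D.pos (perm D g j)) : basisN D q (lin L g) * basisN D q (lin L (refl D j)) =
      basisN D q (lin L (g * refl D j)) := by
  rw [lin_mul, ← affRefl_finite]
  exact hj.basisN_mul_of_pos (by rwa [affAct_lin, affPos_zero])

/-- Moving `θ_x` past `N_g`, up to lower terms. -/
theorem theta_mul_basisN_sub_mem (hqa : IsLabeling D q qa) (g : G) (x : L) :
    theta D q x * basisN D q (lin L g) - basisN D q (lin L g) * theta D q (g⁻¹ • x) ∈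
      lowerSpan D q (len D (lin L g)) := by
  refine fin_induction_right D (p := fun g => ∀ x, theta D q x * basisN D q (lin L g) -
    basisN D q (lin L g) * theta D q (g⁻¹ • x) ∈ lowerSpan D q (len D (lin L g))) ?_ ?_ g x
  · intro x
    rw [lin_one, basisN_one, mul_one, one_mul, inv_one, one_smul, sub_self]
    exact zero_mem _
  · intro g j hj hpos ih x
    have h1 := lowerSpan_mul_refl hqa (ih x) hj
    have e : theta D q x * basisN D q (lin L (g * refl D j)) -
        basisN D q (lin L (g * refl D j)) * theta D q ((g * refl D j)⁻¹ • x) =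
        (theta D q x * basisN D q (lin L g) - basisN D q (lin L g) * theta D q (g⁻¹ • x)) *
          basisN D q (lin L (refl D j)) +
        basisN D q (lin L g) * thetaHom hqa (bernPoly D qa j (g⁻¹ • x)) := by
      have h2 := bernstein_relation hqa hj (g⁻¹ • x)
      rw [← sub_eq_iff_eq_add'] at h2
      rw [← h2, ← basisN_mul_refl_of_pos hj hpos, mul_inv_rev, refl_inv, mul_smul]
      simp only [mul_sub, sub_mul, mul_assoc]; abel
    rw [e, len_mul_refl_of_pos hj hpos]
    exact add_mem h1 (mem_lowerSpan' hqa (by omega) _)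

theorem basisN_mul_basisN_mem (hqa : IsLabeling D q qa) (u g : G) :
    basisN D q (lin L u) * basisN D q (lin L g) ∈
      lowerSpan D q (len D (lin L u) + len D (lin L g) + 1) := by
  refine fin_induction_right D (p := fun g => basisN D q (lin L u) * basisN D q (lin L g) ∈
    lowerSpan D q (len D (lin L u) + len D (lin L g) + 1)) ?_ ?_ g
  · rw [lin_one, basisN_one, mul_one, len_one]
    have := mem_lowerSpan (q := q) (n := len D (lin L u) + 1) (Nat.lt_succ_self _) 0
    rwa [theta_zero hqa, mul_one] at this
  · intro g j hj hpos ih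
    rw [← basisN_mul_refl_of_pos hj hpos, len_mul_refl_of_pos hj hpos, ← mul_assoc]
    exact lowerSpan_mul_refl hqa ih hj

theorem basisN_mul_lowerSpan (hqa : IsLabeling D q qa) (u : G) {n : ℕ} {h : HeckeAlg D q}
    (hh : h ∈ lowerSpan D q n) :
    basisN D q (lin L u) * h ∈ lowerSpan D q (len D (lin L u) + n) := by
  induction hh using Submodule.span_induction with
  | mem h hh =>
    obtain ⟨g, y, hg, rfl⟩ := hh
    rw [← mul_assoc]
    exact lowerSpan_mono (by omega) (lowerSpan_mul_theta hqa (basisN_mul_basisN_mem hqa u g) _)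
  | zero => rw [mul_zero]; exact zero_mem _
  | add a b _ _ ha hb => rw [mul_add]; exact add_mem ha hb
  | smul c a _ ha => rw [mul_smul_comm]; exact Submodule.smul_mem _ _ ha

/-! #### The basis `N_g θ_x` -/

theorem exists_common_dom (G : Type*) [Group G] [DistribMulAction G L] [RootedDatum D G]
    (s : Finset L) : ∃ z, Dom D z ∧ ∀ x ∈ s, Dom D (x + z) := by
  classical
  induction s using Finset.induction_on with
  | empty => exact ⟨0, Dom.zero, by simp⟩
  | insert x s _ ih =>
    obtain ⟨z, hz, hs⟩ := ih
    obtain ⟨h1, h2⟩ := dom_shift (D := D) G x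
    refine ⟨(∑ᶠ j, |D.coroot j x|) • twoRho D + z, h1.add hz, fun y hy => ?_⟩
    rcases Finset.mem_insert.1 hy with rfl | hy
    · rw [← add_assoc]; exact h2.add hz
    · rw [add_left_comm]; exact h1.add (hs y hy)

theorem basisN_theta_linearIndependent (hqa : IsLabeling D q qa) :
    LinearIndependent ℂ fun p : G × L => basisN D q (lin L p.1) * theta D q p.2 := by
  classical
  rw [linearIndependent_iff]
  intro f hf
  obtain ⟨z, hz, hs⟩ := exists_common_dom (D := D) G (f.support.image Prod.snd)
  have h1 := congrArg (· * basisN D q (tr G z)) hf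
  simp only [Finsupp.linearCombination_apply, Finsupp.sum, Finset.sum_mul, zero_mul] at h1
  have h2 : ∑ p ∈ f.support, f p • basisN D q (lin L p.1 * tr G (p.2 + z)) = 0 := by
    rw [← h1]
    refine Finset.sum_congr rfl fun p hp => ?_
    have hd := hs p.2 (Finset.mem_image_of_mem _ hp)
    rw [smul_mul_assoc, mul_assoc, theta_mul_basisN hqa hz hd,
      AffineHecke.basisN_mul (hd.len_lin_mul_tr _)]
  have hinj : Function.Injective fun p : G × L => lin L p.1 * tr G (p.2 + z) := by
    rintro ⟨g, x⟩ ⟨h, y⟩ e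
    simp only [lin_mul_tr] at e
    have e1 := congrArg (fun w => act w 0) e
    have e2 := congrArg SemidirectProduct.right e
    simp only [act_mul, act_lin, smul_zero, act_tr, add_zero] at e1
    simp only [tr, lin, SemidirectProduct.mul_right, SemidirectProduct.right_inl,
      SemidirectProduct.right_inr, one_mul] at e2
    subst e2
    have e3 := smul_left_cancel g e1
    rw [add_right_cancel e3]
  have h3 := linearIndependent_iff'.1 ((basisN_linearIndependent hqa).comp _ hinj) f.support f h2
  ext p
  by_cases hp : p ∈ f.support
  · exact h3 p hp
  · exact Finsupp.notMem_support_iff.1 hp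

theorem basisN_theta_span (hqa : IsLabeling D q qa) :
    Submodule.span ℂ (Set.range fun p : G × L => basisN D q (lin L p.1) * theta D q p.2) = ⊤ := by
  set S := Submodule.span ℂ (Set.range fun p : G × L =>
    basisN D q (lin L p.1) * theta D q p.2) with hS
  have hle : ∀ n, lowerSpan D q n ≤ S := fun n =>
    Submodule.span_mono fun _ ⟨g, x, _, hx⟩ => ⟨(g, x), hx.symm⟩
  have hex : ∀ h ∈ S, ∃ n, h ∈ lowerSpan D q n := by
    intro h hh
    induction hh using Submodule.span_induction with
    | mem h hh => obtain ⟨p, rfl⟩ := hh; exact ⟨_, mem_lowerSpan (Nat.lt_succ_self _) _⟩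
    | zero => exact ⟨0, zero_mem _⟩
    | add a b _ _ ha hb =>
      obtain ⟨m, hm⟩ := ha
      obtain ⟨n, hn⟩ := hb
      exact ⟨max m n, add_mem (lowerSpan_mono (le_max_left _ _) hm)
        (lowerSpan_mono (le_max_right _ _) hn)⟩
    | smul c a _ ha => obtain ⟨m, hm⟩ := ha; exact ⟨m, Submodule.smul_mem _ _ hm⟩
  have hrefl : ∀ h ∈ S, ∀ j, IsSimpleAff D G (j, 0) →
      h * basisN D q (lin L (refl D j)) ∈ S := by
    intro h hh j hj
    obtain ⟨n, hn⟩ := hex h hh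
    exact hle _ (lowerSpan_mul_refl hqa hn hj)
  have hinv : ∀ v : G, ∀ h ∈ S, ∀ h', h' * basisN D q (lin L v) = h → h' ∈ S := by
    intro v
    refine fin_induction_right D (p := fun v => ∀ h ∈ S, ∀ h',
      h' * basisN D q (lin L v) = h → h' ∈ S) ?_ ?_ v
    · intro h hh h' e
      rw [lin_one, basisN_one, mul_one] at e
      rwa [e]
    · intro v j hj hpos ih h hh h' e
      rw [← basisN_mul_refl_of_pos hj hpos, ← mul_assoc] at e
      refine ih (h * (basisN D q (lin L (refl D j)) - algebraMap ℂ _ (qdiff qa (j, 0)))) ?_ h' ?_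
      · rw [mul_sub, ← Algebra.commutes, ← Algebra.smul_def]
        exact sub_mem (hrefl h hh j hj) (Submodule.smul_mem _ _ hh)
      · rw [← e, mul_assoc _ (basisN D q (lin L (refl D j))), ← affRefl_finite,
          basisN_mul_basisN_sub hqa hj, mul_one]
  refine eq_top_iff.2 ?_
  rw [← basisN_span hqa, Submodule.span_le]
  rintro _ ⟨w, rfl⟩
  obtain ⟨u, v, x, hx, h1, h2⟩ := exists_dominant_decomposition (D := D) w
  refine hinv v _ ?_ _ (AffineHecke.basisN_mul h2)
  rw [h1, ← AffineHecke.basisN_mul (hx.len_lin_mul_tr u), ← theta_dom hqa hx]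
  exact Submodule.subset_span ⟨(u, x), rfl⟩

/-- The basis `N_g θ_x` of the affine Hecke algebra. -/
def rightBasis (hqa : IsLabeling D q qa) : Module.Basis (G × L) ℂ (HeckeAlg D q) :=
  Module.Basis.mk (basisN_theta_linearIndependent hqa) (basisN_theta_span hqa).ge

theorem rightBasis_apply (hqa : IsLabeling D q qa) (p : G × L) :
    rightBasis hqa p = basisN D q (lin L p.1) * theta D q p.2 := by
  rw [rightBasis, Module.Basis.mk_apply]

open Classical in
/-- The coefficient of `N_g` of an element of the Hecke algebra, as a right module over the group
algebra of the lattice. -/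
def coefA (hqa : IsLabeling D q qa) (g : G) : HeckeAlg D q →ₗ[ℂ] AddMonoidAlgebra ℂ L :=
  (rightBasis hqa).constr ℂ fun p => if p.1 = g then AddMonoidAlgebra.single p.2 1 else 0

open Classical in
theorem coefA_basis (hqa : IsLabeling D q qa) (g g' : G) (x : L) :
    coefA hqa g (basisN D q (lin L g') * theta D q x) =
      if g' = g then AddMonoidAlgebra.single x 1 else 0 := by
  rw [← rightBasis_apply hqa (g', x), coefA, Module.Basis.constr_basis]

theorem hecke_induction (hqa : IsLabeling D q qa) {p : HeckeAlg D q → Prop} (h : HeckeAlg D q)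
    (h0 : p 0) (hadd : ∀ a b, p a → p b → p (a + b)) (hsmul : ∀ (c : ℂ) a, p a → p (c • a))
    (hb : ∀ g x, p (basisN D q (lin L g) * theta D q x)) : p h := by
  have : h ∈ (⊤ : Submodule ℂ (HeckeAlg D q)) := trivial
  rw [← basisN_theta_span hqa] at this
  induction this using Submodule.span_induction with
  | mem h hh => obtain ⟨p, rfl⟩ := hh; exact hb _ _
  | zero => exact h0
  | add a b _ _ ha hb => exact hadd a b ha hb
  | smul c a _ ha => exact hsmul c a ha

theorem coefA_mul_theta (hqa : IsLabeling D q qa) (g : G) (h : HeckeAlg D q) (x : L) :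
    coefA hqa g (h * theta D q x) = coefA hqa g h * AddMonoidAlgebra.single x 1 := by
  classical
  induction h using hecke_induction hqa with
  | h0 => simp only [zero_mul, map_zero]
  | hadd a b ha hb => simp only [add_mul, map_add, ha, hb]
  | hsmul c a ha => simp only [smul_mul_assoc, map_smul, ha]
  | hb g' y =>
    rw [mul_assoc, ← theta_add hqa, coefA_basis, coefA_basis]
    split_ifs
    · rw [AddMonoidAlgebra.single_mul_single, mul_one]
    · rw [zero_mul]

theorem coefA_eq_zero_of_mem (hqa : IsLabeling D q qa) {n : ℕ} {h : HeckeAlg D q}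
    (hh : h ∈ lowerSpan D q n) {g : G} (hg : n ≤ len D (lin L g)) : coefA hqa g h = 0 := by
  classical
  induction hh using Submodule.span_induction with
  | mem h hh =>
    obtain ⟨g', x, hg', rfl⟩ := hh
    rw [coefA_basis, if_neg]
    rintro rfl
    omega
  | zero => rw [map_zero]
  | add a b _ _ ha hb => rw [map_add, ha, hb, add_zero]
  | smul c a _ ha => rw [map_smul, ha, smul_zero]

theorem coefA_coeff (hqa : IsLabeling D q qa) (g : G) (h : HeckeAlg D q) (x : L) :
    (coefA hqa g h).coeff x = (rightBasis hqa).repr h (g, x) := by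
  classical
  induction h using hecke_induction hqa with
  | h0 => simp
  | hadd a b ha hb => simp [ha, hb]
  | hsmul c a ha => simp [ha]
  | hb g' y =>
    rw [coefA_basis, ← rightBasis_apply hqa (g', y), Module.Basis.repr_self, Finsupp.single_apply]
    by_cases h : g' = g
    · simp [h, AddMonoidAlgebra.coeff_single, Finsupp.single_apply]
    · simp [h]

theorem mem_lowerSpan_of_coefA (hqa : IsLabeling D q qa) {n : ℕ} {h : HeckeAlg D q}
    (hh : ∀ g : G, n ≤ len D (lin L g) → coefA hqa g h = 0) : h ∈ lowerSpan D q n := by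
  rw [← (rightBasis hqa).linearCombination_repr h, Finsupp.linearCombination_apply]
  refine sum_mem fun p hp => Submodule.smul_mem _ _ ?_
  rw [rightBasis_apply]
  refine mem_lowerSpan ?_ _
  by_contra hlt
  rw [Finsupp.mem_support_iff] at hp
  refine hp ?_
  rw [show p = (p.1, p.2) from rfl, ← coefA_coeff, hh p.1 (not_lt.1 hlt)]
  rfl

theorem eq_zero_of_coefA (hqa : IsLabeling D q qa) {h : HeckeAlg D q}
    (hh : ∀ g : G, coefA hqa g h = 0) : h = 0 := by
  have := mem_lowerSpan_of_coefA hqa (n := 0) fun g _ => hh g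
  have h0 : lowerSpan D q 0 = ⊥ := by
    rw [lowerSpan, Submodule.span_eq_bot]
    rintro _ ⟨g, x, hg, -⟩
    omega
  rwa [h0, Submodule.mem_bot] at this

/-- Leading coefficients of products `θ(a) h`. -/
theorem coefA_thetaHom_mul (hqa : IsLabeling D q qa) {n : ℕ} {h : HeckeAlg D q}
    (hh : h ∈ lowerSpan D q (n + 1)) {g : G} (hg : len D (lin L g) = n)
    (a : AddMonoidAlgebra ℂ L) :
    coefA hqa g (thetaHom hqa a * h) = actA g⁻¹ a * coefA hqa g h := by
  classical
  induction a using algebra_induction with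
  | h0 => simp only [zero_mul, map_zero]
  | hadd a b ha hb => simp only [add_mul, map_add, ha, hb]
  | hsmul c a ha => simp only [smul_mul_assoc, map_smul, ha]
  | hs x =>
    rw [thetaHom_single, one_smul, actA_single]
    induction hh using Submodule.span_induction with
    | mem h hh =>
      obtain ⟨g', y, hg', rfl⟩ := hh
      have h1 := lowerSpan_mul_theta hqa (theta_mul_basisN_sub_mem hqa g' x) y
      have h2 := coefA_eq_zero_of_mem hqa h1 (g := g) (by omega)
      rw [sub_mul, map_sub, sub_eq_zero, mul_assoc, mul_assoc, ← theta_add hqa] at h2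
      rw [h2, coefA_basis, coefA_basis]
      split_ifs with h
      · rw [AddMonoidAlgebra.single_mul_single, mul_one, h]
      · rw [mul_zero]
    | zero => simp only [mul_zero, map_zero]
    | add a b _ _ ha hb => simp only [mul_add, map_add, ha, hb]
    | smul c a _ ha => simp only [mul_smul_comm, map_smul, ha]

/-! #### The Bernstein bases attached to parabolic subgroups -/

/-- A parabolic subgroup `K` of the finite group `G` with a set `M` of representatives of shortest
length for the cosets of `K`. -/
structure IsParabolic (D : Datum J L) [RootedDatum D G] (M : Set G) (K : Subgroup G) : Prop where
  exists_mul : ∀ g, ∃ u ∈ M, ∃ w ∈ K, g = u * w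
  injective : ∀ {u u' w w'}, u ∈ M → u' ∈ M → w ∈ K → w' ∈ K → u * w = u' * w' → u = u' ∧ w = w'
  len_mul : ∀ {u w}, u ∈ M → w ∈ K →
    len D (lin L (u * w)) = len D (lin L u) + len D (lin L w)
  descent : ∀ {w}, w ∈ K → len D (lin L w) ≠ 0 →
    ∃ j, refl D j ∈ K ∧ IsSimpleAff D G (j, 0) ∧ ¬ D.pos (perm D w j)

variable {M : Set G} {K : Subgroup G}

theorem IsParabolic.induction (hK : IsParabolic D M K) {p : G → Prop} (one : p 1)
    (step : ∀ w j, w ∈ K → refl D j ∈ K → IsSimpleAff D G (j, 0) → D.pos (perm D w j) → p w →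
      p (w * refl D j)) {w : G} (hw : w ∈ K) : p w := by
  induction hn : len D (lin L w) generalizing w with
  | zero => rw [eq_one_of_len_eq_zero hn]; exact one
  | succ n ih =>
    obtain ⟨j, hjK, hj, hneg⟩ := hK.descent hw (by omega)
    have hpos : D.pos (perm D (w * refl D j) j) := by
      rw [map_mul, Equiv.Perm.mul_apply]
      have h1 := (pos_neg_iff (D := D) G (perm D w j)).2 hneg
      rw [refl_perm, ← Equiv.Perm.mul_apply, ← map_mul, inv_mul_cancel_right, map_mul] at h1
      exact h1
    have hlen := len_mul_refl_of_pos hj hpos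
    rw [mul_assoc, refl_mul_self, mul_one] at hlen
    have := step (w * refl D j) j (mul_mem hw hjK) hjK hj hpos
      (ih (mul_mem hw hjK) (by omega))
    rwa [mul_assoc, refl_mul_self, mul_one] at this

theorem basisN_mul_thetaHom_mem (hqa : IsLabeling D q qa) (hK : IsParabolic D M K) {w : G}
    (hw : w ∈ K) (x : L) : basisN D q (lin L w) * theta D q x ∈
      Submodule.span ℂ (Set.range fun p : L × K =>
        theta D q p.1 * basisN D q (lin L p.2.1)) := by
  set S := Submodule.span ℂ (Set.range fun p : L × K =>
    theta D q p.1 * basisN D q (lin L p.2.1)) with hS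
  have hmul : ∀ h ∈ S, ∀ j, refl D j ∈ K → IsSimpleAff D G (j, 0) →
      h * basisN D q (lin L (refl D j)) ∈ S := by
    intro h hh j hjK hj
    induction hh using Submodule.span_induction with
    | mem h hh =>
      obtain ⟨⟨y, w'⟩, rfl⟩ := hh
      simp only
      have hm : theta D q y * basisN D q (lin L (w'.1 * refl D j)) ∈ S :=
        Submodule.subset_span ⟨(y, ⟨_, mul_mem w'.2 hjK⟩), rfl⟩
      by_cases hpos : AffPos D (affAct D (lin L w'.1) (j, 0))
      · rw [mul_assoc, ← affRefl_finite, hj.basisN_mul_of_pos hpos, affRefl_finite, ← lin_mul]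
        exact hm
      · rw [mul_assoc, ← affRefl_finite, hj.basisN_mul_of_neg hqa hpos, affRefl_finite,
          ← lin_mul, mul_add, mul_smul_comm]
        exact add_mem hm (Submodule.smul_mem _ _ (Submodule.subset_span ⟨(y, w'), rfl⟩))
    | zero => rw [zero_mul]; exact zero_mem _
    | add a b _ _ ha hb => rw [add_mul]; exact add_mem ha hb
    | smul c a _ ha => rw [smul_mul_assoc]; exact Submodule.smul_mem _ _ ha
  refine hK.induction (p := fun w => ∀ x, basisN D q (lin L w) * theta D q x ∈ S) ?_ ?_ hw x
  · intro x
    rw [lin_one, basisN_one, one_mul]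
    have : theta D q x * basisN D q (lin L (1 : G)) ∈ S :=
      Submodule.subset_span ⟨(x, 1), rfl⟩
    rwa [lin_one, basisN_one, mul_one] at this
  · intro w j hw hjK hj hpos ih x
    have ihA : ∀ a, basisN D q (lin L w) * thetaHom hqa a ∈ S := by
      intro a
      induction a using algebra_induction with
      | h0 => rw [map_zero, mul_zero]; exact zero_mem _
      | hadd a b ha hb => rw [map_add, mul_add]; exact add_mem ha hb
      | hsmul c a ha => rw [map_smul, mul_smul_comm]; exact Submodule.smul_mem _ _ ha
      | hs x => rw [thetaHom_single, one_smul]; exact ih x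
    rw [← basisN_mul_refl_of_pos hj hpos, mul_assoc, basisN_mul_theta hqa hj, mul_sub, ← mul_assoc]
    exact sub_mem (hmul _ (ih _) j hjK hj) (ihA _)

theorem bernstein_span (hqa : IsLabeling D q qa) (hK : IsParabolic D M K) :
    Submodule.span ℂ (Set.range fun p : M × L × K => basisN D q (lin L p.1.1) * theta D q p.2.1 *
      basisN D q (lin L p.2.2.1)) = ⊤ := by
  refine eq_top_iff.2 ?_
  rw [← basisN_theta_span hqa, Submodule.span_le]
  rintro _ ⟨⟨g, x⟩, rfl⟩
  obtain ⟨u, hu, w, hw, rfl⟩ := hK.exists_mul g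
  have h1 := basisN_mul_thetaHom_mem hqa hK hw x
  simp only
  rw [lin_mul, ← AffineHecke.basisN_mul (by rw [← lin_mul]; exact hK.len_mul hu hw), mul_assoc]
  generalize basisN D q (lin L w) * theta D q x = h at h1
  induction h1 using Submodule.span_induction with
  | mem h hh =>
    obtain ⟨⟨y, w'⟩, rfl⟩ := hh
    refine Submodule.subset_span ⟨(⟨u, hu⟩, y, w'), ?_⟩
    simp only [mul_assoc]
  | zero => rw [mul_zero]; exact zero_mem _
  | add a b _ _ ha hb => rw [mul_add]; exact add_mem ha hb
  | smul c a _ ha => rw [mul_smul_comm]; exact Submodule.smul_mem _ _ ha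

theorem bernstein_linearIndependent (hqa : IsLabeling D q qa) (hK : IsParabolic D M K) :
    LinearIndependent ℂ fun p : M × L × K => basisN D q (lin L p.1.1) * theta D q p.2.1 *
      basisN D q (lin L p.2.2.1) := by
  classical
  rw [linearIndependent_iff]
  intro f hf
  by_contra hne
  obtain ⟨p₀, hp₀, hmax⟩ := Finset.exists_max_image f.support
    (fun p => len D (lin L (p.1.1 * p.2.2.1))) (Finsupp.support_nonempty_iff.2 hne)
  have hlead : ∀ p ∈ f.support, coefA hqa (p₀.1.1 * p₀.2.2.1) (basisN D q (lin L p.1.1) *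
      theta D q p.2.1 * basisN D q (lin L p.2.2.1)) =
      if p.1.1 * p.2.2.1 = p₀.1.1 * p₀.2.2.1 then
        AddMonoidAlgebra.single (p.2.2.1⁻¹ • p.2.1) 1 else 0 := by
    intro p hp
    have h1 := basisN_mul_lowerSpan hqa p.1.1 (theta_mul_basisN_sub_mem hqa p.2.2.1 p.2.1)
    have h2 := hmax p hp
    rw [hK.len_mul p.1.2 p.2.2.2] at h2
    have h3 := coefA_eq_zero_of_mem hqa h1 (g := p₀.1.1 * p₀.2.2.1) h2
    rw [mul_sub, map_sub, sub_eq_zero, ← mul_assoc, ← mul_assoc, AffineHecke.basisN_mul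
      (by rw [← lin_mul]; exact hK.len_mul p.1.2 p.2.2.2), ← lin_mul, coefA_basis] at h3
    exact h3
  have h1 := congrArg (fun h => (coefA hqa (p₀.1.1 * p₀.2.2.1) h).coeff (p₀.2.2.1⁻¹ • p₀.2.1)) hf
  simp only [Finsupp.linearCombination_apply, Finsupp.sum, map_sum, map_zero, map_smul,
    AddMonoidAlgebra.coeff_zero, Finsupp.coe_zero, Pi.zero_apply] at h1
  rw [AddMonoidAlgebra.coeff_sum, Finsupp.finsetSum_apply, Finset.sum_eq_single_of_mem p₀ hp₀]
    at h1
  · rw [hlead p₀ hp₀, if_pos rfl, AddMonoidAlgebra.coeff_smul, AddMonoidAlgebra.coeff_single,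
      Finsupp.smul_apply, Finsupp.single_eq_same, smul_eq_mul, mul_one] at h1
    exact Finsupp.mem_support_iff.1 hp₀ h1
  · intro p hp hpp
    rw [hlead p hp, AddMonoidAlgebra.coeff_smul, Finsupp.smul_apply]
    split_ifs with h
    · rw [AddMonoidAlgebra.coeff_single, Finsupp.single_apply, if_neg, smul_zero]
      intro h3
      obtain ⟨h4, h5⟩ := hK.injective p.1.2 p₀.1.2 p.2.2.2 p₀.2.2.2 h
      rw [h5] at h3
      refine hpp (Prod.ext (Subtype.ext h4) (Prod.ext (smul_left_cancel _ h3) (Subtype.ext h5)))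
    · simp

end Bases


open RootedDatum

section Generic

variable {J L G : Type*} [AddCommGroup L] [Group G] [DistribMulAction G L]
variable {D : Datum J L} [RootedDatum D G] {q : AffW G L → ℝ} {qa : J × ℤ → ℝ}

theorem basisN_mul_refl_of_not_pos (hqa : IsLabeling D q qa) {g : G} {j : J}
    (hj : IsSimpleAff D G (j, 0)) (h : ¬ D.pos (perm D g j)) :
    basisN D q (lin L g) * basisN D q (lin L (refl D j)) =
      basisN D q (lin L (g * refl D j)) + qdiff qa (j, 0) • basisN D q (lin L g) := by
  have := hj.basisN_mul_of_neg hqa (w := lin L g) (by rwa [affAct_lin, affPos_zero])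
  rwa [affRefl_finite, ← lin_mul] at this

theorem thetaHom_of (hqa : IsLabeling D q qa) (x : L) :
    thetaHom hqa (AddMonoidAlgebra.single x 1) = theta D q x := by
  rw [thetaHom_single, one_smul]

end Generic

section RootData

variable {ι X Y : Type*} [AddCommGroup X] [AddCommGroup Y] {R : RootDatum ι X Y} {b : R.Base}
variable [Finite ι] [R.IsReduced] {q : WX R → ℝ}

theorem minReps_isParabolic (P : Par b) : IsParabolic (datum R b) (minReps P) (parW P) where
  exists_mul := exists_minReps_mul P
  injective := minReps_mul_injective P
  len_mul := len_minReps_mul P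
  descent hw h := by
    obtain ⟨j, hj, hwj⟩ := exists_simple_descent_parW P hw h
    exact ⟨j.1, ofIdx_mem_parW P j.2, hj, hwj⟩

/-- The basis `N_u θ_x N_w` of the affine Hecke algebra. -/
def bernsteinBasis (P : Par b) (hq : IsLabelFunction (datum R b) q) :
    Module.Basis (minReps P × X × parW P) ℂ (Hk R b q) :=
  Module.Basis.mk (bernstein_linearIndependent hq.isLabeling (minReps_isParabolic P))
    (bernstein_span hq.isLabeling (minReps_isParabolic P)).ge

theorem bernsteinBasis_apply (P : Par b) (hq : IsLabelFunction (datum R b) q)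
    (p : minReps P × X × parW P) :
    bernsteinBasis P hq p = bernsteinElt b q p.1 p.2.1 p.2.2 :=
  Module.Basis.mk_apply _ _ _

theorem bernsteinCoeff_eq (P : Par b) (hq : IsLabelFunction (datum R b) q) (h : Hk R b q) :
    bernsteinCoeff P q h = (bernsteinBasis P hq).repr h := by
  have h0 : (fun p : minReps P × X × parW P => bernsteinElt b q p.1 p.2.1 p.2.2.1) =
      bernsteinBasis P hq := funext fun p => (bernsteinBasis_apply P hq p).symm
  have h1 := (bernsteinBasis P hq).linearCombination_repr h
  rw [bernsteinCoeff, h0]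
  conv_lhs => rw [← h1]
  exact Function.leftInverse_invFun (bernsteinBasis P hq).linearIndependent _

variable {P : Par b}

omit [Finite ι] [R.IsReduced] in
theorem satLat_smul_root {i : ι} (hi : R.root i ∈ rootLat P) (k : ℤ) :
    k • R.root i ∈ satLat P := by
  refine ⟨1, one_ne_zero, ?_⟩
  rw [one_smul]
  exact (rootLat P).smul_mem _ hi

omit [Finite ι] [R.IsReduced] in
theorem torus_smul {t : AddChar X ℂ} (ht : t ∈ torus P) {i : ι} (hi : R.root i ∈ rootLat P)
    (k : ℤ) : t (k • R.root i) = 1 := ht _ (satLat_smul_root hi k)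

omit [Finite ι] [R.IsReduced] in
theorem torus_sub_smul {t : AddChar X ℂ} (ht : t ∈ torus P) {i : ι} (hi : R.root i ∈ rootLat P)
    (x : X) (k : ℤ) : t (x - k • R.root i) = t x := by
  rw [sub_eq_add_neg, ← neg_smul, AddChar.map_add_eq_mul, torus_smul ht hi, mul_one]

section Twisted

variable (hq : IsLabelFunction (datum R b) q) (δ : DS P q) (t : AddChar X ℂ)

/-- The representation `δ_t` of the commutative subalgebra `ℂ[X]`. -/
def twistedHom : AddMonoidAlgebra ℂ X →ₐ[ℂ] Module.End ℂ δ.V :=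
  AddMonoidAlgebra.lift ℂ (Module.End ℂ δ.V) X
    { toFun := fun x => t x.toAdd • δ.rep (theta (G := parW P) (parDatum P) (parLabel P q)
        (Submodule.Quotient.mk x.toAdd))
      map_one' := by
        rw [toAdd_one, AddChar.map_zero_eq_one, one_smul, Submodule.Quotient.mk_zero,
          theta_zero (parLabel_isLabeling P hq), map_one]
      map_mul' := fun x y => by
        rw [toAdd_mul, AddChar.map_add_eq_mul, Submodule.Quotient.mk_add,
          theta_add (parLabel_isLabeling P hq), map_mul, smul_mul_smul_comm] }

theorem twistedHom_single (x : X) (c : ℂ) : twistedHom hq δ t (AddMonoidAlgebra.single x c) =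
    c • t x • δ.rep (theta (G := parW P) (parDatum P) (parLabel P q)
      (Submodule.Quotient.mk x)) := by
  rw [twistedHom, AddMonoidAlgebra.lift_single]
  rfl

theorem twistedHom_of (x : X) : twistedHom hq δ t (AddMonoidAlgebra.single x 1) =
    t x • δ.rep (theta (G := parW P) (parDatum P) (parLabel P q)
      (Submodule.Quotient.mk x)) := by
  rw [twistedHom_single]
  exact one_smul ℂ _

theorem twistedA_eq (f : AddMonoidAlgebra ℂ X) : twistedA δ t f = twistedHom hq δ t f := by
  rw [twistedHom, AddMonoidAlgebra.lift_apply', twistedA]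
  refine Finsupp.sum_congr fun x _ => ?_
  rw [twisted, lin_one, basisN_one, mul_one, ← Algebra.smul_def]
  rfl

attribute [irreducible] twistedHom

theorem twisted_one (x : X) :
    twisted δ t x 1 = twistedHom hq δ t (AddMonoidAlgebra.single x 1) := by
  rw [twistedHom_of, twisted, lin_one, basisN_one, mul_one]

theorem twisted_eq (x : X) (w : parW P) : twisted δ t x w =
    twistedHom hq δ t (AddMonoidAlgebra.single x 1) *
      δ.rep (basisN (parDatum P) (parLabel P q) (lin (XP P) w)) := by
  rw [twisted, twistedHom_of, map_mul, smul_mul_assoc]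

theorem twisted_apply (x : X) (w : parW P) (v : δ.V) : twisted δ t x w v =
    twistedHom hq δ t (AddMonoidAlgebra.single x 1)
      (δ.rep (basisN (parDatum P) (parLabel P q) (lin (XP P) w)) v) :=
  LinearMap.congr_fun (twisted_eq hq δ t x w) v

variable {t}

theorem twistedHom_bernPoly (ht : t ∈ torus P) (j : {i // R.root i ∈ rootLat P}) (x : X) :
    twistedHom hq δ t (bernPoly (datum R b) (affLabel (datum R b) q) j.1 x) =
      t x • δ.rep (thetaHom (parLabel_isLabeling P hq) (bernPoly (parDatum P)
        (fun a => affLabel (datum R b) q (a.1.1, a.2)) j (Submodule.Quotient.mk x))) := by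
  have hco : (parDatum P).coroot j (Submodule.Quotient.mk x) = R.coroot' j.1 x := rfl
  have hco' : (datum R b).coroot j.1 x = R.coroot' j.1 x := rfl
  have hr : (parDatum P).root j = Submodule.Quotient.mk (R.root j.1) := rfl
  have hr' : (datum R b).root j.1 = R.root j.1 := rfl
  rw [bernPoly, bernPoly, hco, hco', hr, hr']
  simp only [map_sub, map_sum, twistedHom_single, thetaHom_single, map_smul,
    Submodule.Quotient.mk_sub, Submodule.Quotient.mk_smul, torus_sub_smul ht j.2,
    smul_sub, Finset.smul_sum, smul_comm _ (t x)]
  rfl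

theorem twistedHom_mul_refl (ht : t ∈ torus P) {j : {i // R.root i ∈ rootLat P}}
    (hj : IsSimpleAff (parDatum P) (parW P) (j, 0)) (x : X) :
    twistedHom hq δ t (AddMonoidAlgebra.single x 1) *
        δ.rep (basisN (parDatum P) (parLabel P q) (lin (XP P) (refl (parDatum P) j))) =
      δ.rep (basisN (parDatum P) (parLabel P q) (lin (XP P) (refl (parDatum P) j))) *
        twistedHom hq δ t (AddMonoidAlgebra.single ((refl (datum R b) j.1 : R.weylGroup) • x) 1) +
      twistedHom hq δ t (bernPoly (datum R b) (affLabel (datum R b) q) j.1 x) := by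
  have h := congrArg δ.rep (bernstein_relation (parLabel_isLabeling P hq) hj
    (Submodule.Quotient.mk x))
  have hs : (refl (datum R b) j.1 : R.weylGroup) • x = x - R.coroot' j.1 x • R.root j.1 :=
    RootedDatum.refl_smul (D := datum R b) j.1 x
  have hs' : (refl (parDatum P) j : parW P) • (Submodule.Quotient.mk x : XP P) =
      Submodule.Quotient.mk (x - R.coroot' j.1 x • R.root j.1) := by
    rw [← hs]; rfl
  rw [hs', map_mul, map_add, map_mul] at h
  rw [twistedHom_bernPoly hq δ ht, twistedHom_of, twistedHom_of, hs,
    torus_sub_smul ht j.2, smul_mul_assoc, mul_smul_comm, ← smul_add]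
  exact congrArg (fun A => t x • A) h

theorem twistedHom_refl_apply (ht : t ∈ torus P) {j : {i // R.root i ∈ rootLat P}}
    (hj : IsSimpleAff (parDatum P) (parW P) (j, 0)) (y : X) (v : δ.V) :
    twistedHom hq δ t (AddMonoidAlgebra.single ((refl (datum R b) j.1 : R.weylGroup) • y) 1)
        (δ.rep (basisN (parDatum P) (parLabel P q) (lin (XP P) (refl (parDatum P) j))) v) =
      δ.rep (basisN (parDatum P) (parLabel P q) (lin (XP P) (refl (parDatum P) j)))
        (twistedHom hq δ t (AddMonoidAlgebra.single y 1) v) +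
      twistedHom hq δ t (bernPoly (datum R b) (affLabel (datum R b) q) j.1
        ((refl (datum R b) j.1 : R.weylGroup) • y)) v := by
  have h := twistedHom_mul_refl hq δ ht hj ((refl (datum R b) j.1 : R.weylGroup) • y)
  rw [← mul_smul, refl_mul_self (D := datum R b) (G := R.weylGroup) j.1, one_smul] at h
  exact LinearMap.congr_fun h v

end Twisted

/-! #### The induced representation -/

section Induced

variable (hq : IsLabelFunction (datum R b) q) (δ : DS P q) (t : AddChar X ℂ)

/-- The map `(h, v) ↦ h ⊗ v` onto the induced module. -/
def indMap : Hk R b q →ₗ[ℂ] δ.V →ₗ[ℂ] indSpace δ :=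
  (bernsteinBasis P hq).constr ℂ fun p => incl δ p.1 ∘ₗ twisted δ t p.2.1 p.2.2

theorem indMap_apply (h : Hk R b q) : indMap hq δ t h =
    (bernsteinCoeff P q h).sum fun p c => c • (incl δ p.1 ∘ₗ twisted δ t p.2.1 p.2.2) := by
  rw [indMap, Module.Basis.constr_apply, bernsteinCoeff_eq P hq]

theorem indMap_bernsteinElt {u : R.weylGroup} (hu : u ∈ minReps P) (x : X) {w : R.weylGroup}
    (hw : w ∈ parW P) (v : δ.V) :
    indMap hq δ t (bernsteinElt b q u x w) v = incl δ ⟨u, hu⟩ (twisted δ t x ⟨w, hw⟩ v) := by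
  have h := bernsteinBasis_apply P hq (⟨u, hu⟩, x, ⟨w, hw⟩)
  simp only at h
  rw [← h, indMap, Module.Basis.constr_basis]
  rfl

attribute [irreducible] indMap

theorem bernstein_induction {p : Hk R b q → Prop} (hq : IsLabelFunction (datum R b) q)
    (P : Par b) (h : Hk R b q) (h0 : p 0) (hadd : ∀ h h', p h → p h' → p (h + h'))
    (hsmul : ∀ (c : ℂ) h, p h → p (c • h))
    (hb : ∀ u ∈ minReps P, ∀ x, ∀ w ∈ parW P, p (bernsteinElt b q u x w)) : p h := by
  have := (bernsteinBasis P hq).mem_span h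
  induction this using Submodule.span_induction with
  | mem h hh =>
    obtain ⟨⟨u, x, w⟩, rfl⟩ := hh
    rw [bernsteinBasis_apply]
    exact hb _ u.2 _ _ w.2
  | zero => exact h0
  | add a b _ _ ha hb => exact hadd _ _ ha hb
  | smul c a _ ha => exact hsmul _ _ ha

omit [Finite ι] [R.IsReduced] in
open Classical in
theorem comp_incl (u u' : minReps P) (v : δ.V) :
    comp δ u' (incl δ u v) = if u' = u then v else 0 := by
  ext j
  by_cases h : u' = u <;> simp [comp, incl, h]

omit [R.IsReduced] in
theorem sum_incl_comp (f : indSpace δ) : ∑ u, incl δ u (comp δ u f) = f := by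
  classical
  ext ⟨u, j⟩
  simp [comp, incl]

theorem indRep_apply (h : Hk R b q) (f : indSpace δ) : indRep δ t h f =
    ∑ u : minReps P, indMap hq δ t (h * basisN (datum R b) q (lin X u.1)) (comp δ u f) := by
  change (∑ u' : minReps P, _ : indSpace δ →ₗ[ℂ] indSpace δ) f = _
  rw [LinearMap.sum_apply]
  refine Finset.sum_congr rfl fun u _ => ?_
  rw [indMap_apply, Finsupp.sum, Finsupp.sum, LinearMap.sum_apply, LinearMap.sum_apply]
  rfl

theorem indRep_incl (h : Hk R b q) (u : minReps P) (v : δ.V) : indRep δ t h (incl δ u v) =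
    indMap hq δ t (h * basisN (datum R b) q (lin X u.1)) v := by
  classical
  rw [indRep_apply hq, Finset.sum_eq_single u]
  · rw [comp_incl, if_pos rfl]
  · intro u' _ hu'
    rw [comp_incl, if_neg hu', map_zero]
  · exact fun h => absurd (Finset.mem_univ _) h

variable {t}

theorem coe_refl_parDatum (j : {i // R.root i ∈ rootLat P}) :
    ((refl (parDatum P) j : parW P) : R.weylGroup) = refl (datum R b) j.1 := rfl

theorem indMap_mul_refl {j : {i // R.root i ∈ rootLat P}}
    (hj : IsSimpleAff (datum R b) R.weylGroup (j.1, 0)) (h : Hk R b q) (v : δ.V) :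
    indMap hq δ t (h * basisN (datum R b) q (lin X (refl (datum R b) j.1))) v =
      indMap hq δ t h (δ.rep (basisN (parDatum P) (parLabel P q)
        (lin (XP P) (refl (parDatum P) j))) v) := by
  have hj' := (isSimpleAff_parDatum_iff P j).2 hj
  induction h using bernstein_induction hq P with
  | h0 => simp only [zero_mul, map_zero, LinearMap.zero_apply]
  | hadd a b ha hb => simp only [add_mul, map_add, LinearMap.add_apply, ha, hb]
  | hsmul c a ha => simp only [smul_mul_assoc, map_smul, LinearMap.smul_apply, ha]
  | hb u hu x w hw =>
    have hjP : refl (datum R b) j.1 ∈ parW P := (refl (parDatum P) j : parW P).2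
    rw [indMap_bernsteinElt hq δ t hu x hw, bernsteinElt, mul_assoc]
    by_cases hpos : (datum R b).pos (perm (datum R b) w j.1)
    · rw [basisN_mul_refl_of_pos hj hpos]
      change indMap hq δ t (bernsteinElt b q u x (w * refl (datum R b) j.1)) v = _
      rw [indMap_bernsteinElt hq δ t hu x (mul_mem hw hjP), twisted_apply hq, twisted_apply hq]
      have h2 := basisN_mul_refl_of_pos (q := parLabel P q) (D := parDatum P) (g := ⟨w, hw⟩) hj' hpos
      have h3 := congrArg (fun h => δ.rep h v) h2
      simp only [map_mul, Module.End.mul_apply] at h3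
      rw [h3]
      rfl
    · rw [basisN_mul_refl_of_not_pos hq.isLabeling hj hpos, mul_add, mul_smul_comm, map_add,
        map_smul]
      change indMap hq δ t (bernsteinElt b q u x (w * refl (datum R b) j.1)) v +
        qdiff (affLabel (datum R b) q) (j.1, 0) • indMap hq δ t (bernsteinElt b q u x w) v = _
      rw [indMap_bernsteinElt hq δ t hu x (mul_mem hw hjP), indMap_bernsteinElt hq δ t hu x hw,
        twisted_apply hq, twisted_apply hq, twisted_apply hq]
      have h2 := basisN_mul_refl_of_not_pos (parLabel_isLabeling P hq) (g := ⟨w, hw⟩) hj' hpos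
      have h3 := congrArg (fun h => δ.rep h v) h2
      simp only [map_mul, map_add, map_smul, Module.End.mul_apply, LinearMap.add_apply,
        LinearMap.smul_apply] at h3
      refine ((congrArg (fun v => incl δ ⟨u, hu⟩ (twistedHom hq δ t (AddMonoidAlgebra.single x 1) v))
        h3).trans ?_).symm
      simp only [map_add, map_smul]
      rfl

theorem indMap_mul_thetaHom (ht : t ∈ torus P) (h : Hk R b q) (a : AddMonoidAlgebra ℂ X)
    (v : δ.V) : indMap hq δ t (h * thetaHom hq.isLabeling a) v =
      indMap hq δ t h (twistedHom hq δ t a v) := by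
  induction h using bernstein_induction hq P with
  | h0 => simp only [zero_mul, map_zero, LinearMap.zero_apply]
  | hadd a b ha hb => simp only [add_mul, map_add, LinearMap.add_apply, ha, hb]
  | hsmul c a ha => simp only [smul_mul_assoc, map_smul, LinearMap.smul_apply, ha]
  | hb u hu x w hw =>
    have key : ∀ (a : AddMonoidAlgebra ℂ X) v,
        indMap hq δ t (bernsteinElt b q u x w * thetaHom hq.isLabeling a) v =
          indMap hq δ t (bernsteinElt b q u x w) (twistedHom hq δ t a v) := by
      clear a v
      refine (minReps_isParabolic P).induction
        (p := fun w => ∀ (a : AddMonoidAlgebra ℂ X) v,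
          indMap hq δ t (bernsteinElt b q u x w * thetaHom hq.isLabeling a) v =
          indMap hq δ t (bernsteinElt b q u x w) (twistedHom hq δ t a v)) ?_ ?_ hw
      · intro a v
        induction a using algebra_induction with
        | h0 => simp only [map_zero, mul_zero, LinearMap.zero_apply]
        | hadd a b ha hb => simp only [map_add, mul_add, LinearMap.add_apply, ha, hb]
        | hsmul c a ha => simp only [map_smul, mul_smul_comm, LinearMap.smul_apply, ha]
        | hs y =>
          have h1 : bernsteinElt b q u x 1 * thetaHom hq.isLabeling (AddMonoidAlgebra.single y 1) =
              bernsteinElt b q u (x + y) 1 := by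
            rw [bernsteinElt, bernsteinElt, lin_one, basisN_one, mul_one, mul_one,
              thetaHom_of, theta_add hq.isLabeling, mul_assoc]
          rw [h1, indMap_bernsteinElt hq δ t hu _ (one_mem _),
            indMap_bernsteinElt hq δ t hu _ (one_mem _)]
          have h2 : (⟨1, one_mem _⟩ : parW P) = 1 := rfl
          rw [h2, twisted_one hq, twisted_one hq, ← Module.End.mul_apply, ← map_mul,
            AddMonoidAlgebra.single_mul_single, one_mul]
      · intro w j hw hjK hj hpos ih a v
        obtain ⟨j, rfl⟩ : ∃ k : {i // R.root i ∈ rootLat P}, k.1 = j := by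
          refine ⟨⟨j, mem_rootLat_of_inversion P hjK hj.pos ?_⟩, rfl⟩
          exact fun h => (pos_neg_iff (D := datum R b) R.weylGroup j).1 h hj.pos
        have h1 : bernsteinElt b q u x (w * refl (datum R b) j.1) =
            bernsteinElt b q u x w * basisN (datum R b) q (lin X (refl (datum R b) j.1)) := by
          rw [bernsteinElt, bernsteinElt, mul_assoc _ (basisN (datum R b) q (lin X w)),
            basisN_mul_refl_of_pos hj hpos]
        have hj' := (isSimpleAff_parDatum_iff P j).2 hj
        induction a using algebra_induction with
        | h0 => simp only [map_zero, mul_zero, LinearMap.zero_apply]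
        | hadd a b ha hb => simp only [map_add, mul_add, LinearMap.add_apply, ha, hb]
        | hsmul c a ha => simp only [map_smul, mul_smul_comm, LinearMap.smul_apply, ha]
        | hs y =>
          have h3 := twistedHom_refl_apply hq δ ht hj' y v
          have h4 := ih (AddMonoidAlgebra.single ((refl (datum R b) j.1 : R.weylGroup) • y) 1)
            (δ.rep (basisN (parDatum P) (parLabel P q) (lin (XP P) (refl (parDatum P) j))) v)
          have h5 : bernsteinElt b q u x w * basisN (datum R b) q (lin X (refl (datum R b) j.1)) *
              theta (datum R b) q y = bernsteinElt b q u x w *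
                theta (datum R b) q ((refl (datum R b) j.1 : R.weylGroup) • y) *
                  basisN (datum R b) q (lin X (refl (datum R b) j.1)) -
              bernsteinElt b q u x w * thetaHom hq.isLabeling (bernPoly (datum R b)
                (affLabel (datum R b) q) j.1 ((refl (datum R b) j.1 : R.weylGroup) • y)) := by
            rw [mul_assoc, basisN_mul_theta hq.isLabeling hj, mul_sub, ← mul_assoc]
          have h6 := indMap_mul_refl hq δ (t := t) hj (bernsteinElt b q u x w *
                theta (datum R b) q ((refl (datum R b) j.1 : R.weylGroup) • y)) v
          have h7 := indMap_mul_refl hq δ (t := t) hj (bernsteinElt b q u x w)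
            (twistedHom hq δ t (AddMonoidAlgebra.single y 1) v)
          rw [thetaHom_of] at h4
          rw [thetaHom_of, h1, h5, map_sub, LinearMap.sub_apply]
          refine (congrArg₂ (fun a c => a - c) (h6.trans (h4.trans
            ((congrArg (indMap hq δ t _) h3).trans (map_add _ _ _)))) (ih _ v)).trans ?_
          exact (add_sub_cancel_right _ _).trans h7.symm
    exact key a v

theorem indMap_mul_basisN (h : Hk R b q) (w : parW P) (v : δ.V) :
    indMap hq δ t (h * basisN (datum R b) q (lin X w.1)) v =
      indMap hq δ t h (δ.rep (basisN (parDatum P) (parLabel P q) (lin (XP P) w)) v) := by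
  refine fin_induction_right (parDatum P) (p := fun w => ∀ v, indMap hq δ t
    (h * basisN (datum R b) q (lin X w.1)) v = indMap hq δ t h (δ.rep (basisN (parDatum P)
      (parLabel P q) (lin (XP P) w)) v)) ?_ ?_ w v
  · intro v
    rw [lin_one, basisN_one, map_one, OneMemClass.coe_one, lin_one, basisN_one, mul_one]
    rfl
  · intro w j hj hpos ih v
    have hj' := (isSimpleAff_parDatum_iff P j).1 hj
    have h1 := basisN_mul_refl_of_pos (q := q) (g := w.1) hj' hpos
    rw [← basisN_mul_refl_of_pos hj hpos, Subgroup.coe_mul, coe_refl_parDatum, ← h1, ← mul_assoc,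
      indMap_mul_refl hq δ hj', ih, map_mul]
    rfl

theorem indRep_indMap (ht : t ∈ torus P) (h g : Hk R b q) (v : δ.V) :
    indRep δ t h (indMap hq δ t g v) = indMap hq δ t (h * g) v := by
  induction g using bernstein_induction hq P with
  | h0 => simp only [mul_zero, map_zero, LinearMap.zero_apply]
  | hadd a b ha hb => simp only [mul_add, map_add, LinearMap.add_apply, ha, hb]
  | hsmul c a ha => simp only [mul_smul_comm, map_smul, LinearMap.smul_apply, ha]
  | hb u hu x w hw =>
    rw [indMap_bernsteinElt hq δ t hu x hw, indRep_incl hq, twisted_apply hq,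
      ← indMap_mul_thetaHom hq δ ht, ← indMap_mul_basisN hq δ, thetaHom_of,
      bernsteinElt, mul_assoc, mul_assoc, mul_assoc]

theorem incl_eq_indMap (u : minReps P) (v : δ.V) :
    incl δ u v = indMap hq δ t (basisN (datum R b) q (lin X u.1)) v := by
  have h := indMap_bernsteinElt hq δ t u.2 0 (one_mem (parW P)) v
  have h2 : (⟨1, one_mem _⟩ : parW P) = 1 := rfl
  rw [h2, twisted_one hq, bernsteinElt, theta_zero hq.isLabeling, mul_one, lin_one, basisN_one,
    mul_one, ← AddMonoidAlgebra.one_def, map_one] at h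
  exact h.symm

omit [R.IsReduced] in
theorem indSpace_induction {p : indSpace δ → Prop} (f : indSpace δ)
    (hadd : ∀ f g, p f → p g → p (f + g)) (h0 : p 0) (hi : ∀ u v, p (incl δ u v)) : p f := by
  rw [← sum_incl_comp δ f]
  exact Finset.sum_induction _ p hadd h0 fun u _ => hi u _

/-- The induced representation as a homomorphism of algebras. -/
def indHom (ht : t ∈ torus P) : Hk R b q →ₐ[ℂ] (indSpace δ →L[ℂ] indSpace δ) :=
  AlgHom.ofLinearMap
    { toFun := indRep δ t
      map_add' := fun g h => by
        ext1 f
        rw [_root_.add_apply, indRep_apply hq, indRep_apply hq, indRep_apply hq,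
          ← Finset.sum_add_distrib]
        simp only [add_mul, map_add, LinearMap.add_apply]
      map_smul' := fun c h => by
        ext1 f
        rw [RingHom.id_apply, _root_.smul_apply, indRep_apply hq, indRep_apply hq,
          Finset.smul_sum]
        simp only [smul_mul_assoc, map_smul, LinearMap.smul_apply] }
    (by
      ext1 f
      change indRep δ t 1 f = f
      rw [indRep_apply hq]
      simp only [one_mul, ← incl_eq_indMap]
      exact sum_incl_comp δ f)
    (fun g h => by
      ext1 f
      change indRep δ t (g * h) f = indRep δ t g (indRep δ t h f)
      rw [indRep_apply hq _ _ (g * h), indRep_apply hq _ _ h, map_sum]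
      refine Finset.sum_congr rfl fun u _ => ?_
      rw [indRep_indMap hq δ ht, mul_assoc])

theorem indHom_apply (ht : t ∈ torus P) (h : Hk R b q) : indHom hq δ ht h = indRep δ t h := rfl

end Induced

end RootData


open RootedDatum

section Generic

variable {J L G : Type*} [AddCommGroup L] [Group G] [DistribMulAction G L]
variable {D : Datum J L} [RootedDatum D G] {q : AffW G L → ℝ} {qa : J × ℤ → ℝ}

/-! #### Boundedness of discrete series representations -/

namespace DiscreteSeries

variable (δ : DiscreteSeries D q)

/-- The linear forms whose orbit under the operators `δ(N_w)` is bounded. -/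
def boundedForms : Submodule ℂ (Module.Dual ℂ δ.V) where
  carrier := {f | ∃ C : ℝ, ∀ w v, ‖f (δ.rep (basisN D q w) v)‖ ≤ C * ‖v‖}
  add_mem' := by
    rintro f g ⟨C, hC⟩ ⟨C', hC'⟩
    refine ⟨C + C', fun w v => ?_⟩
    rw [LinearMap.add_apply, add_mul]
    exact (norm_add_le _ _).trans (add_le_add (hC w v) (hC' w v))
  zero_mem' := ⟨0, fun w v => by simp⟩
  smul_mem' := by
    rintro c f ⟨C, hC⟩
    refine ⟨‖c‖ * C, fun w v => ?_⟩
    rw [LinearMap.smul_apply, norm_smul, mul_assoc]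
    exact mul_le_mul_of_nonneg_left (hC w v) (norm_nonneg c)

/-- The value at `w` as a linear form. -/
def evalForm (Φ : δ.V →ₗ[ℂ] lp (fun _ : AffW G L => ℂ) 2) (w : AffW G L) : Module.Dual ℂ δ.V where
  toFun v := Φ v w
  map_add' v v' := by rw [map_add]; rfl
  map_smul' c v := by rw [map_smul]; rfl

theorem exists_bound (hqa : IsLabeling D q qa) :
    ∃ C : ℝ, 0 ≤ C ∧ ∀ w v, ‖δ.rep (basisN D q w) v‖ ≤ C * ‖v‖ := by
  obtain ⟨Φ, hinj, hs, hu⟩ := δ.regular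
  have hS : ∀ a, IsSimpleAff D G a → ∀ w v, AffPos D (affAct D w⁻¹ a) →
      Φ (δ.rep (basisN D q (affRefl D G a)) v) w = Φ v (affRefl D G a * w) := by
    intro a ha w v hw
    rw [hs _ ha.mem_simpleRefl, if_neg, add_zero, affRefl_inv]
    rw [ha.refl_mul_len_of_pos hw]
    omega
  have h1 : ∀ w v, Φ (δ.rep (basisN D q w) v) 1 = Φ v w⁻¹ := by
    refine len_induction_right D (p := fun w => ∀ v, Φ (δ.rep (basisN D q w) v) 1 = Φ v w⁻¹) ?_ ?_
    · intro u h v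
      rw [hu u h, mul_one]
    · intro w a ha hw ih v
      rw [← ha.basisN_mul_of_pos hw, map_mul, Module.End.mul_apply, ih, hS a ha _ _ (by rwa [inv_inv]),
        mul_inv_rev, affRefl_inv]
  have hb1 : δ.evalForm Φ 1 ∈ δ.boundedForms := by
    refine ⟨‖LinearMap.toContinuousLinearMap Φ‖, fun w v => ?_⟩
    change ‖Φ (δ.rep (basisN D q w) v) 1‖ ≤ _
    rw [h1]
    exact (lp.norm_apply_le_norm two_ne_zero _ _).trans
      ((LinearMap.toContinuousLinearMap Φ).le_opNorm v)
  have hb : ∀ w, δ.evalForm Φ w ∈ δ.boundedForms := by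
    refine len_induction_left D (p := fun w => δ.evalForm Φ w ∈ δ.boundedForms) ?_ ?_
    · intro u h
      obtain ⟨C, hC⟩ := hb1
      refine ⟨C, fun w v => ?_⟩
      have h2 := hC (u⁻¹ * w) v
      have hu' : len D u⁻¹ = 0 := by rw [len_inv, h]
      rw [← AffineHecke.basisN_mul (by rw [len_zero_mul hu', hu', zero_add]), map_mul,
        Module.End.mul_apply] at h2
      change ‖Φ _ 1‖ ≤ _ at h2
      rw [hu _ hu', inv_inv, mul_one] at h2
      exact h2
    · rintro w₀ a ha hw₀ ⟨C, hC⟩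
      refine ⟨C + ‖qdiff qa a‖ * C, fun w v => ?_⟩
      have h2 := hS a ha w₀ (δ.rep (basisN D q w) v) hw₀
      change ‖Φ _ _‖ ≤ _
      rw [← h2, ← Module.End.mul_apply, ← map_mul]
      have h3 := hC (affRefl D G a * w) v
      have h4 := mul_le_mul_of_nonneg_left (hC w v) (norm_nonneg (qdiff qa a))
      change ‖Φ _ _‖ ≤ _ at h3
      change _ * ‖Φ _ _‖ ≤ _ at h4
      by_cases hw : AffPos D (affAct D w⁻¹ a)
      · rw [ha.basisN_mul_left_of_pos hw]
        have := (mul_nonneg (norm_nonneg _) (norm_nonneg _)).trans h4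
        linarith
      · rw [ha.basisN_mul_left_of_neg hqa hw, map_add, map_smul, LinearMap.add_apply, map_add,
          LinearMap.smul_apply, map_smul]
        refine (norm_add_le _ _).trans ?_
        rw [add_mul]
        refine add_le_add h3 ?_
        rw [mul_assoc]
        exact (norm_smul_le _ _).trans h4
  have htop : δ.boundedForms = ⊤ := by
    by_contra hne
    obtain ⟨f, hf, hle⟩ := Submodule.exists_le_ker_of_lt_top _ (lt_top_iff_ne_top.2 hne)
    obtain ⟨v, rfl⟩ := (Module.evalEquiv ℂ δ.V).surjective f
    refine hf ?_
    have : v = 0 := by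
      refine hinj ?_
      rw [map_zero]
      ext w
      exact hle (hb w)
    rw [this, map_zero]
  have hcoord : ∀ j : Fin δ.dim, ∃ C : ℝ, ∀ w v, ‖δ.rep (basisN D q w) v j‖ ≤ C * ‖v‖ := by
    intro j
    have : (EuclideanSpace.proj j : δ.V →L[ℂ] ℂ).toLinearMap ∈ δ.boundedForms := by
      rw [htop]; trivial
    exact this
  choose C hC using hcoord
  refine ⟨∑ j, |C j|, Finset.sum_nonneg fun j _ => abs_nonneg _, fun w v => ?_⟩
  rw [Finset.sum_mul]
  refine le_trans ?_ (Finset.sum_le_sum fun j _ => (hC j w v).trans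
    (mul_le_mul_of_nonneg_right (le_abs_self _) (norm_nonneg v)))
  rw [EuclideanSpace.norm_eq]
  refine Real.sqrt_le_iff.2 ⟨Finset.sum_nonneg fun j _ => norm_nonneg _, ?_⟩
  exact Finset.sum_sq_le_sq_sum_of_nonneg fun j _ => norm_nonneg _

end DiscreteSeries

end Generic

/-! #### Products of block triangular operators -/

theorem norm_prod_triangular_le {κ E : Type*} [NormedAddCommGroup E] [NormedSpace ℂ E]
    (A D : κ → E →L[ℂ] E) (F : ℕ → Submodule ℂ E) (h0 : F 0 = ⊥)
    (hD : ∀ n i, ∀ v ∈ F n, D i v ∈ F n)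
    (hU : ∀ n i, ∀ v ∈ F (n + 1), A i v - D i v ∈ F n) {C C' ν : ℝ} (hC : 1 ≤ C) (hC' : 0 ≤ C')
    (hν : 1 ≤ ν) (hDb : ∀ (l : List κ) v, ‖(l.map D).prod v‖ ≤ C * ν ^ l.length * ‖v‖)
    (hUb : ∀ i v, ‖A i v - D i v‖ ≤ C' * ‖v‖) (n : ℕ) :
    ∀ v ∈ F n, ∀ l : List κ, ‖(l.map A).prod v‖ ≤
      C * (1 + C' * C * l.length) ^ n * ν ^ l.length * ‖v‖ := by
  have hC0 : 0 ≤ C := zero_le_one.trans hC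
  have hν0 : 0 ≤ ν := zero_le_one.trans hν
  have hDl : ∀ n (l : List κ), ∀ v ∈ F n, (l.map D).prod v ∈ F n := by
    intro n l v hv
    induction l with
    | nil => exact hv
    | cons i l ih =>
      rw [List.map_cons, List.prod_cons]
      exact hD n i _ ih
  suffices h : ∀ n, ∀ v ∈ F n, ∀ l l' : List κ, ‖(l.map A).prod ((l'.map D).prod v)‖ ≤
      C * (1 + C' * C * l.length) ^ n * ν ^ (l.length + l'.length) * ‖v‖ from
    fun v hv l => h n v hv l []
  intro n
  induction n with
  | zero =>
    intro v hv l l'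
    rw [h0, Submodule.mem_bot] at hv
    rw [hv, map_zero, map_zero, norm_zero, mul_zero]
  | succ n ih =>
    intro v hv l
    induction l using List.reverseRecOn with
    | nil =>
      intro l'
      simpa using hDb l' v
    | append_singleton l i ihl =>
      intro l'
      have hw := hDl _ l' v hv
      set w := (l'.map D).prod v with hwdef
      have e : ((l ++ [i]).map A).prod w = (l.map A).prod (((i :: l').map D).prod v) +
          (l.map A).prod (A i w - D i w) := by
        rw [List.map_append, List.prod_append, List.map_singleton, List.prod_singleton,
          List.map_cons, List.prod_cons, ← map_add]
        change _ = (l.map A).prod (D i w + (A i w - D i w))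
        rw [add_sub_cancel]
        rfl
      have h1 := ihl (i :: l')
      have h2 := ih _ (hU n i w hw) l []
      have h3 := (hUb i w).trans (mul_le_mul_of_nonneg_left (hDb l' v) hC')
      rw [e]
      refine (norm_add_le _ _).trans ((add_le_add h1 (h2.trans
        (mul_le_mul_of_nonneg_left h3 (by positivity)))).trans ?_)
      simp only [List.length_cons, List.length_append, List.length_nil, add_zero, zero_add,
        Nat.cast_add, Nat.cast_one]
      set k : ℝ := (l.length : ℝ) with hk
      have hk0 : 0 ≤ k := Nat.cast_nonneg _
      set a := C' * C with ha
      have ha0 : 0 ≤ a := mul_nonneg hC' hC0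
      have h4 : ν ^ (l.length + l'.length) ≤ ν ^ (l.length + (l'.length + 1)) :=
        pow_le_pow_right₀ hν (by omega)
      have h5 : (1 + a * k) ^ n ≤ (1 + a * (k + 1)) ^ n := by
        gcongr
        linarith
      calc C * (1 + a * k) ^ (n + 1) * ν ^ (l.length + (l'.length + 1)) * ‖v‖ +
            C * (1 + a * k) ^ n * ν ^ l.length * (C' * (C * ν ^ l'.length * ‖v‖))
          = C * (1 + a * k) ^ n * ((1 + a * k) * ν ^ (l.length + (l'.length + 1)) +
              a * ν ^ (l.length + l'.length)) * ‖v‖ := by rw [ha]; ring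
        _ ≤ C * (1 + a * (k + 1)) ^ n * ((1 + a * k) * ν ^ (l.length + (l'.length + 1)) +
              a * ν ^ (l.length + (l'.length + 1))) * ‖v‖ := by gcongr
        _ = C * (1 + a * (k + 1)) ^ (n + 1) * ν ^ (l.length + 1 + l'.length) * ‖v‖ := by
          rw [show l.length + 1 + l'.length = l.length + (l'.length + 1) by ring]; ring


open RootedDatum

/-! #### Laurent polynomials -/

section Laurent

variable {X F F' : Type*} [AddCommGroup X] [NormedAddCommGroup F] [NormedSpace ℂ F]
  [NormedAddCommGroup F'] [NormedSpace ℂ F']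

/-- Laurent polynomials with coefficients in `F`, as functions of a character. -/
def IsLaurent (f : AddChar X ℂ → F) : Prop :=
  ∃ c : X →₀ F, ∀ t, f t = c.sum fun x A => t x • A

theorem isLaurent_single (x : X) (A : F) : IsLaurent fun t : AddChar X ℂ => t x • A :=
  ⟨Finsupp.single x A, fun t => (Finsupp.sum_single_index (h := fun x A => t x • A) (smul_zero _)).symm⟩

theorem IsLaurent.add {f g : AddChar X ℂ → F} (hf : IsLaurent f) (hg : IsLaurent g) :
    IsLaurent fun t => f t + g t := by
  classical
  obtain ⟨c, hc⟩ := hf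
  obtain ⟨d, hd⟩ := hg
  refine ⟨c + d, fun t => ?_⟩
  beta_reduce
  rw [hc, hd, Finsupp.sum_add_index' (fun _ => smul_zero _) (fun _ _ _ => smul_add _ _ _)]

theorem isLaurent_zero : IsLaurent fun _ : AddChar X ℂ => (0 : F) :=
  ⟨0, fun t => by beta_reduce; rw [Finsupp.sum_zero_index]⟩

theorem IsLaurent.sum {κ : Type*} {s : Finset κ} {f : κ → AddChar X ℂ → F}
    (hf : ∀ i ∈ s, IsLaurent (f i)) : IsLaurent fun t => ∑ i ∈ s, f i t := by
  classical
  induction s using Finset.induction_on with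
  | empty => simp only [Finset.sum_empty]; exact isLaurent_zero
  | insert i s hi ih =>
    simp only [Finset.sum_insert hi]
    exact (hf i (Finset.mem_insert_self _ _)).add
      (ih fun j hj => hf j (Finset.mem_insert_of_mem hj))

theorem IsLaurent.map {f : AddChar X ℂ → F} (hf : IsLaurent f) (φ : F →ₗ[ℂ] F') :
    IsLaurent fun t => φ (f t) := by
  obtain ⟨c, hc⟩ := hf
  simp only [hc, Finsupp.sum, map_sum, map_smul]
  exact IsLaurent.sum fun x _ => isLaurent_single x _

theorem IsLaurent.exists_bound {f : AddChar X ℂ → F} (hf : IsLaurent f) {Ω : Set (AddChar X ℂ)}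
    (hΩ : ∀ x, ∃ M : ℝ, ∀ t ∈ Ω, ‖t x‖ ≤ M) : ∃ C : ℝ, 0 ≤ C ∧ ∀ t ∈ Ω, ‖f t‖ ≤ C := by
  obtain ⟨c, hc⟩ := hf
  choose M hM using hΩ
  refine ⟨∑ x ∈ c.support, |M x| * ‖c x‖,
    Finset.sum_nonneg fun x _ => mul_nonneg (abs_nonneg _) (norm_nonneg _), fun t ht => ?_⟩
  rw [hc]
  refine (norm_sum_le _ _).trans (Finset.sum_le_sum fun x _ => ?_)
  rw [norm_smul]
  exact mul_le_mul_of_nonneg_right ((hM x t ht).trans (le_abs_self _)) (norm_nonneg _)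

end Laurent

section RootData

variable {ι X Y : Type*} [AddCommGroup X] [AddCommGroup Y] {R : RootDatum ι X Y} {b : R.Base}
variable [Finite ι] [R.IsReduced] {q : WX R → ℝ} {P : Par b}

omit [R.IsReduced] in
theorem indRep_isLaurent (δ : DS P q) (h : Hk R b q) :
    IsLaurent fun t => indRep δ t h := by
  have e : (fun t => indRep δ t h) = fun t => ∑ u' : minReps P,
      ∑ p ∈ (bernsteinCoeff P q (h * basisN (datum R b) q (lin X u'.1))).support, t p.2.1 •
        LinearMap.toContinuousLinearMap
          (bernsteinCoeff P q (h * basisN (datum R b) q (lin X u'.1)) p •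
            (incl δ p.1 ∘ₗ twisted δ 1 p.2.1 p.2.2 ∘ₗ comp δ u')) := by
    funext t
    rw [indRep, map_sum]
    refine Finset.sum_congr rfl fun u' _ => ?_
    rw [Finsupp.sum, map_sum]
    refine Finset.sum_congr rfl fun p _ => ?_
    rw [← map_smul]
    congr 1
    rw [smul_comm, twisted, twisted]
    simp only [AddChar.one_apply, one_smul, LinearMap.smul_comp, LinearMap.comp_smul]
  rw [e]
  exact IsLaurent.sum fun u' _ => IsLaurent.sum fun p _ => isLaurent_single _ _

/-- The operator which is diagonal with respect to the decomposition of `i(V_δ)` and acts by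
`δ_t(θ_{u⁻¹ y})` on `N_u ⊗ V_δ`. -/
def diagOp (hq : IsLabelFunction (datum R b) q) (δ : DS P q) (t : AddChar X ℂ) (y : X) :
    indSpace δ →L[ℂ] indSpace δ :=
  LinearMap.toContinuousLinearMap (∑ u : minReps P, incl δ u ∘ₗ
    twistedHom hq δ t (AddMonoidAlgebra.single ((u : R.weylGroup)⁻¹ • y) 1) ∘ₗ comp δ u)

variable (hq : IsLabelFunction (datum R b) q) (δ : DS P q)

theorem diagOp_incl (t : AddChar X ℂ) (y : X) (u : minReps P) (v : δ.V) :
    diagOp hq δ t y (incl δ u v) = incl δ u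
      (twistedHom hq δ t (AddMonoidAlgebra.single ((u : R.weylGroup)⁻¹ • y) 1) v) := by
  classical
  change (∑ u : minReps P, _ : indSpace δ →ₗ[ℂ] indSpace δ) _ = _
  rw [LinearMap.sum_apply, Finset.sum_eq_single u]
  · rw [LinearMap.comp_apply, LinearMap.comp_apply, comp_incl, if_pos rfl]
  · intro u' _ hu'
    rw [LinearMap.comp_apply, LinearMap.comp_apply, comp_incl, if_neg hu', map_zero, map_zero]
  · exact fun h => absurd (Finset.mem_univ _) h

omit [R.IsReduced] in
theorem indSpace_ext {F : Type*} [AddCommGroup F] [Module ℂ F] {f g : indSpace δ →ₗ[ℂ] F}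
    (h : ∀ u v, f (incl δ u v) = g (incl δ u v)) : f = g := by
  ext1 x
  rw [← sum_incl_comp δ x, map_sum, map_sum]
  exact Finset.sum_congr rfl fun u _ => h _ _

theorem diagOp_zero (t : AddChar X ℂ) : diagOp hq δ t 0 = 1 := by
  refine ContinuousLinearMap.coe_injective (indSpace_ext δ fun u v => ?_)
  change diagOp hq δ t 0 _ = incl δ u v
  rw [diagOp_incl, smul_zero, ← AddMonoidAlgebra.one_def, map_one]
  rfl

theorem diagOp_add (t : AddChar X ℂ) (x y : X) :
    diagOp hq δ t (x + y) = diagOp hq δ t x * diagOp hq δ t y := by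
  refine ContinuousLinearMap.coe_injective (indSpace_ext δ fun u v => ?_)
  change diagOp hq δ t (x + y) _ = diagOp hq δ t x (diagOp hq δ t y _)
  rw [diagOp_incl, diagOp_incl, diagOp_incl, smul_add, ← one_mul (1 : ℂ),
    ← AddMonoidAlgebra.single_mul_single, map_mul, one_mul]
  rfl

theorem diagOp_list {κ : Type*} (t : AddChar X ℂ) (x : κ → X) (l : List κ) :
    (l.map fun i => diagOp hq δ t (x i)).prod = diagOp hq δ t (l.map x).sum := by
  induction l with
  | nil => simp [diagOp_zero]
  | cons i l ih => simp [ih, diagOp_add]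

theorem diagOp_isLaurent (y : X) : IsLaurent fun t => diagOp hq δ t y := by
  have e : (fun t => diagOp hq δ t y) = fun t => ∑ u : minReps P, t ((u : R.weylGroup)⁻¹ • y) •
        LinearMap.toContinuousLinearMap (incl δ u ∘ₗ δ.rep (theta (G := parW P) (parDatum P)
          (parLabel P q) (Submodule.Quotient.mk ((u : R.weylGroup)⁻¹ • y))) ∘ₗ comp δ u) := by
    funext t
    rw [diagOp, map_sum]
    refine Finset.sum_congr rfl fun u _ => ?_
    rw [← map_smul, twistedHom_of, LinearMap.smul_comp, LinearMap.comp_smul]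
  rw [e]
  exact IsLaurent.sum fun u _ => isLaurent_single _ _

theorem Dom.minReps_inv_smul {y : X} (hy : Dom (datum R b) y) {u : R.weylGroup}
    (hu : u ∈ minReps P) : Dom (parDatum P) (Submodule.Quotient.mk (u⁻¹ • y) : XP P) := by
  intro j hj
  have h := hy _ (minReps_perm_pos P hu hj j.2)
  rw [← smul_inv_smul u y, coroot_perm] at h
  exact h

theorem diagOp_bound : ∃ C : ℝ, 1 ≤ C ∧ ∀ (t : AddChar X ℂ) (y : X) (M : ℝ),
    Dom (datum R b) y → (∀ u : R.weylGroup, ‖t (u • y)‖ ≤ M) →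
      ∀ f, ‖diagOp hq δ t y f‖ ≤ C * M * ‖f‖ := by
  obtain ⟨C, hC0, hC⟩ := δ.exists_bound (parLabel_isLabeling P hq)
  set A : ℝ := ∑ u : minReps P, ‖LinearMap.toContinuousLinearMap (incl δ u)‖ *
    (C * ‖LinearMap.toContinuousLinearMap (comp δ u)‖) with hA
  have hA0 : 0 ≤ A := Finset.sum_nonneg fun u _ => by positivity
  refine ⟨1 + A, by linarith, fun t y M hy hM f => ?_⟩
  have hM0 : 0 ≤ M := (norm_nonneg _).trans (hM 1)
  suffices h : ‖diagOp hq δ t y f‖ ≤ A * M * ‖f‖ by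
    refine h.trans ?_
    gcongr
    linarith
  change ‖(∑ u : minReps P, _ : indSpace δ →ₗ[ℂ] indSpace δ) f‖ ≤ _
  rw [LinearMap.sum_apply, hA, Finset.sum_mul, Finset.sum_mul]
  refine (norm_sum_le _ _).trans (Finset.sum_le_sum fun u _ => ?_)
  rw [twistedHom_of, theta_dom (parLabel_isLabeling P hq) (hy.minReps_inv_smul u.2)]
  have h1 := (LinearMap.toContinuousLinearMap (comp δ u)).le_opNorm f
  have h2 := hC (tr (parW P) (Submodule.Quotient.mk ((u : R.weylGroup)⁻¹ • y))) (comp δ u f)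
  have h3 := (LinearMap.toContinuousLinearMap (incl δ u)).le_opNorm
    (t ((u : R.weylGroup)⁻¹ • y) • δ.rep (basisN (parDatum P) (parLabel P q)
      (tr (parW P) (Submodule.Quotient.mk ((u : R.weylGroup)⁻¹ • y)))) (comp δ u f))
  rw [norm_smul] at h3
  refine h3.trans ?_
  calc _ ≤ ‖LinearMap.toContinuousLinearMap (incl δ u)‖ * (M * (C *
        (‖LinearMap.toContinuousLinearMap (comp δ u)‖ * ‖f‖))) := by
        gcongr
        · exact hM _
        · exact h2.trans (mul_le_mul_of_nonneg_left h1 hC0)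
    _ = _ := by ring

/-- The sum of the `N_u ⊗ V_δ` with `l(u) < n`. -/
def lenFiltration (n : ℕ) : Submodule ℂ (indSpace δ) :=
  ⨆ (u : minReps P) (_ : len (datum R b) (lin X (u : R.weylGroup)) < n), LinearMap.range (incl δ u)

omit [Finite ι] [R.IsReduced] in
theorem incl_mem_lenFiltration {n : ℕ} {u : minReps P}
    (hu : len (datum R b) (lin X (u : R.weylGroup)) < n) (v : δ.V) :
    incl δ u v ∈ lenFiltration δ n :=
  Submodule.mem_iSup_of_mem u (Submodule.mem_iSup_of_mem hu ⟨v, rfl⟩)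

omit [Finite ι] [R.IsReduced] in
theorem lenFiltration_induction {n : ℕ} {S : Submodule ℂ (indSpace δ)}
    (h : ∀ u : minReps P, len (datum R b) (lin X (u : R.weylGroup)) < n → ∀ v, incl δ u v ∈ S) :
    lenFiltration δ n ≤ S := by
  refine iSup_le fun u => iSup_le fun hu => ?_
  rintro _ ⟨v, rfl⟩
  exact h u hu v

theorem indMap_mem_lenFiltration {t : AddChar X ℂ} (ht : t ∈ torus P) {n : ℕ} {h : Hk R b q}
    (hh : h ∈ lowerSpan (datum R b) q n) (v : δ.V) : indMap hq δ t h v ∈ lenFiltration δ n := by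
  have key : lowerSpan (datum R b) q n ≤
      (lenFiltration δ n).comap ((LinearMap.applyₗ v).comp (indMap hq δ t)) := by
    rw [lowerSpan, Submodule.span_le]
    rintro _ ⟨g, y, hg, rfl⟩
    obtain ⟨u, hu, w, hw, rfl⟩ := exists_minReps_mul P g
    change indMap hq δ t (basisN (datum R b) q (lin X (u * w)) * theta (datum R b) q y) v ∈
      lenFiltration δ n
    have h1 := len_minReps_mul P hu hw
    rw [← thetaHom_of hq.isLabeling, indMap_mul_thetaHom hq δ ht, lin_mul,
      ← AffineHecke.basisN_mul (by rw [← lin_mul]; exact h1)]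
    have h2 := indMap_mul_basisN hq δ (t := t) (basisN (datum R b) q (lin X u)) ⟨w, hw⟩
      (twistedHom hq δ t (AddMonoidAlgebra.single y 1) v)
    have h3 := incl_eq_indMap hq δ (t := t) ⟨u, hu⟩ (δ.rep (basisN (parDatum P) (parLabel P q)
      (lin (XP P) (⟨w, hw⟩ : parW P))) (twistedHom hq δ t (AddMonoidAlgebra.single y 1) v))
    simp only at h2 h3
    rw [h2, ← h3]
    exact incl_mem_lenFiltration δ (by simp only; omega) _
  exact key hh

include hq in
/-- Products of the operators `θ_x`, where `x` is a dominant vector. -/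
theorem exists_bound_theta_list {κ : Type*} [Finite κ] (x : κ → X)
    (hx : ∀ i, Dom (datum R b) (x i)) (Ω : Set (AddChar X ℂ)) (hΩ : Ω ⊆ torus P)
    (hbd : ∀ y, ∃ M : ℝ, ∀ t ∈ Ω, ‖t y‖ ≤ M) (ν : AddChar X ℂ → ℝ) (hν1 : ∀ t ∈ Ω, 1 ≤ ν t)
    (hν : ∀ t ∈ Ω, ∀ i (w : R.weylGroup), ‖t (w • x i)‖ ≤ ν t) :
    ∃ d : ℕ, ∃ C : ℝ, 0 < C ∧ ∀ t ∈ Ω, ∀ l : List κ,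
      ‖indRep δ t (theta (datum R b) q (l.map x).sum)‖ ≤
        C * (1 + l.length) ^ d * ν t ^ l.length := by
  classical
  cases nonempty_fintype κ
  obtain ⟨C, hC1, hC⟩ := diagOp_bound hq δ
  have hU : ∀ i, ∃ C' : ℝ, 0 ≤ C' ∧ ∀ t ∈ Ω,
      ‖indRep δ t (theta (datum R b) q (x i)) - diagOp hq δ t (x i)‖ ≤ C' := by
    intro i
    obtain ⟨C₁, h10, h1⟩ := (indRep_isLaurent δ (theta (datum R b) q (x i))).exists_bound hbd
    obtain ⟨C₂, h20, h2⟩ := (diagOp_isLaurent hq δ (x i)).exists_bound hbd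
    exact ⟨C₁ + C₂, add_nonneg h10 h20, fun t ht => (norm_sub_le _ _).trans
      (add_le_add (h1 t ht) (h2 t ht))⟩
  choose C' hC'0 hC' using hU
  obtain ⟨N, hN⟩ : ∃ N : ℕ, ∀ u : R.weylGroup, len (datum R b) (lin X u) < N := by
    obtain ⟨N, hN⟩ := (Set.finite_range fun u : R.weylGroup =>
      len (datum R b) (lin X u)).bddAbove
    exact ⟨N + 1, fun u => Nat.lt_succ_of_le (hN ⟨u, rfl⟩)⟩
  have hS0 : 0 ≤ ∑ i, C' i := Finset.sum_nonneg fun i _ => hC'0 i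
  refine ⟨N, C * (1 + (∑ i, C' i) * C) ^ N, by positivity, fun t ht l => ?_⟩
  have hν0 : 0 ≤ ν t := zero_le_one.trans (hν1 t ht)
  have hA : (l.map fun i => indRep δ t (theta (datum R b) q (x i))).prod =
      indRep δ t (theta (datum R b) q (l.map x).sum) := by
    induction l with
    | nil =>
      simp only [List.map_nil, List.prod_nil, List.sum_nil]
      rw [theta_zero hq.isLabeling]
      exact (map_one (indHom hq δ (hΩ ht))).symm
    | cons i l ih =>
      rw [List.map_cons, List.prod_cons, ih, List.map_cons, List.sum_cons,
        theta_add hq.isLabeling]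
      exact (map_mul (indHom hq δ (hΩ ht)) _ _).symm
  have hDl : ∀ l : List κ, Dom (datum R b) (l.map x).sum ∧
      ∀ w : R.weylGroup, ‖t (w • (l.map x).sum)‖ ≤ ν t ^ l.length := by
    intro l
    induction l with
    | nil => simpa using Dom.zero
    | cons i l ih =>
      refine ⟨by rw [List.map_cons, List.sum_cons]; exact (hx i).add ih.1, fun w => ?_⟩
      rw [List.map_cons, List.sum_cons, smul_add, AddChar.map_add_eq_mul, norm_mul,
        List.length_cons, pow_succ']
      exact mul_le_mul (hν t ht i w) (ih.2 w) (norm_nonneg _) hν0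
  have key := norm_prod_triangular_le (fun i => indRep δ t (theta (datum R b) q (x i)))
    (fun i => diagOp hq δ t (x i)) (lenFiltration δ)
    (by
      refine le_bot_iff.1 (lenFiltration_induction δ fun u hu => ?_)
      exact absurd hu (Nat.not_lt_zero _))
    (fun n i => lenFiltration_induction δ
      (S := (lenFiltration δ n).comap (diagOp hq δ t (x i)).toLinearMap) fun u hu v => by
        change diagOp hq δ t (x i) (incl δ u v) ∈ lenFiltration δ n
        rw [diagOp_incl]
        exact incl_mem_lenFiltration δ hu _)
    (fun n i => lenFiltration_induction δ (S := (lenFiltration δ n).comap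
        (indRep δ t (theta (datum R b) q (x i)) - diagOp hq δ t (x i)).toLinearMap)
        fun u hu v => by
        change indRep δ t (theta (datum R b) q (x i)) (incl δ u v) -
          diagOp hq δ t (x i) (incl δ u v) ∈ lenFiltration δ n
        rw [diagOp_incl, indRep_incl hq, incl_eq_indMap hq δ (t := t),
          ← indMap_mul_thetaHom hq δ (hΩ ht), thetaHom_of, ← LinearMap.sub_apply, ← map_sub]
        refine indMap_mem_lenFiltration hq δ (hΩ ht) (lowerSpan_mono (Nat.le_of_lt_succ hu) ?_) v
        exact theta_mul_basisN_sub_mem hq.isLabeling _ _)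
    hC1 hS0 (hν1 t ht)
    (fun l v => by
      rw [diagOp_list]
      exact hC t _ _ (hDl l).1 (hDl l).2 v)
    (fun i v => (ContinuousLinearMap.le_opNorm (indRep δ t (theta (datum R b) q (x i)) -
        diagOp hq δ t (x i)) v).trans (mul_le_mul_of_nonneg_right ((hC' i t ht).trans
          (Finset.single_le_sum (fun i _ => hC'0 i) (Finset.mem_univ i))) (norm_nonneg v))) N
  refine ContinuousLinearMap.opNorm_le_bound _ (by positivity) fun f => ?_
  have hf : f ∈ lenFiltration δ N := by
    rw [← sum_incl_comp δ f]
    exact sum_mem fun u _ => incl_mem_lenFiltration δ (hN _) _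
  refine (hA ▸ key f hf l).trans ?_
  rw [mul_assoc C (_ ^ N) (_ ^ N), ← mul_pow]
  have h1 : 1 + (∑ i, C' i) * C * (l.length : ℝ) ≤
      (1 + (∑ i, C' i) * C) * (1 + (l.length : ℝ)) := by
    have : 0 ≤ (∑ i, C' i) * C := by positivity
    have h2 : (0 : ℝ) ≤ l.length := Nat.cast_nonneg _
    nlinarith
  gcongr

end RootData


open RootedDatum

section RootData

variable {ι X Y : Type*} [AddCommGroup X] [AddCommGroup Y] {R : RootDatum ι X Y} {b : R.Base}
variable [Finite ι] {κ : Type*} [Fintype κ] (z : Module.Basis κ ℤ (centralLattice R))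

/-! #### The norm of the central part -/

theorem eq_zero_of_mem_rootSpan {x : X} (hx : x ∈ R.rootSpan ℤ)
    (h : ∀ i, R.coroot' i x = 0) : x = 0 := by
  obtain ⟨B, -, hpos, hco, hdef⟩ := exists_form R
  refine hdef x hx ?_
  have : R.rootSpan ℤ ≤ LinearMap.ker (B x) := by
    rw [RootPairing.rootSpan, Submodule.span_le]
    rintro _ ⟨i, rfl⟩
    have := hco i x
    rw [h i, zero_mul] at this
    simp only [SetLike.mem_coe, LinearMap.mem_ker]
    omega
  exact this hx

omit [Finite ι] in
theorem smul_sub_mem_rootSpan (g : R.weylGroup) (x : X) : g • x - x ∈ R.rootSpan ℤ := by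
  obtain ⟨g, hg⟩ := g
  induction hg using RootPairing.weylGroup.induction generalizing x with
  | mem i =>
    change RootPairing.weylGroup.ofIdx R i • x - x ∈ _
    rw [ofIdx_smul, sub_sub_cancel_left]
    exact neg_mem (Submodule.smul_mem _ _ (Submodule.subset_span ⟨i, rfl⟩))
  | one =>
    change (1 : R.weylGroup) • x - x ∈ _
    rw [one_smul, sub_self]; exact zero_mem _
  | mul g h hg hh ihg ihh =>
    change ((⟨g, hg⟩ : R.weylGroup) * ⟨h, hh⟩) • x - x ∈ _
    rw [mul_smul]
    have := add_mem (ihg ((⟨h, hh⟩ : R.weylGroup) • x)) (ihh x)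
    rwa [sub_add_sub_cancel] at this

omit [Finite ι] in
theorem smul_central (g : R.weylGroup) (y : centralLattice R) : g • (y : X) = y := by
  obtain ⟨g, hg⟩ := g
  induction hg using RootPairing.weylGroup.induction with
  | mem i =>
    change RootPairing.weylGroup.ofIdx R i • (y : X) = _
    rw [ofIdx_smul]
    have : R.coroot' i (y : X) = 0 := y.2 i
    rw [this, zero_smul, sub_zero]
  | one => exact one_smul R.weylGroup _
  | mul g h hg hh ihg ihh =>
    change ((⟨g, hg⟩ : R.weylGroup) * ⟨h, hh⟩) • (y : X) = _
    rw [mul_smul, ihh, ihg]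

variable (R) in
theorem exists_weylSum (x : X) : ∃ y : centralLattice R,
    (y : X) = ∑ᶠ g : R.weylGroup, g • x ∧ Nat.card R.weylGroup • x - (y : X) ∈ R.rootSpan ℤ := by
  cases nonempty_fintype R.weylGroup
  refine ⟨⟨∑ᶠ g : R.weylGroup, g • x, fun i => ?_⟩, rfl, ?_⟩
  · rw [finsum_eq_sum_of_fintype]
    have h1 : RootPairing.weylGroup.ofIdx R i • ∑ g : R.weylGroup, g • x =
        ∑ g : R.weylGroup, g • x := by
      rw [Finset.smul_sum]
      simp only [← mul_smul]
      exact Fintype.sum_equiv (Equiv.mulLeft (RootPairing.weylGroup.ofIdx R i)) _ _ fun g => rfl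
    rw [ofIdx_smul, sub_eq_self] at h1
    have h2 : R.coroot' i (R.root i) = 2 := R.root_coroot_two i
    have h3 := congrArg (R.coroot' i) h1
    rw [map_smul, h2, map_zero, smul_eq_mul] at h3
    omega
  · simp only
    rw [finsum_eq_sum_of_fintype, Nat.card_eq_fintype_card, ← neg_mem_iff, neg_sub,
      ← Finset.card_univ, ← Finset.sum_const, ← Finset.sum_sub_distrib]
    exact sum_mem fun g _ => smul_sub_mem_rootSpan g x

/-- The norm on `Z_X`. -/
def zNorm (y : centralLattice R) : ℝ := ∑ k, |((z.repr y k : ℤ) : ℝ)|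

omit [Finite ι] in
theorem zNorm_nonneg (y : centralLattice R) : 0 ≤ zNorm z y :=
  Finset.sum_nonneg fun _ _ => abs_nonneg _

omit [Finite ι] in
theorem zNorm_add_le (y y' : centralLattice R) : zNorm z (y + y') ≤ zNorm z y + zNorm z y' := by
  rw [zNorm, zNorm, zNorm, ← Finset.sum_add_distrib]
  refine Finset.sum_le_sum fun k _ => ?_
  rw [map_add, Finsupp.add_apply, Int.cast_add]
  exact abs_add_le _ _

omit [Finite ι] in
theorem zNorm_nsmul (n : ℕ) (y : centralLattice R) : zNorm z (n • y) = n * zNorm z y := by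
  rw [zNorm, zNorm, Finset.mul_sum]
  refine Finset.sum_congr rfl fun k _ => ?_
  rw [map_nsmul, Finsupp.smul_apply, nsmul_eq_mul, Int.cast_mul, Int.cast_natCast, abs_mul,
    Nat.abs_cast]

theorem centralNorm_eq {m : ℕ} (hm : 0 < m) {x : X} {y : centralLattice R}
    (h : m • x - (y : X) ∈ R.rootSpan ℤ) : centralNorm R z x = zNorm z y / m := by
  have hex : ∃ p : ℕ × centralLattice R, 0 < p.1 ∧
      p.1 • x - (p.2 : X) ∈ Submodule.span ℤ (Set.range R.root) := ⟨(m, y), hm, h⟩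
  rw [centralNorm, dif_pos hex]
  obtain ⟨hm', h'⟩ := hex.choose_spec
  set p := hex.choose
  have e : p.1 • y = m • p.2 := by
    refine Subtype.ext ?_
    rw [← sub_eq_zero]
    refine eq_zero_of_mem_rootSpan ?_ fun i => (p.1 • y - m • p.2).2 i
    have := sub_mem ((R.rootSpan ℤ).smul_of_tower_mem m h') ((R.rootSpan ℤ).smul_of_tower_mem p.1 h)
    rw [smul_sub, smul_sub, smul_comm m p.1 x, sub_sub_sub_cancel_left] at this
    exact this
  have e2 := congrArg (zNorm z) e
  rw [zNorm_nsmul, zNorm_nsmul] at e2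
  change zNorm z p.2 / p.1 = _
  have h1 : (0 : ℝ) < m := Nat.cast_pos.2 hm
  have h2 : (0 : ℝ) < p.1 := Nat.cast_pos.2 hm'
  rw [div_eq_div_iff h2.ne' h1.ne']
  linarith

theorem centralNorm_nonneg (x : X) : 0 ≤ centralNorm R z x := by
  obtain ⟨y, -, hy⟩ := exists_weylSum R x
  rw [centralNorm_eq z Nat.card_pos hy]
  exact div_nonneg (zNorm_nonneg z y) (Nat.cast_nonneg _)

theorem centralNorm_add_le (x x' : X) :
    centralNorm R z (x + x') ≤ centralNorm R z x + centralNorm R z x' := by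
  obtain ⟨y, -, hy⟩ := exists_weylSum R x
  obtain ⟨y', -, hy'⟩ := exists_weylSum R x'
  have h : Nat.card R.weylGroup • (x + x') - ((y + y' : centralLattice R) : X) ∈ R.rootSpan ℤ := by
    have := add_mem hy hy'
    rw [sub_add_sub_comm, ← smul_add] at this
    exact this
  rw [centralNorm_eq z Nat.card_pos hy, centralNorm_eq z Nat.card_pos hy',
    centralNorm_eq z Nat.card_pos h, ← add_div]
  exact div_le_div_of_nonneg_right (zNorm_add_le z y y') (Nat.cast_nonneg _)

theorem centralNorm_add_rootSpan (x : X) {x' : X} (hx' : x' ∈ R.rootSpan ℤ) :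
    centralNorm R z (x + x') = centralNorm R z x := by
  obtain ⟨y, -, hy⟩ := exists_weylSum R x
  rw [centralNorm_eq z Nat.card_pos hy]
  refine centralNorm_eq z Nat.card_pos ?_
  rw [smul_add, add_sub_right_comm]
  exact add_mem hy ((R.rootSpan ℤ).smul_of_tower_mem _ hx')

theorem centralNorm_smul (g : R.weylGroup) (x : X) : centralNorm R z (g • x) = centralNorm R z x := by
  rw [← add_sub_cancel x (g • x)]
  exact centralNorm_add_rootSpan z x (smul_sub_mem_rootSpan g x)

theorem centralNorm_central (y : centralLattice R) : centralNorm R z (y : X) = zNorm z y := by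
  rw [centralNorm_eq z one_pos (y := y), Nat.cast_one, div_one]
  rw [one_smul, sub_self]
  exact zero_mem _

variable (b)

theorem normW_nonneg (w : WX R) : 0 ≤ normW R b z w :=
  add_nonneg (Nat.cast_nonneg _) (centralNorm_nonneg z _)

theorem one_le_one_add_normW (w : WX R) : 1 ≤ 1 + normW R b z w :=
  le_add_of_nonneg_right (normW_nonneg b z w)

variable [R.IsReduced]

/-- Comparison of the norms of `w` and the translations in a decomposition of `w`. -/
theorem exists_normW_tr_sub_le (S : Set X) (hS : S.Finite) : ∃ c : ℝ, 0 ≤ c ∧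
    ∀ (w : WX R) (u v : R.weylGroup) (x f : X), f ∈ S → w * lin X v = lin X u * tr R.weylGroup x →
      normW R b z (tr R.weylGroup (x - f)) ≤ normW R b z w + c := by
  obtain ⟨N, hN⟩ : ∃ N : ℕ, ∀ u : R.weylGroup, len (datum R b) (lin X u) ≤ N := by
    obtain ⟨N, hN⟩ := (Set.finite_range fun u : R.weylGroup =>
      len (datum R b) (lin X u)).bddAbove
    exact ⟨N, fun u => hN ⟨u, rfl⟩⟩
  obtain ⟨M, hM⟩ := (hS.image fun f => normW R b z (tr R.weylGroup (-f))).bddAbove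
  refine ⟨|M| + 2 * N, by positivity, fun w u v x f hf h => ?_⟩
  have hMf : normW R b z (tr R.weylGroup (-f)) ≤ |M| := (hM ⟨f, hf, rfl⟩).trans (le_abs_self _)
  have e : tr R.weylGroup x = lin X u⁻¹ * w * lin X v := by
    rw [mul_assoc, h, ← mul_assoc, ← lin_mul, inv_mul_cancel, lin_one, one_mul]
  have h1 : len (datum R b) (tr R.weylGroup x) ≤ len (datum R b) w + 2 * N := by
    rw [e]
    have := len_mul_le (D := datum R b) (lin X u⁻¹ * w) (lin X v)
    have := len_mul_le (D := datum R b) (lin X u⁻¹) w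
    have := hN u⁻¹
    have := hN v
    omega
  have h2 : len (datum R b) (tr R.weylGroup (x - f)) ≤
      len (datum R b) (tr R.weylGroup x) + len (datum R b) (tr R.weylGroup (-f)) := by
    rw [sub_eq_add_neg, tr_add]
    exact len_mul_le _ _
  have h3 : centralNorm R z (act w 0) = centralNorm R z x := by
    have := congrArg (fun w => act w (0 : X)) h
    simp only [act_mul, act_lin, act_tr, smul_zero, add_zero] at this
    rw [this, centralNorm_smul]
  have h4 := centralNorm_add_le z x (-f)
  rw [← sub_eq_add_neg] at h4
  unfold normW at hMf ⊢
  rw [act_tr, add_zero] at hMf ⊢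
  rw [h3]
  have h5 : (len (datum R b) (tr R.weylGroup (x - f)) : ℝ) ≤
      len (datum R b) w + 2 * N + len (datum R b) (tr R.weylGroup (-f)) := by
    exact_mod_cast h2.trans (Nat.add_le_add_right h1 _)
  linarith

variable {b}

/-- Finitely many translations reduce dominant vectors to dominant vectors in `Q + Z_X`. -/
theorem exists_finite_shift [Module.Finite ℤ X] : ∃ S : Set X, S.Finite ∧ ∀ x, Dom (datum R b) x →
    ∃ f ∈ S, ∃ y ∈ R.rootSpan ℤ, ∃ y' : centralLattice R, Dom (datum R b) y ∧ x - f = y + y' := by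
  set M : Submodule ℤ X := R.rootSpan ℤ ⊔ centralLattice R with hM
  have hfin : Finite (X ⧸ M) := by
    refine Module.finite_of_fg_torsion _ fun {x} => ?_
    obtain ⟨x, rfl⟩ := Submodule.Quotient.mk_surjective _ x
    obtain ⟨y, -, hy⟩ := exists_weylSum R x
    refine ⟨⟨(Nat.card R.weylGroup : ℤ), mem_nonZeroDivisors_of_ne_zero
      (Nat.cast_ne_zero.2 Nat.card_pos.ne')⟩, ?_⟩
    change (Nat.card R.weylGroup : ℤ) • (Submodule.Quotient.mk x : X ⧸ M) = 0
    rw [← Submodule.Quotient.mk_smul, Submodule.Quotient.mk_eq_zero, natCast_zsmul]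
    rw [← sub_add_cancel (Nat.card R.weylGroup • x) (y : X)]
    exact add_mem (Submodule.mem_sup_left hy) (Submodule.mem_sup_right y.2)
  have hρ : twoRho (datum R b) ∈ R.rootSpan ℤ := by
    cases nonempty_fintype ι
    classical
    rw [twoRho, finsum_cond_eq_sum_filter]
    exact sum_mem fun i _ => Submodule.subset_span ⟨i, rfl⟩
  have hrep : ∀ c : X ⧸ M, ∃ f : X, Submodule.Quotient.mk f = c ∧ Dom (datum R b) (-f) := by
    intro c
    obtain ⟨f, rfl⟩ := Submodule.Quotient.mk_surjective _ c
    have h1 := (dom_shift (D := datum R b) R.weylGroup (-f)).2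
    set k := ∑ᶠ j, |(datum R b).coroot j (-f)|
    refine ⟨f - k • twoRho (datum R b), ?_, ?_⟩
    · rw [Submodule.Quotient.eq, sub_sub_cancel_left]
      exact neg_mem (Submodule.mem_sup_left (Submodule.smul_mem _ _ hρ))
    · rwa [neg_sub, sub_eq_neg_add]
  choose f hf1 hf2 using hrep
  refine ⟨Set.range f, Set.finite_range f, fun x hx => ?_⟩
  have h1 : x - f (Submodule.Quotient.mk x) ∈ M := by
    rw [← Submodule.Quotient.eq, hf1]
  obtain ⟨y, hy, y', hy', e⟩ := Submodule.mem_sup.1 h1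
  refine ⟨_, ⟨_, rfl⟩, y, hy, ⟨y', hy'⟩, fun j hj => ?_, e.symm⟩
  have h2 := (hx.add (hf2 (Submodule.Quotient.mk x))) j hj
  rw [← sub_eq_add_neg, ← e, map_add] at h2
  have h3 : (datum R b).coroot j y' = 0 := hy' j
  rwa [h3, add_zero] at h2

end RootData

theorem exists_list_of_finsupp {κ M : Type*} [AddCommMonoid M] (x : κ → M) (m : κ →₀ ℕ) :
    ∃ l : List κ, (l.map x).sum = m.sum (fun i c => c • x i) ∧ l.length = m.sum fun _ c => c := by
  classical
  induction m using Finsupp.induction_linear with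
  | zero => exact ⟨[], by simp, by simp⟩
  | add f g hf hg =>
    obtain ⟨l, hl, hl'⟩ := hf
    obtain ⟨l', hl2, hl2'⟩ := hg
    refine ⟨l ++ l', ?_, ?_⟩
    · rw [List.map_append, List.sum_append, hl, hl2, Finsupp.sum_add_index'
        (h := fun i c => c • x i) (fun _ => zero_smul _ _) (fun _ _ _ => add_smul _ _ _)]
    · rw [List.length_append, hl', hl2', Finsupp.sum_add_index' (fun _ => rfl) (fun _ _ _ => rfl)]
  | single i c =>
    refine ⟨List.replicate c i, ?_, ?_⟩
    · rw [Finsupp.sum_single_index (h := fun i c => c • x i) (zero_smul _ _), List.map_replicate,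
        List.sum_replicate]
    · rw [Finsupp.sum_single_index rfl, List.length_replicate]

theorem exists_list_of_finsupp_int {κ M : Type*} [AddCommGroup M] (x : κ → M) (m : κ →₀ ℤ) :
    ∃ l : List (κ × Bool), (l.map fun p => if p.2 then x p.1 else -x p.1).sum =
      m.sum (fun i c => c • x i) ∧ (l.length : ℝ) = m.sum fun _ c => |(c : ℝ)| := by
  classical
  induction m using Finsupp.induction with
  | zero => exact ⟨[], by simp, by simp⟩
  | single_add i c f hi hc ih =>
    obtain ⟨l, hl, hl'⟩ := ih
    have hd : Disjoint (Finsupp.single i c).support f.support :=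
      Finset.disjoint_of_subset_left Finsupp.support_single_subset
        (Finset.disjoint_singleton_left.2 hi)
    refine ⟨List.replicate c.natAbs (i, decide (0 ≤ c)) ++ l, ?_, ?_⟩
    · rw [List.map_append, List.sum_append, hl, Finsupp.sum_add_index_of_disjoint hd,
        Finsupp.sum_single_index (h := fun i c => c • x i) (zero_smul _ _), List.map_replicate,
        List.sum_replicate]
      congr 1
      rcases le_total 0 c with h | h
      · simp only [h, decide_true, if_true]
        rw [← natCast_zsmul, Int.natAbs_of_nonneg h]
      · rcases h.lt_or_eq with h | h
        · simp only [not_le.2 h, decide_false, Bool.false_eq_true, if_false]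
          rw [← natCast_zsmul, Int.ofNat_natAbs_of_nonpos h.le, smul_neg, neg_smul, neg_neg]
        · exact absurd h hc
    · rw [List.length_append, List.length_replicate, Nat.cast_add, hl',
        Finsupp.sum_add_index_of_disjoint hd, Finsupp.sum_single_index (by simp), Nat.cast_natAbs,
        Int.cast_abs]


open RootedDatum

section RootData

variable {ι X Y : Type*} [AddCommGroup X] [AddCommGroup Y] {R : RootDatum ι X Y} {b : R.Base}
variable [Finite ι] [R.IsReduced] {q : WX R → ℝ} {κ : Type*} [Fintype κ]
variable (z : Module.Basis κ ℤ (centralLattice R))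

/-! #### Estimates of the induced representations -/

/-- The elements `x_i` together with the elements of a basis of `Z_X` and their inverses. -/
def genFamily {κ₁ κ₂ : Type*} (xQ : κ₁ → X) (xZ : κ₂ → X) : κ₁ ⊕ κ₂ × Bool → X :=
  Sum.elim xQ fun p => if p.2 then xZ p.1 else -xZ p.1

theorem exists_decomposition [Module.Finite ℤ X] (hq : IsLabelFunction (datum R b) q)
    {κ₁ κ₂ : Type*} (xQ : κ₁ → X) (xZ : Module.Basis κ₂ ℤ (centralLattice R))
    (hxQ : (AddSubmonoid.closure (Set.range xQ) : Set X) =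
        {x | x ∈ R.rootSpan ℤ ∧ ∀ i, (datum R b).pos i → 0 ≤ R.coroot' i x}) {K : ℝ} (hK : 0 < K)
    (hKb : ∀ (m : κ₁ →₀ ℕ) (m' : κ₂ →₀ ℤ),
        (m.sum fun _ c => (c : ℝ)) + (m'.sum fun _ c => |(c : ℝ)|) ≤
          K * normW R b z (tr R.weylGroup
            ((m.sum fun i c => c • xQ i) + (m'.sum fun j c => c • (xZ j : X))))) :
    ∃ T : Set (Hk R b q × Hk R b q), T.Finite ∧ ∃ c : ℝ, 0 ≤ c ∧ ∀ w : WX R, ∃ h ∈ T,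
      ∃ l : List (κ₁ ⊕ κ₂ × Bool), basisN (datum R b) q w =
        h.1 * theta (datum R b) q (l.map (genFamily xQ fun j => (xZ j : X))).sum * h.2 ∧
        (l.length : ℝ) ≤ K * (normW R b z w + c) := by
  obtain ⟨S, hS, hSx⟩ := exists_finite_shift (R := R) (b := b)
  obtain ⟨c, hc0, hc⟩ := exists_normW_tr_sub_le b z S hS
  refine ⟨(fun p : (R.weylGroup × R.weylGroup) × X =>
    (basisN (datum R b) q (lin X p.1.1) * theta (datum R b) q p.2,
      Ring.inverse (basisN (datum R b) q (lin X p.1.2)))) '' (Set.univ ×ˢ S),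
    (Set.finite_univ.prod hS).image _, c, hc0, fun w => ?_⟩
  obtain ⟨u, v, x, hx, e, hlen⟩ := exists_dominant_decomposition (D := datum R b) w
  obtain ⟨f, hf, y, hy, y', hyd, hxf⟩ := hSx x hx
  have hy' : y ∈ (AddSubmonoid.closure (Set.range xQ) : Set X) := by
    rw [hxQ]; exact ⟨hy, hyd⟩
  obtain ⟨m, hm⟩ := AddSubmonoid.exists_finsupp_of_mem_closure_range _ _ hy'
  obtain ⟨l₁, hl₁, hl₁'⟩ := exists_list_of_finsupp xQ m
  obtain ⟨l₂, hl₂, hl₂'⟩ := exists_list_of_finsupp_int (fun j => (xZ j : X)) (xZ.repr y')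
  have hz : ((xZ.repr y').sum fun j c => c • (xZ j : X)) = y' := by
    conv_rhs => rw [← xZ.linearCombination_repr y']
    rw [Finsupp.linearCombination_apply, Finsupp.sum, Finsupp.sum, AddSubmonoidClass.coe_finsetSum]
    rfl
  have hxl : ((l₁.map Sum.inl ++ l₂.map Sum.inr).map (genFamily xQ fun j => (xZ j : X))).sum =
      x - f := by
    rw [hxf, List.map_append, List.sum_append, List.map_map, List.map_map]
    refine congrArg₂ (· + ·) ?_ ?_
    · exact hl₁.trans hm.symm
    · exact hl₂.trans hz
  refine ⟨_, ⟨((u, v), f), ⟨Set.mem_univ _, hf⟩, rfl⟩, l₁.map Sum.inl ++ l₂.map Sum.inr, ?_, ?_⟩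
  · rw [hxl]
    simp only
    rw [mul_assoc _ (theta (datum R b) q f), ← theta_add hq.isLabeling, add_sub_cancel,
      theta_dom hq.isLabeling hx]
    have h1 : basisN (datum R b) q w * basisN (datum R b) q (lin X v) =
        basisN (datum R b) q (lin X u) * basisN (datum R b) q (tr R.weylGroup x) := by
      rw [AffineHecke.basisN_mul hlen, e, AffineHecke.basisN_mul (hx.len_lin_mul_tr u)]
    rw [← h1, mul_assoc, Ring.mul_inverse_cancel _ (isUnit_basisN hq.isLabeling _), mul_one]
  · rw [List.length_append, List.length_map, List.length_map, Nat.cast_add, hl₂']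
    have h1 := hKb m (xZ.repr y')
    have h2 : (l₁.length : ℝ) = m.sum fun _ c => (c : ℝ) := by
      rw [hl₁', Finsupp.sum, Finsupp.sum, Nat.cast_sum]
    rw [h2]
    refine h1.trans (mul_le_mul_of_nonneg_left ?_ hK.le)
    rw [hz, ← show y = m.sum fun i c => c • xQ i from hm, ← hxf]
    exact hc w u v x f hf e

theorem exists_bound_indRep {κ₀ : Type*} [Finite κ₀] (hq : IsLabelFunction (datum R b) q)
    {P : Par b} (δ : DS P q) (x : κ₀ → X) (hx : ∀ i, Dom (datum R b) (x i)) {K c : ℝ} (hK : 0 < K)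
    (hc : 0 ≤ c) {T : Set (Hk R b q × Hk R b q)} (hT : T.Finite)
    (hw : ∀ w : WX R, ∃ h ∈ T, ∃ l : List κ₀, basisN (datum R b) q w =
        h.1 * theta (datum R b) q (l.map x).sum * h.2 ∧ (l.length : ℝ) ≤ K * (normW R b z w + c))
    (Ω : Set (AddChar X ℂ)) (hΩ : Ω ⊆ torus P)
    (hbd : ∀ y, ∃ M : ℝ, ∀ t ∈ Ω, ‖t y‖ ≤ M) (ν : AddChar X ℂ → ℝ) (hν1 : ∀ t ∈ Ω, 1 ≤ ν t)
    (hν : ∀ t ∈ Ω, ∀ i (w : R.weylGroup), ‖t (w • x i)‖ ≤ ν t) {r : ℝ}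
    (hr : ∀ t ∈ Ω, ν t ≤ r) :
    ∃ d : ℕ, ∃ C > 0, ∀ t ∈ Ω, ∀ w : WX R, ‖indRep δ t (basisN (datum R b) q w)‖ ≤
      C * (1 + normW R b z w) ^ d * ν t ^ (K * normW R b z w) := by
  obtain ⟨d, C, hC, hl⟩ := exists_bound_theta_list hq δ x hx Ω hΩ hbd ν hν1 hν
  have hB : ∀ h : Hk R b q, ∃ B : ℝ, 0 ≤ B ∧ ∀ t ∈ Ω, ‖indRep δ t h‖ ≤ B := fun h =>
    (indRep_isLaurent δ h).exists_bound hbd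
  choose B hB0 hB using hB
  obtain ⟨M, hM⟩ := (hT.image fun h => B h.1 * B h.2).bddAbove
  set A : ℝ := 1 + K * (1 + c) with hA
  have hA1 : 0 < A := by positivity
  refine ⟨d, C * (1 + |M|) * A ^ d * (max r 1) ^ (K * c), by positivity, fun t ht w => ?_⟩
  obtain ⟨h, hh, l, e, hlen⟩ := hw w
  have hν0 : 0 < ν t := zero_lt_one.trans_le (hν1 t ht)
  have hN := normW_nonneg b z w
  have e1 : indRep δ t (basisN (datum R b) q w) = indRep δ t h.1 *
      indRep δ t (theta (datum R b) q (l.map x).sum) * indRep δ t h.2 := by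
    rw [e, ← indHom_apply hq δ (hΩ ht), map_mul, map_mul]
    rfl
  have h1 : ‖indRep δ t h.1‖ * ‖indRep δ t h.2‖ ≤ 1 + |M| :=
    (mul_le_mul (hB _ t ht) (hB _ t ht) (norm_nonneg _) (hB0 _)).trans
      ((hM ⟨h, hh, rfl⟩).trans ((le_abs_self M).trans (by linarith)))
  have h2 : (1 + (l.length : ℝ)) ^ d ≤ A ^ d * (1 + normW R b z w) ^ d := by
    rw [← mul_pow]
    refine pow_le_pow_left₀ (by positivity) ?_ d
    have : 0 ≤ K * c := by positivity
    have : 0 ≤ K * c * normW R b z w := by positivity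
    nlinarith
  have h3 : ν t ^ l.length ≤ ν t ^ (K * normW R b z w) * (max r 1) ^ (K * c) := by
    rw [← Real.rpow_natCast]
    refine (Real.rpow_le_rpow_of_exponent_le (hν1 t ht) hlen).trans ?_
    rw [mul_add, Real.rpow_add hν0]
    refine mul_le_mul_of_nonneg_left ?_ (Real.rpow_nonneg hν0.le _)
    exact Real.rpow_le_rpow hν0.le ((hr t ht).trans (le_max_left _ _)) (by positivity)
  rw [e1]
  refine (norm_mul_le _ _).trans ((mul_le_mul_of_nonneg_right (norm_mul_le _ _)
    (norm_nonneg _)).trans ?_)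
  calc _ = ‖indRep δ t h.1‖ * ‖indRep δ t h.2‖ *
        ‖indRep δ t (theta (datum R b) q (l.map x).sum)‖ := by ring
    _ ≤ (1 + |M|) * (C * (A ^ d * (1 + normW R b z w) ^ d) *
        (ν t ^ (K * normW R b z w) * (max r 1) ^ (K * c))) := by
      refine mul_le_mul h1 ((hl t ht l).trans ?_) (norm_nonneg _) (by positivity)
      have := Real.rpow_nonneg hν0.le (K * normW R b z w)
      gcongr
    _ = _ := by ring

section Nu

variable {κ₁ κ₂ : Type*} [Finite κ₁] [Finite κ₂] (xQ : κ₁ → X) (xZ : κ₂ → X)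

omit [R.IsReduced]

theorem bddAbove_nu (t : AddChar X ℂ) :
    BddAbove ({1} ∪ {r | ∃ j, r = ‖t (xZ j)‖ ∨ r = ‖t (-xZ j)‖} ∪
      {r | ∃ (i : κ₁) (w : R.weylGroup), r = ‖t (w • xQ i)‖}) := by
  refine Set.Finite.bddAbove (((Set.finite_singleton _).union ?_).union ?_)
  · refine ((Set.finite_range fun j => ‖t (xZ j)‖).union
      (Set.finite_range fun j => ‖t (-xZ j)‖)).subset ?_
    rintro _ ⟨j, rfl | rfl⟩
    exacts [Or.inl ⟨j, rfl⟩, Or.inr ⟨j, rfl⟩]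
  · refine (Set.finite_range fun p : κ₁ × R.weylGroup => ‖t (p.2 • xQ p.1)‖).subset ?_
    rintro _ ⟨i, w, rfl⟩
    exact ⟨(i, w), rfl⟩

theorem one_le_nu (t : AddChar X ℂ) : 1 ≤ nu (R := R) xQ xZ t :=
  le_csSup (bddAbove_nu xQ xZ t) (Or.inl (Or.inl rfl))

theorem norm_smul_xQ_le_nu (t : AddChar X ℂ) (i : κ₁) (w : R.weylGroup) :
    ‖t (w • xQ i)‖ ≤ nu (R := R) xQ xZ t :=
  le_csSup (bddAbove_nu xQ xZ t) (Or.inr ⟨i, w, rfl⟩)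

theorem norm_xZ_le_nu (t : AddChar X ℂ) (j : κ₂) : ‖t (xZ j)‖ ≤ nu (R := R) xQ xZ t :=
  le_csSup (bddAbove_nu xQ xZ t) (Or.inl (Or.inr ⟨j, Or.inl rfl⟩))

theorem norm_neg_xZ_le_nu (t : AddChar X ℂ) (j : κ₂) : ‖t (-xZ j)‖ ≤ nu (R := R) xQ xZ t :=
  le_csSup (bddAbove_nu xQ xZ t) (Or.inl (Or.inr ⟨j, Or.inr rfl⟩))

end Nu

omit [R.IsReduced] in
theorem norm_genFamily_le_nu {κ₁ κ₂ : Type*} [Finite κ₁] [Finite κ₂] (xQ : κ₁ → X)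
    (xZ : κ₂ → centralLattice R) (t : AddChar X ℂ) (i : κ₁ ⊕ κ₂ × Bool) (w : R.weylGroup) :
    ‖t (w • genFamily xQ (fun j => (xZ j : X)) i)‖ ≤ nu (R := R) xQ (fun j => (xZ j : X)) t := by
  obtain i | ⟨j, s | s⟩ := i
  · exact norm_smul_xQ_le_nu _ _ t i w
  · change ‖t (w • -(xZ j : X))‖ ≤ _
    rw [smul_neg, smul_central]
    exact norm_neg_xZ_le_nu xQ (fun j => (xZ j : X)) t j
  · change ‖t (w • (xZ j : X))‖ ≤ _
    rw [smul_central]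
    exact norm_xZ_le_nu xQ (fun j => (xZ j : X)) t j

/-- The values of the characters in a domain `ν(|t|) ≤ r` are bounded. -/
theorem exists_bound_of_nu_le {κ₁ κ₂ : Type*} [Finite κ₁] [Finite κ₂] (xQ : κ₁ → X)
    (xZ : Module.Basis κ₂ ℤ (centralLattice R))
    (hxQ : (AddSubmonoid.closure (Set.range xQ) : Set X) =
        {x | x ∈ R.rootSpan ℤ ∧ ∀ i, (datum R b).pos i → 0 ≤ R.coroot' i x}) (r : ℝ) (y : X) :
    ∃ M : ℝ, ∀ t ∈ {t : AddChar X ℂ | nu (R := R) xQ (fun j => (xZ j : X)) t ≤ r}, ‖t y‖ ≤ M := by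
  set Ω := {t : AddChar X ℂ | nu (R := R) xQ (fun j => (xZ j : X)) t ≤ r}
  let S : AddSubmonoid X :=
    { carrier := {y | ∃ M : ℝ, ∀ t ∈ Ω, ‖t y‖ ≤ M}
      zero_mem' := ⟨1, fun t _ => by rw [AddChar.map_zero_eq_one, norm_one]⟩
      add_mem' := by
        rintro y y' ⟨M, hM⟩ ⟨M', hM'⟩
        refine ⟨M * M', fun t ht => ?_⟩
        rw [AddChar.map_add_eq_mul, norm_mul]
        exact mul_le_mul (hM t ht) (hM' t ht) (norm_nonneg _) ((norm_nonneg _).trans (hM t ht)) }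
  change y ∈ S
  have hroot : ∀ (n : ℕ), 0 < n → ∀ y, n • y ∈ S → y ∈ S := by
    rintro n hn y ⟨M, hM⟩
    refine ⟨max 1 M, fun t ht => ?_⟩
    by_contra hcon
    have h1 : max 1 M < ‖t y‖ := not_le.1 hcon
    have h2 := hM t ht
    rw [AddChar.map_nsmul_eq_pow, norm_pow] at h2
    have h3 : 1 < ‖t y‖ := (le_max_left _ _).trans_lt h1
    have h4 := le_self_pow₀ h3.le hn.ne'
    linarith [le_max_right 1 M]
  have hZ : ∀ y : centralLattice R, (y : X) ∈ S := by
    intro y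
    have h0 : ∀ j, (xZ j : X) ∈ S ∧ -(xZ j : X) ∈ S := fun j =>
      ⟨⟨r, fun t ht => (norm_xZ_le_nu xQ (fun j => (xZ j : X)) t j).trans ht⟩,
        ⟨r, fun t ht => (norm_neg_xZ_le_nu xQ (fun j => (xZ j : X)) t j).trans ht⟩⟩
    rw [← xZ.linearCombination_repr y, Finsupp.linearCombination_apply, Finsupp.sum,
      AddSubmonoidClass.coe_finsetSum]
    refine sum_mem fun j _ => ?_
    change (xZ.repr y j : ℤ) • (xZ j : X) ∈ S
    obtain ⟨n, hn | hn⟩ := (xZ.repr y j).eq_nat_or_neg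
    · rw [hn, natCast_zsmul]; exact nsmul_mem (h0 j).1 n
    · rw [hn, neg_smul, natCast_zsmul, ← smul_neg]; exact nsmul_mem (h0 j).2 n
  have hdom : ∀ y ∈ R.rootSpan ℤ, Dom (datum R b) y → ∀ g : R.weylGroup, g • y ∈ S := by
    intro y hy hyd g
    have hy' : y ∈ (AddSubmonoid.closure (Set.range xQ) : Set X) := by
      rw [hxQ]; exact ⟨hy, hyd⟩
    have hle : AddSubmonoid.closure (Set.range xQ) ≤
        S.comap (DistribSMul.toAddMonoidHom X g) := by
      rw [AddSubmonoid.closure_le]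
      rintro _ ⟨i, rfl⟩
      exact ⟨r, fun t ht => (norm_smul_xQ_le_nu xQ (fun j => (xZ j : X)) t i g).trans ht⟩
    exact hle hy'
  have hρ : twoRho (datum R b) ∈ R.rootSpan ℤ := by
    cases nonempty_fintype ι
    classical
    rw [twoRho, finsum_cond_eq_sum_filter]
    exact sum_mem fun i _ => Submodule.subset_span ⟨i, rfl⟩
  have hnegρ : -twoRho (datum R b) ∈ S := by
    classical
    cases nonempty_fintype R.weylGroup
    obtain ⟨y, hy1, hy2⟩ := exists_weylSum R (twoRho (datum R b))
    have hy0 : (y : X) = 0 := by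
      refine eq_zero_of_mem_rootSpan ?_ y.2
      rw [← sub_sub_cancel (Nat.card R.weylGroup • twoRho (datum R b)) (y : X)]
      exact sub_mem ((R.rootSpan ℤ).smul_of_tower_mem _ hρ) hy2
    rw [hy0, finsum_eq_sum_of_fintype, ← Finset.add_sum_erase _ _ (Finset.mem_univ 1),
      one_smul] at hy1
    rw [neg_eq_of_add_eq_zero_right hy1.symm]
    exact sum_mem fun g _ => hdom _ hρ (dom_twoRho (D := datum R b) R.weylGroup) g
  have hQ : ∀ y ∈ R.rootSpan ℤ, y ∈ S := by
    intro y hy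
    obtain ⟨h1, h2⟩ := dom_shift (D := datum R b) R.weylGroup y
    set k := ∑ᶠ j, |(datum R b).coroot j y|
    have hk : 0 ≤ k := finsum_nonneg fun j => abs_nonneg _
    have h3 := hdom _ (add_mem hy (Submodule.smul_mem _ k hρ)) h2 1
    rw [one_smul] at h3
    obtain ⟨n, hn⟩ := Int.eq_ofNat_of_zero_le hk
    have h4 := add_mem h3 (nsmul_mem hnegρ n)
    rwa [hn, natCast_zsmul, smul_neg, add_neg_cancel_right] at h4
  obtain ⟨y', -, hy'⟩ := exists_weylSum R y
  refine hroot _ (Nat.card_pos (α := R.weylGroup)) y ?_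
  rw [← sub_add_cancel (Nat.card R.weylGroup • y) (y' : X)]
  exact add_mem (hQ _ hy') (hZ y')

omit [R.IsReduced] in
theorem norm_matrixCoeff_le {P : Par b} (δ : DS P q) (A : indSpace δ →L[ℂ] indSpace δ) {B : ℝ}
    (hA : ‖A‖ ≤ B) (a a' : indSpace δ) : ‖inner ℂ a (A a')‖ ≤ B * ‖a‖ * ‖a'‖ := by
  refine (norm_inner_le_norm _ _).trans ?_
  rw [mul_comm B, mul_assoc]
  exact mul_le_mul_of_nonneg_left ((A.le_opNorm a').trans
    (mul_le_mul_of_nonneg_right hA (norm_nonneg _))) (norm_nonneg _)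

/-- The uniform estimates of the matrix coefficients. -/
theorem exists_bound_matrixCoeff [Module.Finite ℤ X] (hq : IsLabelFunction (datum R b) q)
    {κ₁ κ₂ : Type*} [Finite κ₁] (xQ : κ₁ → X) (xZ : Module.Basis κ₂ ℤ (centralLattice R))
    (hxQ : (AddSubmonoid.closure (Set.range xQ) : Set X) =
        {x | x ∈ R.rootSpan ℤ ∧ ∀ i, (datum R b).pos i → 0 ≤ R.coroot' i x}) {K : ℝ} (hK : 0 < K)
    (hKb : ∀ (m : κ₁ →₀ ℕ) (m' : κ₂ →₀ ℤ),
        (m.sum fun _ c => (c : ℝ)) + (m'.sum fun _ c => |(c : ℝ)|) ≤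
          K * normW R b z (tr R.weylGroup
            ((m.sum fun i c => c • xQ i) + (m'.sum fun j c => c • (xZ j : X)))))
    (r : ℝ) {P : Par b} (δ : DS P q) :
    ∃ d : ℕ, ∃ C > 0, ∀ (w : WX R) (a a' : indSpace δ), ∀ t ∈ torus P,
      nu (R := R) xQ (fun j => (xZ j : X)) t ≤ r →
        ‖inner ℂ a (indRep δ t (basisN (datum R b) q w) a')‖ ≤
          C * ‖a‖ * ‖a'‖ * (1 + normW R b z w) ^ d *
            nu (R := R) xQ (fun j => (xZ j : X)) t ^ (K * normW R b z w) := by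
  have : Finite κ₂ := Module.Finite.finite_basis xZ
  obtain ⟨T, hT, c, hc0, hw⟩ := exists_decomposition z hq xQ xZ hxQ hK hKb
  have hdom : ∀ i, Dom (datum R b) (genFamily xQ (fun j => (xZ j : X)) i) := by
    rintro (i | ⟨j, s⟩) k hk
    · have : xQ i ∈ (AddSubmonoid.closure (Set.range xQ) : Set X) :=
        AddSubmonoid.subset_closure ⟨i, rfl⟩
      rw [hxQ] at this
      exact this.2 k hk
    · have h0 : (datum R b).coroot k (xZ j : X) = 0 := (xZ j).2 k
      cases s
      · change 0 ≤ (datum R b).coroot k (-(xZ j : X))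
        rw [map_neg, h0, neg_zero]
      · exact h0.ge
  obtain ⟨d, C, hC, h⟩ := exists_bound_indRep z hq δ _ hdom hK hc0 hT hw
    {t | t ∈ torus P ∧ nu (R := R) xQ (fun j => (xZ j : X)) t ≤ r} (fun t ht => ht.1)
    (fun y => by
      obtain ⟨M, hM⟩ := exists_bound_of_nu_le xQ xZ hxQ r y
      exact ⟨M, fun t ht => hM t ht.2⟩)
    (nu (R := R) xQ (fun j => (xZ j : X))) (fun t _ => one_le_nu xQ _ t)
    (fun t _ i w => norm_genFamily_le_nu xQ xZ t i w) (fun t ht => ht.2)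
  refine ⟨d, C, hC, fun w a a' t ht hr => (norm_matrixCoeff_le δ _ (h t ⟨ht, hr⟩ w) a a').trans_eq ?_⟩
  ring

end RootData


open RootedDatum

/-! #### Trigonometric polynomials on the compact tori -/

section Calculus

variable {ι X Y : Type*} [AddCommGroup X] [AddCommGroup Y] {R : RootDatum ι X Y} {b : R.Base}
variable {P : Par b} {F F' : Type*} [NormedAddCommGroup F] [NormedSpace ℂ F]
  [NormedAddCommGroup F'] [NormedSpace ℂ F']

/-- Trigonometric polynomials on `T^P_u`. -/
def TrigPoly (f : UTorus P → F) : Prop :=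
  ∃ c : X →₀ F, ∀ t, f t = c.sum fun x A => t.1 x • A

theorem IsLaurent.trigPoly {f : AddChar X ℂ → F} (hf : IsLaurent f) :
    TrigPoly fun t : UTorus P => f t.1 := by
  obtain ⟨c, hc⟩ := hf
  exact ⟨c, fun t => hc t.1⟩

theorem TrigPoly.exists_laurent {f : UTorus P → F} (hf : TrigPoly f) :
    ∃ g : AddChar X ℂ → F, IsLaurent g ∧ f = fun t => g t.1 := by
  obtain ⟨c, hc⟩ := hf
  exact ⟨_, ⟨c, fun t => rfl⟩, funext hc⟩

namespace TrigPoly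

theorem single (x : X) (A : F) : TrigPoly fun t : UTorus P => t.1 x • A :=
  (isLaurent_single x A).trigPoly

theorem add {f g : UTorus P → F} (hf : TrigPoly f) (hg : TrigPoly g) :
    TrigPoly fun t => f t + g t := by
  obtain ⟨f', hf', rfl⟩ := hf.exists_laurent
  obtain ⟨g', hg', rfl⟩ := hg.exists_laurent
  exact (hf'.add hg').trigPoly

theorem sum {κ : Type*} {s : Finset κ} {f : κ → UTorus P → F} (hf : ∀ i ∈ s, TrigPoly (f i)) :
    TrigPoly fun t => ∑ i ∈ s, f i t := by
  classical
  induction s using Finset.induction_on with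
  | empty => simp only [Finset.sum_empty]; exact isLaurent_zero.trigPoly
  | insert i s hi ih =>
    simp only [Finset.sum_insert hi]
    exact (hf i (Finset.mem_insert_self _ _)).add
      (ih fun j hj => hf j (Finset.mem_insert_of_mem hj))

theorem map {f : UTorus P → F} (hf : TrigPoly f) (φ : F →ₗ[ℂ] F') :
    TrigPoly fun t => φ (f t) := by
  obtain ⟨f', hf', rfl⟩ := hf.exists_laurent
  exact (hf'.map φ).trigPoly

theorem mul {A : Type*} [NormedRing A] [NormedAlgebra ℂ A] {f g : UTorus P → A} (hf : TrigPoly f)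
    (hg : TrigPoly g) : TrigPoly fun t => f t * g t := by
  obtain ⟨c, hc⟩ := hf
  obtain ⟨d, hd⟩ := hg
  have e : (fun t => f t * g t) = fun t : UTorus P => ∑ x ∈ c.support, ∑ y ∈ d.support,
      t.1 (x + y) • (c x * d y) := by
    funext t
    rw [hc, hd, Finsupp.sum, Finsupp.sum, Finset.sum_mul_sum]
    refine Finset.sum_congr rfl fun x _ => Finset.sum_congr rfl fun y _ => ?_
    rw [smul_mul_smul_comm, AddChar.map_add_eq_mul]
  rw [e]
  exact TrigPoly.sum fun x _ => TrigPoly.sum fun y _ => TrigPoly.single _ _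

theorem const (A : F) : TrigPoly fun _ : UTorus P => A := by
  have := TrigPoly.single (P := P) 0 A
  simpa using this

theorem exists_bound {f : UTorus P → F} (hf : TrigPoly f) : ∃ C : ℝ, 0 ≤ C ∧ ∀ t, ‖f t‖ ≤ C := by
  obtain ⟨f', hf', rfl⟩ := hf.exists_laurent
  obtain ⟨C, hC0, hC⟩ := hf'.exists_bound (Ω := {t | ∀ x, ‖t x‖ = 1})
    fun x => ⟨1, fun t ht => (ht x).le⟩
  exact ⟨C, hC0, fun t => hC _ t.2.2⟩

theorem shift_zero (t : UTorus P) : t.shift 0 = t := by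
  refine Subtype.ext (DFunLike.ext _ _ fun x => ?_)
  change t.1 x * Complex.exp (((0 : lieT P).1 x : ℝ) * Complex.I) = _
  simp

theorem shift_add (t : UTorus P) (v w : lieT P) : t.shift (v + w) = (t.shift v).shift w := by
  refine Subtype.ext (DFunLike.ext _ _ fun x => ?_)
  change t.1 x * Complex.exp (((v + w : lieT P).1 x : ℝ) * Complex.I) =
    t.1 x * Complex.exp ((v.1 x : ℝ) * Complex.I) * Complex.exp ((w.1 x : ℝ) * Complex.I)
  rw [mul_assoc, ← Complex.exp_add, Submodule.coe_add, LinearMap.add_apply, Complex.ofReal_add,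
    add_mul]

theorem hasDerivAt_single (x : X) (A : F) (t : UTorus P) (v : lieT P) :
    HasDerivAt (fun s : ℝ => (t.shift (s • v)).1 x • A)
      (t.1 x • ((v.1 x : ℂ) * Complex.I) • A) 0 := by
  have h1 : HasDerivAt (fun s : ℝ => (s : ℂ) * ((v.1 x : ℂ) * Complex.I))
      ((v.1 x : ℂ) * Complex.I) 0 := by
    have := (Complex.ofRealCLM.hasDerivAt (x := (0 : ℝ))).mul_const ((v.1 x : ℂ) * Complex.I)
    simpa using this
  have h2 := ((h1.cexp).const_mul (t.1 x)).smul_const A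
  have e : (fun s : ℝ => (t.shift (s • v)).1 x • A) =
      fun s : ℝ => (t.1 x * Complex.exp ((s : ℂ) * ((v.1 x : ℂ) * Complex.I))) • A := by
    funext s
    change (t.1 x * Complex.exp (((s • v).1 x : ℝ) * Complex.I)) • A = _
    rw [Submodule.coe_smul, LinearMap.smul_apply, smul_eq_mul, Complex.ofReal_mul, mul_assoc]
  rw [e]
  convert h2 using 1
  simp [smul_smul]

theorem hasDerivAt_aux {f : UTorus P → F} (hf : TrigPoly f) (v : lieT P) :
    ∃ g : UTorus P → F, TrigPoly g ∧
      ∀ t, HasDerivAt (fun s : ℝ => f (t.shift (s • v))) (g t) 0 := by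
  obtain ⟨c, hc⟩ := hf
  refine ⟨fun t => ∑ x ∈ c.support, t.1 x • ((v.1 x : ℂ) * Complex.I) • c x,
    TrigPoly.sum fun x _ => TrigPoly.single _ _, fun t => ?_⟩
  simp only [hc, Finsupp.sum]
  have := HasDerivAt.sum (u := c.support) fun x _ => hasDerivAt_single x (c x) t v
  rwa [Finset.sum_fn] at this

theorem hasDerivAt {f : UTorus P → F} (hf : TrigPoly f) (v : lieT P) (t : UTorus P) :
    HasDerivAt (fun s : ℝ => f (t.shift (s • v))) (vecField v f t) 0 := by
  obtain ⟨g, -, hg⟩ := hf.hasDerivAt_aux v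
  exact (hg t).differentiableAt.hasDerivAt

theorem vecField {f : UTorus P → F} (hf : TrigPoly f) (v : lieT P) : TrigPoly (vecField v f) := by
  obtain ⟨g, h1, hg⟩ := hf.hasDerivAt_aux v
  have : AffineHecke.vecField v f = g := funext fun t => (hg t).deriv
  rwa [this]

theorem foldr {f : UTorus P → F} (hf : TrigPoly f) (l : List (lieT P)) :
    TrigPoly (l.foldr AffineHecke.vecField f) := by
  induction l with
  | nil => exact hf
  | cons v l ih => exact ih.vecField v

theorem vecField_add {f g : UTorus P → F} (hf : TrigPoly f) (hg : TrigPoly g) (v : lieT P) :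
    AffineHecke.vecField v (fun t => f t + g t) =
      fun t => AffineHecke.vecField v f t + AffineHecke.vecField v g t :=
  funext fun t => ((hf.hasDerivAt v t).add (hg.hasDerivAt v t)).deriv

theorem vecField_sum {κ : Type*} {s : Finset κ} {f : κ → UTorus P → F}
    (hf : ∀ i ∈ s, TrigPoly (f i)) (v : lieT P) : AffineHecke.vecField v (fun t => ∑ i ∈ s, f i t) =
      fun t => ∑ i ∈ s, AffineHecke.vecField v (f i) t := by
  funext t
  have := HasDerivAt.sum (u := s) fun i hi => (hf i hi).hasDerivAt v t
  rw [Finset.sum_fn] at this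
  exact this.deriv

theorem vecField_map {f : UTorus P → F} (hf : TrigPoly f) (φ : F →L[ℂ] F') (v : lieT P) :
    AffineHecke.vecField v (fun t => φ (f t)) = fun t => φ (AffineHecke.vecField v f t) :=
  funext fun t => ((φ.restrictScalars ℝ).hasFDerivAt.comp_hasDerivAt (0 : ℝ)
    (hf.hasDerivAt v t)).deriv

theorem foldr_map {f : UTorus P → F} (hf : TrigPoly f) (φ : F →L[ℂ] F') (l : List (lieT P)) :
    l.foldr AffineHecke.vecField (fun t => φ (f t)) =
      fun t => φ (l.foldr AffineHecke.vecField f t) := by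
  induction l with
  | nil => rfl
  | cons v l ih => rw [List.foldr_cons, ih, (hf.foldr l).vecField_map, List.foldr_cons]

theorem vecField_mul {A : Type*} [NormedRing A] [NormedAlgebra ℂ A] {f g : UTorus P → A}
    (hf : TrigPoly f) (hg : TrigPoly g) (v : lieT P) :
    AffineHecke.vecField v (fun t => f t * g t) =
      fun t => AffineHecke.vecField v f t * g t + f t * AffineHecke.vecField v g t := by
  funext t
  have := ((hf.hasDerivAt v t).mul (hg.hasDerivAt v t)).deriv
  rw [zero_smul, shift_zero] at this
  exact this

theorem list_prod {A κ : Type*} [NormedRing A] [NormedAlgebra ℂ A] {f : κ → UTorus P → A}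
    (hf : ∀ i, TrigPoly (f i)) (l : List κ) : TrigPoly fun t => (l.map fun i => f i t).prod := by
  induction l with
  | nil => exact TrigPoly.const _
  | cons i l ih => simp only [List.map_cons, List.prod_cons]; exact (hf i).mul ih

theorem vecField_list_prod {A κ : Type*} [NormedRing A] [NormedAlgebra ℂ A] {f : κ → UTorus P → A}
    (hf : ∀ i, TrigPoly (f i)) (v : lieT P) (l : List κ) :
    AffineHecke.vecField v (fun t => (l.map fun i => f i t).prod) = fun t =>
      ∑ j : Fin l.length, ((l.take j).map fun i => f i t).prod *
        AffineHecke.vecField v (f (l.get j)) t *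
        ((l.drop (j + 1)).map fun i => f i t).prod := by
  induction l with
  | nil =>
    funext t
    simp [AffineHecke.vecField]
  | cons i l ih =>
    simp only [List.map_cons, List.prod_cons]
    rw [vecField_mul (hf i) (TrigPoly.list_prod hf l), ih]
    funext t
    simp only [List.length_cons]
    rw [Fin.sum_univ_succ, Finset.mul_sum]
    refine congrArg₂ (· + ·) ?_ (Finset.sum_congr rfl fun j _ => ?_)
    · simp
    · simp [mul_assoc]

end TrigPoly

/-! #### Families with polynomially bounded derivatives -/

/-- Families of trigonometric polynomials whose derivatives of order at most `k` are bounded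
polynomially in the size of the index. -/
def Tempered {I : Type*} (σ : I → ℝ) : ℕ → (I → UTorus P → F) → Prop
  | 0, f => (∀ a, TrigPoly (f a)) ∧ ∃ d : ℕ, ∃ C : ℝ, 0 ≤ C ∧ ∀ a t, ‖f a t‖ ≤ C * σ a ^ d
  | k + 1, f => Tempered σ 0 f ∧ ∀ v, Tempered σ k fun a => vecField v (f a)

theorem tempered_zero {I : Type*} {σ : I → ℝ} {f : I → UTorus P → F} : Tempered σ 0 f ↔
    (∀ a, TrigPoly (f a)) ∧ ∃ d : ℕ, ∃ C : ℝ, 0 ≤ C ∧ ∀ a t, ‖f a t‖ ≤ C * σ a ^ d := by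
  rw [Tempered]

theorem tempered_succ {I : Type*} {σ : I → ℝ} {k : ℕ} {f : I → UTorus P → F} :
    Tempered σ (k + 1) f ↔ Tempered σ 0 f ∧ ∀ v, Tempered σ k fun a => vecField v (f a) := by
  rw [tempered_zero, Tempered, tempered_zero]

namespace Tempered

variable {I I' : Type*} {σ : I → ℝ} {k : ℕ}

theorem vecField {f : I → UTorus P → F} (hf : Tempered σ (k + 1) f) (v : lieT P) :
    Tempered σ k fun a => vecField v (f a) :=
  (tempered_succ.1 hf).2 v

theorem zero {f : I → UTorus P → F} (hf : Tempered σ k f) : Tempered σ 0 f := by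
  cases k with
  | zero => exact hf
  | succ k => exact (tempered_succ.1 hf).1

theorem trigPoly {f : I → UTorus P → F} (hf : Tempered σ k f) (a : I) : TrigPoly (f a) :=
  (tempered_zero.1 hf.zero).1 a

theorem of_succ {f : I → UTorus P → F} (hf : Tempered σ (k + 1) f) : Tempered σ k f := by
  induction k generalizing f with
  | zero => exact hf.zero
  | succ k ih => exact tempered_succ.2 ⟨hf.zero, fun v => ih (hf.vecField v)⟩

theorem foldr_bound {f : I → UTorus P → F} (hf : ∀ k, Tempered σ k f) (l : List (lieT P)) :
    ∃ d : ℕ, ∃ C : ℝ, 0 ≤ C ∧ ∀ a t, ‖l.foldr AffineHecke.vecField (f a) t‖ ≤ C * σ a ^ d := by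
  induction l using List.reverseRecOn generalizing f with
  | nil => exact (tempered_zero.1 (hf 0)).2
  | append_singleton l v ih =>
    simp only [List.foldr_append, List.foldr_cons, List.foldr_nil]
    exact ih fun k => (hf (k + 1)).vecField v

theorem add (hσ : ∀ a, 1 ≤ σ a) {f g : I → UTorus P → F} (hf : Tempered σ k f)
    (hg : Tempered σ k g) : Tempered σ k fun a t => f a t + g a t := by
  induction k generalizing f g with
  | zero =>
    obtain ⟨hf1, d, C, hC, h⟩ := tempered_zero.1 hf
    obtain ⟨hg1, d', C', hC', h'⟩ := tempered_zero.1 hg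
    refine tempered_zero.2 ⟨fun a => (hf1 a).add (hg1 a), d + d', C + C', add_nonneg hC hC', fun a t => ?_⟩
    refine (norm_add_le _ _).trans ((add_le_add (h a t) (h' a t)).trans ?_)
    rw [add_mul]
    have h1 := pow_le_pow_right₀ (hσ a) (Nat.le_add_right d d')
    have h2 := pow_le_pow_right₀ (hσ a) (Nat.le_add_left d' d)
    gcongr
  | succ k ih =>
    refine tempered_succ.2 ⟨ih hf.of_succ hg.of_succ |>.zero, fun v => ?_⟩
    simp only [TrigPoly.vecField_add (hf.trigPoly _) (hg.trigPoly _)]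
    exact ih (hf.vecField v) (hg.vecField v)

theorem mul {A : Type*} [NormedRing A] [NormedAlgebra ℂ A] (hσ : ∀ a, 1 ≤ σ a)
    {f g : I → UTorus P → A} (hf : Tempered σ k f) (hg : Tempered σ k g) :
    Tempered σ k fun a t => f a t * g a t := by
  induction k generalizing f g with
  | zero =>
    obtain ⟨hf1, d, C, hC, h⟩ := tempered_zero.1 hf
    obtain ⟨hg1, d', C', hC', h'⟩ := tempered_zero.1 hg
    refine tempered_zero.2 ⟨fun a => (hf1 a).mul (hg1 a), d + d', C * C', mul_nonneg hC hC', fun a t => ?_⟩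
    refine (norm_mul_le _ _).trans ((mul_le_mul (h a t) (h' a t) (norm_nonneg _)
      ((norm_nonneg _).trans (h a t))).trans_eq ?_)
    rw [pow_add]; ring
  | succ k ih =>
    refine tempered_succ.2 ⟨ih hf.of_succ hg.of_succ |>.zero, fun v => ?_⟩
    simp only [TrigPoly.vecField_mul (hf.trigPoly _) (hg.trigPoly _)]
    exact (ih (hf.vecField v) hg.of_succ).add hσ (ih hf.of_succ (hg.vecField v))

theorem comp {σ' : I' → ℝ} {f : I → UTorus P → F} (hσ : ∀ a, 1 ≤ σ a)
    (hσ' : ∀ a, 1 ≤ σ' a) (hf : Tempered σ k f) (φ : I' → I) {M : ℝ} (hM : ∀ a, σ (φ a) ≤ M * σ' a) : Tempered σ' k fun a => f (φ a) := by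
  induction k generalizing f with
  | zero =>
    obtain ⟨hf1, d, C, hC, h⟩ := tempered_zero.1 hf
    refine tempered_zero.2 ⟨fun a => hf1 (φ a), d, C * |M| ^ d, by positivity, fun a t => (h (φ a) t).trans ?_⟩
    rw [mul_assoc, ← mul_pow]
    refine mul_le_mul_of_nonneg_left ?_ hC
    have h0 := hσ (φ a)
    have h1 := hM a
    have h2 : M * σ' a ≤ |M| * σ' a :=
      mul_le_mul_of_nonneg_right (le_abs_self M) (zero_le_one.trans (hσ' a))
    exact pow_le_pow_left₀ (by linarith) (h1.trans h2) d
  | succ k ih => exact tempered_succ.2 ⟨ih hf.of_succ |>.zero, fun v => ih (hf.vecField v)⟩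

theorem of_finite {I : Type*} [Finite I] {f : I → UTorus P → F} (hf : ∀ a, TrigPoly (f a)) :
    Tempered (fun _ => 1) k f := by
  cases nonempty_fintype I
  induction k generalizing f with
  | zero =>
    choose C hC0 hC using fun a => (hf a).exists_bound
    refine tempered_zero.2 ⟨hf, 0, ∑ a, C a, Finset.sum_nonneg fun a _ => hC0 a, fun a t => ?_⟩
    rw [one_pow, mul_one]
    exact (hC a t).trans (Finset.single_le_sum (fun a _ => hC0 a) (Finset.mem_univ a))
  | succ k ih => exact tempered_succ.2 ⟨ih hf |>.zero, fun v => ih fun a => (hf a).vecField v⟩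

theorem sum {n : I → ℕ} (hσ : ∀ a, 1 ≤ σ a) (hn : ∀ a, (n a : ℝ) ≤ σ a)
    {f : (Σ a, Fin (n a)) → UTorus P → F} (hf : Tempered (fun p => σ p.1) k f) :
    Tempered σ k fun a t => ∑ j, f ⟨a, j⟩ t := by
  induction k generalizing f with
  | zero =>
    obtain ⟨hf1, d, C, hC, h⟩ := tempered_zero.1 hf
    refine tempered_zero.2 ⟨fun a => TrigPoly.sum fun j _ => hf1 _, d + 1, C, hC, fun a t => ?_⟩
    refine (norm_sum_le _ _).trans ((Finset.sum_le_sum fun j _ => h ⟨a, j⟩ t).trans ?_)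
    change ∑ _i : Fin (n a), C * σ a ^ d ≤ _
    rw [Finset.sum_const, Finset.card_univ, Fintype.card_fin, nsmul_eq_mul, pow_succ, mul_comm,
      ← mul_assoc]
    have : 0 ≤ σ a := zero_le_one.trans (hσ a)
    exact mul_le_mul_of_nonneg_left (hn a) (by positivity)
  | succ k ih =>
    refine tempered_succ.2 ⟨ih hf.of_succ |>.zero, fun v => ?_⟩
    simp only [TrigPoly.vecField_sum fun j _ => hf.trigPoly _]
    exact ih (hf.vecField v)

theorem list_prod {A κ : Type*} [NormedRing A] [NormedAlgebra ℂ A] [Finite κ]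
    {f : κ → UTorus P → A} (hf : ∀ i, TrigPoly (f i))
    (h0 : Tempered (fun l : List κ => 1 + (l.length : ℝ)) 0
      fun l t => (l.map fun i => f i t).prod) (k : ℕ) :
    Tempered (fun l : List κ => 1 + (l.length : ℝ)) k fun l t => (l.map fun i => f i t).prod := by
  have hσ : ∀ l : List κ, 1 ≤ 1 + (l.length : ℝ) := fun l =>
    le_add_of_nonneg_right (Nat.cast_nonneg _)
  induction k with
  | zero => exact h0
  | succ k ih =>
    refine tempered_succ.2 ⟨h0, fun v => ?_⟩
    simp only [TrigPoly.vecField_list_prod hf]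
    refine Tempered.sum (n := fun l : List κ => l.length) (f := fun p t =>
        ((p.1.take p.2).map fun i => f i t).prod * AffineHecke.vecField v (f (p.1.get p.2)) t *
        ((p.1.drop (p.2 + 1)).map fun i => f i t).prod) hσ
      (fun l => le_add_of_nonneg_left zero_le_one) ?_
    have hσ' : ∀ p : Σ l : List κ, Fin l.length, 1 ≤ 1 + (p.1.length : ℝ) := fun p => hσ p.1
    refine mul hσ' (mul hσ' ?_ ?_) ?_
    · refine ih.comp hσ hσ' (fun p => p.1.take p.2) (M := 1) fun p => ?_
      rw [one_mul]
      have : (p.1.take p.2).length ≤ p.1.length := by simp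
      gcongr
    · refine (of_finite (fun i => (hf i).vecField v)).comp (fun _ => le_rfl) hσ'
        (fun p => p.1.get p.2) (M := 1) fun p => ?_
      rw [one_mul]
      exact hσ p.1
    · refine ih.comp hσ hσ' (fun p => p.1.drop (p.2 + 1)) (M := 1) fun p => ?_
      rw [one_mul]
      have : (p.1.drop (p.2 + 1)).length ≤ p.1.length := by simp
      gcongr

end Tempered

end Calculus


open RootedDatum

section RootData

variable {ι X Y : Type*} [AddCommGroup X] [AddCommGroup Y] {R : RootDatum ι X Y} {b : R.Base}
variable [Finite ι]

variable (R b) in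
/-- The monoid of dominant vectors in the root lattice is finitely generated. -/
theorem exists_generators : ∃ (n : ℕ) (x : Fin n → X), (∀ i, x i ≠ 0) ∧
    (AddSubmonoid.closure (Set.range x) : Set X) =
      {x | x ∈ R.rootSpan ℤ ∧ ∀ i, (datum R b).pos i → 0 ≤ R.coroot' i x} := by
  classical
  let Q : AddSubmonoid X :=
    { carrier := {x | x ∈ R.rootSpan ℤ ∧ ∀ i, (datum R b).pos i → 0 ≤ R.coroot' i x}
      zero_mem' := ⟨zero_mem _, fun i _ => (map_zero _).ge⟩
      add_mem' := fun hx hy => ⟨add_mem hx.1 hy.1, fun i hi => by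
        rw [map_add]; exact add_nonneg (hx.2 i hi) (hy.2 i hi)⟩ }
  let S : AddSubmonoid ({i // (datum R b).pos i} →₀ ℕ) :=
    { carrier := {f | ∃ x ∈ Q, ∀ i, R.coroot' i.1 x = f i}
      zero_mem' := ⟨0, zero_mem _, fun i => map_zero _⟩
      add_mem' := by
        rintro f g ⟨x, hx, hfx⟩ ⟨y, hy, hgy⟩
        refine ⟨x + y, add_mem hx hy, fun i => ?_⟩
        rw [map_add, hfx, hgy, Finsupp.add_apply, Nat.cast_add] }
  have hfg : S.FG := by
    refine AddSubmonoid.fg_of_subtractive ?_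
    rintro f ⟨x, hx, hfx⟩ g ⟨y, hy, hgy⟩
    have h : ∀ i : {i // (datum R b).pos i}, R.coroot' i.1 (y - x) = g i := fun i => by
      rw [map_sub, hgy, hfx, Finsupp.add_apply, Nat.cast_add, add_sub_cancel_left]
    exact ⟨y - x, ⟨sub_mem hy.1 hx.1, fun i hi => by rw [h ⟨i, hi⟩]; exact Nat.cast_nonneg _⟩, h⟩
  have hinj : ∀ x ∈ R.rootSpan ℤ, ∀ y ∈ R.rootSpan ℤ,
      (∀ i, (datum R b).pos i → R.coroot' i x = R.coroot' i y) → x = y := by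
    intro x hx y hy h
    rw [← sub_eq_zero]
    refine eq_zero_of_mem_rootSpan (sub_mem hx hy) fun i => ?_
    by_cases hi : (datum R b).pos i
    · rw [map_sub, h i hi, sub_self]
    · have h1 := h _ ((datum_pos_neg_iff i).2 hi)
      rw [coroot'_reflectionPerm_self, coroot'_reflectionPerm_self] at h1
      rw [map_sub]
      omega
  obtain ⟨T, hT⟩ := hfg
  have hTS : ∀ f ∈ T, f ∈ S := fun f hf => hT ▸ AddSubmonoid.subset_closure hf
  choose! x hxQ hx using hTS
  let e := (T.filter fun f => x f ≠ 0).equivFin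
  refine ⟨_, fun i => x (e.symm i).1, fun i => (Finset.mem_filter.1 (e.symm i).2).2, ?_⟩
  change _ = (Q : Set X)
  refine congrArg _ (le_antisymm ?_ fun y hy => ?_)
  · rw [AddSubmonoid.closure_le]
    rintro _ ⟨i, rfl⟩
    exact hxQ _ (Finset.mem_filter.1 (e.symm i).2).1
  · set C := AddSubmonoid.closure (Set.range fun i => x (e.symm i).1) with hC
    have hCQ : C ≤ Q := by
      rw [hC, AddSubmonoid.closure_le]
      rintro _ ⟨i, rfl⟩
      exact hxQ _ (Finset.mem_filter.1 (e.symm i).2).1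
    have key : ∀ f ∈ AddSubmonoid.closure (T : Set ({i // (datum R b).pos i} →₀ ℕ)),
        ∃ y ∈ C, ∀ i, R.coroot' i.1 y = f i := by
      intro f hf
      induction hf using AddSubmonoid.closure_induction with
      | mem f hf =>
        refine ⟨x f, ?_, hx f hf⟩
        by_cases h0 : x f = 0
        · rw [h0]; exact zero_mem _
        · refine AddSubmonoid.subset_closure ⟨e ⟨f, Finset.mem_filter.2 ⟨hf, h0⟩⟩, ?_⟩
          simp
      | zero => exact ⟨0, zero_mem _, fun i => map_zero _⟩
      | add f g _ _ hf hg =>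
        obtain ⟨y, hy, hfy⟩ := hf
        obtain ⟨y', hy', hgy⟩ := hg
        refine ⟨y + y', add_mem hy hy', fun i => ?_⟩
        rw [map_add, hfy, hgy, Finsupp.add_apply, Nat.cast_add]
    cases nonempty_fintype ι
    obtain ⟨y', hy', h⟩ := key (Finsupp.equivFunOnFinite.symm fun i => (R.coroot' i.1 y).toNat) (by
      rw [hT]
      refine ⟨y, hy, fun i => ?_⟩
      change _ = ((R.coroot' i.1 y).toNat : ℤ)
      rw [Int.toNat_of_nonneg (hy.2 _ i.2)])
    have : y = y' := hinj _ hy.1 _ (hCQ hy').1 fun i hi => by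
      rw [h ⟨i, hi⟩]
      change _ = ((R.coroot' i y).toNat : ℤ)
      rw [Int.toNat_of_nonneg (hy.2 _ hi)]
    rw [this]
    exact hy'

variable {κ : Type*} [Fintype κ] (z : Module.Basis κ ℤ (centralLattice R)) [R.IsReduced]

theorem sum_le_normW {κ₁ : Type*} {x : κ₁ → X} (h0 : ∀ i, x i ≠ 0)
    (hx : (AddSubmonoid.closure (Set.range x) : Set X) =
      {x | x ∈ R.rootSpan ℤ ∧ ∀ i, (datum R b).pos i → 0 ≤ R.coroot' i x})
    (m : κ₁ →₀ ℕ) (m' : κ →₀ ℤ) :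
    (m.sum fun _ c => (c : ℝ)) + (m'.sum fun _ c => |(c : ℝ)|) ≤
      1 * normW R b z (tr R.weylGroup
        ((m.sum fun i c => c • x i) + (m'.sum fun j c => c • (z j : X)))) := by
  have hxi : ∀ i, x i ∈ R.rootSpan ℤ ∧ Dom (datum R b) (x i) := fun i => by
    have : x i ∈ (AddSubmonoid.closure (Set.range x) : Set X) :=
      AddSubmonoid.subset_closure ⟨i, rfl⟩
    rwa [hx] at this
  have hz : (m'.sum fun j c => c • (z j : X)) =
      ((z.repr.symm m' : centralLattice R) : X) := by
    rw [Module.Basis.repr_symm_apply, Finsupp.linearCombination_apply, Finsupp.sum, Finsupp.sum,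
      AddSubmonoidClass.coe_finsetSum]
    rfl
  have hzN : zNorm z (z.repr.symm m') = m'.sum fun _ c => |(c : ℝ)| := by
    rw [zNorm, LinearEquiv.apply_symm_apply, Finsupp.sum_fintype]
    simp
  have hlen1 : ∀ i, 1 ≤ len (datum R b) (tr R.weylGroup (x i)) := by
    intro i
    by_contra hcon
    have h1 : len (datum R b) (tr R.weylGroup (x i)) = 0 := by omega
    refine h0 i (eq_zero_of_mem_rootSpan (hxi i).1 fun j => ?_)
    have key : ∀ j, (datum R b).pos j → R.coroot' j (x i) = 0 := by
      intro j hj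
      have h2 := (len_eq_zero_iff _).1 h1 (j, 0) ((affPos_zero _).2 hj)
      by_contra h3
      refine ((hxi i).2.tr_neg_iff R.weylGroup ((affPos_zero _).2 hj)).2 ⟨hj, ?_⟩ h2
      exact lt_of_le_of_ne ((hxi i).2 j hj) (Ne.symm h3)
    by_cases hj : (datum R b).pos j
    · exact key j hj
    · have h2 := key _ ((datum_pos_neg_iff j).2 hj)
      rw [coroot'_reflectionPerm_self] at h2
      omega
  have hsum : (m.sum fun i c => c • x i) ∈ R.rootSpan ℤ ∧ Dom (datum R b) (m.sum fun i c => c • x i) ∧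
      (m.sum fun _ c => (c : ℝ)) ≤ len (datum R b) (tr R.weylGroup (m.sum fun i c => c • x i)) := by
    have hmul : ∀ (i : κ₁) (c : ℕ), c • x i ∈ R.rootSpan ℤ ∧ Dom (datum R b) (c • x i) ∧
        c ≤ len (datum R b) (tr R.weylGroup (c • x i)) := by
      intro i c
      induction c with
      | zero => rw [zero_smul]; exact ⟨zero_mem _, Dom.zero, Nat.zero_le _⟩
      | succ c ih =>
        rw [succ_nsmul]
        refine ⟨add_mem ih.1 (hxi i).1, ih.2.1.add (hxi i).2, ?_⟩
        rw [ih.2.1.len_tr_add R.weylGroup (hxi i).2]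
        have := hlen1 i
        omega
    classical
    induction m using Finsupp.induction with
    | zero => simpa using Dom.zero
    | single_add i c f hi hc ih =>
      have hd : Disjoint (Finsupp.single i c).support f.support :=
        Finset.disjoint_of_subset_left Finsupp.support_single_subset
          (Finset.disjoint_singleton_left.2 hi)
      rw [Finsupp.sum_add_index_of_disjoint hd, Finsupp.sum_add_index_of_disjoint hd,
        Finsupp.sum_single_index (h := fun i c => c • x i) (zero_smul _ _),
        Finsupp.sum_single_index (by simp)]
      refine ⟨add_mem (hmul i c).1 ih.1, (hmul i c).2.1.add ih.2.1, ?_⟩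
      rw [(hmul i c).2.1.len_tr_add R.weylGroup ih.2.1, Nat.cast_add]
      exact add_le_add (Nat.cast_le.2 (hmul i c).2.2) ih.2.2
  rw [one_mul, normW, act_tr, add_zero]
  refine add_le_add (hsum.2.2.trans (Nat.cast_le.2 ?_)) ?_
  · have hdz : Dom (datum R b) (m'.sum fun j c => c • (z j : X)) := by
      rw [hz]
      exact fun j _ => ((z.repr.symm m').2 j).ge
    rw [hsum.2.1.len_tr_add R.weylGroup hdz]
    exact Nat.le_add_right _ _
  · rw [add_comm, centralNorm_add_rootSpan z _ hsum.1, hz, centralNorm_central, hzN]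

variable {q : WX R → ℝ} {P : Par b}

theorem indRep_mul (hq : IsLabelFunction (datum R b) q) (δ : DS P q) {t : AddChar X ℂ}
    (ht : t ∈ torus P) (g h : Hk R b q) :
    indRep δ t (g * h) = indRep δ t g * indRep δ t h :=
  map_mul (indHom hq δ ht) g h

/-- The derivatives of the operators `π(P, δ, t)(N_w)` grow polynomially in `w`. -/
theorem tempered_indRep [Module.Finite ℤ X] (hq : IsLabelFunction (datum R b) q) (δ : DS P q)
    (k : ℕ) : Tempered (fun w : WX R => 1 + normW R b z w) k
      fun w (t : UTorus P) => indRep δ t.1 (basisN (datum R b) q w) := by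
  obtain ⟨n, x, h0, hx⟩ := exists_generators R b
  obtain ⟨T, hT, c, hc0, hw⟩ := exists_decomposition z hq x z hx one_pos (sum_le_normW z h0 hx)
  have hdom : ∀ i, Dom (datum R b) (genFamily x (fun j => (z j : X)) i) := by
    rintro (i | ⟨j, s⟩) k hk
    · have : x i ∈ (AddSubmonoid.closure (Set.range x) : Set X) :=
        AddSubmonoid.subset_closure ⟨i, rfl⟩
      rw [hx] at this
      exact this.2 k hk
    · have h0 : (datum R b).coroot k (z j : X) = 0 := (z j).2 k
      cases s
      · change 0 ≤ (datum R b).coroot k (-(z j : X))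
        rw [map_neg, h0, neg_zero]
      · exact h0.ge
  set g := genFamily x (fun j => (z j : X)) with hg
  have hΩ : {t : AddChar X ℂ | t ∈ torus P ∧ ∀ x, ‖t x‖ = 1} ⊆ torus P := fun t ht => ht.1
  obtain ⟨d, C, hC, hl⟩ := exists_bound_theta_list hq δ g hdom _ hΩ
    (fun y => ⟨1, fun t ht => (ht.2 y).le⟩) (fun _ => 1) (fun _ _ => le_rfl)
    (fun t ht i w => (ht.2 _).le)
  have hprod : ∀ (t : UTorus P) (l : List (Fin n ⊕ κ × Bool)),
      (l.map fun i => indRep δ t.1 (theta (datum R b) q (g i))).prod =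
      indRep δ t.1 (theta (datum R b) q (l.map g).sum) := by
    intro t l
    induction l with
    | nil =>
      rw [List.map_nil, List.prod_nil, List.map_nil, List.sum_nil, theta_zero hq.isLabeling]
      exact (map_one (indHom hq δ t.2.1)).symm
    | cons i l ih =>
      rw [List.map_cons, List.prod_cons, ih, List.map_cons, List.sum_cons,
        theta_add hq.isLabeling]
      exact (map_mul (indHom hq δ t.2.1) _ _).symm
  have hlist := Tempered.list_prod (P := P)
    (f := fun i t => indRep δ t.1 (theta (datum R b) q (g i)))
    (fun i => (indRep_isLaurent δ _).trigPoly)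
    (tempered_zero.2 ⟨fun l => TrigPoly.list_prod
      (f := fun i t => indRep δ t.1 (theta (datum R b) q (g i)))
      (fun i => (indRep_isLaurent δ _).trigPoly) l, d, C, hC.le, fun l t => by
      rw [hprod]
      have := hl t.1 t.2 l
      rwa [one_pow, mul_one] at this⟩) k
  choose h hh l hwl hlen using hw
  have hσ : ∀ w : WX R, 1 ≤ 1 + normW R b z w := one_le_one_add_normW b z
  have hfin : Finite T := hT
  have h1 : Tempered (fun w : WX R => 1 + normW R b z w) k
      fun w (t : UTorus P) => indRep δ t.1 (h w).1 :=
    (Tempered.of_finite (f := fun (p : T) (t : UTorus P) => indRep δ t.1 p.1.1)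
      fun p => (indRep_isLaurent δ _).trigPoly).comp (fun _ => le_rfl) hσ
      (fun w => ⟨h w, hh w⟩) (M := 1) fun w => by rw [one_mul]; exact hσ w
  have h2 : Tempered (fun w : WX R => 1 + normW R b z w) k
      fun w (t : UTorus P) => indRep δ t.1 (h w).2 :=
    (Tempered.of_finite (f := fun (p : T) (t : UTorus P) => indRep δ t.1 p.1.2)
      fun p => (indRep_isLaurent δ _).trigPoly).comp (fun _ => le_rfl) hσ
      (fun w => ⟨h w, hh w⟩) (M := 1) fun w => by rw [one_mul]; exact hσ w
  have h3 := hlist.comp (fun l => le_add_of_nonneg_right (Nat.cast_nonneg _)) hσ l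
    (M := 1 + c) fun w => by
      have := hlen w
      have h4 := mul_nonneg hc0 (normW_nonneg b z w)
      rw [one_mul] at this
      linarith
  refine cast (congrArg _ (funext fun w => funext fun t => ?_)) ((h1.mul hσ h3).mul hσ h2)
  rw [hprod, hwl w, indRep_mul hq δ t.2.1, indRep_mul hq δ t.2.1]

/-- The estimates of the derivatives of the matrix coefficients. -/
theorem exists_bound_diffOp [Module.Finite ℤ X] (hq : IsLabelFunction (datum R b) q) (δ : DS P q)
    (D : List (lieT P) →₀ ℂ) : ∃ d : ℕ, ∃ C > 0,
      ∀ (t : UTorus P) (a a' : indSpace δ) (w : WX R),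
        ‖diffOp D (fun s => inner ℂ a (indRep δ s.1 (basisN (datum R b) q w) a')) t‖ ≤
          C * ‖a‖ * ‖a'‖ * (1 + normW R b z w) ^ d := by
  choose d C hC0 hC using Tempered.foldr_bound (P := P) (tempered_indRep z hq δ)
  refine ⟨∑ l ∈ D.support, d l, 1 + ∑ l ∈ D.support, ‖D l‖ * C l,
    add_pos_of_pos_of_nonneg one_pos (Finset.sum_nonneg fun l _ =>
      mul_nonneg (norm_nonneg _) (hC0 l)), fun t a a' w => ?_⟩
  have hN := one_le_one_add_normW b z w
  have e : ∀ l : List (lieT P), l.foldr vecField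
      (fun s : UTorus P => inner ℂ a (indRep δ s.1 (basisN (datum R b) q w) a')) t =
      inner ℂ a (l.foldr vecField
        (fun s : UTorus P => indRep δ s.1 (basisN (datum R b) q w)) t a') := by
    intro l
    exact congrFun (TrigPoly.foldr_map (indRep_isLaurent δ (basisN (datum R b) q w)).trigPoly
      ((innerSL ℂ a).comp (ContinuousLinearMap.apply ℂ (indSpace δ) a')) l) t
  rw [diffOp, Finsupp.sum]
  calc _ ≤ ∑ l ∈ D.support, ‖D l‖ * C l *
        ((1 + normW R b z w) ^ (∑ l ∈ D.support, d l) * ‖a‖ * ‖a'‖) := by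
        refine (norm_sum_le _ _).trans (Finset.sum_le_sum fun l hl => ?_)
        rw [norm_smul, e, mul_assoc]
        refine mul_le_mul_of_nonneg_left ((norm_matrixCoeff_le δ _ (hC l w t) a a').trans ?_)
          (norm_nonneg _)
        have h1 : (1 + normW R b z w) ^ d l ≤ (1 + normW R b z w) ^ (∑ l ∈ D.support, d l) :=
          pow_le_pow_right₀ hN (Finset.single_le_sum (fun _ _ => Nat.zero_le _) hl)
        have := hC0 l
        calc _ = C l * ((1 + normW R b z w) ^ d l * ‖a‖ * ‖a'‖) := by ring
          _ ≤ _ := by gcongr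
    _ = (∑ l ∈ D.support, ‖D l‖ * C l) *
        ((1 + normW R b z w) ^ (∑ l ∈ D.support, d l) * ‖a‖ * ‖a'‖) := by rw [Finset.sum_mul]
    _ ≤ (1 + ∑ l ∈ D.support, ‖D l‖ * C l) *
        ((1 + normW R b z w) ^ (∑ l ∈ D.support, d l) * ‖a‖ * ‖a'‖) := by
        refine mul_le_mul_of_nonneg_right (by linarith) (by positivity)
    _ = _ := by ring

end RootData


open RootedDatum

section Weights

variable {J L G : Type*} [AddCommGroup L] [Group G] [DistribMulAction G L]
variable {D : Datum J L} [RootedDatum D G] {q : AffW G L → ℝ} {qa : J × ℤ → ℝ}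

/-! ### Weight vectors in the affine Hecke algebra -/

variable (D G) in
include D G in
theorem isDomain_algebra : IsDomain (AddMonoidAlgebra ℂ L) := by
  have : IsAddTorsionFree L := ⟨fun n hn x y h => sub_eq_zero.1
    (torsionFree (D := D) (G := G) (n : ℤ) (x - y) (by exact_mod_cast hn)
      (by rw [smul_sub]; simpa [sub_eq_zero] using h))⟩
  have : TwoUniqueSums L := TwoUniqueSums.of_injective_addHom
    (DivisibleHull.coeAddMonoidHom L : L →ₙ+ DivisibleHull L)
    (fun _ _ h => DivisibleHull.coe_injective h) inferInstance
  have : NoZeroDivisors (AddMonoidAlgebra ℂ L) := inferInstance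
  exact NoZeroDivisors.to_isDomain _

omit [RootedDatum D G] in
theorem actA_injective (g : G) : Function.Injective (actA g : AddMonoidAlgebra ℂ L → _) :=
  Function.LeftInverse.injective (g := actA g⁻¹) fun a => by
    rw [← actA_mul, inv_mul_cancel, actA_one]

theorem exists_top_coefA (hqa : IsLabeling D q qa) {h : HeckeAlg D q} (hh : h ≠ 0) :
    ∃ g : G, coefA hqa g h ≠ 0 ∧ h ∈ lowerSpan D q (len D (lin L g) + 1) := by
  classical
  have hex : ∃ n, h ∈ lowerSpan (G := G) D q n := ⟨Nat.card J + 1, mem_lowerSpan_of_coefA hqa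
    fun g hg => absurd (len_lin_le (D := D) g) (by omega)⟩
  obtain ⟨n, hn⟩ : ∃ n, Nat.find hex = n + 1 := by
    refine Nat.exists_eq_succ_of_ne_zero fun h0 => hh ?_
    have h1 := Nat.find_spec hex
    rw [h0] at h1
    exact eq_zero_of_coefA hqa fun g => coefA_eq_zero_of_mem hqa h1 (Nat.zero_le _)
  have h1 := Nat.find_spec hex
  rw [hn] at h1
  have h2 : ¬ ∀ g : G, n ≤ len D (lin L g) → coefA hqa g h = 0 := fun h3 =>
    Nat.find_min hex (m := n) (by omega) (mem_lowerSpan_of_coefA hqa h3)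
  push Not at h2
  obtain ⟨g, hg, hc⟩ := h2
  refine ⟨g, hc, lowerSpan_mono (by omega) h1⟩

theorem eq_zero_of_thetaHom_mul (hqa : IsLabeling D q qa) {d : AddMonoidAlgebra ℂ L} (hd : d ≠ 0)
    {h : HeckeAlg D q} (hh : thetaHom hqa d * h = 0) : h = 0 := by
  have := isDomain_algebra G D
  by_contra h0
  obtain ⟨g, hc, hm⟩ := exists_top_coefA hqa h0
  have h1 := coefA_thetaHom_mul hqa hm rfl d
  rw [hh, map_zero] at h1
  rcases mul_eq_zero.1 h1.symm with h2 | h2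
  · exact hd (actA_injective g⁻¹ (h2.trans (map_zero _).symm))
  · exact hc h2

/-- An element of weight `w` is determined by its coefficient at `w`. -/
theorem eq_zero_of_weight (hqa : IsLabeling D q qa) {w : G} {h : HeckeAlg D q}
    (hw : ∀ x, theta D q x * h = h * theta D q (w⁻¹ • x)) (h0 : coefA hqa w h = 0) : h = 0 := by
  have := isDomain_algebra G D
  by_contra hh
  obtain ⟨g, hc, hm⟩ := exists_top_coefA hqa hh
  refine hc ?_
  by_cases hgw : g⁻¹ = w⁻¹
  · rw [inv_injective hgw]; exact h0
  have hx : ∃ x : L, g⁻¹ • x ≠ w⁻¹ • x := by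
    by_contra hall
    push Not at hall
    refine hgw (mul_inv_eq_one.1 (faithful (D := D) _ fun y => ?_))
    rw [mul_smul, hall, smul_inv_smul]
  obtain ⟨x, hx⟩ := hx
  have h1 := coefA_thetaHom_mul hqa hm rfl (AddMonoidAlgebra.single x 1)
  rw [thetaHom_of, hw, coefA_mul_theta, actA_single, mul_comm, ← sub_eq_zero, ← sub_mul] at h1
  refine (mul_eq_zero.1 h1).resolve_left fun h2 => hx ?_
  exact (Finsupp.single_left_injective (one_ne_zero (α := ℂ))
    (congrArg AddMonoidAlgebra.coeff (sub_eq_zero.1 h2))).symm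

/-! ### Intertwining elements -/

variable (D) in
open Classical in
/-- The multiple `1 - θ_{-α}` or `1 - θ_{-2α}` that clears the denominator in the Bernstein
relation, multiplied by the square root of the label. -/
def rootDenom (qa : J × ℤ → ℝ) (j : J) : AddMonoidAlgebra ℂ L :=
  ((√(qa (j, 0)) : ℝ) : ℂ) • if ∀ x, Even (D.coroot j x) then
    1 - AddMonoidAlgebra.single (-((2 : ℤ) • D.root j)) 1
  else 1 - AddMonoidAlgebra.single (-D.root j) 1

variable (D) in
open Classical in
/-- The numerator in the Bernstein relation. -/
def rootNumer (qa : J × ℤ → ℝ) (j : J) : AddMonoidAlgebra ℂ L :=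
  ((√(qa (j, 0)) : ℝ) : ℂ) • if ∀ x, Even (D.coroot j x) then
    algebraMap ℂ _ (qdiff qa (j, 0)) + AddMonoidAlgebra.single (-D.root j) (qdiff qa (j, -1))
  else algebraMap ℂ _ (qdiff qa (j, 0))

theorem even_coroot_perm (g : G) (j : J) :
    (∀ x, Even (D.coroot (perm D g j) x)) ↔ ∀ x, Even (D.coroot j x) := by
  constructor <;> intro h x
  · rw [← coroot_perm g]; exact h _
  · rw [← smul_inv_smul g x, coroot_perm]; exact h _

theorem IsLabeling.perm_eq (hqa : IsLabeling D q qa) (g : G) (j : J) (n : ℤ) :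
    qa (perm D g j, n) = qa (j, n) := by
  rw [← hqa.inv (lin L g) (j, n), affAct_lin]

theorem actA_rootDenom (hqa : IsLabeling D q qa) (g : G) (j : J) :
    actA g (rootDenom D qa j) = rootDenom D qa (perm D g j) := by
  unfold rootDenom
  rw [map_smul, hqa.perm_eq, root_perm]
  by_cases h : ∀ x, Even (D.coroot j x)
  · rw [if_pos h, if_pos ((even_coroot_perm g j).2 h), map_sub, map_one, actA_single, smul_neg,
      smul_comm g]
  · rw [if_neg h, if_neg (mt (even_coroot_perm g j).1 h), map_sub, map_one, actA_single, smul_neg]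

theorem actA_rootNumer (hqa : IsLabeling D q qa) (g : G) (j : J) :
    actA g (rootNumer D qa j) = rootNumer D qa (perm D g j) := by
  unfold rootNumer qdiff
  rw [map_smul, hqa.perm_eq, hqa.perm_eq, root_perm]
  by_cases h : ∀ x, Even (D.coroot j x)
  · rw [if_pos h, if_pos ((even_coroot_perm g j).2 h), map_add, AlgHom.commutes, actA_single,
      smul_neg]
  · rw [if_neg h, if_neg (mt (even_coroot_perm g j).1 h), AlgHom.commutes]

theorem rootDenom_ne_zero (hqa : IsLabeling D q qa) (j : J) : rootDenom D qa j ≠ 0 := by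
  have hr : ∀ m : ℤ, m ≠ 0 → -(m • D.root j) ≠ 0 := fun m hm h => by
    have h1 := congrArg (D.coroot j) h
    rw [map_neg, map_zsmul, coroot_root (G := G), map_zero] at h1
    simp [hm] at h1
  have hs : ∀ x : L, x ≠ 0 → (1 : AddMonoidAlgebra ℂ L) - AddMonoidAlgebra.single x 1 ≠ 0 :=
    fun x hx h => hx (Finsupp.single_left_injective (one_ne_zero (α := ℂ))
      (congrArg AddMonoidAlgebra.coeff (sub_eq_zero.1 h))).symm
  refine smul_ne_zero (by exact_mod_cast (hqa.sqrt_pos _).ne') ?_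
  split_ifs
  · exact hs _ (hr 2 two_ne_zero)
  · have := hr 1 one_ne_zero
    rw [one_smul] at this
    exact hs _ this

theorem bernPoly_neg {j : J} {x : L} (hx : D.coroot j x ≤ 0) :
    bernPoly D qa j x = -bernPoly D qa j ((refl D j : G) • x) := by
  rw [bernPoly, bernPoly, coroot_refl_smul, neg_neg, refl_smul, Int.toNat_of_nonpos hx]
  simp

theorem rootDenom_mul_bernPoly (hqa : IsLabeling D q qa) (j : J) (x : L) :
    rootDenom D qa j * bernPoly D qa j x = rootNumer D qa j *
      (AddMonoidAlgebra.single x 1 - AddMonoidAlgebra.single ((refl D j : G) • x) 1) := by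
  have hnonneg : ∀ (n : ℕ) (x : L), D.coroot j x = n →
      rootDenom D qa j * bernPoly D qa j x = rootNumer D qa j *
      (AddMonoidAlgebra.single x 1 - AddMonoidAlgebra.single ((refl D j : G) • x) 1) := by
    intro n x hx
    rw [bernPoly, refl_smul, hx, Int.toNat_natCast, Int.toNat_of_nonpos (by simp)]
    rw [Finset.range_zero, Finset.sum_empty, sub_zero]
    unfold rootDenom rootNumer
    rw [smul_mul_assoc, smul_mul_assoc]
    congr 1
    split_ifs with hev
    · obtain ⟨m, hm⟩ : Even n := by have := hev x; rw [hx] at this; exact_mod_cast this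
      subst hm
      clear hx
      rw [Algebra.algebraMap_eq_smul_one]
      induction m with
      | zero => simp
      | succ m ih =>
        rw [show m + 1 + (m + 1) = m + m + 1 + 1 by ring, Finset.sum_range_succ,
          Finset.sum_range_succ, mul_add, mul_add, ih]
        have e0 : qdiff qa (j, -((m + m : ℕ) : ℤ)) = qdiff qa (j, 0) := by
          have := qdiff_add_even hqa j 0 (-m)
          rw [← this]; congr 2; push_cast; ring
        have e1 : qdiff qa (j, -((m + m + 1 : ℕ) : ℤ)) = qdiff qa (j, -1) := by
          have := qdiff_add_even hqa j (-1) (-m)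
          rw [← this]; congr 2; push_cast; ring
        rw [e0, e1]
        have hq : ∀ (y : L) (c : ℂ), AddMonoidAlgebra.single y c =
            c • AddMonoidAlgebra.single y 1 := fun y c => by
          rw [AddMonoidAlgebra.smul_single, smul_eq_mul, mul_one]
        rw [hq _ (qdiff qa (j, 0)), hq _ (qdiff qa (j, -1)), hq _ (qdiff qa (j, -1))]
        simp only [sub_mul, add_mul, mul_sub, one_mul, smul_mul_assoc, mul_smul_comm,
          AddMonoidAlgebra.single_mul_single, mul_one]
        rw [show -((2 : ℤ) • D.root j) + (x - ((m + m : ℕ) : ℤ) • D.root j) =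
            x - ((m + m + 1 + 1 : ℕ) : ℤ) • D.root j by push_cast; module,
          show -((2 : ℤ) • D.root j) + (x - ((m + m + 1 : ℕ) : ℤ) • D.root j) =
            -D.root j + (x - ((m + m + 1 + 1 : ℕ) : ℤ) • D.root j) by push_cast; module,
          show x - ((m + m + 1 : ℕ) : ℤ) • D.root j =
            -D.root j + (x - ((m + m : ℕ) : ℤ) • D.root j) by push_cast; module]
        module
    · push Not at hev
      obtain ⟨y, hy⟩ := hev
      have hc : ∀ k : ℤ, qdiff qa (j, k) = qdiff qa (j, 0) := fun k =>
        qdiff_of_odd hqa j (Int.not_even_iff_odd.1 hy) k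
      simp only [hc]
      rw [Algebra.algebraMap_eq_smul_one]
      clear hx
      induction n with
      | zero => simp
      | succ m ih =>
        rw [Finset.sum_range_succ, mul_add, ih]
        have hq : ∀ (y : L) (c : ℂ), AddMonoidAlgebra.single y c =
            c • AddMonoidAlgebra.single y 1 := fun y c => by
          rw [AddMonoidAlgebra.smul_single, smul_eq_mul, mul_one]
        rw [hq _ (qdiff qa (j, 0))]
        simp only [sub_mul, mul_sub, one_mul, smul_mul_assoc, mul_smul_comm,
          AddMonoidAlgebra.single_mul_single, mul_one]
        rw [show -D.root j + (x - ((m : ℕ) : ℤ) • D.root j) =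
            x - ((m + 1 : ℕ) : ℤ) • D.root j by push_cast; module]
        module
  rcases le_total 0 (D.coroot j x) with h | h
  · exact hnonneg _ x (Int.toNat_of_nonneg h).symm
  · have h1 := hnonneg (-D.coroot j x).toNat ((refl D j : G) • x)
      (by rw [coroot_refl_smul, Int.toNat_of_nonneg (by omega)])
    rw [bernPoly_neg (G := G) h, mul_neg, h1, ← mul_neg, neg_sub, ← mul_smul, refl_mul_self,
      one_smul]

/-- The intertwining element attached to a simple root. -/
def iotaGen (hqa : IsLabeling D q qa) (j : J) : HeckeAlg D q :=
  thetaHom hqa (rootDenom D qa j) * basisN D q (lin L (refl D j : G)) -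
    thetaHom hqa (rootNumer D qa j)

theorem theta_mul_iotaGen (hqa : IsLabeling D q qa) {j : J} (hj : IsSimpleAff D G (j, 0)) (x : L) :
    theta D q x * iotaGen hqa j = iotaGen hqa j * theta D q ((refl D j : G) • x) := by
  have h1 := congrArg (thetaHom hqa) (rootDenom_mul_bernPoly (G := G) hqa j x)
  rw [map_mul, map_mul, map_sub, thetaHom_of, thetaHom_of] at h1
  have hc : ∀ a, theta D q x * thetaHom hqa a = thetaHom hqa a * theta D q x := fun a => by
    rw [← thetaHom_of hqa, ← map_mul, mul_comm, map_mul]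
  unfold iotaGen
  rw [mul_sub, ← mul_assoc, hc, hc, mul_assoc, bernstein_relation hqa hj, mul_add, h1, mul_sub,
    sub_mul, mul_assoc]
  abel

end Weights


open RootedDatum

section IotaList

variable {J L G : Type*} [AddCommGroup L] [Group G] [DistribMulAction G L]
variable {D : Datum J L} [RootedDatum D G] {q : AffW G L → ℝ} {qa : J × ℤ → ℝ}

/-! ### Products of intertwining elements -/

theorem len_reflProd_le (l : List J) (hl : ∀ j ∈ l, IsSimpleAff D G (j, 0)) :
    len D (lin L (reflProd D G l)) ≤ l.length := by
  induction l with
  | nil => simp [reflProd, lin_one, len_one D]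
  | cons j l ih =>
    have h1 := ih fun k hk => hl k (List.mem_cons_of_mem _ hk)
    have h2 := len_mul_le (D := D) (lin L (refl D j : G)) (lin L (reflProd D G l))
    have h3 := (hl j List.mem_cons_self).len
    rw [affRefl_finite] at h3
    rw [← lin_mul] at h2
    change len D (lin L ((refl D j : G) * reflProd D G l)) ≤ l.length + 1
    omega

theorem reflProd_cons (j : J) (l : List J) :
    reflProd D G (j :: l) = refl D j * reflProd D G l := rfl

theorem reduced_tail {j : J} {l : List J} (hl : ∀ k ∈ j :: l, IsSimpleAff D G (k, 0))
    (hr : (j :: l).length = len D (lin L (reflProd D G (j :: l)))) :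
    l.length = len D (lin L (reflProd D G l)) ∧ D.pos (perm D (reflProd D G l)⁻¹ j) := by
  have hj := hl j List.mem_cons_self
  have h1 := len_reflProd_le l fun k hk => hl k (List.mem_cons_of_mem _ hk)
  have h2 := len_mul_le (D := D) (lin L (refl D j : G)) (lin L (reflProd D G l))
  have h3 := hj.len
  rw [reflProd_cons, List.length_cons] at hr
  rw [affRefl_finite] at h3
  rw [← lin_mul] at h2
  refine ⟨by omega, ?_⟩
  by_contra hneg
  have h4 := hj.refl_mul_len_of_neg (w := lin L (reflProd D G l))
    (by rwa [← lin_inv, affAct_lin, affPos_zero])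
  rw [affRefl_finite, ← lin_mul] at h4
  omega

variable (D) in
/-- The negative roots that are mapped to positive roots by `w`. -/
def negInv (w : G) : Set J := {j | ¬ D.pos j ∧ D.pos (perm D w j)}

theorem negInv_one : negInv D (1 : G) = ∅ := by
  ext j
  simp [negInv]

theorem perm_inv_self (g : G) (j : J) : perm D g⁻¹ (perm D g j) = j := by
  rw [← Equiv.Perm.mul_apply, ← map_mul, inv_mul_cancel, map_one, Equiv.Perm.one_apply]

theorem perm_self_inv (g : G) (j : J) : perm D g (perm D g⁻¹ j) = j := by
  rw [← Equiv.Perm.mul_apply, ← map_mul, mul_inv_cancel, map_one, Equiv.Perm.one_apply]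

theorem negInv_refl_mul {j : J} (hj : IsSimpleAff D G (j, 0)) {w : G}
    (hw : D.pos (perm D w⁻¹ j)) : perm D (refl D j * w)⁻¹ j ∉ negInv D w ∧
      negInv D (refl D j * w) = insert (perm D (refl D j * w)⁻¹ j) (negInv D w) := by
  have hneg : perm D w (perm D (refl D j * w)⁻¹ j) = perm D (refl D j : G) j := by
    rw [mul_inv_rev, map_mul, Equiv.Perm.mul_apply, perm_self_inv, refl_inv]
  have hj' : ¬ D.pos (perm D (refl D j : G) j) := by rw [pos_neg_iff]; exact not_not.2 hj.pos
  refine ⟨fun h => hj' (hneg ▸ h.2), ?_⟩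
  ext k
  simp only [negInv, Set.mem_insert_iff, Set.mem_ofPred_eq, map_mul (perm (G := G) D), Equiv.Perm.mul_apply]
  constructor
  · rintro ⟨h1, h2⟩
    by_cases hk : k = perm D (refl D j * w)⁻¹ j
    · exact Or.inl hk
    refine Or.inr ⟨h1, ?_⟩
    have h3 := hj.pos_perm h2 fun h => hk
      ((perm_inv_self (D := D) (refl D j * w) k).symm.trans (congrArg _ (by
        rw [map_mul, Equiv.Perm.mul_apply, h])))
    rwa [perm_refl_refl] at h3
  · rintro (rfl | ⟨h1, h2⟩)
    · rw [hneg, perm_refl_refl]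
      refine ⟨?_, hj.pos⟩
      rw [mul_inv_rev, refl_inv, map_mul, Equiv.Perm.mul_apply]
      have h1 := (pos_neg_iff (D := D) G (perm D w⁻¹ j)).not_left.2 (by simpa using hw)
      rwa [refl_perm, inv_inv, map_mul, map_mul, Equiv.Perm.mul_apply, Equiv.Perm.mul_apply,
        perm_self_inv] at h1
    · refine ⟨h1, hj.pos_perm h2 ?_⟩
      rintro rfl
      rw [perm_inv_self] at hw
      exact h1 hw

/-- Products over reduced words depend only on the element. -/
theorem prod_word_eq {M : Type*} [CommMonoid M] (f : J → M) (F : List J → M) (h1 : F [] = 1)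
    (hF : ∀ j l, (∀ k ∈ j :: l, IsSimpleAff D G (k, 0)) →
      (j :: l).length = len D (lin L (reflProd D G (j :: l))) →
      F (j :: l) = f (perm D (reflProd D G (j :: l))⁻¹ j) * F l)
    (l : List J) (hl : ∀ j ∈ l, IsSimpleAff D G (j, 0))
    (hr : l.length = len D (lin L (reflProd D G l))) :
    F l = ∏ᶠ j ∈ negInv D (reflProd D G l), f j := by
  have := finite (D := D) (G := G)
  induction l with
  | nil => rw [h1, reflProd, List.map_nil, List.prod_nil, negInv_one, finprod_mem_empty]
  | cons j l ih =>
    obtain ⟨h2, h3⟩ := reduced_tail hl hr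
    obtain ⟨h4, h5⟩ := negInv_refl_mul (hl j List.mem_cons_self) h3
    rw [hF j l hl hr, ih (fun k hk => hl k (List.mem_cons_of_mem _ hk)) h2, reflProd_cons, h5,
      finprod_mem_insert f h4 (Set.toFinite _)]

/-- The product of the intertwining elements along a word. -/
def iotaList (hqa : IsLabeling D q qa) (l : List J) : HeckeAlg D q := (l.map (iotaGen hqa)).prod

theorem iotaList_cons (hqa : IsLabeling D q qa) (j : J) (l : List J) :
    iotaList hqa (j :: l) = iotaGen hqa j * iotaList hqa l := by
  rw [iotaList, List.map_cons, List.prod_cons, iotaList]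

theorem theta_mul_iotaList (hqa : IsLabeling D q qa) (l : List J)
    (hl : ∀ j ∈ l, IsSimpleAff D G (j, 0)) (x : L) :
    theta D q x * iotaList hqa l = iotaList hqa l * theta D q ((reflProd D G l)⁻¹ • x) := by
  induction l generalizing x with
  | nil => simp [iotaList, reflProd]
  | cons j l ih =>
    rw [iotaList_cons, ← mul_assoc, theta_mul_iotaGen hqa (hl j List.mem_cons_self), mul_assoc,
      ih fun k hk => hl k (List.mem_cons_of_mem _ hk), ← mul_assoc, reflProd_cons, mul_inv_rev,
      mul_smul, refl_inv]

theorem thetaHom_mul_iotaList (hqa : IsLabeling D q qa) (l : List J)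
    (hl : ∀ j ∈ l, IsSimpleAff D G (j, 0)) (a : AddMonoidAlgebra ℂ L) :
    thetaHom hqa (actA (reflProd D G l) a) * iotaList hqa l =
      iotaList hqa l * thetaHom hqa a := by
  induction a using algebra_induction with
  | h0 => simp only [map_zero, zero_mul, mul_zero]
  | hadd a b ha hb => simp only [map_add, add_mul, mul_add, ha, hb]
  | hsmul c a ha => simp only [map_smul, smul_mul_assoc, mul_smul_comm, ha]
  | hs x => rw [actA_single, thetaHom_of, thetaHom_of, theta_mul_iotaList hqa l hl,
      inv_smul_smul]

theorem coefA_refl_mul (hqa : IsLabeling D q qa) {j : J} (hj : IsSimpleAff D G (j, 0)) {w : G}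
    (hw : D.pos (perm D w⁻¹ j)) {h : HeckeAlg D q}
    (hh : h ∈ lowerSpan D q (len D (lin L w) + 1)) :
    coefA hqa (refl D j * w) (basisN D q (lin L (refl D j : G)) * h) = coefA hqa w h ∧
      basisN D q (lin L (refl D j : G)) * h ∈ lowerSpan (G := G) D q (len D (lin L w) + 1 + 1) := by
  classical
  refine ⟨?_, lowerSpan_mono (by
    have h3 := hj.len
    rw [affRefl_finite] at h3
    omega) (basisN_mul_lowerSpan hqa (refl D j : G) hh)⟩
  have hlen : len D (lin L (refl D j * w)) = len D (lin L w) + 1 := by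
    have h1 := hj.refl_mul_len_of_pos (w := lin L w)
      (by rwa [← lin_inv, affAct_lin, affPos_zero])
    rwa [affRefl_finite, ← lin_mul] at h1
  induction hh using Submodule.span_induction with
  | mem h hh =>
    obtain ⟨g, x, hg, rfl⟩ := hh
    by_cases hp : D.pos (perm D g⁻¹ j)
    · have h1 := hj.basisN_mul_left_of_pos (q := q) (w := lin L g)
        (by rwa [← lin_inv, affAct_lin, affPos_zero])
      rw [affRefl_finite, ← lin_mul] at h1
      rw [← mul_assoc, h1, coefA_basis, coefA_basis]
      simp only [mul_right_inj]
    · have h1 := IsSimpleAff.basisN_mul_left_of_neg hqa hj (w := lin L g)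
        (by rwa [← lin_inv, affAct_lin, affPos_zero])
      rw [affRefl_finite, ← lin_mul] at h1
      rw [← mul_assoc, h1, add_mul, smul_mul_assoc, map_add, map_smul, coefA_basis, coefA_basis,
        coefA_basis, if_neg, if_neg, if_neg, smul_zero, add_zero]
      · rintro rfl; exact hp hw
      · rintro rfl; omega
      · intro h; rw [mul_right_inj] at h; rw [h] at hp; exact hp hw
  | zero => simp only [mul_zero, map_zero]
  | add a b _ _ ha hb => simp only [mul_add, map_add, ha, hb]
  | smul c a _ ha => simp only [mul_smul_comm, map_smul, ha]

theorem thetaHom_mul_mem (hqa : IsLabeling D q qa) {n : ℕ} {h : HeckeAlg D q}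
    (hh : h ∈ lowerSpan (G := G) D q n) (a : AddMonoidAlgebra ℂ L) :
    thetaHom hqa a * h ∈ lowerSpan (G := G) D q n := by
  induction a using algebra_induction with
  | h0 => simp only [map_zero, zero_mul]; exact zero_mem _
  | hadd a b ha hb => simp only [map_add, add_mul]; exact add_mem ha hb
  | hsmul c a ha => simp only [map_smul, smul_mul_assoc]; exact Submodule.smul_mem _ _ ha
  | hs x =>
    rw [thetaHom_of]
    induction hh using Submodule.span_induction with
    | mem h hh =>
      obtain ⟨g, y, hg, rfl⟩ := hh
      have h1 := lowerSpan_mono (Nat.le_of_lt hg)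
        (lowerSpan_mul_theta hqa (theta_mul_basisN_sub_mem hqa g x) y)
      have h2 := add_mem h1 (mem_lowerSpan (q := q) hg (g⁻¹ • x + y))
      rwa [sub_mul, mul_assoc, mul_assoc, ← theta_add hqa, sub_add_cancel] at h2
    | zero => rw [mul_zero]; exact zero_mem _
    | add a b _ _ ha hb => rw [mul_add]; exact add_mem ha hb
    | smul c a _ ha => rw [mul_smul_comm]; exact Submodule.smul_mem _ _ ha

theorem iotaList_mem (hqa : IsLabeling D q qa) (l : List J)
    (hl : ∀ j ∈ l, IsSimpleAff D G (j, 0))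
    (hr : l.length = len D (lin L (reflProd D G l))) :
    iotaList hqa l ∈ lowerSpan (G := G) D q (l.length + 1) := by
  induction l with
  | nil =>
    have := mem_lowerSpan (q := q) (n := 1) (g := (1 : G)) (D := D)
      (by rw [lin_one, len_one D]; exact one_pos) 0
    rw [theta_zero hqa, lin_one, basisN_one, mul_one] at this
    simpa [iotaList] using this
  | cons j l ih =>
    obtain ⟨h2, h3⟩ := reduced_tail hl hr
    have h4 := ih (fun k hk => hl k (List.mem_cons_of_mem _ hk)) h2
    rw [iotaList_cons, iotaGen, sub_mul, mul_assoc]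
    refine sub_mem (thetaHom_mul_mem hqa ?_ _)
      (thetaHom_mul_mem hqa (lowerSpan_mono (Nat.le_succ _) h4) _)
    rw [h2] at h4
    rw [List.length_cons, h2]
    exact (coefA_refl_mul hqa (hl j List.mem_cons_self) h3 h4).2

theorem coefA_iotaList (hqa : IsLabeling D q qa) (l : List J)
    (hl : ∀ j ∈ l, IsSimpleAff D G (j, 0))
    (hr : l.length = len D (lin L (reflProd D G l))) :
    coefA hqa (reflProd D G l) (iotaList hqa l) =
      ∏ᶠ j ∈ negInv D (reflProd D G l), rootDenom D qa j := by
  refine prod_word_eq (rootDenom D qa) (fun l => coefA hqa (reflProd D G l) (iotaList hqa l))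
    ?_ ?_ l hl hr
  · have h1 := coefA_basis hqa (1 : G) 1 0
    rw [theta_zero hqa, lin_one, basisN_one, mul_one, if_pos rfl] at h1
    rw [AddMonoidAlgebra.one_def]
    simpa only [iotaList, reflProd, List.map_nil, List.prod_nil] using h1
  · intro j l hl hr
    obtain ⟨h2, h3⟩ := reduced_tail hl hr
    have h4 := iotaList_mem hqa l (fun k hk => hl k (List.mem_cons_of_mem _ hk)) h2
    have hlow := thetaHom_mul_mem hqa h4 (rootNumer D qa j)
    rw [h2] at h4
    obtain ⟨h5, h6⟩ := coefA_refl_mul hqa (hl j List.mem_cons_self) h3 h4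
    change coefA hqa (reflProd D G (j :: l)) (iotaList hqa (j :: l)) = _
    rw [iotaList_cons, iotaGen, sub_mul, mul_assoc, map_sub,
      coefA_eq_zero_of_mem hqa hlow (by rw [← hr, List.length_cons]), sub_zero,
      coefA_thetaHom_mul hqa h6 (by rw [← hr, List.length_cons, h2]), actA_rootDenom hqa]
    rw [reflProd_cons, h5]

/-- The products of the intertwining elements along two reduced words of an element agree. -/
theorem iotaList_congr (hqa : IsLabeling D q qa) {l l' : List J}
    (hl : ∀ j ∈ l, IsSimpleAff D G (j, 0)) (hl' : ∀ j ∈ l', IsSimpleAff D G (j, 0))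
    (hr : l.length = len D (lin L (reflProd D G l)))
    (hr' : l'.length = len D (lin L (reflProd D G l')))
    (h : reflProd D G l = reflProd D G l') : iotaList hqa l = iotaList hqa l' := by
  refine sub_eq_zero.1 (eq_zero_of_weight hqa (w := reflProd D G l) (fun x => ?_) ?_)
  · rw [mul_sub, sub_mul, theta_mul_iotaList hqa l hl, theta_mul_iotaList hqa l' hl', h]
  · rw [map_sub, coefA_iotaList hqa l hl hr, h, coefA_iotaList hqa l' hl' hr', sub_self]

theorem refl_mul_iotaList (hqa : IsLabeling D q qa) {l : List J}
    (hl : ∀ j ∈ l, IsSimpleAff D G (j, 0)) (hr : l.length = len D (lin L (reflProd D G l)))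
    {j : J} (hj : IsSimpleAff D G (j, 0))
    (hi : IsSimpleAff D G (perm D (reflProd D G l) j, 0)) :
    basisN D q (lin L (refl D (perm D (reflProd D G l) j) : G)) * iotaList hqa l =
      iotaList hqa l * basisN D q (lin L (refl D j : G)) := by
  set i := perm D (reflProd D G l) j with hidef
  have hprod : reflProd D G (l ++ [j]) = reflProd D G l * refl D j := by simp [reflProd]
  have heq : reflProd D G (i :: l) = reflProd D G (l ++ [j]) := by
    rw [reflProd_cons, hprod, hidef, refl_perm, inv_mul_cancel_right]
  have hlen : len D (lin L (reflProd D G (l ++ [j]))) = l.length + 1 := by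
    rw [hprod, len_mul_refl_of_pos hj hi.pos, hr]
  have h1 : iotaList hqa (i :: l) = iotaList hqa (l ++ [j]) := by
    refine iotaList_congr hqa (fun k hk => ?_) (fun k hk => ?_) ?_ ?_ heq
    · rcases List.mem_cons.1 hk with rfl | hk
      exacts [hi, hl k hk]
    · rcases List.mem_append.1 hk with hk | hk
      · exact hl k hk
      · rw [List.mem_singleton.1 hk]; exact hj
    · rw [heq, hlen, List.length_cons]
    · rw [hlen, List.length_append, List.length_singleton]
  have h2 : iotaList hqa (l ++ [j]) = iotaList hqa l * iotaGen hqa j := by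
    rw [iotaList, List.map_append, List.prod_append, iotaList]; simp
  rw [iotaList_cons, h2, iotaGen, iotaGen, sub_mul, mul_sub, ← mul_assoc,
    ← thetaHom_mul_iotaList hqa l hl, ← thetaHom_mul_iotaList hqa l hl, actA_rootDenom hqa,
    actA_rootNumer hqa, ← hidef, sub_left_inj, mul_assoc, mul_assoc, ← sub_eq_zero,
    ← mul_sub] at h1
  exact sub_eq_zero.1 (eq_zero_of_thetaHom_mul hqa (rootDenom_ne_zero hqa i) h1)

end IotaList


open RootedDatum

section Words

variable {ι X Y : Type*} [AddCommGroup X] [AddCommGroup Y] {R : RootDatum ι X Y} {b : R.Base}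
variable [Finite ι] [R.IsReduced] {q : WX R → ℝ}

/-! ### Intertwining elements for root data -/

omit [Finite ι] [R.IsReduced] in
theorem isDouble_iff (i : ι) : IsDouble (R := R) i ↔ ∀ x, Even ((datum R b).coroot i x) := by
  constructor
  · rintro ⟨y, hy⟩ x
    change Even (R.toLinearMap x (R.coroot i))
    rw [hy, map_nsmul]
    exact even_iff_two_dvd.2 ⟨_, by rw [nsmul_eq_mul]; rfl⟩
  · intro h
    have h2 : ∀ x, 2 * (R.coroot' i x / 2) = R.coroot' i x := fun x =>
      Int.mul_ediv_cancel' (even_iff_two_dvd.1 (h x))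
    let f : X →ₗ[ℤ] ℤ := AddMonoidHom.toIntLinearMap
      { toFun := fun x => R.coroot' i x / 2
        map_zero' := by simp
        map_add' := fun x y => by
          have h3 := h2 (x + y)
          rw [map_add] at h3 ⊢
          have h4 := h2 x
          have h5 := h2 y
          omega }
    refine ⟨R.toLinearMap.flip.toPerfPair.symm f, R.toLinearMap.flip.toPerfPair.injective ?_⟩
    ext x
    rw [map_nsmul, LinearEquiv.apply_symm_apply]
    change R.coroot' i x = (2 • f) x
    rw [LinearMap.smul_apply, nsmul_eq_mul]
    exact (h2 x).symm

theorem iotaElt_eq (hq : IsLabelFunction (datum R b) q) (i : ι) :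
    iotaElt b q i = iotaGen hq.isLabeling i := by
  have h0 := hq.isLabeling.pos (i, 0)
  have h1 := hq.isLabeling.pos (i, -1)
  have hs0 : (√(affLabel (datum R b) q (i, 0)) : ℝ) ≠ 0 := (Real.sqrt_pos.2 h0).ne'
  have hs1 : (√(affLabel (datum R b) q (i, -1)) : ℝ) ≠ 0 := (Real.sqrt_pos.2 h1).ne'
  have hq0 : ((√(affLabel (datum R b) q (i, 0)) : ℝ) : ℂ) *
      qdiff (affLabel (datum R b) q) (i, 0) =
        -((1 - affLabel (datum R b) q (i, 0) : ℝ) : ℂ) := by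
    rw [qdiff, ← Complex.ofReal_mul, mul_sub, mul_inv_cancel₀ hs0, Real.mul_self_sqrt h0.le]
    push_cast; ring
  have hq1 : ((√(affLabel (datum R b) q (i, 0)) : ℝ) : ℂ) *
      qdiff (affLabel (datum R b) q) (i, -1) =
        -((√(affLabel (datum R b) q (i, 0) / affLabel (datum R b) q (i, -1)) *
          (1 - affLabel (datum R b) q (i, -1)) : ℝ) : ℂ) := by
    rw [qdiff, ← Complex.ofReal_mul, ← Complex.ofReal_neg, Real.sqrt_div h0.le]
    congr 1
    field_simp
    rw [Real.sq_sqrt h1.le]; ring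
  have hθ : ∀ x : X, thetaHom hq.isLabeling (AddMonoidAlgebra.single x 1) =
      theta (datum R b) q x := thetaHom_of hq.isLabeling
  unfold iotaElt iotaGen rootDenom rootNumer
  rw [show (refl (datum R b) i : R.weylGroup) = RootPairing.weylGroup.ofIdx R i from rfl,
    show (datum R b).root i = R.root i from rfl]
  by_cases h : IsDouble (R := R) i
  · rw [if_pos ((isDouble_iff (b := b) i).1 h), if_pos ((isDouble_iff (b := b) i).1 h)]
    simp only [if_pos h]
    rw [map_smul, map_smul, map_sub, map_add, map_one, hθ, thetaHom_single, AlgHom.commutes,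
      smul_add, smul_smul, hq1, Algebra.algebraMap_eq_smul_one, smul_smul, hq0, smul_mul_assoc,
      neg_smul, neg_smul, ← neg_add, sub_neg_eq_add, two_zsmul, two_nsmul, ← add_assoc]
  · rw [if_neg (mt (isDouble_iff (b := b) i).2 h), if_neg (mt (isDouble_iff (b := b) i).2 h)]
    simp only [if_neg h]
    rw [map_smul, map_smul, map_sub, map_one, hθ, AlgHom.commutes,
      Algebra.algebraMap_eq_smul_one, smul_smul, hq0, smul_mul_assoc,
      neg_smul, sub_neg_eq_add]

theorem root_perm_datum (g : R.weylGroup) (i : ι) :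
    R.root (perm (datum R b) g i) = g • R.root i := root_perm (D := datum R b) g i

/-- The list of indices of a word in the simple reflections. -/
def wordList (l : List b.support) : List ι := l.map Subtype.val

omit [Finite ι] [R.IsReduced] in
theorem mem_wordList {l : List b.support} {j : ι} (hj : j ∈ wordList l) : j ∈ b.support := by
  obtain ⟨k, _, rfl⟩ := List.mem_map.1 hj
  exact k.2

theorem isSimpleAff_wordList (l : List b.support) :
    ∀ j ∈ wordList l, IsSimpleAff (datum R b) R.weylGroup (j, 0) := fun _ hj =>
  isSimpleAff_of_mem (mem_wordList hj)

theorem wordElt_eq (l : List b.support) :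
    wordElt l = reflProd (datum R b) R.weylGroup (wordList l) := by
  rw [wordElt, reflProd, wordList, List.map_map]; rfl

theorem iotaWord_eq (hq : IsLabelFunction (datum R b) q) (l : List b.support) :
    iotaWord q l = iotaList hq.isLabeling (wordList l) := by
  rw [iotaWord, iotaList, wordList, List.map_map]
  congr 1
  exact List.map_congr_left fun i _ => iotaElt_eq hq i.1

theorem normElt_eq (hq : IsLabelFunction (datum R b) q) (i : ι) (g : R.weylGroup) :
    normElt b q i g = normElt b q (perm (datum R b) g i) 1 := by
  have hd : IsDouble (R := R) (perm (datum R b) g i) ↔ IsDouble (R := R) i := by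
    rw [isDouble_iff (b := b), isDouble_iff (b := b), even_coroot_perm]
  unfold normElt
  by_cases h : IsDouble (R := R) i
  · simp only [if_pos h, if_pos (hd.2 h), hq.isLabeling.perm_eq, one_smul, root_perm_datum]
  · simp only [if_neg h, if_neg (mt hd.1 h), hq.isLabeling.perm_eq, one_smul, root_perm_datum]

theorem actA_normElt (hq : IsLabelFunction (datum R b) q) (i : ι) (g : R.weylGroup) :
    actA g (normElt b q i 1) = normElt b q (perm (datum R b) g i) 1 := by
  rw [← normElt_eq hq]
  unfold normElt
  split_ifs
  · rw [map_mul, map_add, map_sub, AlgHom.commutes, AlgHom.commutes, actA_single, one_smul,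
      smul_neg]
  · rw [map_sub, AlgHom.commutes, actA_single, one_smul, smul_neg]

theorem normWord_eq (hq : IsLabelFunction (datum R b) q) (l : List b.support)
    (hr : l.length = len (datum R b) (lin X (wordElt l))) :
    normWord q l = ∏ᶠ j ∈ negInv (datum R b) (wordElt l), normElt b q j 1 := by
  induction l with
  | nil =>
    rw [wordElt_eq, normWord, wordList, List.map_nil, reflProd, List.map_nil, List.prod_nil,
      negInv_one, finprod_mem_empty]
  | cons i l ih =>
    have hr' : (wordList (i :: l)).length =
        len (datum R b) (lin X (reflProd (datum R b) R.weylGroup (wordList (i :: l)))) := by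
      rw [← wordElt_eq, ← hr, wordList, List.length_map]
    obtain ⟨h2, h3⟩ := reduced_tail (isSimpleAff_wordList (i :: l)) hr'
    change (wordList l).length = _ at h2
    change (datum R b).pos (perm _ (reflProd _ _ (wordList l))⁻¹ _) at h3
    obtain ⟨h4, h5⟩ := negInv_refl_mul (isSimpleAff_of_mem i.2) h3
    have h6 : wordElt (i :: l) = refl (datum R b) i.1 *
        reflProd (datum R b) R.weylGroup (wordList l) := by rw [wordElt_eq]; rfl
    rw [normWord, normElt_eq hq, h6, h5, finprod_mem_insert _ h4 (Set.toFinite _), ih, wordElt_eq]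
    rw [wordElt_eq]
    exact (List.length_map _).symm.trans h2

theorem actA_normWord (hq : IsLabelFunction (datum R b) q) (l : List b.support)
    (hr : l.length = len (datum R b) (lin X (wordElt l))) {j : ι}
    (hj : IsSimpleAff (datum R b) R.weylGroup (j, 0))
    (hi : IsSimpleAff (datum R b) R.weylGroup (perm (datum R b) (wordElt l) j, 0)) :
    actA (refl (datum R b) j : R.weylGroup) (normWord q l) = normWord q l := by
  have hmaps : ∀ k ∈ negInv (datum R b) (wordElt l),
      perm (datum R b) (refl (datum R b) j : R.weylGroup) k ∈ negInv (datum R b) (wordElt l) := by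
    intro k hk
    refine ⟨fun hneg => hk.1 ?_, ?_⟩
    · rw [← perm_refl_refl (D := datum R b) (G := R.weylGroup) j k]
      refine hj.pos_perm hneg ?_
      intro h
      have h1 : k = perm (datum R b) (refl (datum R b) j : R.weylGroup) j := by
        rw [← perm_refl_refl (D := datum R b) (G := R.weylGroup) j k]
        exact congrArg _ h
      have h2 := hk.2
      rw [h1, ← Equiv.Perm.mul_apply, ← map_mul, ← inv_mul_cancel_right
        (wordElt l * refl (datum R b) j) (wordElt l), ← refl_perm, map_mul, Equiv.Perm.mul_apply,
        pos_neg_iff] at h2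
      exact h2 hi.pos
    · have h1 : wordElt l * refl (datum R b) j =
          refl (datum R b) (perm (datum R b) (wordElt l) j) * wordElt l := by
        rw [refl_perm, inv_mul_cancel_right]
      rw [← Equiv.Perm.mul_apply, ← map_mul, h1, map_mul, Equiv.Perm.mul_apply]
      refine hi.pos_perm hk.2 fun h => hk.1 ?_
      rw [(perm (datum R b) (wordElt l)).injective h]
      exact hj.pos
  have himage : perm (datum R b) (refl (datum R b) j : R.weylGroup) ''
      negInv (datum R b) (wordElt l) = negInv (datum R b) (wordElt l) := by
    refine Set.Subset.antisymm (Set.image_subset_iff.2 hmaps) fun k hk =>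
      ⟨_, hmaps k hk, perm_refl_refl _ _⟩
  rw [normWord_eq hq l hr]
  conv_rhs => rw [← himage, finprod_mem_image (Equiv.injective _).injOn]
  refine (MonoidHom.map_finprod_mem _
    (actA (L := X) (refl (datum R b) j : R.weylGroup)).toMonoidHom (Set.toFinite _)).trans ?_
  exact finprod_mem_congr rfl fun k _ => actA_normElt hq k _

/-! ### Standard parabolic subsystems with the same type -/

variable {P Q : Par b} {n : R.weylGroup}

omit [Finite ι] [R.IsReduced] in
theorem MapsPar.inv (h : MapsPar P Q n) : MapsPar Q P n⁻¹ := by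
  unfold MapsPar at h ⊢
  rw [← h, Set.image_image]
  simp

theorem MapsPar.perm_mem (h : MapsPar P Q n) {i : ι} (hi : i ∈ P.1) :
    perm (datum R b) n i ∈ Q.1 := by
  have h1 : n • R.root i ∈ R.root '' Q.1 := by
    rw [← h]; exact Set.mem_image_of_mem _ (Set.mem_image_of_mem _ hi)
  obtain ⟨j, hj, hji⟩ := h1
  rw [← root_perm_datum (b := b) n i] at hji
  rwa [← R.root.injective hji]

omit [Finite ι] [R.IsReduced] in
theorem MapsPar.smul_mem (h : MapsPar P Q n) {x : X} (hx : x ∈ rootLat P) :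
    n • x ∈ rootLat Q := by
  induction hx using Submodule.span_induction with
  | mem x hx =>
    refine Submodule.subset_span ?_
    rw [← h]; exact Set.mem_image_of_mem _ hx
  | zero => rw [smul_zero]; exact zero_mem _
  | add x y _ _ hx hy => rw [smul_add]; exact add_mem hx hy
  | smul c x _ hx => rw [smul_comm]; exact Submodule.smul_mem _ _ hx

omit [Finite ι] [R.IsReduced] in
theorem MapsPar.smul_mem_satLat (h : MapsPar P Q n) {x : X} (hx : x ∈ satLat P) :
    n • x ∈ satLat Q := by
  obtain ⟨m, hm, hx⟩ := hx
  exact ⟨m, hm, by rw [smul_comm]; exact h.smul_mem hx⟩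

theorem MapsPar.perm_pos (h : MapsPar P Q n) {i : ι} (hi : (datum R b).pos i)
    (hiP : R.root i ∈ rootLat P) : (datum R b).pos (perm (datum R b) n i) := by
  change R.root (perm (datum R b) n i) ∈ AddSubmonoid.closure (R.root '' b.support)
  rw [root_perm_datum]
  have h1 := mem_closure_of_pos P hi hiP
  generalize R.root i = x at h1
  induction h1 using AddSubmonoid.closure_induction with
  | mem x hx =>
    refine AddSubmonoid.subset_closure ?_
    have h2 : n • x ∈ R.root '' Q.1 := by rw [← h]; exact Set.mem_image_of_mem _ hx
    exact Set.image_mono (by exact_mod_cast Q.2) h2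
  | zero => rw [smul_zero]; exact zero_mem _
  | add x y _ _ hx hy => rw [smul_add]; exact add_mem hx hy

theorem mem_of_isSimpleAff {i : ι} (hi : IsSimpleAff (datum R b) R.weylGroup (i, 0))
    (hiP : R.root i ∈ rootLat P) : i ∈ P.1 := by
  by_contra hnot
  have h1 := mem_closure_of_pos P hi.pos hiP
  have h2 : (refl (datum R b) i : R.weylGroup) • R.root i ∈
      AddSubmonoid.closure (R.root '' b.support) := by
    generalize R.root i = x at h1
    induction h1 using AddSubmonoid.closure_induction with
    | mem x hx =>
      obtain ⟨k, hk, rfl⟩ := hx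
      rw [← root_perm_datum (b := b)]
      exact hi.pos_perm (datum_pos_of_mem (P.2 hk)) (by rintro rfl; exact hnot hk)
    | zero => rw [smul_zero]; exact zero_mem _
    | add x y _ _ hx hy => rw [smul_add]; exact add_mem hx hy
  rw [← root_perm_datum (b := b)] at h2
  exact (pos_neg_iff (D := datum R b) R.weylGroup i).1 h2 hi.pos

theorem root_mem_of_refl_mem {i : ι} (hi : IsSimpleAff (datum R b) R.weylGroup (i, 0))
    (h : (refl (datum R b) i : R.weylGroup) ∈ parW P) : R.root i ∈ rootLat P :=
  mem_rootLat_of_inversion P h hi.pos fun h1 =>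
    (pos_neg_iff (D := datum R b) R.weylGroup i).1 h1 hi.pos

theorem MapsPar.conj_mem (h : MapsPar P Q n) {w : R.weylGroup} (hw : w ∈ parW P) :
    n * w * n⁻¹ ∈ parW Q := by
  induction hw using Subgroup.closure_induction with
  | mem w hw =>
    obtain ⟨i, hi, rfl⟩ := hw
    have h1 := refl_perm (D := datum R b) n i
    rw [show RootPairing.weylGroup.ofIdx R i = refl (datum R b) i from rfl, ← h1]
    exact Subgroup.subset_closure (Set.mem_image_of_mem _ (h.perm_mem hi))
  | one => rw [mul_one, mul_inv_cancel]; exact one_mem _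
  | mul v w _ _ hv hw =>
    have := mul_mem hv hw
    rwa [show n * v * n⁻¹ * (n * w * n⁻¹) = n * (v * w) * n⁻¹ by group] at this
  | inv w _ hw =>
    have := inv_mem hw
    rwa [show (n * w * n⁻¹)⁻¹ = n * w⁻¹ * n⁻¹ by group] at this

/-- The intertwining element of `n⁻¹` conjugates `ℋ(W_Q)` into `ℋ(W_P)`. -/
theorem basisN_mul_iotaWord (hq : IsLabelFunction (datum R b) q) (h : MapsPar P Q n)
    {l : List b.support} (hl : wordElt l = n⁻¹)
    (hr : l.length = len (datum R b) (lin X n⁻¹)) {w : R.weylGroup} (hw : w ∈ parW P) :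
    basisN (datum R b) q (lin X w) * iotaWord q l =
      iotaWord q l * basisN (datum R b) q (lin X (n * w * n⁻¹)) := by
  have hr' : (wordList l).length =
      len (datum R b) (lin X (reflProd (datum R b) R.weylGroup (wordList l))) := by
    rw [← wordElt_eq, hl, ← hr, wordList, List.length_map]
  refine (minReps_isParabolic P).induction
    (p := fun w => basisN (datum R b) q (lin X w) * iotaWord q l =
      iotaWord q l * basisN (datum R b) q (lin X (n * w * n⁻¹))) ?_ ?_ hw
  · change basisN (datum R b) q (lin X 1) * iotaWord q l =
      iotaWord q l * basisN (datum R b) q (lin X (n * 1 * n⁻¹))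
    rw [mul_one n, mul_inv_cancel, lin_one, basisN_one, one_mul, mul_one]
  · intro w i hwP hi hsi hpos ih
    have hiP := root_mem_of_refl_mem hsi hi
    have hiQ := h.perm_mem (mem_of_isSimpleAff hsi hiP)
    have hsj := isSimpleAff_of_mem (R := R) (b := b) (Q.2 hiQ)
    have hpi : perm (datum R b) (reflProd (datum R b) R.weylGroup (wordList l))
        (perm (datum R b) n i) = i := by rw [← wordElt_eq, hl, perm_inv_self]
    have h1 := refl_mul_iotaList hq.isLabeling (isSimpleAff_wordList l) hr' hsj
      (by rw [hpi]; exact hsi)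
    rw [hpi, ← iotaWord_eq hq] at h1
    have h2 : n * (w * refl (datum R b) i) * n⁻¹ =
        n * w * n⁻¹ * refl (datum R b) (perm (datum R b) n i) := by rw [refl_perm]; group
    have h3 : (datum R b).pos (perm (datum R b) (n * w * n⁻¹) (perm (datum R b) n i)) := by
      rw [map_mul, Equiv.Perm.mul_apply, perm_inv_self, map_mul, Equiv.Perm.mul_apply]
      exact h.perm_pos hpos ((parW_perm_mem_iff P hwP i).2 hiP)
    change basisN (datum R b) q (lin X (w * refl (datum R b) i)) * iotaWord q l =
      iotaWord q l * basisN (datum R b) q (lin X (n * (w * refl (datum R b) i) * n⁻¹))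
    rw [h2, ← basisN_mul_refl_of_pos hsi hpos, ← basisN_mul_refl_of_pos hsj h3, mul_assoc, h1,
      ← mul_assoc, ih, mul_assoc]

theorem theta_mul_iotaWord (hq : IsLabelFunction (datum R b) q)
    {l : List b.support} (hl : wordElt l = n⁻¹) (x : X) :
    theta (datum R b) q x * iotaWord q l = iotaWord q l * theta (datum R b) q (n • x) := by
  rw [iotaWord_eq hq, theta_mul_iotaList _ _ (isSimpleAff_wordList l), ← wordElt_eq, hl, inv_inv]

end Words


open RootedDatum

section Generic

variable {J L G : Type*} [AddCommGroup L] [Group G] [DistribMulAction G L]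
variable {D : Datum J L} [RootedDatum D G] {q : AffW G L → ℝ} {qa : J × ℤ → ℝ}

/-! ### Invariant elements of `ℂ[X]` -/

theorem exists_bernstein_relation (hqa : IsLabeling D q qa) {B : Type*} [Ring B] [Algebra ℂ B]
    (T : AddMonoidAlgebra ℂ L →ₐ[ℂ] B) (N : B) (j : J)
    (key : ∀ x, T (AddMonoidAlgebra.single x 1) * N =
      N * T (AddMonoidAlgebra.single ((refl D j : G) • x) 1) + T (bernPoly D qa j x))
    (a : AddMonoidAlgebra ℂ L) : ∃ c : AddMonoidAlgebra ℂ L,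
      rootDenom D qa j * c = rootNumer D qa j * (a - actA (refl D j : G) a) ∧
      T a * N = N * T (actA (refl D j : G) a) + T c := by
  induction a using algebra_induction with
  | h0 => exact ⟨0, by simp only [map_zero, sub_zero, mul_zero], by
      simp only [map_zero, zero_mul, mul_zero, add_zero]⟩
  | hadd a a' ha ha' =>
    obtain ⟨c, h1, h2⟩ := ha
    obtain ⟨c', h1', h2'⟩ := ha'
    refine ⟨c + c', ?_, ?_⟩
    · rw [mul_add, h1, h1', map_add, ← mul_add]; congr 1; abel
    · rw [map_add, add_mul, h2, h2', map_add, map_add, map_add, mul_add]; abel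
  | hsmul r a ha =>
    obtain ⟨c, h1, h2⟩ := ha
    refine ⟨r • c, ?_, ?_⟩
    · rw [mul_smul_comm, h1, map_smul, ← smul_sub, mul_smul_comm]
    · rw [map_smul, smul_mul_assoc, h2, map_smul, map_smul, map_smul, mul_smul_comm, smul_add]
  | hs x =>
    refine ⟨_, rootDenom_mul_bernPoly hqa j x |>.trans ?_, (key x).trans ?_⟩ <;> rw [actA_single]

theorem commute_of_invariant (hqa : IsLabeling D q qa) {B : Type*} [Ring B] [Algebra ℂ B]
    (T : AddMonoidAlgebra ℂ L →ₐ[ℂ] B) (N : B) (j : J)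
    (key : ∀ x, T (AddMonoidAlgebra.single x 1) * N =
      N * T (AddMonoidAlgebra.single ((refl D j : G) • x) 1) + T (bernPoly D qa j x))
    {a : AddMonoidAlgebra ℂ L} (ha : actA (refl D j : G) a = a) : Commute (T a) N := by
  have := isDomain_algebra G D
  obtain ⟨c, h1, h2⟩ := exists_bernstein_relation hqa T N j key a
  rw [ha, sub_self, mul_zero] at h1
  have hc : c = 0 := (mul_eq_zero.1 h1).resolve_left (rootDenom_ne_zero hqa j)
  rw [hc, map_zero, add_zero, ha] at h2
  exact h2

end Generic

section Commutation

variable {ι X Y : Type*} [AddCommGroup X] [AddCommGroup Y] {R : RootDatum ι X Y} {b : R.Base}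
variable [Finite ι] [R.IsReduced] {q : WX R → ℝ} {P Q : Par b}
variable (hq : IsLabelFunction (datum R b) q)

/-! ### Intertwining operators between induced representations -/

theorem twistedHom_commute_refl (δ : DS P q) {t : AddChar X ℂ} (ht : t ∈ torus P)
    {j : {i // R.root i ∈ rootLat P}} (hj : IsSimpleAff (parDatum P) (parW P) (j, 0))
    {a : AddMonoidAlgebra ℂ X} (ha : actA (refl (datum R b) j.1 : R.weylGroup) a = a) :
    Commute (twistedHom hq δ t a)
      (δ.rep (basisN (parDatum P) (parLabel P q) (lin (XP P) (refl (parDatum P) j)))) :=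
  commute_of_invariant hq.isLabeling (twistedHom hq δ t) _ j.1
    (fun x => twistedHom_mul_refl hq δ ht hj x) ha

theorem twistedHom_commute (δ : DS P q) {t : AddChar X ℂ} (ht : t ∈ torus P)
    {a : AddMonoidAlgebra ℂ X} (ha : ∀ j : {i // R.root i ∈ rootLat P},
      IsSimpleAff (datum R b) R.weylGroup (j.1, 0) →
      actA (refl (datum R b) j.1 : R.weylGroup) a = a) (w : parW P) :
    Commute (twistedHom hq δ t a)
      (δ.rep (basisN (parDatum P) (parLabel P q) (lin (XP P) w))) := by
  refine fin_induction_right (parDatum P) (p := fun w => Commute (twistedHom hq δ t a)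
      (δ.rep (basisN (parDatum P) (parLabel P q) (lin (XP P) w)))) ?_ ?_ w
  · rw [lin_one, basisN_one, map_one]
    exact Commute.one_right _
  · intro g j hj hpos ih
    rw [← basisN_mul_refl_of_pos hj hpos, map_mul]
    exact ih.mul_right (twistedHom_commute_refl hq δ ht hj
      (ha j ((isSimpleAff_parDatum_iff P j).1 hj)))

variable {n : R.weylGroup} {l : List b.support}

include hq in
theorem actA_normWord_of_mapsPar (h : MapsPar P Q n) (hl : wordElt l = n⁻¹)
    (hr : l.length = len (datum R b) (lin X n⁻¹)) (j : {i // R.root i ∈ rootLat Q})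
    (hj : IsSimpleAff (datum R b) R.weylGroup (j.1, 0)) :
    actA (refl (datum R b) j.1 : R.weylGroup) (normWord q l) = normWord q l := by
  refine actA_normWord hq l (by rw [hl, hr]) hj ?_
  rw [hl]
  exact isSimpleAff_of_mem (P.2 (h.inv.perm_mem (mem_of_isSimpleAff hj j.2)))

omit [Finite ι] [R.IsReduced] in
theorem moveChar_mem_torus (h : MapsPar P Q n) {k t : AddChar X ℂ} (hk : k ∈ torus Q)
    (ht : t ∈ torus P) : moveChar k n t ∈ torus Q := fun x hx => by
  change k x * t (n⁻¹ • x) = 1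
  rw [hk x hx, ht _ (h.inv.smul_mem_satLat hx), one_mul]

omit [Finite ι] [R.IsReduced] in
theorem IsTwistIso.apply {k t : AddChar X ℂ} {δ : DS P q} {δ' : DS Q q} {U : δ.V ≃ₗᵢ[ℂ] δ'.V}
    (hU : IsTwistIso n k δ δ' U) (x : X) (w : parW P) (w' : parW Q) (hw : w'.1 = n * w.1 * n⁻¹)
    (v : δ.V) : U (twisted δ t x w v) = twisted δ' (moveChar k n t) (n • x) w' (U v) := by
  have h1 := hU x w w' hw v
  have e1 : twisted δ t x w v = t x • twisted δ 1 x w v := by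
    unfold twisted
    rw [AddChar.one_apply, LinearMap.smul_apply, LinearMap.smul_apply, one_smul ℂ (_ : δ.V)]
  have e2 : twisted δ' (moveChar k n t) (n • x) w' (U v) =
      t x • twisted δ' k (n • x) w' (U v) := by
    unfold twisted
    rw [LinearMap.smul_apply, LinearMap.smul_apply, smul_smul]
    congr 1
    change k (n • x) * t (n⁻¹ • n • x) = _
    rw [inv_smul_smul, mul_comm]
  rw [e1, e2, map_smul, h1]

/-- The operator `v ↦ m⁻¹ U v`. -/
def normOp (l : List b.support) (δ : DS P q) (δ' : DS Q q) (U : δ.V ≃ₗᵢ[ℂ] δ'.V)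
    (t' : AddChar X ℂ) : δ.V →ₗ[ℂ] δ'.V :=
  Ring.inverse (twistedA δ' t' (normWord q l)) ∘ₗ U.toLinearEquiv.toLinearMap

include hq in
theorem normOp_twisted (h : MapsPar P Q n) (hl : wordElt l = n⁻¹)
    (hr : l.length = len (datum R b) (lin X n⁻¹)) {k t : AddChar X ℂ} (hk : k ∈ torus Q)
    (ht : t ∈ torus P) {δ : DS P q} {δ' : DS Q q} {U : δ.V ≃ₗᵢ[ℂ] δ'.V}
    (hU : IsTwistIso n k δ δ' U)
    (hM : IsUnit (twistedA δ' (moveChar k n t) (normWord q l)))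
    (x : X) (w : parW P) (w' : parW Q) (hw : w'.1 = n * w.1 * n⁻¹) (v : δ.V) :
    normOp l δ δ' U (moveChar k n t) (twisted δ t x w v) =
      twisted δ' (moveChar k n t) (n • x) w' (normOp l δ δ' U (moveChar k n t) v) := by
  change Ring.inverse (twistedA δ' _ (normWord q l)) (U (twisted δ t x w v)) =
    twisted δ' _ (n • x) w' (Ring.inverse (twistedA δ' _ (normWord q l)) (U v))
  rw [hU.apply x w w' hw]
  generalize U v = v'
  have hc : Commute (twistedA δ' (moveChar k n t) (normWord q l))
      (twisted δ' (moveChar k n t) (n • x) w') := by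
    rw [twistedA_eq hq, twisted_eq hq]
    refine Commute.mul_right ?_ (twistedHom_commute hq δ' (moveChar_mem_torus h hk ht)
      (actA_normWord_of_mapsPar hq h hl hr) w')
    exact (Commute.all (normWord q l) (AddMonoidAlgebra.single (n • x) 1)).map
      (twistedHom hq δ' (moveChar k n t))
  generalize twistedA δ' (moveChar k n t) (normWord q l) = M at hM hc
  obtain ⟨M, rfl⟩ := hM
  rw [Ring.inverse_unit]
  exact LinearMap.congr_fun hc.units_inv_left v'

theorem intertwinerFormula_incl (δ : DS P q) (δ' : DS Q q) (U : δ.V ≃ₗᵢ[ℂ] δ'.V)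
    (t' : AddChar X ℂ) (u : minReps P) (v : δ.V) :
    intertwinerFormula l δ δ' U t' (incl δ u v) =
      indMap hq δ' t' (basisN (datum R b) q (lin X u.1) * iotaWord q l)
        (normOp l δ δ' U t' v) := by
  classical
  have h1 : inclOne δ' = incl δ' ⟨1, one_mem_minReps Q⟩ := dif_pos _
  have h2 : ∀ g : Hk R b q, ∀ v', indRep δ' t' g (inclOne δ' v') = indMap hq δ' t' g v' := by
    intro g v'
    rw [h1, indRep_incl hq δ' t' g ⟨1, one_mem_minReps Q⟩ v', lin_one, basisN_one, mul_one]
  unfold intertwinerFormula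
  rw [LinearMap.coe_toContinuousLinearMap', LinearMap.sum_apply, Finset.sum_eq_single u]
  · refine Eq.trans ?_ (h2 _ _)
    simp only [LinearMap.comp_apply]
    rw [comp_incl, if_pos rfl]
    rfl
  · intro u' _ hu'
    simp only [LinearMap.comp_apply]
    rw [comp_incl, if_neg hu']
    simp only [map_zero]
  · intro hu
    exact absurd (Finset.mem_univ u) hu

include hq in
theorem intertwinerFormula_indMap (h : MapsPar P Q n) (hl : wordElt l = n⁻¹)
    (hr : l.length = len (datum R b) (lin X n⁻¹)) {k t : AddChar X ℂ} (hk : k ∈ torus Q)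
    (ht : t ∈ torus P) {δ : DS P q} {δ' : DS Q q} {U : δ.V ≃ₗᵢ[ℂ] δ'.V}
    (hU : IsTwistIso n k δ δ' U)
    (hM : IsUnit (twistedA δ' (moveChar k n t) (normWord q l))) (g : Hk R b q) (v : δ.V) :
    intertwinerFormula l δ δ' U (moveChar k n t) (indMap hq δ t g v) =
      indMap hq δ' (moveChar k n t) (g * iotaWord q l)
        (normOp l δ δ' U (moveChar k n t) v) := by
  induction g using bernstein_induction hq P with
  | h0 => rw [zero_mul, map_zero, map_zero, LinearMap.zero_apply, LinearMap.zero_apply, map_zero]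
  | hadd g g' hg hg' =>
    rw [add_mul, map_add, map_add, LinearMap.add_apply, LinearMap.add_apply, map_add, hg, hg']
  | hsmul c g hg =>
    rw [smul_mul_assoc, map_smul, map_smul, LinearMap.smul_apply, LinearMap.smul_apply, map_smul,
      hg]
  | hb u hu x w hw =>
    have hw' : n * w * n⁻¹ ∈ parW Q := h.conj_mem hw
    have ht' := moveChar_mem_torus h hk ht
    rw [indMap_bernsteinElt hq δ t hu x hw, intertwinerFormula_incl hq,
      normOp_twisted hq h hl hr hk ht hU hM x ⟨w, hw⟩ ⟨n * w * n⁻¹, hw'⟩ rfl, twisted_apply hq,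
      ← indMap_mul_thetaHom hq δ' ht', ← indMap_mul_basisN hq δ' _ ⟨n * w * n⁻¹, hw'⟩, thetaHom_of]
    refine LinearMap.congr_fun (congrArg (indMap hq δ' (moveChar k n t)) ?_) _
    have h1 := basisN_mul_iotaWord hq h hl hr hw
    have h2 := theta_mul_iotaWord hq hl x
    have h3 : bernsteinElt b q u x w * iotaWord q l = basisN (datum R b) q (lin X u) *
        (theta (datum R b) q x * (basisN (datum R b) q (lin X w) * iotaWord q l)) := by
      unfold bernsteinElt
      rw [mul_assoc, mul_assoc]
    refine Eq.symm (h3.trans ?_)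
    rw [h1, ← mul_assoc (theta (datum R b) q x), h2]
    simp only [mul_assoc]

include hq in
theorem intertwinerFormula_comp (h : MapsPar P Q n) (hl : wordElt l = n⁻¹)
    (hr : l.length = len (datum R b) (lin X n⁻¹)) {k t : AddChar X ℂ} (hk : k ∈ torus Q)
    (ht : t ∈ torus P) {δ : DS P q} {δ' : DS Q q} {U : δ.V ≃ₗᵢ[ℂ] δ'.V}
    (hU : IsTwistIso n k δ δ' U)
    (hM : IsUnit (twistedA δ' (moveChar k n t) (normWord q l))) (g : Hk R b q) :
    indRep δ' (moveChar k n t) g ∘L intertwinerFormula l δ δ' U (moveChar k n t) =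
      intertwinerFormula l δ δ' U (moveChar k n t) ∘L indRep δ t g := by
  ext1 f
  rw [ContinuousLinearMap.comp_apply, ContinuousLinearMap.comp_apply]
  induction f using indSpace_induction with
  | hadd f f' hf hf' => rw [map_add, map_add, map_add, map_add, hf, hf']
  | h0 => rw [map_zero, map_zero, map_zero, map_zero]
  | hi u v =>
    rw [intertwinerFormula_incl hq, indRep_indMap hq δ' (moveChar_mem_torus h hk ht),
      incl_eq_indMap hq δ (t := t) u v, indRep_indMap hq δ ht,
      intertwinerFormula_indMap hq h hl hr hk ht hU hM, mul_assoc]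

end Commutation


open RootedDatum

section Density

variable {ι X Y : Type*} [AddCommGroup X] [AddCommGroup Y] {R : RootDatum ι X Y} {b : R.Base}
variable [Finite ι] [R.IsReduced] {q : WX R → ℝ} {P Q : Par b}

/-! ### Regular points of the intertwining operators -/

theorem finite_not_isUnit {V : Type*} [AddCommGroup V] [Module ℂ V] [FiniteDimensional ℂ V]
    (T : Module.End ℂ V) {c : ℂ} (hc : c ≠ 0) :
    {μ : ℂ | ¬ IsUnit (algebraMap ℂ (Module.End ℂ V) c - μ • T)}.Finite := by
  refine Set.Finite.subset ((Module.End.finite_spectrum T).image fun x => c / x) ?_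
  intro μ hμ
  have hμ0 : μ ≠ 0 := by
    rintro rfl
    refine hμ ?_
    rw [zero_smul, sub_zero]
    exact (isUnit_iff_ne_zero.2 hc).map (algebraMap ℂ (Module.End ℂ V))
  refine ⟨c / μ, ?_, by simp only; rw [div_div_cancel₀ hc]⟩
  intro h
  refine hμ ?_
  have h1 := ((isUnit_iff_ne_zero.2 hμ0).map (algebraMap ℂ (Module.End ℂ V))).mul h
  rwa [mul_sub, ← map_mul, mul_div_cancel₀ _ hμ0, ← Algebra.smul_def] at h1

variable (hq : IsLabelFunction (datum R b) q)

theorem twistedHom_sub_single (δ : DS P q) (t : AddChar X ℂ) (c : ℂ) (y : X) :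
    twistedHom hq δ t (algebraMap ℂ _ c - AddMonoidAlgebra.single y 1) =
      algebraMap ℂ (Module.End ℂ δ.V) c - t y • δ.rep (theta (G := parW P) (parDatum P)
        (parLabel P q) (Submodule.Quotient.mk y)) := by
  rw [map_sub, AlgHom.commutes, twistedHom_of]

theorem exists_finite_normElt (δ : DS P q) (j : ι) : ∃ Z : Set ℂ, Z.Finite ∧
    ∀ t : AddChar X ℂ, t (-R.root j) ∉ Z → IsUnit (twistedHom hq δ t (normElt b q j 1)) := by
  have h0 := hq.isLabeling.pos (j, 0)
  have h1 := hq.isLabeling.pos (j, -1)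
  set T := δ.rep (theta (G := parW P) (parDatum P) (parLabel P q)
    (Submodule.Quotient.mk (-R.root j)))
  by_cases hd : IsDouble (R := R) j
  · have hs : 0 < √(affLabel (datum R b) q (j, 0) / affLabel (datum R b) q (j, -1)) :=
      Real.sqrt_pos.2 (div_pos h0 h1)
    have hc : -((√(affLabel (datum R b) q (j, 0) / affLabel (datum R b) q (j, -1)) : ℝ) : ℂ) ≠ 0 :=
      neg_ne_zero.2 (by exact_mod_cast hs.ne')
    have hc' : ((√(affLabel (datum R b) q (j, 0) / affLabel (datum R b) q (j, -1)) *
        affLabel (datum R b) q (j, -1) : ℝ) : ℂ) ≠ 0 := by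
      exact_mod_cast (mul_pos hs h1).ne'
    refine ⟨_, (finite_not_isUnit T hc).union (finite_not_isUnit T hc'), fun t ht => ?_⟩
    rw [Set.mem_union, not_or] at ht
    have e : normElt b q j 1 =
        -((algebraMap ℂ (AddMonoidAlgebra ℂ X)
          (-((√(affLabel (datum R b) q (j, 0) / affLabel (datum R b) q (j, -1)) : ℝ) : ℂ)) -
            AddMonoidAlgebra.single (-R.root j) 1) *
        (algebraMap ℂ _ ((√(affLabel (datum R b) q (j, 0) / affLabel (datum R b) q (j, -1)) *
          affLabel (datum R b) q (j, -1) : ℝ) : ℂ) - AddMonoidAlgebra.single (-R.root j) 1)) := by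
      unfold normElt
      simp only [if_pos hd]
      rw [one_smul, map_neg, ← neg_mul, neg_sub, sub_neg_eq_add, add_comm (AddMonoidAlgebra.single _ _)]
    rw [e, map_neg, map_mul, twistedHom_sub_single, twistedHom_sub_single]
    exact ((not_not.1 ht.1).mul (not_not.1 ht.2)).neg
  · have hc : ((affLabel (datum R b) q (j, 0) : ℝ) : ℂ) ≠ 0 := by exact_mod_cast h0.ne'
    refine ⟨_, finite_not_isUnit T hc, fun t ht => ?_⟩
    unfold normElt
    simp only [if_neg hd]
    rw [one_smul, twistedHom_sub_single]
    exact not_not.1 ht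

/-- The sum of the positive coroots, as a functional. -/
def twoRhoDual (b : R.Base) : X →+ ℤ := ∑ᶠ (i : ι) (_ : (datum R b).pos i), (datum R b).coroot i

omit [R.IsReduced] in
theorem twoRhoDual_apply (x : X) :
    twoRhoDual b x = ∑ᶠ (i : ι) (_ : (datum R b).pos i), (datum R b).coroot i x := by
  classical
  cases nonempty_fintype ι
  rw [twoRhoDual, finsum_cond_eq_sum_filter, finsum_cond_eq_sum_filter, AddMonoidHom.finsetSum_apply]

theorem twoRhoDual_pos {i : ι} (hi : (datum R b).pos i) : 0 < twoRhoDual b (R.root i) := by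
  have key : ∀ x ∈ AddSubmonoid.closure (R.root '' b.support), x = 0 ∨ 0 < twoRhoDual b x := by
    intro x hx
    induction hx using AddSubmonoid.closure_induction with
    | mem x hx =>
      obtain ⟨k, hk, rfl⟩ := hx
      refine Or.inr ?_
      rw [twoRhoDual_apply, show R.root k = (datum R b).root k from rfl,
        (isSimpleAff_of_mem (R := R) hk).sum_coroot_root]
      exact two_pos
    | zero => exact Or.inl rfl
    | add x y _ _ hx hy =>
      rw [map_add]
      rcases hx with rfl | hx <;> rcases hy with rfl | hy
      · exact Or.inl (add_zero 0)
      · right; rw [map_zero]; omega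
      · right; rw [map_zero]; omega
      · right; omega
  exact (key _ hi).resolve_left (R.ne_zero i)

variable (P) in
/-- An element in the centre of the Lie algebra which is positive on the positive roots outside
of the parabolic subsystem. -/
theorem exists_lieT_pos : ∃ v : lieT P, ∀ i, (datum R b).pos i → R.root i ∉ rootLat P →
    0 < v.1 (R.root i) := by
  classical
  cases nonempty_fintype (parW P)
  let f : X →ₗ[ℤ] ℝ := AddMonoidHom.toIntLinearMap
    { toFun := fun x => ((∑ g : parW P, twoRhoDual b (g.1 • x) : ℤ) : ℝ)
      map_zero' := by simp
      map_add' := fun x y => by simp [Finset.sum_add_distrib] }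
  have hf : ∀ x, f x = ((∑ g : parW P, twoRhoDual b (g.1 • x) : ℤ) : ℝ) := fun x => rfl
  have hinv : ∀ (h : parW P) x, f (h.1 • x) = f x := by
    intro h x
    rw [hf, hf]
    congr 1
    refine Fintype.sum_equiv (Equiv.mulRight h) _ _ fun g => ?_
    rw [← mul_smul]; rfl
  have hroot : ∀ x ∈ rootLat P, f x = 0 := by
    intro x hx
    induction hx using Submodule.span_induction with
    | mem x hx =>
      obtain ⟨i, hi, rfl⟩ := hx
      have h1 := hinv ⟨_, ofIdx_mem_parW P (root_mem_rootLat P hi)⟩ (R.root i)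
      have h2 : RootPairing.weylGroup.ofIdx R i • R.root i = -R.root i := by
        rw [ofIdx_smul, show R.coroot' i (R.root i) = 2 from R.root_coroot_two i, two_smul]
        abel
      rw [h2, map_neg] at h1
      linarith
    | zero => rw [map_zero]
    | add x y _ _ hx hy => rw [map_add, hx, hy, add_zero]
    | smul c x _ hx => rw [map_smul, hx, smul_zero]
  refine ⟨⟨f, fun x hx => ?_⟩, fun i hi hiP => ?_⟩
  · obtain ⟨m, hm, hx⟩ := hx
    have h1 := hroot _ hx
    rw [map_smul, zsmul_eq_mul] at h1
    exact (mul_eq_zero.1 h1).resolve_left (by exact_mod_cast hm)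
  · change 0 < f (R.root i)
    rw [hf, Int.cast_pos]
    refine Finset.sum_pos (fun g _ => ?_) Finset.univ_nonempty
    rw [← root_perm_datum (b := b)]
    exact twoRhoDual_pos ((parW_perm_pos P g.2 hiP).2 hi)

omit [Finite ι] [R.IsReduced] in
theorem continuous_eval (x : X) : Continuous fun t : UTorus P => t.1 x :=
  (continuous_apply x).comp continuous_induced_dom

omit [Finite ι] [R.IsReduced] in
theorem continuous_shift (t : UTorus P) (v : lieT P) : Continuous fun s : ℝ => t.shift (s • v) := by
  refine continuous_induced_rng.2 (continuous_pi fun x => ?_)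
  change Continuous fun s : ℝ => t.1 x * Complex.exp (((s * v.1 x : ℝ) : ℂ) * Complex.I)
  fun_prop

variable {n : R.weylGroup} {l : List b.support}

theorem isUnit_twistedHom_normWord (hr : l.length = len (datum R b) (lin X (wordElt l)))
    (δ : DS P q) (t : AddChar X ℂ) (h : ∀ j ∈ negInv (datum R b) (wordElt l),
      IsUnit (twistedHom hq δ t (normElt b q j 1))) :
    IsUnit (twistedHom hq δ t (normWord q l)) := by
  rw [normWord_eq hq l hr]
  refine finprod_mem_induction (p := fun a => IsUnit (twistedHom hq δ t a)) ?_ ?_ h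
  · rw [map_one]; exact isUnit_one
  · intro x y hx hy
    rw [map_mul]; exact hx.mul hy

include hq in
theorem mem_closure_regular (h : MapsPar P Q n) (hl : wordElt l = n⁻¹)
    (hr : l.length = len (datum R b) (lin X n⁻¹)) (k : AddChar X ℂ) (δ' : DS Q q)
    (t : UTorus P) :
    t ∈ closure {s : UTorus P | IsUnit (twistedA δ' (moveChar k n s.1) (normWord q l))} := by
  obtain ⟨v, hv⟩ := exists_lieT_pos P
  choose Z hZ hunit using fun j => exists_finite_normElt hq δ' j
  have hne : ∀ j ∈ negInv (datum R b) n⁻¹, ∀ᶠ s : ℝ in 𝓝[≠] 0,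
      moveChar k n (t.shift (s • v)).1 (-R.root j) ∉ Z j := by
    intro j hj
    have hvj : 0 < v.1 (n⁻¹ • R.root j) := by
      rw [← root_perm_datum (b := b)]
      refine hv _ hj.2 fun hmem => hj.1 ?_
      rw [← perm_self_inv (D := datum R b) n j]
      exact h.perm_pos hj.2 hmem
    have e : ∀ s : ℝ, moveChar k n (t.shift (s • v)).1 (-R.root j) =
        k (-R.root j) * (t.1 (n⁻¹ • -R.root j) *
          Complex.exp (((s * v.1 (n⁻¹ • -R.root j) : ℝ) : ℂ) * Complex.I)) := fun s => rfl
    have hd : HasDerivAt (fun s : ℝ => moveChar k n (t.shift (s • v)).1 (-R.root j))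
        (k (-R.root j) * (t.1 (n⁻¹ • -R.root j) *
          ((v.1 (n⁻¹ • -R.root j) : ℂ) * Complex.I))) 0 := by
      simp only [e]
      refine HasDerivAt.const_mul _ (HasDerivAt.const_mul _ ?_)
      have h1 : HasDerivAt (fun s : ℝ => ((s * v.1 (n⁻¹ • -R.root j) : ℝ) : ℂ) * Complex.I)
          ((v.1 (n⁻¹ • -R.root j) : ℂ) * Complex.I) 0 := by
        have := ((hasDerivAt_id (0 : ℝ)).mul_const (v.1 (n⁻¹ • -R.root j))).ofReal_comp.mul_const
          Complex.I
        simpa using this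
      simpa using h1.cexp
    have hu : ∀ (φ : AddChar X ℂ) (x : X), φ x ≠ 0 := fun φ x h0 => by
      simpa [h0] using φ.map_add_eq_mul x (-x)
    have hd0 : k (-R.root j) * (t.1 (n⁻¹ • -R.root j) *
        ((v.1 (n⁻¹ • -R.root j) : ℂ) * Complex.I)) ≠ 0 := by
      refine mul_ne_zero (hu _ _) (mul_ne_zero (hu _ _) (mul_ne_zero ?_ Complex.I_ne_zero))
      rw [smul_neg, map_neg]
      exact_mod_cast neg_ne_zero.2 hvj.ne'
    have h2 := (eventually_all_finite (hZ j)).2 fun z _ => hd.eventually_ne (c := z) hd0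
    filter_upwards [h2] with s hs hmem
    exact hs _ hmem rfl
  have hall := (eventually_all_finite (Set.toFinite (negInv (datum R b) n⁻¹))).2 hne
  have ht : Tendsto (fun s : ℝ => t.shift (s • v)) (𝓝[≠] 0) (𝓝 t) := by
    have h1 := (continuous_shift t v).tendsto 0
    rw [zero_smul, TrigPoly.shift_zero] at h1
    exact h1.mono_left nhdsWithin_le_nhds
  refine mem_closure_of_tendsto ht ?_
  filter_upwards [hall] with s hs
  rw [twistedA_eq hq]
  refine isUnit_twistedHom_normWord hq (by rw [hl, hr]) δ' _ fun j hj => hunit j _ (hs j ?_)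
  rwa [hl] at hj

omit [Finite ι] [R.IsReduced] in
theorem IsLaurent.continuous_moveChar {F : Type*} [NormedAddCommGroup F] [NormedSpace ℂ F]
    {f : AddChar X ℂ → F} (hf : IsLaurent f) (k : AddChar X ℂ) :
    Continuous fun s : UTorus P => f (moveChar k n s.1) := by
  obtain ⟨c, hc⟩ := hf
  simp only [hc, Finsupp.sum]
  refine continuous_finsetSum _ fun x _ => Continuous.smul ?_ continuous_const
  change Continuous fun s : UTorus P => k x * s.1 (n⁻¹ • x)
  exact continuous_const.mul (continuous_eval _)

omit [Finite ι] [R.IsReduced] in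
theorem IsLaurent.continuous {F : Type*} [NormedAddCommGroup F] [NormedSpace ℂ F]
    {f : AddChar X ℂ → F} (hf : IsLaurent f) : Continuous fun s : UTorus P => f s.1 := by
  obtain ⟨c, hc⟩ := hf
  simp only [hc, Finsupp.sum]
  exact continuous_finsetSum _ fun x _ => (continuous_eval x).smul continuous_const

theorem equivariant_fourierH (hq : IsLabelFunction (datum R b) q) (Δ : ∀ P : Par b, Set (DS P q))
    (g : Hk R b q) : Equivariant Δ (fourierH Δ g) := by
  intro P Q n k hn hk δ δ' U hU l hl hr t t' ht' A hA
  change indRep δ'.1 t'.1 g ∘L A = A ∘L indRep δ.1 t.1 g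
  have : (𝓝[{s : UTorus P | IsUnit (twistedA δ'.1 (moveChar k n s.1) (normWord q l))}] t).NeBot :=
    mem_closure_iff_nhdsWithin_neBot.1 (mem_closure_regular hq hn hl hr k δ'.1 t)
  have h1 := (((indRep_isLaurent δ'.1 g).continuous_moveChar (P := P) (n := n) k).tendsto
    t).mono_left (nhdsWithin_le_nhds
      (s := {s : UTorus P | IsUnit (twistedA δ'.1 (moveChar k n s.1) (normWord q l))}))
  have h2 := (((indRep_isLaurent δ.1 g).continuous (P := P)).tendsto t).mono_left
    (nhdsWithin_le_nhds
      (s := {s : UTorus P | IsUnit (twistedA δ'.1 (moveChar k n s.1) (normWord q l))}))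
  rw [ht']
  have h3 := ((isBoundedBilinearMap_comp (𝕜 := ℂ)).continuous.tendsto
    (indRep δ'.1 (moveChar k n t.1) g, A)).comp (h1.prodMk_nhds hA)
  have h4 := ((isBoundedBilinearMap_comp (𝕜 := ℂ)).continuous.tendsto
    (A, indRep δ.1 t.1 g)).comp (Tendsto.prodMk_nhds hA h2)
  refine tendsto_nhds_unique h3 (h4.congr' ?_)
  filter_upwards [self_mem_nhdsWithin] with s hs
  exact (intertwinerFormula_comp hq hn hl hr hk.1 s.2.1 hU hs g).symm

end Density


open RootedDatum

/-! ### Summability of inverse powers of the norm -/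

theorem exists_summable_norm_int (O : Type*) [Fintype O] :
    ∃ n : ℕ, Summable fun m : O → ℤ => ‖m‖⁻¹ ^ n := by
  classical
  obtain ⟨L, hd, hL⟩ : ∃ L : Submodule ℤ (O → ℝ), DiscreteTopology L ∧
      ∀ m : O → ℤ, (fun o => (m o : ℝ)) ∈ L := by
    refine ⟨Submodule.span ℤ (Set.range (Pi.basisFun ℝ O)), inferInstance, fun m => ?_⟩
    rw [show (fun o => (m o : ℝ)) = ∑ o, m o • Pi.basisFun ℝ O o by
      ext o; simp [Pi.single_apply]]
    exact sum_mem fun o _ => Submodule.smul_mem _ _ (Submodule.subset_span ⟨o, rfl⟩)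
  refine ⟨Module.finrank ℤ L + 1, ?_⟩
  have h := (ZLattice.summable_norm_pow_inv L _ (Nat.lt_succ_self _)).comp_injective
    (i := fun m : O → ℤ => ⟨_, hL m⟩) fun m m' h => funext fun o => by
      have h' : (m o : ℝ) = m' o := congrFun (congrArg Subtype.val h) o
      exact_mod_cast h'
  refine h.congr fun m => ?_
  rfl

theorem exists_summable_inv_pow {I G O : Type*} [Finite G] [Fintype O] {σ : I → ℝ}
    (hσ : ∀ a, 1 ≤ σ a) (g : I → G) (f : I → O → ℤ)
    (hinj : Function.Injective fun a => (g a, f a)) (h1 : ∀ a, ∃ o, f a o = 1) {c : ℝ}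
    (hc : 0 ≤ c) (hf : ∀ a o, |(f a o : ℝ)| ≤ c * σ a) :
    ∃ n : ℕ, Summable fun a => (σ a ^ n)⁻¹ := by
  obtain ⟨n, hn⟩ := exists_summable_norm_int O
  have h2 : Summable fun p : G × (O → ℤ) => 1 * ‖p.2‖⁻¹ ^ n :=
    Summable.mul_of_nonneg (f := fun _ : G => (1 : ℝ)) Summable.of_finite hn
      (fun _ => zero_le_one) fun _ => pow_nonneg (inv_nonneg.2 (norm_nonneg _)) _
  refine ⟨n, Summable.of_nonneg_of_le (fun a => ?_) (fun a => ?_)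
    ((h2.comp_injective hinj).mul_left (c ^ n))⟩
  · exact inv_nonneg.2 (pow_nonneg (zero_le_one.trans (hσ a)) _)
  · have h0 : 0 < σ a := zero_lt_one.trans_le (hσ a)
    have h4 : 1 ≤ ‖f a‖ := by
      obtain ⟨o, ho⟩ := h1 a
      simpa [ho] using norm_le_pi_norm (f a) o
    have h3 : ‖f a‖ ≤ c * σ a :=
      (pi_norm_le_iff_of_nonneg (mul_nonneg hc h0.le)).2 fun o => hf a o
    change _ ≤ c ^ n * (1 * ‖f a‖⁻¹ ^ n)
    rw [one_mul, inv_pow, ← div_eq_mul_inv, le_div_iff₀ (pow_pos (zero_lt_one.trans_le h4) _),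
      inv_mul_le_iff₀ (pow_pos h0 _), ← mul_pow, mul_comm (σ a)]
    exact pow_le_pow_left₀ (norm_nonneg _) h3 _

section Summability

variable {ι X Y : Type*} [AddCommGroup X] [AddCommGroup Y] {R : RootDatum ι X Y} {b : R.Base}
variable [Finite ι] [R.IsReduced]
variable {κ : Type*} [Fintype κ] (z : Module.Basis κ ℤ (centralLattice R))

theorem coroot_le_len_tr (i : ι) (x : X) :
    R.coroot' i x ≤ len (datum R b) (tr R.weylGroup x) + 1 := by
  have h1 : (fun m : ℤ => (i, m)) '' (Finset.Ioo 0 (R.coroot' i x) : Set ℤ) ⊆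
      inversions (datum R b) (tr R.weylGroup x) := by
    rw [inversions_eq]
    rintro _ ⟨m, hm, rfl⟩
    rw [Finset.coe_Ioo, Set.mem_Ioo] at hm
    refine ⟨Or.inl hm.1, ?_⟩
    rw [affAct_tr]
    have : (datum R b).coroot i x = R.coroot' i x := rfl
    rintro (h | ⟨h, -⟩) <;> simp only [this] at h <;> omega
  have h2 := Set.ncard_le_ncard h1 (inversions_finite _)
  rw [Set.ncard_image_of_injective _ (fun _ _ h => (Prod.mk.inj h).2), Set.ncard_coe_finset,
    Int.card_Ioo] at h2
  change _ ≤ len (datum R b) (tr R.weylGroup x) at h2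
  omega

/-- The sum of the conjugates of `x`, as an element of `Z_X`. -/
def weylSum (x : X) : centralLattice R := (exists_weylSum R x).choose

omit [R.IsReduced] in
theorem weylSum_spec (x : X) :
    Nat.card R.weylGroup • x - ((weylSum x : centralLattice R) : X) ∈ R.rootSpan ℤ := (exists_weylSum R x).choose_spec.2

/-- Coordinates which determine an element of `X`, together with the coordinate `1`. -/
def latticeCoord (x : X) (o : Option (ι ⊕ κ)) : ℤ :=
  o.elim 1 (Sum.elim (fun i => R.coroot' i x) fun k => z.repr (weylSum x) k)

omit [R.IsReduced] [Fintype κ] in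
theorem latticeCoord_injective : Function.Injective (latticeCoord z) := by
  intro x x' h
  have h1 : ∀ i, R.coroot' i x = R.coroot' i x' := fun i => congrFun h (some (Sum.inl i))
  have h2 : weylSum (R := R) x = weylSum x' :=
    z.repr.injective (Finsupp.ext fun k => congrFun h (some (Sum.inr k)))
  have h3 := Submodule.sub_mem _ (weylSum_spec (R := R) x)
    (weylSum_spec (R := R) x')
  rw [h2, sub_sub_sub_cancel_right, ← smul_sub] at h3
  have h4 := eq_zero_of_mem_rootSpan (R := R) h3 fun i => by
    rw [map_nsmul, map_sub, h1, sub_self, smul_zero]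
  exact sub_eq_zero.1 (datum_torsionFree R (Nat.card R.weylGroup : ℤ) _
    (by exact_mod_cast Nat.card_pos.ne') (by rwa [natCast_zsmul]))

theorem coroot_le_len (i : ι) (w : WX R) :
    (R.coroot' i (act w 0) : ℝ) ≤ len (datum R b) w + Nat.card ι + 1 := by
  have h2 : tr R.weylGroup (act w 0) = w * lin X w.right⁻¹ := by
    have h := eq_tr_mul_lin w
    rw [lin_inv, eq_mul_inv_iff_mul_eq]
    exact h.symm
  have h3 := len_mul_le (D := datum R b) w (lin X w.right⁻¹)
  have h4 := len_lin_le (D := datum R b) w.right⁻¹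
  have h5 := coroot_le_len_tr (b := b) i (act w 0)
  rw [← h2] at h3
  have : R.coroot' i (act w 0) ≤ len (datum R b) w + Nat.card ι + 1 := by omega
  exact_mod_cast this

theorem latticeCoord_le (w : WX R) (o : Option (ι ⊕ κ)) :
    |(latticeCoord z (act w 0) o : ℝ)| ≤
      (Nat.card ι + Nat.card R.weylGroup + 2) * (1 + normW R b z w) := by
  have hcn := centralNorm_nonneg z (act w 0)
  have hN : normW R b z w = len (datum R b) w + centralNorm R z (act w 0) := rfl
  have hι : (0 : ℝ) ≤ Nat.card ι := Nat.cast_nonneg _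
  have hG : (0 : ℝ) < Nat.card R.weylGroup := by exact_mod_cast Nat.card_pos
  have hl : (0 : ℝ) ≤ len (datum R b) w := Nat.cast_nonneg _
  have hle : (len (datum R b) w : ℝ) + Nat.card ι + 1 ≤
      (Nat.card ι + Nat.card R.weylGroup + 2) * (1 + normW R b z w) := by
    rw [hN]
    have h1 := mul_nonneg (add_nonneg (add_nonneg hι hG.le) zero_le_one) hl
    have h2 := mul_nonneg (add_nonneg (add_nonneg hι hG.le) zero_le_two) hcn
    linarith
  match o with
  | none =>
    change |((1 : ℤ) : ℝ)| ≤ _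
    rw [Int.cast_one, abs_one]
    linarith
  | some (Sum.inl i) =>
    refine abs_le.2 ⟨?_, (coroot_le_len i w).trans hle⟩
    have h2 := coroot_le_len (b := b) (R.reflectionPerm i i) w
    rw [coroot'_reflectionPerm_self, Int.cast_neg] at h2
    change _ ≤ ((R.coroot' i (act w 0) : ℤ) : ℝ)
    linarith
  | some (Sum.inr k) =>
    have h2 := centralNorm_eq z Nat.card_pos (weylSum_spec (act w 0))
    have h3 : |((z.repr (weylSum (act w 0)) k : ℤ) : ℝ)| ≤ zNorm z (weylSum (act w 0)) :=
      Finset.single_le_sum (f := fun k => |((z.repr (weylSum (act w 0)) k : ℤ) : ℝ)|)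
        (fun _ _ => abs_nonneg _) (Finset.mem_univ k)
    refine h3.trans ?_
    rw [eq_div_iff hG.ne'] at h2
    rw [← h2, hN, mul_comm]
    exact mul_le_mul (by linarith) (by linarith) hcn (by linarith)

variable (b) in
theorem exists_summable_normW :
    ∃ n : ℕ, Summable fun w : WX R => ((1 + normW R b z w) ^ n)⁻¹ := by
  cases nonempty_fintype ι
  refine exists_summable_inv_pow (one_le_one_add_normW b z) (fun w => w.right)
    (fun w => latticeCoord z (act w 0)) (fun w w' h => ?_) (fun w => ⟨none, rfl⟩)
    (by positivity) (latticeCoord_le z)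
  have h1 : w.right = w'.right := congrArg Prod.fst h
  have h2 : act w 0 = act w' 0 := latticeCoord_injective z (congrArg Prod.snd h)
  rw [eq_tr_mul_lin w, eq_tr_mul_lin w', h1, h2]

end Summability


open RootedDatum

section SumCalculus

variable {ι X Y : Type*} [AddCommGroup X] [AddCommGroup Y] {R : RootDatum ι X Y} {b : R.Base}
variable {P : Par b} {F : Type*} [NormedAddCommGroup F] [NormedSpace ℂ F]

/-! ### Sums of trigonometric polynomials -/

theorem TrigPoly.differentiable {f : UTorus P → F} (hf : TrigPoly f) {k : ℕ} (v : Fin k → lieT P)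
    (t : UTorus P) :
    Differentiable ℝ fun s : Fin k → ℝ => f (t.shift (∑ j, s j • v j)) := by
  obtain ⟨c, hc⟩ := hf
  simp only [hc, Finsupp.sum]
  refine Differentiable.fun_sum fun x _ => ?_
  have e : (fun s : Fin k → ℝ => (t.shift (∑ j, s j • v j)).1 x • c x) = fun s : Fin k → ℝ =>
      (t.1 x * Complex.exp (((∑ j, s j * (v j).1 x : ℝ) : ℂ) * Complex.I)) • c x := by
    funext s
    change (t.1 x * Complex.exp (((∑ j, s j • v j : lieT P).1 x : ℝ) * Complex.I)) • c x = _
    rw [Submodule.coe_sum, LinearMap.sum_apply]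
    rfl
  rw [e]
  have h1 : Differentiable ℝ fun s : Fin k → ℝ => ∑ j, s j * (v j).1 x := by fun_prop
  have h2 : Differentiable ℝ fun s : Fin k → ℝ => ((∑ j, s j * (v j).1 x : ℝ) : ℂ) :=
    Complex.ofRealCLM.differentiable.comp h1
  exact (((h2.mul_const _).cexp).const_mul _).smul_const _

theorem TrigPoly.hasFDerivAt {f : UTorus P → F} (hf : TrigPoly f) {k : ℕ} (v : Fin k → lieT P)
    (t : UTorus P) (s : Fin k → ℝ) :
    HasFDerivAt (fun s : Fin k → ℝ => f (t.shift (∑ j, s j • v j)))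
      (∑ j, (ContinuousLinearMap.proj (R := ℝ) (φ := fun _ : Fin k => ℝ) j).smulRight
        (AffineHecke.vecField (v j) f (t.shift (∑ j, s j • v j)))) s := by
  classical
  have h := (hf.differentiable v t s).hasFDerivAt
  generalize fderiv ℝ (fun s : Fin k → ℝ => f (t.shift (∑ j, s j • v j))) s = D at h
  refine h.congr_fderiv (ContinuousLinearMap.ext fun x => ?_)
  conv_lhs => rw [pi_eq_sum_univ' x, map_sum]
  rw [_root_.sum_apply]
  refine Finset.sum_congr rfl fun j _ => ?_
  rw [D.map_smul]
  refine congrArg (x j • ·) (Eq.symm ?_)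
  have h1 := h.hasLineDerivAt (Pi.single j 1)
  have h2 := hf.hasDerivAt (v j) (t.shift (∑ j, s j • v j))
  refine h2.unique ?_
  unfold HasLineDerivAt at h1
  convert h1 using 3 with r
  rw [← TrigPoly.shift_add]
  refine congrArg t.shift ?_
  simp only [Pi.add_apply, Pi.smul_apply, Pi.single_apply, smul_eq_mul, add_smul, Finset.sum_add_distrib, mul_ite,
    mul_one, mul_zero, ite_smul, zero_smul, Finset.sum_ite_eq', Finset.mem_univ, if_true]

/-- Families of trigonometric polynomials, whose derivatives are uniformly summable. -/
def SmoothFamily {I : Type*} (g : I → UTorus P → F) : Prop :=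
  (∀ a, TrigPoly (g a)) ∧ ∀ l : List (lieT P), ∃ u : I → ℝ, Summable u ∧
    ∀ a t, ‖l.foldr vecField (g a) t‖ ≤ u a

namespace SmoothFamily

variable {I : Type*} {g : I → UTorus P → F}

theorem vecField (hg : SmoothFamily g) (v : lieT P) :
    SmoothFamily fun a => vecField v (g a) := by
  refine ⟨fun a => (hg.1 a).vecField v, fun l => ?_⟩
  obtain ⟨u, hu, h⟩ := hg.2 (l ++ [v])
  refine ⟨u, hu, ?_⟩
  simpa only [List.foldr_append, List.foldr_cons, List.foldr_nil] using h

variable [CompleteSpace F]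

theorem summable (hg : SmoothFamily g) (t : UTorus P) : Summable fun a => g a t := by
  obtain ⟨u, hu, h⟩ := hg.2 []
  exact Summable.of_norm_bounded hu fun a => h a t

theorem hasFDerivAt (hg : SmoothFamily g) {k : ℕ} (v : Fin k → lieT P)
    (t : UTorus P) (s : Fin k → ℝ) :
    HasFDerivAt (fun s : Fin k → ℝ => ∑' a, g a (t.shift (∑ j, s j • v j)))
      (∑ j, (ContinuousLinearMap.proj (R := ℝ) (φ := fun _ : Fin k => ℝ) j).smulRight
        (∑' a, AffineHecke.vecField (v j) (g a) (t.shift (∑ j, s j • v j)))) s := by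
  choose u hu h using fun j => (hg.vecField (v j)).2 []
  set p : Fin k → (Fin k → ℝ) →L[ℝ] ℝ :=
    fun j => ContinuousLinearMap.proj (R := ℝ) (φ := fun _ : Fin k => ℝ) j with hp
  have h1 := hasFDerivAt_tsum (u := fun a => ∑ j, ‖p j‖ * u j a)
    (summable_sum fun j _ => (hu j).mul_left _)
    (fun a s => (hg.1 a).hasFDerivAt v t s) (fun a s => ?_) (hg.summable _) (x₀ := 0) s
  · refine h1.congr_fderiv ?_
    rw [Summable.tsum_finsetSum fun j _ => ?_]
    · refine Finset.sum_congr rfl fun j _ => ?_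
      exact ((ContinuousLinearMap.smulRightL ℝ (Fin k → ℝ) F (p j)).map_tsum
        ((hg.vecField (v j)).summable _)).symm
    · exact ((hg.vecField (v j)).summable _).map
        (ContinuousLinearMap.smulRightL ℝ (Fin k → ℝ) F (p j))
        (ContinuousLinearMap.smulRightL ℝ (Fin k → ℝ) F (p j)).continuous
  · refine (norm_sum_le _ _).trans (Finset.sum_le_sum fun j _ => ?_)
    rw [ContinuousLinearMap.norm_smulRight_apply]
    exact mul_le_mul_of_nonneg_left (h j a _) (norm_nonneg _)

theorem smoothOnTorus (hg : SmoothFamily g) : SmoothOnTorus fun t => ∑' a, g a t := by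
  intro k v t
  refine contDiff_infty.2 fun n => ?_
  induction n generalizing g with
  | zero => exact contDiff_zero.2 (continuous_iff_continuousAt.2 fun s =>
      (hg.hasFDerivAt v t s).continuousAt)
  | succ n ih =>
    refine contDiff_succ_iff_hasFDerivAt.2 ⟨_, ?_, fun s => hg.hasFDerivAt v t s⟩
    exact ContDiff.sum fun j _ => (ContinuousLinearMap.smulRightL ℝ (Fin k → ℝ) F
      (ContinuousLinearMap.proj (R := ℝ) (φ := fun _ : Fin k => ℝ) j)).contDiff.comp
        (ih (hg.vecField (v j)))

theorem vecField_tsum (hg : SmoothFamily g) (v : lieT P) :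
    AffineHecke.vecField v (fun t => ∑' a, g a t) =
      fun t => ∑' a, AffineHecke.vecField v (g a) t := by
  funext t
  have h := (hg.hasFDerivAt (fun _ : Fin 1 => v) t 0).comp_hasDerivAt (0 : ℝ)
    (hasDerivAt_pi.2 fun _ : Fin 1 => hasDerivAt_id (0 : ℝ))
  have h2 := h.deriv
  simp only [Fin.sum_univ_one, Function.comp_def, id, Pi.zero_apply, zero_smul,
    TrigPoly.shift_zero] at h2
  refine h2.trans ?_
  simp

theorem foldr_tsum (hg : SmoothFamily g) (l : List (lieT P)) :
    l.foldr AffineHecke.vecField (fun t => ∑' a, g a t) =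
      fun t => ∑' a, l.foldr AffineHecke.vecField (g a) t := by
  induction l using List.reverseRecOn generalizing g with
  | nil => rfl
  | append_singleton l v ih =>
    simp only [List.foldr_append, List.foldr_cons, List.foldr_nil]
    rw [hg.vecField_tsum, ih (hg.vecField v)]

end SmoothFamily

end SumCalculus


open RootedDatum

section RapidDecay

variable {ι X Y : Type*} [AddCommGroup X] [AddCommGroup Y] {R : RootDatum ι X Y} {b : R.Base}
variable {P : Par b} {F : Type*} [NormedAddCommGroup F] [NormedSpace ℂ F]
variable {I : Type*} {σ : I → ℝ} {f : I → UTorus P → F} {n : ℕ}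

/-! ### Rapidly decreasing combinations of tempered families -/

/-- Rapidly decreasing families of coefficients. -/
def RapidDecay (σ : I → ℝ) (x : I → ℂ) : Prop := ∀ m : ℕ, ∃ C : ℝ, ∀ a, ‖x a‖ * σ a ^ m ≤ C

theorem TrigPoly.foldr_const_smul {g : UTorus P → F} (hg : TrigPoly g) (c : ℂ)
    (l : List (lieT P)) :
    l.foldr AffineHecke.vecField (fun t => c • g t) =
      fun t => c • l.foldr AffineHecke.vecField g t :=
  hg.foldr_map (c • ContinuousLinearMap.id ℂ F) l

theorem Tempered.exists_bound_smul (hσ : ∀ a, 1 ≤ σ a) (hf : ∀ k, Tempered σ k f) (n : ℕ)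
    (l : List (lieT P)) :
    ∃ m : ℕ, ∃ C : ℝ, 0 ≤ C ∧ ∀ (x : I → ℂ) (ε : ℝ), (∀ a, ‖x a‖ * σ a ^ m ≤ ε) →
      ∀ a t, ‖x a • l.foldr AffineHecke.vecField (f a) t‖ ≤ C * ε * (σ a ^ n)⁻¹ := by
  obtain ⟨d, C, hC, h⟩ := Tempered.foldr_bound hf l
  refine ⟨d + n, C, hC, fun x ε hx a t => ?_⟩
  have h0 : 0 < σ a := zero_lt_one.trans_le (hσ a)
  rw [norm_smul, ← div_eq_mul_inv, le_div_iff₀ (pow_pos h0 n)]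
  refine le_trans ?_ (mul_le_mul_of_nonneg_left (hx a) hC)
  have h1 := mul_le_mul_of_nonneg_left (h a t)
    (mul_nonneg (norm_nonneg (x a)) (pow_pos h0 n).le)
  rw [pow_add]
  linarith

theorem Tempered.smoothFamily (hσ : ∀ a, 1 ≤ σ a) (hf : ∀ k, Tempered σ k f)
    (hn : Summable fun a => (σ a ^ n)⁻¹) {x : I → ℂ} (hx : RapidDecay σ x) :
    SmoothFamily fun a t => x a • f a t := by
  refine ⟨fun a => ((hf 0).trigPoly a).map (x a • LinearMap.id), fun l => ?_⟩
  obtain ⟨m, C, -, h⟩ := exists_bound_smul hσ hf n l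
  obtain ⟨M, hM⟩ := hx m
  refine ⟨_, hn.mul_left (C * M), fun a t => ?_⟩
  rw [TrigPoly.foldr_const_smul ((hf 0).trigPoly a)]
  exact h x M hM a t

theorem Tempered.exists_bound_sub [CompleteSpace F] (hσ : ∀ a, 1 ≤ σ a)
    (hf : ∀ k, Tempered σ k f) (hn : Summable fun a => (σ a ^ n)⁻¹) (l : List (lieT P)) :
    ∃ m : ℕ, ∃ C : ℝ, 0 ≤ C ∧ ∀ x y : I → ℂ, RapidDecay σ x → RapidDecay σ y →
      ∀ ε : ℝ, (∀ a, ‖x a - y a‖ * σ a ^ m ≤ ε) →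
      ∀ t, ‖l.foldr AffineHecke.vecField (fun t => ∑' a, x a • f a t) t -
        l.foldr AffineHecke.vecField (fun t => ∑' a, y a • f a t) t‖ ≤ C * ε := by
  obtain ⟨m, C, hC, h⟩ := exists_bound_smul hσ hf n l
  have hS : 0 ≤ ∑' a, (σ a ^ n)⁻¹ :=
    tsum_nonneg fun a => inv_nonneg.2 (pow_nonneg (zero_le_one.trans (hσ a)) n)
  refine ⟨m, C * ∑' a, (σ a ^ n)⁻¹, mul_nonneg hC hS, fun x y hx hy ε hε t => ?_⟩
  have hs : ∀ {x : I → ℂ}, RapidDecay σ x →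
      Summable fun a => x a • l.foldr AffineHecke.vecField (f a) t := fun {x} hx => by
    obtain ⟨M, hM⟩ := hx m
    exact Summable.of_norm_bounded (hn.mul_left (C * M)) fun a => h x M hM a t
  rw [(smoothFamily hσ hf hn hx).foldr_tsum, (smoothFamily hσ hf hn hy).foldr_tsum]
  simp only [TrigPoly.foldr_const_smul ((hf 0).trigPoly _)]
  rw [← (hs hx).tsum_sub (hs hy), mul_right_comm]
  refine tsum_of_norm_bounded (hn.hasSum.mul_left (C * ε)) fun a => ?_
  rw [← sub_smul]
  exact h (fun a => x a - y a) ε hε a t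

end RapidDecay

section FourierS

variable {ι X Y : Type*} [AddCommGroup X] [AddCommGroup Y] {R : RootDatum ι X Y} {b : R.Base}
variable [Finite ι] [R.IsReduced] [Module.Finite ℤ X] {q : WX R → ℝ} {P : Par b}
variable {κ : Type*} [Fintype κ] {z : Module.Basis κ ℤ (centralLattice R)}

/-! ### The Fourier transform of the Schwartz space -/

/-- The sum `∑ x_w π(ξ)(N_w)`. -/
def fourierSum (δ : DS P q) (x : WX R → ℂ) (t : UTorus P) : indSpace δ →L[ℂ] indSpace δ :=
  ∑' w, x w • indRep δ t.1 (basisN (datum R b) q w)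

omit [Finite ι] [R.IsReduced] [Module.Finite ℤ X] in
theorem rapidDecay (x : Schwartz b z) : RapidDecay (fun w => 1 + normW R b z w) x.1 := x.2

theorem smoothFamily_fourier (hq : IsLabelFunction (datum R b) q) (δ : DS P q)
    (x : Schwartz b z) :
    SmoothFamily fun w (t : UTorus P) => x.1 w • indRep δ t.1 (basisN (datum R b) q w) :=
  Tempered.smoothFamily (one_le_one_add_normW b z) (tempered_indRep z hq δ)
    (exists_summable_normW b z).choose_spec (rapidDecay x)

theorem hasSum_fourierSum (hq : IsLabelFunction (datum R b) q) (δ : DS P q)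
    (x : Schwartz b z) (t : UTorus P) :
    HasSum (fun w => x.1 w • indRep δ t.1 (basisN (datum R b) q w)) (fourierSum δ x.1 t) :=
  ((smoothFamily_fourier hq δ x).summable t).hasSum

theorem equivariant_fourierSum (hq : IsLabelFunction (datum R b) q)
    (Δ : ∀ P : Par b, Set (DS P q)) (x : Schwartz b z) :
    Equivariant Δ fun _ δ => fourierSum δ.1 x.1 := by
  intro P Q n k hn hk δ δ' U hU l hl hl' t t' ht A hA
  have h1 := ((ContinuousLinearMap.compL ℂ (indSpace δ.1) (indSpace δ'.1)
    (indSpace δ'.1)).flip A).hasSum (hasSum_fourierSum hq δ'.1 x t')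
  have h2 := (ContinuousLinearMap.compL ℂ (indSpace δ.1) (indSpace δ.1)
    (indSpace δ'.1) A).hasSum (hasSum_fourierSum hq δ.1 x t)
  refine h1.tsum_eq.symm.trans ((tsum_congr fun w => ?_).trans h2.tsum_eq)
  have h3 := equivariant_fourierH hq Δ (basisN (datum R b) q w) P Q n k hn hk δ δ' U hU l hl hl'
    t t' ht A hA
  change (x.1 w • indRep δ'.1 t'.1 (basisN (datum R b) q w)) ∘L A =
    A ∘L (x.1 w • indRep δ.1 t.1 (basisN (datum R b) q w))
  rw [ContinuousLinearMap.smul_comp, ContinuousLinearMap.comp_smul]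
  exact congrArg (x.1 w • ·) h3

theorem continuous_foldr_fourierSum (hq : IsLabelFunction (datum R b) q) (δ : DS P q)
    (l : List (lieT P)) :
    Continuous fun x : Schwartz b z =>
      UniformFun.ofFun (l.foldr vecField (fourierSum δ x.1)) := by
  obtain ⟨m, C, hC, h⟩ := Tempered.exists_bound_sub (one_le_one_add_normW b z)
    (tempered_indRep z hq δ) (exists_summable_normW b z).choose_spec l
  have hc : Continuous fun x : Schwartz b z =>
      UniformFun.ofFun (fun w => (((1 + normW R b z w) ^ m : ℝ) : ℂ) * x.1 w) :=
    continuous_iInf_dom (i := m) continuous_induced_dom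
  refine continuous_iff_continuousAt.2 fun x => ?_
  have h1 := hc.tendsto x
  rw [UniformFun.tendsto_iff_tendstoUniformly, Metric.tendstoUniformly_iff] at h1
  refine UniformFun.tendsto_iff_tendstoUniformly.2 (Metric.tendstoUniformly_iff.2 fun ε hε => ?_)
  have hC' : 0 < C + 1 := by linarith
  filter_upwards [h1 (ε / (C + 1)) (div_pos hε hC')] with y hy t
  refine (dist_eq_norm _ _).trans_lt ((h x.1 y.1 (rapidDecay x) (rapidDecay y) (ε / (C + 1))
    (fun w => ?_) t).trans_lt ?_)
  · have h2 := (hy w).le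
    have h3 : 0 ≤ (1 + normW R b z w) ^ m :=
      pow_nonneg (zero_le_one.trans (one_le_one_add_normW b z w)) m
    change dist ((((1 + normW R b z w) ^ m : ℝ) : ℂ) * x.1 w)
      ((((1 + normW R b z w) ^ m : ℝ) : ℂ) * y.1 w) ≤ _ at h2
    rwa [dist_eq_norm, ← mul_sub, norm_mul, Complex.norm_real, Real.norm_of_nonneg h3,
      mul_comm] at h2
  · rw [← mul_div_assoc, div_lt_iff₀ hC']
    linarith

variable (z) in
/-- The Fourier transform `ℱ_𝒮`. -/
def fourierS (hq : IsLabelFunction (datum R b) q) (Δ : ∀ P : Par b, Set (DS P q)) :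
    Schwartz b z →L[ℂ] CInfW Δ where
  toFun x := ⟨fun _ δ => fourierSum δ.1 x.1,
    fun _ δ => (smoothFamily_fourier hq δ.1 x).smoothOnTorus, equivariant_fourierSum hq Δ x⟩
  map_add' x y := Subtype.ext <| funext fun P => funext fun δ => funext fun t => by
    have h := (hasSum_fourierSum hq δ.1 x t).add (hasSum_fourierSum hq δ.1 y t)
    exact (tsum_congr fun w => add_smul (x.1 w) (y.1 w) _).trans h.tsum_eq
  map_smul' c x := Subtype.ext <| funext fun P => funext fun δ => funext fun t => by
    have h := (hasSum_fourierSum hq δ.1 x t).const_smul c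
    exact (tsum_congr fun w => mul_smul c (x.1 w) _).trans h.tsum_eq
  cont := by
    refine continuous_iInf_rng.2 fun P => continuous_iInf_rng.2 fun δ =>
      continuous_iInf_rng.2 fun D => continuous_induced_rng.2 ?_
    refine (continuous_finsetSum D.support fun l _ =>
      (continuous_foldr_fourierSum hq δ.1 l).const_smul (D l)).congr fun x => ?_
    exact funext fun t => Finset.sum_apply t D.support fun l =>
      (D l • l.foldr vecField (fourierSum δ.1 x.1) : UTorus P → _)

end FourierS


open RootedDatum

/-! ### Comparison with the `L₂`-extension -/

theorem tsum_liminf_le {I J : Type*} {u : Filter J} [u.IsCountablyGenerated]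
    (f : J → I → ℝ≥0∞) : ∑' i, liminf (fun j => f j i) u ≤ liminf (fun j => ∑' i, f j i) u := by
  let _ : MeasurableSpace I := ⊤
  have h := lintegral_liminf_le (μ := Measure.count) (u := u) (f := f)
    fun j => measurable_from_top
  simpa only [lintegral_count] using h

/-- The square of the Hilbert-Schmidt norm. -/
def hsSq {V : Type*} [NormedAddCommGroup V] [InnerProductSpace ℂ V] [CompleteSpace V]
    (A : V →L[ℂ] V) : ℝ≥0∞ :=
  ENNReal.ofReal (LinearMap.trace ℂ V (ContinuousLinearMap.adjoint A ∘L A).toLinearMap).re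

theorem continuous_hsSq {V : Type*} [NormedAddCommGroup V] [InnerProductSpace ℂ V]
    [FiniteDimensional ℂ V] [CompleteSpace V] : Continuous (hsSq (V := V)) := by
  have h1 : Continuous fun A : V →L[ℂ] V => ContinuousLinearMap.adjoint A ∘L A :=
    (ContinuousLinearMap.adjoint (𝕜 := ℂ) (E := V) (F := V)).continuous.clm_comp continuous_id
  have h2 : Continuous fun A : V →L[ℂ] V => LinearMap.trace ℂ V A.toLinearMap :=
    LinearMap.continuous_of_finiteDimensional
      (LinearMap.trace ℂ V ∘ₗ ContinuousLinearMap.coeLM ℂ)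
  exact ENNReal.continuous_ofReal.comp (Complex.continuous_re.comp (h2.comp h1))

theorem hasSum_finsupp_smul {I M : Type*} [NormedAddCommGroup M] [Module ℂ M] (c : I →₀ ℂ)
    (f : I → M) : HasSum (fun w => c w • f w) (c.sum fun w a => a • f w) :=
  hasSum_sum_of_ne_finset_zero fun w hw => by rw [Finsupp.notMem_support_iff.1 hw, zero_smul]

open Classical in
/-- The restriction of a function to a finite set. -/
def truncate {I : Type*} (x : I → ℂ) (s : Finset I) : I →₀ ℂ :=
  Finsupp.onFinset s (fun w => if w ∈ s then x w else 0) fun _ hw => by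
    by_contra h
    exact hw (if_neg h)

theorem truncate_of_mem {I : Type*} (x : I → ℂ) {s : Finset I} {w : I} (h : w ∈ s) :
    truncate x s w = x w := if_pos h

theorem truncate_of_notMem {I : Type*} (x : I → ℂ) {s : Finset I} {w : I} (h : w ∉ s) :
    truncate x s w = 0 := if_neg h

theorem sum_truncate {I M : Type*} [AddCommGroup M] [Module ℂ M] (x : I → ℂ) (s : Finset I)
    (f : I → M) : (truncate x s).sum (fun w a => a • f w) = ∑ w ∈ s, x w • f w := by
  rw [Finsupp.sum_of_support_subset (truncate x s) (s := s) (fun w hw => ?_)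
    (fun w a => a • f w) fun w _ => zero_smul _ _]
  · exact Finset.sum_congr rfl fun w hw => by rw [truncate_of_mem x hw]
  · by_contra h
    exact Finsupp.mem_support_iff.1 hw (truncate_of_notMem x h)

section FourierL2

variable {ι X Y : Type*} [AddCommGroup X] [AddCommGroup Y] {R : RootDatum ι X Y} {b : R.Base}
variable [Finite ι] [R.IsReduced] [Module.Finite ℤ X] {q : WX R → ℝ}
variable {κ : Type*} [Fintype κ] {z : Module.Basis κ ℤ (centralLattice R)}
variable {Δ : ∀ P : Par b, Set (DS P q)} {μ : ∀ P : Par b, Δ P → Measure (UTorus P)}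

omit [R.IsReduced] [Module.Finite ℤ X] in
theorem distSq_eq (f g : Sec Δ) :
    distSq Δ μ f g = ∑' (P : Par b) (δ : Δ P), ∫⁻ t, hsSq (f P δ t - g P δ t) ∂μ P δ := rfl

omit [R.IsReduced] [Module.Finite ℤ X] in
theorem distSq_le_liminf {f : Sec Δ} {J : Type*} {u : Filter J} [u.IsCountablyGenerated] [u.NeBot]
    {g : Sec Δ} {g' : J → Sec Δ} (hf : ∀ P δ, Continuous (f P δ))
    (hg' : ∀ j P δ, Continuous (g' j P δ))
    (h : ∀ P δ t, Tendsto (fun j => g' j P δ t) u (𝓝 (g P δ t))) :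
    distSq Δ μ f g ≤ liminf (fun j => distSq Δ μ f (g' j)) u := by
  simp only [distSq_eq]
  refine le_trans (ENNReal.tsum_le_tsum fun P => ?_) (tsum_liminf_le _)
  refine le_trans (ENNReal.tsum_le_tsum fun δ => ?_) (tsum_liminf_le _)
  refine le_trans (lintegral_mono fun t => ?_) (lintegral_liminf_le fun j =>
    (continuous_hsSq.comp ((hf P δ).sub (hg' j P δ))).measurable)
  exact ((continuous_hsSq.tendsto _).comp (tendsto_const_nhds.sub (h P δ t))).liminf_eq.ge

omit [R.IsReduced] [Module.Finite ℤ X] in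
theorem continuous_fourierH (h : Hk R b q) (P : Par b)
    (δ : Δ P) : Continuous (fourierH Δ h P δ) := (indRep_isLaurent δ.1 h).continuous

omit [Module.Finite ℤ X] in
theorem fourierH_elt (hq : IsLabelFunction (datum R b) q) (c : WX R →₀ ℂ) (P : Par b)
    (δ : Δ P) (t : UTorus P) : fourierH Δ (elt c) P δ t =
      c.sum fun w a => a • indRep δ.1 t.1 (basisN (datum R b) q w) := by
  have h1 : ∀ h, indHom hq δ.1 t.2.1 h = indRep δ.1 t.1 h := fun h => indHom_apply hq δ.1 t.2.1 h
  refine (h1 _).symm.trans ?_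
  rw [elt, Finsupp.linearCombination_apply, Finsupp.sum, map_sum]
  refine Finset.sum_congr rfl fun w _ => ?_
  rw [map_smul, h1]

omit [Module.Finite ℤ X] in
theorem distSq_fourierH (hq : IsLabelFunction (datum R b) q) (hμ : FourierIsometric Δ μ)
    (c c' : WX R →₀ ℂ) : distSq Δ μ (fourierH Δ (elt c)) (fourierH Δ (elt c')) =
      ∑' w, ENNReal.ofReal (‖c w - c' w‖ ^ 2) := by
  refine Eq.trans ?_ (hμ (c - c'))
  rw [distSq_eq, distSq_eq]
  refine tsum_congr fun P => tsum_congr fun δ => lintegral_congr fun t => congrArg hsSq ?_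
  have h1 : ∀ h, indHom hq δ.1 t.2.1 h = indRep δ.1 t.1 h := fun h => indHom_apply hq δ.1 t.2.1 h
  have h2 : indRep δ.1 t.1 (elt c) - indRep δ.1 t.1 (elt c') =
      indRep δ.1 t.1 (elt (q := q) (b := b) (c - c')) := by
    rw [← h1, ← h1, ← h1, ← map_sub]
    exact congrArg _ (map_sub _ c c').symm
  exact h2.trans (sub_zero _).symm

theorem fourierS_of_finsupp (hq : IsLabelFunction (datum R b) q) (x : Schwartz b z)
    (c : WX R →₀ ℂ) (hc : x.1 = c) : (fourierS z hq Δ x).1 = fourierH Δ (elt c) := by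
  funext P δ t
  rw [fourierH_elt hq]
  refine (hasSum_fourierSum hq δ.1 x t).unique ?_
  rw [hc]
  exact hasSum_finsupp_smul c _

omit [Module.Finite ℤ X] in
variable (b z) in
include b z in
theorem countable_WX : Countable (WX R) := by
  have h := (exists_summable_normW b z).choose_spec.countable_support
  rwa [Function.support_eq_univ fun w => inv_ne_zero (pow_ne_zero _
    (zero_lt_one.trans_le (one_le_one_add_normW b z w)).ne'), Set.countable_univ_iff] at h

theorem distSq_fourierS_le (hq : IsLabelFunction (datum R b) q) (hμ : FourierIsometric Δ μ)
    (x : Schwartz b z) (c : WX R →₀ ℂ) :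
    distSq Δ μ (fourierH Δ (elt c)) (fourierS z hq Δ x).1 ≤
      ∑' w, ENNReal.ofReal (‖c w - x.1 w‖ ^ 2) := by
  have := countable_WX b z
  refine (distSq_le_liminf (u := atTop) (g' := fun s => fourierH Δ (elt (truncate x.1 s)))
    (fun P δ => continuous_fourierH _ P δ) (fun s P δ => continuous_fourierH _ P δ)
    fun P δ t => ?_).trans ?_
  · refine Tendsto.congr (fun s => ?_) (hasSum_fourierSum hq δ.1 x t)
    exact ((fourierH_elt hq _ P δ t).trans (sum_truncate x.1 s _)).symm
  · simp only [distSq_fourierH hq hμ]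
    refine (liminf_le_liminf (v := fun _ => ∑' w, ENNReal.ofReal (‖c w - x.1 w‖ ^ 2)) ?_).trans
      (liminf_const _).le
    filter_upwards [eventually_ge_atTop c.support] with s hs
    refine ENNReal.tsum_le_tsum fun w => ?_
    by_cases h : w ∈ s
    · rw [truncate_of_mem _ h]
    · rw [truncate_of_notMem _ h, Finsupp.notMem_support_iff.1 fun h' => h (hs h'), sub_zero,
        norm_zero]
      simp

theorem tendsto_distSq_fourierS (hq : IsLabelFunction (datum R b) q)
    (hμ : FourierIsometric Δ μ) (x : Schwartz b z) (c : ℕ → WX R →₀ ℂ)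
    (hc : Tendsto (fun m => ∑' w, ENNReal.ofReal (‖c m w - x.1 w‖ ^ 2)) atTop (𝓝 0)) :
    Tendsto (fun m => distSq Δ μ (fourierH Δ (elt (c m))) (fourierS z hq Δ x).1) atTop (𝓝 0) :=
  tendsto_of_tendsto_of_tendsto_of_le_of_le tendsto_const_nhds hc (fun _ => zero_le)
    fun m => distSq_fourierS_le hq hμ x (c m)

end FourierL2

end

end AffineHecke

open AffineHecke in
theorem mainTheorem11 {ι X Y : Type*} [Finite ι] [AddCommGroup X] [AddCommGroup Y]
    [Module.Finite ℤ X] [Module.Finite ℤ Y] (R : RootDatum ι X Y) [R.IsReduced] (b : R.Base)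
    {κ : Type*} [Fintype κ] (z : Module.Basis κ ℤ (centralLattice R))
    (q : WX R → ℝ) (hq : IsLabelFunction (datum R b) q)
    (Δ : ∀ P : Par b, Set (DS P q)) (hΔ : IsComplete Δ) :
    -- uniform estimates of the matrix coefficients near `Ξ_u`
    (∀ {κ₁ κ₂ : Type} [Finite κ₁] (xQ : κ₁ → X) (xZ : Module.Basis κ₂ ℤ (centralLattice R)),
      (AddSubmonoid.closure (Set.range xQ) : Set X) =
        {x | x ∈ Submodule.span ℤ (Set.range R.root) ∧
          ∀ i, (datum R b).pos i → 0 ≤ R.coroot' i x} →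
      ∀ K > 0, (∀ (m : κ₁ →₀ ℕ) (m' : κ₂ →₀ ℤ),
        (m.sum fun _ c => (c : ℝ)) + (m'.sum fun _ c => |(c : ℝ)|) ≤
          K * normW R b z (tr R.weylGroup
            ((m.sum fun i c => c • xQ i) + (m'.sum fun j c => c • (xZ j : X))))) →
      ∀ r > 1, ∀ (P : Par b) (δ : Δ P), ∃ d : ℕ, ∃ C > 0, ∀ (w : WX R) (a a' : indSpace δ.1),
        ∀ t ∈ torus P, nu (R := R) xQ (fun j => (xZ j : X)) t ≤ r →
          ‖inner ℂ a (indRep δ.1 t (basisN (datum R b) q w) a')‖ ≤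
            C * ‖a‖ * ‖a'‖ * (1 + normW R b z w) ^ d *
              nu (R := R) xQ (fun j => (xZ j : X)) t ^ (K * normW R b z w)) ∧
    -- polynomial estimates of the derivatives of the matrix coefficients on `Ξ_u`
    (∀ (P : Par b) (δ : Δ P) (D : List (lieT P) →₀ ℂ), ∃ d : ℕ, ∃ C > 0,
      ∀ (t : UTorus P) (a a' : indSpace δ.1) (w : WX R),
        ‖diffOp D (fun s => inner ℂ a (indRep δ.1 s.1 (basisN (datum R b) q w) a')) t‖ ≤
          C * ‖a‖ * ‖a'‖ * (1 + normW R b z w) ^ d) ∧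
    -- the Fourier transform is a continuous map from `𝒮` to `C^∞(Ξ_u, End(𝒱_Ξ))^𝒲`
    ∃ F : Schwartz b z →L[ℂ] CInfW Δ,
      (∀ (x : Schwartz b z) (c : WX R →₀ ℂ), x.1 = c → (F x).1 = fourierH Δ (elt c)) ∧
      (∀ (x : Schwartz b z) (P : Par b) (δ : Δ P) (t : UTorus P),
        HasSum (fun w => x.1 w • indRep δ.1 t.1 (basisN (datum R b) q w)) ((F x).1 P δ t)) ∧
      (∀ μ : ∀ P : Par b, Δ P → Measure (UTorus P), FourierIsometric Δ μ →
        ∀ (x : Schwartz b z) (c : ℕ → WX R →₀ ℂ),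
          Tendsto (fun m => ∑' w, ENNReal.ofReal (‖c m w - x.1 w‖ ^ 2)) atTop (𝓝 0) →
          Tendsto (fun m => distSq Δ μ (fourierH Δ (elt (c m))) (F x).1) atTop (𝓝 0)) :=
  ⟨fun xQ xZ hxQ K hK hKb r hr P δ => exists_bound_matrixCoeff z hq xQ xZ hxQ hK hKb r δ.1,
    fun P δ D => exists_bound_diffOp z hq δ.1 D,
    fourierS z hq Δ, fun x c hc => fourierS_of_finsupp hq x c hc,
    fun x P δ t => hasSum_fourierSum hq δ.1 x t,
    fun μ hμ x c hc => tendsto_distSq_fourierS hq hμ x c hc⟩
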